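/- **Setting.** Let $\Sigma$ be a closed connected two-sided minimal surface, smoothly embedded in a Riemannian three-manifold $(N,g)$, with unit normal $\nu$, second fundamental form $A$ and $|A|^2+\operatorname{Ric}(\nu,\nu)>0$ on $\Sigma$; let $O(2)\times\mathbb Z_2$ act smoothly on $\Sigma$ and isometrically on $N$, the embedding being equivariant. Let $\mathrm{Cyl}=\mathbb S^1\times\mathbb R$ with coordinates $(\vartheta,s)$, on which $O(2)$ acts through $\mathbb S^1$ and the generator of $\mathbb Z_2$ by $s\mapsto -s$. Let $I=(-l,l)$, $0<l\le\infty$, and let $X:\mathbb S^1\times I\to\Sigma$ be an equivariant conformal diffeomorphism onto its image $\Omega$, $X^*g=e^{2\omega}(d\vartheta^2+ds^2)$, of one of two kinds: (sphere) $l=\infty$, $\Omega$ is $\Sigma$ minus two points, and the two ends of the cylinder converge to these two points; (torus) $l<\infty$, $X$ extends to an equivariant conformal covering $\mathrm{Cyl}\to\Sigma$ which is $2l$-periodic in $s$, and $\Omega$ is $\Sigma$ minus the image of $\{s=l\}$. Put $V=e^{2\omega}\,(|A|^2+\operatorname{Ric}(\nu,\nu))\circ X$; it is a function of $s$, and for a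 function $\phi$ of $s$ the equation $(\Delta_\Sigma+|A|^2+\operatorname{Ric}(\nu,\nu))\phi=0$ reads $\phi''+V\phi=0$. **RLD solutions.** For a positive function $\phi$ of $s$ put $F^\phi_\pm(s)=\partial_\pm\phi(s)/\phi(s)$, where $\partial_+$ is the right derivative and $\partial_-$ is minus the left derivative. A (rotationally invariant) *RLD solution* with jump latitudes $0\le s_1<\dots<s_k<l$, $k\ge1$, is a positive continuous $O(2)\times\mathbb Z_2$-invariant function $\phi$ on $\Omega$ that is smooth, and solves $\phi''+V\phi=0$, on each of the closed pieces into which the circles $s=\pm s_i$ divide $\Omega$, and for which $F_{i\pm}:=F^\phi_\pm(s_i)>0$ for all $i$. It is *unit* if $\phi=1$ at $s=0$. With $F_i=\frac12(F_{i+}+F_{i-})$, its *flux ratios* are $\sigma_j=\log(F_{j+1}/F_j)$, $1\le j\le k-1$, and $\xi_i=(F_{i+}-F_{i-})/(F_{i+}+F_{i-})$, $1\le i\le k$. Let $k_\circ$ be the number of circles $s=\pm s_i$, so $k_\circ=2k$ if $s_1>0$ and $k_\circ=2k-1$ if $s_1=0$. Let $\phi_{\rm even}$ solve $f''+Vf=0$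 on $I$ with $f(0)=1$, $f'(0)=0$, and let $F_{\max}=\lim_{s\nearrow l}\left(-\phi_{\rm even}'(s)/\phi_{\rm even}(s)\right)\in(0,\infty]$ if $\phi_{\rm even}>0$ on $I$, and $F_{\max}=\infty$ otherwise. Let $\phi_{\rm end}$ be the solution of $f''+Vf=0$ on $I$ with $f\to1$ and $f'/f\to0$ as $s\nearrow l$. An RLD solution is *smooth at the ends* if $F_{k+}=\phi_{\rm end}'(s_k)/\phi_{\rm end}(s_k)$. Let $k_\circ^{\min}$ be the least $k_\circ$ of all RLD solutions that are smooth at the ends. **Part 1.** For $F\in(0,F_{\max})$, $\sigma\in\ell^1$ and $\xi\in\ell^\infty$ with $|\xi|_{\ell^\infty}<1$, consider the unit RLD solutions with $s_1>0$, $F_{1-}=F$ and flux ratios $(\sigma_1,\dots,\sigma_{k-1})$, $(\xi_1,\dots,\xi_k)$, where $k$ is the number of their jump latitudes. For every $k$ there is at most one such solution (and its jump latitudes are determined). There is at least one, and there is a largest $k=k[F;\sigma,\xi]$ for which one exists; if $l=\infty$, it is the only one. Let $\hat\phi=\hat\phi[F;\sigma,\xi]$ be the solution for this $k$. Then: (i)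 For fixed $\sigma,\xi$ and every $i$, the jump latitude $s_i$ of $\hat\phi$ is a strictly increasing smooth function of $F$ on the set of those $F$ with $k[F;\sigma,\xi]\ge i$. (ii) $k[F;\sigma,\xi]$ is nonincreasing in $F$. There is $k_{\min}\in\mathbb N$, $k_{\min}\geq 1$, independent of $\sigma,\xi$, and for all $\sigma,\xi$ there is a strictly decreasing sequence $F_{\max}=a_{k_{\min}-1}>a_{k_{\min}}>a_{k_{\min}+1}>\cdots>0$ such that $k[F;\sigma,\xi]\ge k_{\min}$ for all $F\in(0,F_{\max})$, and, for $k\ge k_{\min}$ and $F\in(0,F_{\max})$, $k[F;\sigma,\xi]=k$ if and only if $F\in[a_k,a_{k-1})$. (iii) The restriction of $\hat\phi[F;\sigma,\xi]$ to any compact subset of $\Omega$ depends continuously, in the supremum norm, on $(F,\sigma,\xi)\in(0,F_{\max})\times\ell^1\times\{\xi\in\ell^\infty:|\xi|_{\ell^\infty}<1\}$. **Part 2.** Let $k_\circ\ge k_\circ^{\min}$, $k=\lceil k_\circ/2\rceil$, $\sigma\in\mathbb R^{k-1}$ and $\xi\in\mathbb R^k$ with $\max_i|\xi_i|<1$, and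 $\xi_1=0$ if $k_\circ$ is odd. Then there is a unique unit RLD solution that is smooth at the ends, has $k_\circ$ circles, and has flux ratios $(\sigma,\xi)$. -/

import Mathlib

open Set Filter Topology
open scoped Manifold ContDiff

noncomputable section

namespace RLD

abbrev E2 := EuclideanSpace ℝ (Fin 2)
abbrev E3 := EuclideanSpace ℝ (Fin 3)

/-- The group `O(2) × ℤ₂`; the generator of `ℤ₂` is `-1 : ℤˣ`. -/
abbrev SymGroup := Matrix.orthogonalGroup (Fin 2) ℝ × ℤˣ

/-- The space `ℓ¹` of sequences `σ`. -/
abbrev L1 := lp (fun _ : ℕ => ℝ) 1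

/-- The space `ℓ^∞` of sequences `ξ`. -/
abbrev Linf := lp (fun _ : ℕ => ℝ) ⊤

section Coordinates

/-- The partial derivative `∂ᵢ f` on `ℝⁿ`. -/
def pd {n : ℕ} (f : EuclideanSpace ℝ (Fin n) → ℝ) (i : Fin n) (y : EuclideanSpace ℝ (Fin n)) : ℝ :=
  fderiv ℝ f y (EuclideanSpace.single i 1)

/-- Christoffel symbols `Γᵏᵢⱼ` of a matrix-valued metric `G`. -/
def christoffel {n : ℕ} (G : EuclideanSpace ℝ (Fin n) → Matrix (Fin n) (Fin n) ℝ)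
    (y : EuclideanSpace ℝ (Fin n)) (k i j : Fin n) : ℝ :=
  (1 / 2 : ℝ) * ∑ l, (G y)⁻¹ k l *
    (pd (fun z => G z j l) i y + pd (fun z => G z i l) j y - pd (fun z => G z i j) l y)

/-- Components of the Ricci tensor,
`Rⱼₖ = ∂ᵢ Γⁱⱼₖ - ∂ₖ Γⁱᵢⱼ + Γⁱᵢₚ Γᵖⱼₖ - Γⁱₖₚ Γᵖᵢⱼ` (positive on round spheres). -/
def ricci {n : ℕ} (G : EuclideanSpace ℝ (Fin n) → Matrix (Fin n) (Fin n) ℝ)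
    (y : EuclideanSpace ℝ (Fin n)) (j k : Fin n) : ℝ :=
  ∑ i, (pd (fun z => christoffel G z i j k) i y - pd (fun z => christoffel G z i i j) k y)
    + ∑ i, ∑ p, (christoffel G y i i p * christoffel G y p j k
        - christoffel G y i k p * christoffel G y p i j)

end Coordinates

section Hypersurface

variable {M N : Type*} [TopologicalSpace M] [ChartedSpace E2 M]
  [TopologicalSpace N] [ChartedSpace E3 N] [IsManifold (𝓡 3) ∞ N]

/-- Smooth Riemannian metrics on the three-manifold `N`. -/
abbrev Metric3 (N : Type*) [TopologicalSpace N] [ChartedSpace E3 N] [IsManifold (𝓡 3) ∞ N] :=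
  Bundle.ContMDiffRiemannianMetric (𝓡 3) ∞ E3 (fun y : N => TangentSpace (𝓡 3) y)

/-- The matrix of `g` in the coordinates given by the chart `e` of `N`. -/
def metricMatrix (g : Metric3 N) (e : OpenPartialHomeomorph N E3) (y : E3) :
    Matrix (Fin 3) (Fin 3) ℝ := fun i j =>
  g.inner (e.symm y) (mfderiv (𝓡 3) (𝓡 3) e.symm y (EuclideanSpace.single i (1 : ℝ) : E3))
    (mfderiv (𝓡 3) (𝓡 3) e.symm y (EuclideanSpace.single j (1 : ℝ) : E3))

/-- The metric induced on the surface by a map `ι : M → N`. -/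
def induced (g : Metric3 N) (ι : M → N) (p : M) (u v : TangentSpace (𝓡 2) p) : ℝ :=
  g.inner (ι p) (mfderiv (𝓡 2) (𝓡 3) ι p u) (mfderiv (𝓡 2) (𝓡 3) ι p v)

/-- First derivatives `∂ₐ Fⁱ` at `p` of the expression `F = e ∘ ι ∘ e'⁻¹` of `ι` in charts. -/
def dCoord (ι : M → N) (e : OpenPartialHomeomorph N E3) (e' : OpenPartialHomeomorph M E2)
    (p : M) (a : Fin 2) (i : Fin 3) : ℝ :=
  pd (fun y => e (ι (e'.symm y)) i) a (e' p)

/-- Second derivatives `∂_b ∂ₐ Fⁱ` at `p` of the expression `F = e ∘ ι ∘ e'⁻¹` of `ι` in charts. -/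
def ddCoord (ι : M → N) (e : OpenPartialHomeomorph N E3) (e' : OpenPartialHomeomorph M E2)
    (p : M) (a b : Fin 2) (i : Fin 3) : ℝ :=
  pd (fun z => pd (fun y => e (ι (e'.symm y)) i) a z) b (e' p)

/-- Components `νⁱ` in the chart `e` of a vector `ν ∈ T_{ι p} N`. -/
def normalCoord (ι : M → N) (ν : ∀ p, TangentSpace (𝓡 3) (ι p))
    (e : OpenPartialHomeomorph N E3) (p : M) (i : Fin 3) : ℝ :=
  let w : E3 := mfderiv (𝓡 3) (𝓡 3) e (ι p) (ν p)
  w i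

/-- The first fundamental form in charts. -/
def firstForm (g : Metric3 N) (ι : M → N) (e : OpenPartialHomeomorph N E3)
    (e' : OpenPartialHomeomorph M E2) (p : M) : Matrix (Fin 2) (Fin 2) ℝ := fun a b =>
  ∑ i, ∑ j, metricMatrix g e (e (ι p)) i j * dCoord ι e e' p a i * dCoord ι e e' p b j

/-- The second fundamental form in charts,
`A_{ab} = g(ν, ∂ₐ∂_b F + Γ(∂ₐ F, ∂_b F))`. -/
def secondForm (g : Metric3 N) (ι : M → N) (ν : ∀ p, TangentSpace (𝓡 3) (ι p))
    (e : OpenPartialHomeomorph N E3) (e' : OpenPartialHomeomorph M E2) (p : M) :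
    Matrix (Fin 2) (Fin 2) ℝ := fun a b =>
  ∑ k, ∑ l, metricMatrix g e (e (ι p)) k l * normalCoord ι ν e p k *
    (ddCoord ι e e' p a b l + ∑ i, ∑ j, christoffel (metricMatrix g e) (e (ι p)) l i j *
      dCoord ι e e' p a i * dCoord ι e e' p b j)

/-- The mean curvature: the trace of `A` with respect to the induced metric. -/
def meanCurvature (g : Metric3 N) (ι : M → N) (ν : ∀ p, TangentSpace (𝓡 3) (ι p))
    (e : OpenPartialHomeomorph N E3) (e' : OpenPartialHomeomorph M E2) (p : M) : ℝ :=
  ((firstForm g ι e e' p)⁻¹ * secondForm g ι ν e e' p).trace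

/-- `|A|² + Ric(ν, ν)` computed in charts. -/
def jacobiPotential (g : Metric3 N) (ι : M → N) (ν : ∀ p, TangentSpace (𝓡 3) (ι p))
    (e : OpenPartialHomeomorph N E3) (e' : OpenPartialHomeomorph M E2) (p : M) : ℝ :=
  ((firstForm g ι e e' p)⁻¹ * secondForm g ι ν e e' p *
      ((firstForm g ι e e' p)⁻¹ * secondForm g ι ν e e' p)).trace
    + ∑ j, ∑ k, ricci (metricMatrix g e) (e (ι p)) j k *
        normalCoord ι ν e p j * normalCoord ι ν e p k

end Hypersurface

/-- An `O(2) × ℤ₂`-symmetric background: a two-sided minimal surface `M` embedded by `ι` in a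
Riemannian three-manifold `(N, g)`, equivariantly for actions of `O(2) × ℤ₂`, the action on `N`
being isometric, with `|A|² + Ric(ν, ν) > 0`, together with a conformal equivariant
parametrization of `M` by the cylinder.

The cylinder `Cyl = 𝕊¹ × ℝ` is described through its universal cover: `x (ϑ, s)` is the value of
the parametrization `X` at `((cos ϑ, sin ϑ), s)`. -/
structure Background (M N : Type*) [TopologicalSpace M] [ChartedSpace E2 M]
    [IsManifold (𝓡 2) ∞ M] [TopologicalSpace N] [ChartedSpace E3 N] [IsManifold (𝓡 3) ∞ N]
    [MulAction SymGroup M] [MulAction SymGroup N] where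
  /-- the Riemannian metric of `N` -/
  g : Metric3 N
  /-- the embedding of the surface -/
  ι : M → N
  embedding : Manifold.IsSmoothEmbedding (𝓡 2) (𝓡 3) ∞ ι
  /-- the unit normal -/
  ν : ∀ p, TangentSpace (𝓡 3) (ι p)
  normal_smooth : ContMDiff (𝓡 2) (𝓡 3).tangent ∞
    (fun p => (⟨ι p, ν p⟩ : TangentBundle (𝓡 3) N))
  normal_unit : ∀ p, g.inner (ι p) (ν p) (ν p) = 1
  normal_orthogonal : ∀ p (v : TangentSpace (𝓡 2) p),
    g.inner (ι p) (ν p) (mfderiv (𝓡 2) (𝓡 3) ι p v) = 0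
  minimal : ∀ e ∈ IsManifold.maximalAtlas (𝓡 3) ∞ N, ∀ e' ∈ IsManifold.maximalAtlas (𝓡 2) ∞ M,
    ∀ p ∈ e'.source, ι p ∈ e.source → meanCurvature g ι ν e e' p = 0
  /-- the function `|A|² + Ric(ν, ν)` on the surface -/
  q : M → ℝ
  /-- `q` is given by the usual tensor formula, in whatever charts it is computed -/
  q_eq : ∀ e ∈ IsManifold.maximalAtlas (𝓡 3) ∞ N, ∀ e' ∈ IsManifold.maximalAtlas (𝓡 2) ∞ M,
    ∀ p ∈ e'.source, ι p ∈ e.source → q p = jacobiPotential g ι ν e e' p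
  q_pos : ∀ p, 0 < q p
  action_smooth : ∀ a : SymGroup, ContMDiff (𝓡 2) (𝓡 2) ∞ (fun p : M => a • p)
  action_smooth' : ∀ a : SymGroup, ContMDiff (𝓡 3) (𝓡 3) ∞ (fun y : N => a • y)
  isometric : ∀ (a : SymGroup) (y : N) (v w : TangentSpace (𝓡 3) y),
    g.inner (a • y) (mfderiv (𝓡 3) (𝓡 3) (fun z : N => a • z) y v)
      (mfderiv (𝓡 3) (𝓡 3) (fun z : N => a • z) y w) = g.inner y v w
  equivariant : ∀ (a : SymGroup) (p : M), ι (a • p) = a • ι p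
  /-- the half-length of the interval `I = (-l, l)` -/
  l : EReal
  /-- the conformal parametrization (extended to all of `Cyl` if the surface is a torus) -/
  x : ℝ × ℝ → M
  x_smooth : ContMDiff 𝓘(ℝ, ℝ × ℝ) (𝓡 2) ∞ x
  /-- `X` is equivariant: `(A, ε)` acts on `Cyl` by `(z, s) ↦ (A z, ε s)` -/
  x_equivariant : ∀ (A : Matrix.orthogonalGroup (Fin 2) ℝ) (ε : ℤˣ) (ϑ ϑ' s : ℝ),
    A.1.mulVec ![Real.cos ϑ, Real.sin ϑ] = ![Real.cos ϑ', Real.sin ϑ'] →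
      ((A, ε) : SymGroup) • x (ϑ, s) = x (ϑ', ((ε : ℤ) : ℝ) * s)
  /-- the pullback of the induced metric is a positive multiple of `dϑ² + ds²` -/
  x_conformal : ∀ z : ℝ × ℝ,
    0 < induced g ι (x z) (mfderiv 𝓘(ℝ, ℝ × ℝ) (𝓡 2) x z ((0, 1) : ℝ × ℝ))
        (mfderiv 𝓘(ℝ, ℝ × ℝ) (𝓡 2) x z ((0, 1) : ℝ × ℝ)) ∧
    induced g ι (x z) (mfderiv 𝓘(ℝ, ℝ × ℝ) (𝓡 2) x z ((1, 0) : ℝ × ℝ))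
        (mfderiv 𝓘(ℝ, ℝ × ℝ) (𝓡 2) x z ((1, 0) : ℝ × ℝ)) =
      induced g ι (x z) (mfderiv 𝓘(ℝ, ℝ × ℝ) (𝓡 2) x z ((0, 1) : ℝ × ℝ))
        (mfderiv 𝓘(ℝ, ℝ × ℝ) (𝓡 2) x z ((0, 1) : ℝ × ℝ)) ∧
    induced g ι (x z) (mfderiv 𝓘(ℝ, ℝ × ℝ) (𝓡 2) x z ((1, 0) : ℝ × ℝ))
        (mfderiv 𝓘(ℝ, ℝ × ℝ) (𝓡 2) x z ((0, 1) : ℝ × ℝ)) = 0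
  /-- `X` is injective on `Cyl_I` -/
  x_injective : ∀ ϑ s ϑ' s' : ℝ, ((|s| : ℝ) : EReal) < l → ((|s'| : ℝ) : EReal) < l →
    x (ϑ, s) = x (ϑ', s') → s = s' ∧ Real.cos ϑ = Real.cos ϑ' ∧ Real.sin ϑ = Real.sin ϑ'
  /-- Either the surface is a sphere, `I = ℝ`, and the image of `X` is the complement of two points
  to which the two ends of `Cyl` converge; or the surface is a torus, `l` is finite, and `X`, which
  is then `2l`-periodic in `s`, maps `Cyl_I` onto the complement of the circle `X(Cyl_l)`. -/
  sphere_or_torus :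
    (l = ⊤ ∧ ∃ p₁ p₂ : M, p₁ ≠ p₂ ∧ range x = {p₁, p₂}ᶜ ∧
      Tendsto x (comap Prod.snd atTop) (𝓝 p₁) ∧ Tendsto x (comap Prod.snd atBot) (𝓝 p₂)) ∨
    (∃ L : ℝ, 0 < L ∧ l = (L : EReal) ∧ (∀ ϑ s : ℝ, x (ϑ, s + 2 * L) = x (ϑ, s)) ∧
      x '' (univ ×ˢ Ioo (-L) L) = (x '' (univ ×ˢ {L}))ᶜ)

namespace Background

variable {M N : Type*} [TopologicalSpace M] [ChartedSpace E2 M]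
  [IsManifold (𝓡 2) ∞ M] [TopologicalSpace N] [ChartedSpace E3 N] [IsManifold (𝓡 3) ∞ N]
  [MulAction SymGroup M] [MulAction SymGroup N] (B : Background M N)

/-- The interval `I = (-l, l)`. -/
def I : Set ℝ := {s | ((|s| : ℝ) : EReal) < B.l}

/-- The filter of `s ↗ l`. -/
def atEnd : Filter ℝ := comap (fun s : ℝ => (s : EReal)) (𝓝[<] B.l)

/-- The domain `X(Cyl_I) ⊆ M`. -/
def Ω : Set M := B.x '' (univ ×ˢ B.I)

/-- The conformal factor `e^{2ω}`, where `X^* g = e^{2ω} (dϑ² + ds²)`. -/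
def conformalFactor (z : ℝ × ℝ) : ℝ :=
  induced B.g B.ι (B.x z) (mfderiv 𝓘(ℝ, ℝ × ℝ) (𝓡 2) B.x z ((0, 1) : ℝ × ℝ))
    (mfderiv 𝓘(ℝ, ℝ × ℝ) (𝓡 2) B.x z ((0, 1) : ℝ × ℝ))

/-- The potential `V = e^{2ω} (|A|² + Ric(ν, ν)) ∘ X`. -/
def V (z : ℝ × ℝ) : ℝ := B.conformalFactor z * B.q (B.x z)

/-- The operator `∂²/∂s² + ∂²/∂ϑ² + V = e^{2ω} (Δ + |A|² + Ric(ν, ν))` on functions of `(ϑ, s)`. -/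
def Lchi (u : ℝ × ℝ → ℝ) (z : ℝ × ℝ) : ℝ :=
  iteratedDeriv 2 (fun s => u (z.1, s)) z.2 + iteratedDeriv 2 (fun ϑ => u (ϑ, z.2)) z.1
    + B.V z * u z

/-- The rotationally invariant function `φ` as a function of `s`. -/
def profile (φ : M → ℝ) (s : ℝ) : ℝ := φ (B.x (0, s))

/-- The flux `F_+ = ∂_+ φ / φ`, where `∂_+` is the right derivative in `s`. -/
def fluxP (φ : M → ℝ) (s : ℝ) : ℝ :=
  derivWithin (B.profile φ) (Ici s) s / B.profile φ s

/-- The flux `F_- = ∂_- φ / φ`, where `∂_-` is minus the left derivative in `s`. -/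
def fluxM (φ : M → ℝ) (s : ℝ) : ℝ :=
  -derivWithin (B.profile φ) (Iic s) s / B.profile φ s

/-- `φ` is a rotationally invariant linearized doubling (RLD) solution on `X(Cyl_I)` with the
`k` jump latitudes `s 0 < ⋯ < s (k - 1)` (further values of `s` are irrelevant). -/
structure IsRLD (φ : M → ℝ) (k : ℕ) (s : ℕ → ℝ) : Prop where
  k_pos : 0 < k
  s_nonneg : 0 ≤ s 0
  s_lt : ∀ i, i + 1 < k → s i < s (i + 1)
  s_mem : ∀ i < k, s i ∈ B.I
  invariant : ∀ (a : SymGroup), ∀ p ∈ B.Ω, φ (a • p) = φ p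
  continuousOn : ContinuousOn φ B.Ω
  pos : ∀ p ∈ B.Ω, 0 < φ p
  /-- between consecutive circles `s = ± s i`, and up to these circles, `φ` is smooth -/
  smooth : ∀ a ∈ B.I, ∀ b ∈ B.I, a < b → (∀ i < k, s i ∉ Ioo a b ∧ -s i ∉ Ioo a b) →
    ContDiffOn ℝ ∞ (fun z => φ (B.x z)) (univ ×ˢ Icc a b)
  /-- away from the circles `s = ± s i`, `φ` solves the Jacobi equation -/
  equation : ∀ ϑ : ℝ, ∀ t ∈ B.I, (∀ i < k, t ≠ s i ∧ t ≠ -s i) →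
    B.Lchi (fun z => φ (B.x z)) (ϑ, t) = 0
  fluxM_pos : ∀ i < k, 0 < B.fluxM φ (s i)
  fluxP_pos : ∀ i < k, 0 < B.fluxP φ (s i)

/-- `φ = 1` on the equatorial circle `s = 0`. -/
def IsUnit (φ : M → ℝ) : Prop := B.profile φ 0 = 1

/-- The mean flux `F_i` at the latitude `t`, with `2 F_i = F_{i+} + F_{i-}`. -/
def flux (φ : M → ℝ) (t : ℝ) : ℝ := (B.fluxP φ t + B.fluxM φ t) / 2

/-- The flux ratios of `φ` are `(σ 0, …, σ (k - 2))`, `(ξ 0, …, ξ (k - 1))`. -/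
def HasFluxRatios (φ : M → ℝ) (k : ℕ) (s σ ξ : ℕ → ℝ) : Prop :=
  (∀ j, j + 1 < k → Real.exp (σ j) = B.flux φ (s (j + 1)) / B.flux φ (s j)) ∧
  (∀ i < k, ξ i = (B.fluxP φ (s i) - B.fluxM φ (s i)) / (B.fluxP φ (s i) + B.fluxM φ (s i)))

/-- Smooth solutions on `I` of the equation `f'' + V f = 0` for rotationally invariant functions. -/
def IsSolution (f : ℝ → ℝ) : Prop :=
  ContDiffOn ℝ ∞ f B.I ∧ ∀ t ∈ B.I, iteratedDeriv 2 f t + B.V (0, t) * f t = 0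

/-- The solution `φ_even` with `φ_even(0) = 1`, `φ_even'(0) = 0`. -/
def phiEven : ℝ → ℝ :=
  Classical.epsilon fun f => B.IsSolution f ∧ f 0 = 1 ∧ deriv f 0 = 0

/-- The solution `φ_end` with `φ_end → 1` and `φ_end' / φ_end → 0` as `s ↗ l`. -/
def phiEnd : ℝ → ℝ :=
  Classical.epsilon fun f => B.IsSolution f ∧ Tendsto f B.atEnd (𝓝 1) ∧
    Tendsto (fun t => deriv f t / f t) B.atEnd (𝓝 0)

open Classical in
/-- `F_max` is the limit as `s ↗ l` of the flux `F_- = -φ_even' / φ_even` if `φ_even > 0` on `I`,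
and `∞` otherwise. -/
def Fmax : EReal :=
  if ∀ t ∈ B.I, 0 < B.phiEven t then
    limUnder B.atEnd (fun t => ((-deriv B.phiEven t / B.phiEven t : ℝ) : EReal))
  else ⊤

/-- `φ̂` of the even case: a unit RLD solution with `s_1 > 0`, `F_{1-} = F`, and the prescribed
flux ratios. -/
def IsHat (F : ℝ) (σ ξ : ℕ → ℝ) (φ : M → ℝ) (k : ℕ) (s : ℕ → ℝ) : Prop :=
  B.IsRLD φ k s ∧ B.IsUnit φ ∧ 0 < s 0 ∧ B.fluxM φ (s 0) = F ∧ B.HasFluxRatios φ k s σ ξ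

/-- The parameters `(F, σ, ξ)` with `0 < F < F_max` and `|ξ| < 1`. -/
def params : Set (ℝ × L1 × Linf) := {P | 0 < P.1 ∧ (P.1 : EReal) < B.Fmax ∧ ‖P.2.2‖ < 1}

/-- `φ`, with last jump latitude `s (k - 1)`, is smooth at the ends. -/
def SmoothAtEnds (φ : M → ℝ) (k : ℕ) (s : ℕ → ℝ) : Prop :=
  B.fluxP φ (s (k - 1)) = deriv B.phiEnd (s (k - 1)) / B.phiEnd (s (k - 1))

end Background

/-- The number `k_∘` of the circles `s = ± s_i`. -/
def circles (k : ℕ) (s : ℕ → ℝ) : ℕ := {t : ℝ | ∃ i < k, t = s i ∨ t = -s i}.ncard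

/-- The least number of circles of an RLD solution on the closed surface, that is, of an RLD
solution on `X(Cyl_I)` which is smooth at the ends. -/
def Background.kCircMin {M N : Type*} [TopologicalSpace M] [ChartedSpace E2 M]
    [IsManifold (𝓡 2) ∞ M] [TopologicalSpace N] [ChartedSpace E3 N] [IsManifold (𝓡 3) ∞ N]
    [MulAction SymGroup M] [MulAction SymGroup N] (B : Background M N) : ℕ :=
  sInf {c | ∃ φ k s, B.IsRLD φ k s ∧ B.SmoothAtEnds φ k s ∧ circles k s = c}

end RLD

end

/-!
The function `|A|² + Ric(ν, ν)` is smooth and invariant under the symmetries (`Background.q_smul`),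
and so is the conformal factor. Hence `V` is a smooth positive even function of the latitude, and
everything reduces to the equation `y'' + V y = 0` on the line: an RLD solution is the same as a
*chain* `0 = T 0 < T 1 < ⋯ < T n` in which a positive solution on `[T j, T (j + 1)]` starts with
logarithmic derivative `P j` and ends with `-M (j + 1)`, and a last solution is positive up to the
end `l` (`IsRLD.isProfile`, `IsRLD.eq_radial`, `Potential.IsProfile.isRLD`). The flux ratios
prescribe all `P j` and `M j` up to a common factor `F`, and a chain is determined by them, because
the logarithmic derivative of a positive solution decreases strictly. This gives uniqueness.

The rest follows from three properties of the next latitude `T (j + 1)` as a function of `T j`, `P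
j` and `M (j + 1)`. It is smooth, by the implicit function theorem (`IsNext.contDiffAt_nxt`). It is
increasing, by Sturm comparison (`IsNext.comparison`), so the latitudes increase with `F` and the
number of possible steps decreases. And a solution starting close to the end with slope bounded
below stays increasing up to the end (`IsEnd.exists_dsol_pos`), so every chain stops. Hence the
values of `F` for which `n` steps are possible form an interval `(0, threshold n)`. At a finite
threshold the last step disappears at the end, and solutions starting there are increasing; nearby
chains make at most one further step, whence the thresholds decrease strictly (`threshold_succ_lt`).
Which of them are infinite does not depend on the flux ratios (`threshold_eq_top`), because a chain
is dominated by any other one with a large factor `F`; this gives `k_min`. The same statement about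
the disappearing step gives continuous dependence on compact subsets (`hat_tendstoUniformlyOn`).

For solutions smooth at the ends, one considers chains of `n` steps followed by a maximum. They
exist for small `F`, and a solution smooth at the ends with fewer circles shows, by domination, that
they do not exist for large `F` (`exists_not_flat_reach`). At the supremum of these `F` the
Wronskian of the last solution with the end solution vanishes, being a limit of negative numbers
and, since that solution is increasing, nonnegative (`exists_smooth_end`). Uniqueness is again
monotonicity in `F` (`smooth_end_unique`).

All of this needs an end solution. On a torus `l` is finite and it is the solution with data `(1,
0)` at `l`. On a sphere one has to know that `V` is integrable twice near infinity. This comes from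
the smoothness of the surface at the two poles: in a chart, the cap above a circle of latitude lies
in a disk with radius comparable to the length of the circle (`area_cap_le`), hence the conformal
factor `h` satisfies `∫ₛ^∞ h ≤ C h(s)`, which can be integrated once more.
-/

noncomputable section

set_option linter.unusedSectionVars false

namespace RLD

/-! ### Differentials, charts and immersions -/

section TangentMaps

variable {E F G : Type*} [NormedAddCommGroup E] [NormedSpace ℝ E]
  [NormedAddCommGroup F] [NormedSpace ℝ F] [NormedAddCommGroup G] [NormedSpace ℝ G]
  {X : Type*} [TopologicalSpace X] [ChartedSpace E X] [IsManifold 𝓘(ℝ, E) ∞ X]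
  {Y : Type*} [TopologicalSpace Y] [ChartedSpace F Y] [IsManifold 𝓘(ℝ, F) ∞ Y]
  {Z : Type*} [TopologicalSpace Z] [ChartedSpace G Z]

/-- The differential of a smooth map carries a smooth vector field along a map to a smooth vector
field along the composition. -/
theorem contMDiffAt_mfderiv_comp {f : X → Y} {U : Set X} (hU : IsOpen U)
    (hf : ContMDiffOn 𝓘(ℝ, E) 𝓘(ℝ, F) ∞ f U) {b : Z → X} {w : ∀ z, TangentSpace 𝓘(ℝ, E) (b z)}
    {z₀ : Z} (hw : ContMDiffAt 𝓘(ℝ, G) 𝓘(ℝ, E).tangent ∞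
      (fun z => (⟨b z, w z⟩ : TangentBundle 𝓘(ℝ, E) X)) z₀) (h₀ : b z₀ ∈ U) :
    ContMDiffAt 𝓘(ℝ, G) 𝓘(ℝ, F).tangent ∞
      (fun z => (⟨f (b z), mfderiv 𝓘(ℝ, E) 𝓘(ℝ, F) f (b z) (w z)⟩ : TangentBundle 𝓘(ℝ, F) Y))
      z₀ := by
  have hb : ContMDiffAt 𝓘(ℝ, G) 𝓘(ℝ, E) ∞ b z₀ := (Bundle.contMDiffAt_totalSpace.1 hw).1
  have hT : ContMDiffAt 𝓘(ℝ, E).tangent 𝓘(ℝ, F).tangent ∞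
      (tangentMapWithin 𝓘(ℝ, E) 𝓘(ℝ, F) f U) (⟨b z₀, w z₀⟩ : TangentBundle 𝓘(ℝ, E) X) := by
    have := hf.contMDiffOn_tangentMapWithin (m := ∞) (by simp) hU.uniqueMDiffOn
    refine this.contMDiffAt ?_
    exact (hU.preimage (FiberBundle.continuous_proj E (TangentSpace 𝓘(ℝ, E)))).mem_nhds h₀
  refine (hT.comp z₀ hw).congr_of_eventuallyEq ?_
  filter_upwards [hb.continuousAt.preimage_mem_nhds (hU.mem_nhds h₀)] with z hz
  simp only [Function.comp, tangentMapWithin]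
  rw [mfderivWithin_of_isOpen hU hz]

theorem contMDiffAt_mfderiv_apply {f : E → Y} {U : Set E} (hU : IsOpen U)
    (hf : ContMDiffOn 𝓘(ℝ, E) 𝓘(ℝ, F) ∞ f U) {b : Z → E} {z₀ : Z}
    (hb : ContMDiffAt 𝓘(ℝ, G) 𝓘(ℝ, E) ∞ b z₀) (h₀ : b z₀ ∈ U) (v : E) :
    ContMDiffAt 𝓘(ℝ, G) 𝓘(ℝ, F).tangent ∞
      (fun z => (⟨f (b z), mfderiv 𝓘(ℝ, E) 𝓘(ℝ, F) f (b z) v⟩ : TangentBundle 𝓘(ℝ, F) Y)) z₀ := by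
  refine contMDiffAt_mfderiv_comp (w := fun _ => v) hU hf ?_ h₀
  rw [Bundle.contMDiffAt_totalSpace]
  refine ⟨hb, ?_⟩
  convert! contMDiffAt_const (c := v)
  simp

end TangentMaps

section Metric

variable {N : Type*} [TopologicalSpace N] [ChartedSpace E3 N] [IsManifold (𝓡 3) ∞ N]
  {G : Type*} [NormedAddCommGroup G] [NormedSpace ℝ G]
  {Z : Type*} [TopologicalSpace Z] [ChartedSpace G Z]

theorem contMDiffAt_inner (g : Metric3 N) {b : Z → N} {v w : ∀ z, TangentSpace (𝓡 3) (b z)} {z₀ : Z}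
    (hv : ContMDiffAt 𝓘(ℝ, G) (𝓡 3).tangent ∞ (fun z => (⟨b z, v z⟩ : TangentBundle (𝓡 3) N)) z₀)
    (hw : ContMDiffAt 𝓘(ℝ, G) (𝓡 3).tangent ∞ (fun z => (⟨b z, w z⟩ : TangentBundle (𝓡 3) N)) z₀) :
    ContMDiffAt 𝓘(ℝ, G) 𝓘(ℝ, ℝ) ∞ (fun z => g.inner (b z) (v z) (w z)) z₀ := by
  have hb : ContMDiffAt 𝓘(ℝ, G) (𝓡 3) ∞ b z₀ := (Bundle.contMDiffAt_totalSpace.1 hv).1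
  have : ContMDiffAt 𝓘(ℝ, G) ((𝓡 3).prod 𝓘(ℝ)) ∞
      (fun m ↦ Bundle.TotalSpace.mk' ℝ (E := Bundle.Trivial N ℝ) (b m)
        (g.inner (b m) (v m) (w m))) z₀ := by
    apply ContMDiffAt.clm_bundle_apply₂ (F₁ := E3) (F₂ := E3)
    · exact ContMDiffAt.comp z₀ g.contMDiff.contMDiffAt hb
    · exact hv
    · exact hw
  simp only [Bundle.contMDiffAt_totalSpace] at this
  exact this.2

end Metric

section Charts

variable {n : ℕ} {X : Type*} [TopologicalSpace X] [ChartedSpace (EuclideanSpace ℝ (Fin n)) X]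

theorem chart_mdifferentiable [IsManifold (𝓡 n) ∞ X] {e : OpenPartialHomeomorph X (EuclideanSpace ℝ (Fin n))}
    (he : e ∈ IsManifold.maximalAtlas (𝓡 n) ∞ X) : e.MDifferentiable (𝓡 n) (𝓡 n) :=
  ⟨(contMDiffOn_of_mem_maximalAtlas he).mdifferentiableOn (by simp),
   (contMDiffOn_symm_of_mem_maximalAtlas he).mdifferentiableOn (by simp)⟩

/-- Pulling back a chart of the maximal atlas by a diffeomorphism gives a chart of the maximal
atlas. -/
theorem homeomorph_trans_mem_maximalAtlas [IsManifold (𝓡 n) ∞ X] (h : X ≃ₜ X)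
    (h₁ : ContMDiff (𝓡 n) (𝓡 n) ∞ h) (h₂ : ContMDiff (𝓡 n) (𝓡 n) ∞ h.symm)
    {e : OpenPartialHomeomorph X (EuclideanSpace ℝ (Fin n))}
    (he : e ∈ IsManifold.maximalAtlas (𝓡 n) ∞ X) :
    h.toOpenPartialHomeomorph.trans e ∈ IsManifold.maximalAtlas (𝓡 n) ∞ X := by
  have key : ∀ f : OpenPartialHomeomorph X (EuclideanSpace ℝ (Fin n)),
      ContMDiffOn (𝓡 n) (𝓡 n) ∞ f f.source → ContMDiffOn (𝓡 n) (𝓡 n) ∞ f.symm f.target →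
      f ∈ IsManifold.maximalAtlas (𝓡 n) ∞ X := by
    intro f hf hf'
    refine mem_maximalAtlas_iff.2 fun e' he' => ?_
    have he'' : e' ∈ IsManifold.maximalAtlas (𝓡 n) ∞ X := IsManifold.subset_maximalAtlas he'
    have t1 : ContMDiffOn (𝓡 n) (𝓡 n) ∞ (f.symm ≫ₕ e') (f.symm ≫ₕ e').source := by
      simp only [OpenPartialHomeomorph.coe_trans, OpenPartialHomeomorph.trans_source]
      exact (contMDiffOn_of_mem_maximalAtlas he'').comp (hf'.mono inter_subset_left)
        inter_subset_right
    have t2 : ContMDiffOn (𝓡 n) (𝓡 n) ∞ (e'.symm ≫ₕ f) (e'.symm ≫ₕ f).source := by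
      simp only [OpenPartialHomeomorph.coe_trans, OpenPartialHomeomorph.trans_source]
      exact hf.comp ((contMDiffOn_symm_of_mem_maximalAtlas he'').mono inter_subset_left)
        inter_subset_right
    have c1 := contMDiffOn_iff_contDiffOn.1 t1
    have c2 := contMDiffOn_iff_contDiffOn.1 t2
    constructor
    · rw [contDiffGroupoid, mem_groupoid_of_pregroupoid]
      simp only [contDiffPregroupoid, modelWithCornersSelf_coe,
        modelWithCornersSelf_coe_symm, range_id, inter_univ, Function.comp_id, Function.id_comp,
        preimage_id]
      refine ⟨c1, ?_⟩
      rw [← OpenPartialHomeomorph.symm_source, OpenPartialHomeomorph.trans_symm_eq_symm_trans_symm]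
      simpa using c2
    · rw [contDiffGroupoid, mem_groupoid_of_pregroupoid]
      simp only [contDiffPregroupoid, modelWithCornersSelf_coe,
        modelWithCornersSelf_coe_symm, range_id, inter_univ, Function.comp_id, Function.id_comp,
        preimage_id]
      refine ⟨c2, ?_⟩
      rw [← OpenPartialHomeomorph.symm_source, OpenPartialHomeomorph.trans_symm_eq_symm_trans_symm]
      simpa using c1
  apply key
  · exact (contMDiffOn_of_mem_maximalAtlas he).comp h₁.contMDiffOn (fun x hx => by simpa using hx)
  · have : (h.toOpenPartialHomeomorph.trans e).target = e.target := by simp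
    rw [this]
    exact h₂.comp_contMDiffOn (contMDiffOn_symm_of_mem_maximalAtlas he)

end Charts

section Immersion

variable {M N : Type*} [TopologicalSpace M] [ChartedSpace E2 M] [IsManifold (𝓡 2) ∞ M]
  [TopologicalSpace N] [ChartedSpace E3 N] [IsManifold (𝓡 3) ∞ N]

/-- In the charts of the definition an immersion is a linear injection, so its differential is
injective. -/
theorem injective_mfderiv_of_isImmersionAt {f : M → N} {p : M}
    (h : Manifold.IsImmersionAt (𝓡 2) (𝓡 3) ∞ f p) :
    Function.Injective (mfderiv (𝓡 2) (𝓡 3) f p) := by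
  have hf : MDifferentiableAt (𝓡 2) (𝓡 3) f p := h.contMDiffAt.mdifferentiableAt (by simp)
  have hD := chart_mdifferentiable h.domChart_mem_maximalAtlas
  have hC := chart_mdifferentiable h.codChart_mem_maximalAtlas
  set D := h.domChart
  set C := h.codChart
  let L : E2 →L[ℝ] E3 := (h.equiv : (E2 × h.complement) →L[ℝ] E3).comp (.inl ℝ E2 h.complement)
  have heq : (C ∘ f) =ᶠ[𝓝 p] (L ∘ D) := by
    filter_upwards [D.open_source.mem_nhds h.mem_domChart_source] with q hq
    have hmem : D q ∈ (h.domChart.extend (𝓡 2)).target := by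
      simpa [OpenPartialHomeomorph.extend_target] using D.map_source hq
    have := h.writtenInCharts hmem
    simp only [Function.comp, OpenPartialHomeomorph.extend_coe, modelWithCornersSelf_coe, id,
      OpenPartialHomeomorph.extend_coe_symm, modelWithCornersSelf_coe_symm] at this
    change C (f (D.symm (D q))) = _ at this
    rw [D.left_inv hq] at this
    simpa [L] using this
  have h1 : mfderiv (𝓡 2) (𝓡 3) (C ∘ f) p
      = (mfderiv (𝓡 3) (𝓡 3) C (f p)).comp (mfderiv (𝓡 2) (𝓡 3) f p) :=
    mfderiv_comp p (hC.mdifferentiableAt h.mem_codChart_source) hf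
  have h2 : mfderiv (𝓡 2) (𝓡 3) (L ∘ D) p
      = (mfderiv (𝓡 2) (𝓡 3) L (D p)).comp (mfderiv (𝓡 2) (𝓡 2) D p) :=
    mfderiv_comp p L.mdifferentiableAt (hD.mdifferentiableAt h.mem_domChart_source)
  have hL : Function.Injective L := by
    intro u v huv
    have := h.equiv.injective huv
    simpa using this
  intro u v huv
  have e1 : mfderiv (𝓡 2) (𝓡 3) (L ∘ D) p u = mfderiv (𝓡 2) (𝓡 3) (L ∘ D) p v := by
    rw [← heq.mfderiv_eq, h1]
    exact congrArg (mfderiv (𝓡 3) (𝓡 3) C (f p)) huv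
  rw [h2, mfderiv_eq_fderiv, L.fderiv] at e1
  exact hD.mfderiv_injective h.mem_domChart_source (hL e1)

end Immersion

/-! ### Smoothness of the potential -/

section SmoothMatrices

variable {E : Type*} [NormedAddCommGroup E] [NormedSpace ℝ E]

theorem contDiffAt_matrix_det {n : ℕ} {A : E → Matrix (Fin n) (Fin n) ℝ} {z : E}
    (h : ∀ i j, ContDiffAt ℝ ∞ (fun y => A y i j) z) : ContDiffAt ℝ ∞ (fun y => (A y).det) z := by
  simp only [Matrix.det_apply']
  exact ContDiffAt.sum fun σ _ => contDiffAt_const.mul (contDiffAt_prod fun i _ => h _ _)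

theorem contDiffAt_matrix_inv {n : ℕ} {A : E → Matrix (Fin n) (Fin n) ℝ} {z : E}
    (h : ∀ i j, ContDiffAt ℝ ∞ (fun y => A y i j) z) (h₀ : (A z).det ≠ 0) (i j : Fin n) :
    ContDiffAt ℝ ∞ (fun y => (A y)⁻¹ i j) z := by
  simp only [Matrix.inv_def, Ring.inverse_eq_inv', Matrix.smul_apply, Matrix.adjugate_apply,
    smul_eq_mul]
  refine (ContDiffAt.inv (contDiffAt_matrix_det h) h₀).mul (contDiffAt_matrix_det fun k l => ?_)
  by_cases hk : k = j
  · subst hk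
    simpa using contDiffAt_const
  · simpa [Matrix.updateRow_ne hk] using h k l

theorem contDiffAt_matrix_mul {n : ℕ} {A B : E → Matrix (Fin n) (Fin n) ℝ} {z : E}
    (hA : ∀ i j, ContDiffAt ℝ ∞ (fun y => A y i j) z)
    (hB : ∀ i j, ContDiffAt ℝ ∞ (fun y => B y i j) z) (i j : Fin n) :
    ContDiffAt ℝ ∞ (fun y => (A y * B y) i j) z := by
  simp only [Matrix.mul_apply]
  exact ContDiffAt.sum fun k _ => (hA i k).mul (hB k j)

theorem contDiffAt_pd {n : ℕ} {f : EuclideanSpace ℝ (Fin n) → ℝ} {y : EuclideanSpace ℝ (Fin n)}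
    (h : ContDiffAt ℝ ∞ f y) (i : Fin n) : ContDiffAt ℝ ∞ (pd f i) y :=
  (h.fderiv_right (m := ∞) (by simp)).clm_apply contDiffAt_const

variable {n : ℕ} {G : EuclideanSpace ℝ (Fin n) → Matrix (Fin n) (Fin n) ℝ}
  {y : EuclideanSpace ℝ (Fin n)}

theorem contDiffAt_christoffel (h : ∀ i j, ContDiffAt ℝ ∞ (fun y => G y i j) y)
    (h₀ : (G y).det ≠ 0) (k i j : Fin n) :
    ContDiffAt ℝ ∞ (fun y => christoffel G y k i j) y := by
  unfold christoffel
  refine contDiffAt_const.mul (ContDiffAt.sum fun l _ => ?_)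
  exact (contDiffAt_matrix_inv h h₀ k l).mul
    (((contDiffAt_pd (h j l) i).add (contDiffAt_pd (h i l) j)).sub (contDiffAt_pd (h i j) l))

theorem contDiffAt_ricci (h : ∀ i j, ContDiffAt ℝ ∞ (fun y => G y i j) y)
    (h₀ : (G y).det ≠ 0) (j k : Fin n) :
    ContDiffAt ℝ ∞ (fun y => ricci G y j k) y := by
  unfold ricci
  have hc := fun a b c => contDiffAt_christoffel h h₀ a b c
  refine (ContDiffAt.sum fun i _ => ?_).add
    (ContDiffAt.sum fun i _ => ContDiffAt.sum fun p _ => ?_)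
  · exact (contDiffAt_pd (hc i j k) i).sub (contDiffAt_pd (hc i i j) k)
  · exact ((hc i i p).mul (hc p j k)).sub ((hc i k p).mul (hc p i j))

theorem pd_congr {f f' : EuclideanSpace ℝ (Fin n) → ℝ} (h : f =ᶠ[𝓝 y] f') (i : Fin n) :
    pd f i =ᶠ[𝓝 y] pd f' i := by
  filter_upwards [h.eventually_nhds] with z hz
  simp only [pd, Filter.EventuallyEq.fderiv_eq hz]

theorem christoffel_congr {G' : EuclideanSpace ℝ (Fin n) → Matrix (Fin n) (Fin n) ℝ}
    (h : G =ᶠ[𝓝 y] G') (k i j : Fin n) :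
    (fun z => christoffel G z k i j) =ᶠ[𝓝 y] fun z => christoffel G' z k i j := by
  have hp := fun a b c => pd_congr (f := fun z => G z a b) (f' := fun z => G' z a b) (y := y)
    (h.mono fun z hz => by simp only [hz]) c
  filter_upwards [h, eventually_all.2 fun a => eventually_all.2 fun b => eventually_all.2 fun c =>
    hp a b c] with z h1 h2
  simp only [christoffel, h1, h2]

theorem ricci_congr {G' : EuclideanSpace ℝ (Fin n) → Matrix (Fin n) (Fin n) ℝ}
    (h : G =ᶠ[𝓝 y] G') (j k : Fin n) : ricci G y j k = ricci G' y j k := by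
  have hc := fun a b c => christoffel_congr h a b c
  have hp := fun a b c d => (pd_congr (hc a b c) d).self_of_nhds
  have hc' := fun a b c => (hc a b c).self_of_nhds
  simp only at hc'
  simp only [ricci, hp, hc']

end SmoothMatrices

section Gram

variable {F : Type*} [AddCommGroup F] [Module ℝ F] [TopologicalSpace F] [IsTopologicalAddGroup F]
  [ContinuousConstSMul ℝ F] {n : ℕ}

theorem bilinear_apply_eq_sum (B : F →L[ℝ] F →L[ℝ] ℝ) (L : EuclideanSpace ℝ (Fin n) →L[ℝ] F)
    (v w : EuclideanSpace ℝ (Fin n)) :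
    B (L v) (L w) = ∑ i, ∑ j, B (L (EuclideanSpace.single i 1)) (L (EuclideanSpace.single j 1))
      * v i * w j := by
  have h : ∀ u : EuclideanSpace ℝ (Fin n), u = ∑ i, u i • EuclideanSpace.single i (1 : ℝ) := by
    intro u
    conv_lhs => rw [← (EuclideanSpace.basisFun (Fin n) ℝ).sum_repr u]
    simp
  conv_lhs => rw [h v, h w]
  simp only [map_sum, map_smul, sum_apply, smul_apply, smul_eq_mul, Finset.mul_sum]
  rw [Finset.sum_comm]
  exact Finset.sum_congr rfl fun i _ => Finset.sum_congr rfl fun j _ => by ring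

/-- The Gram matrix of a positive definite form, pulled back by an injective linear map, is
invertible: a vector in its kernel would have length zero. -/
theorem gram_det_ne_zero (B : F →L[ℝ] F →L[ℝ] ℝ) (hB : ∀ v, v ≠ 0 → 0 < B v v)
    (L : EuclideanSpace ℝ (Fin n) →L[ℝ] F) (hL : Function.Injective L) :
    (Matrix.of fun i j => B (L (EuclideanSpace.single i 1)) (L (EuclideanSpace.single j 1))).det
      ≠ 0 := by
  intro h
  obtain ⟨v, hv, hv'⟩ := Matrix.exists_mulVec_eq_zero_iff.2 h
  set u : EuclideanSpace ℝ (Fin n) := WithLp.toLp 2 v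
  have hu : L u ≠ 0 := by
    intro h0
    apply hv
    have : u = 0 := hL (by simpa using h0)
    simpa [u] using this
  have := hB _ hu
  rw [bilinear_apply_eq_sum] at this
  refine absurd this (not_lt.2 (le_of_eq ?_))
  refine Finset.sum_eq_zero fun i _ => ?_
  have := congrFun hv' i
  simp only [Matrix.mulVec, dotProduct, Matrix.of_apply, Pi.zero_apply] at this
  have e : ∀ j, B (L (EuclideanSpace.single i 1)) (L (EuclideanSpace.single j 1)) * u i * u j
      = u i * (B (L (EuclideanSpace.single i 1)) (L (EuclideanSpace.single j 1)) * v j) := by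
    intro j; simp only [u]; ring
  simp only [e]
  rw [← Finset.mul_sum, this, mul_zero]

end Gram

/-- The coordinate functionals of `E3`. -/
def coordFun (i : Fin 3) : E3 →L[ℝ] ℝ := EuclideanSpace.proj i

section FirstForm

variable {M N : Type*} [TopologicalSpace M] [ChartedSpace E2 M] [IsManifold (𝓡 2) ∞ M]
  [TopologicalSpace N] [ChartedSpace E3 N] [IsManifold (𝓡 3) ∞ N]
  {g : Metric3 N} {ι : M → N} {e : OpenPartialHomeomorph N E3} {e' : OpenPartialHomeomorph M E2}

theorem metricMatrix_contDiffAt (he : e ∈ IsManifold.maximalAtlas (𝓡 3) ∞ N) {y : E3}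
    (hy : y ∈ e.target) (i j : Fin 3) : ContDiffAt ℝ ∞ (fun y => metricMatrix g e y i j) y := by
  rw [← contMDiffAt_iff_contDiffAt]
  exact contMDiffAt_inner g
    (contMDiffAt_mfderiv_apply e.open_target (contMDiffOn_symm_of_mem_maximalAtlas he)
      (b := id) contMDiffAt_id hy _)
    (contMDiffAt_mfderiv_apply e.open_target (contMDiffOn_symm_of_mem_maximalAtlas he)
      (b := id) contMDiffAt_id hy _)

theorem metricMatrix_det_ne_zero (he : e ∈ IsManifold.maximalAtlas (𝓡 3) ∞ N) {y : E3}
    (hy : y ∈ e.target) : (metricMatrix g e y).det ≠ 0 :=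
  gram_det_ne_zero (g.inner (e.symm y)) (g.pos _) (mfderiv (𝓡 3) (𝓡 3) e.symm y)
    ((chart_mdifferentiable he).symm.mfderiv_injective hy)

/-- The metric of the three-manifold in terms of its matrix in a chart. -/
theorem inner_eq_sum (he : e ∈ IsManifold.maximalAtlas (𝓡 3) ∞ N) {q : N}
    (hq : q ∈ e.source) (v w : TangentSpace (𝓡 3) q) :
    g.inner q v w = ∑ i, ∑ j, metricMatrix g e (e q) i j *
      coordFun i (mfderiv (𝓡 3) (𝓡 3) e q v) * coordFun j (mfderiv (𝓡 3) (𝓡 3) e q w) := by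
  have h := (chart_mdifferentiable he).symm_comp_deriv hq
  have h1 : ∀ v : E3, (mfderiv (𝓡 3) (𝓡 3) e.symm (e q) (mfderiv (𝓡 3) (𝓡 3) e q v : E3) : E3) = v :=
    fun v => congrArg (fun L : E3 →L[ℝ] E3 => L v) h
  have := bilinear_apply_eq_sum (F := TangentSpace (𝓡 3) (e.symm (e q))) (g.inner (e.symm (e q)))
    (mfderiv (𝓡 3) (𝓡 3) e.symm (e q)) (mfderiv (𝓡 3) (𝓡 3) e q v : E3)
    (mfderiv (𝓡 3) (𝓡 3) e q w : E3)
  erw [h1 v, h1 w] at this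
  refine Eq.trans ?_ this
  have h2 : ∀ q', q' = q → g.inner q v w = (g.inner q' : E3 →L[ℝ] E3 →L[ℝ] ℝ) v w := by
    rintro q' rfl; rfl
  exact h2 _ (e.left_inv hq)

theorem contDiffAt_coord (he : e ∈ IsManifold.maximalAtlas (𝓡 3) ∞ N)
    (he' : e' ∈ IsManifold.maximalAtlas (𝓡 2) ∞ M) (hι : ContMDiff (𝓡 2) (𝓡 3) ∞ ι) {y : E2}
    (hy : y ∈ e'.target) (hy' : ι (e'.symm y) ∈ e.source) :
    ContDiffAt ℝ ∞ (fun y => e (ι (e'.symm y))) y := by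
  rw [← contMDiffAt_iff_contDiffAt]
  exact (contMDiffAt_of_mem_maximalAtlas he hy').comp y
    ((hι _).comp y (contMDiffAt_symm_of_mem_maximalAtlas he' hy))

/-- The partial derivatives of the embedding in charts are the coordinates of its differential. -/
theorem dCoord_eq (he : e ∈ IsManifold.maximalAtlas (𝓡 3) ∞ N)
    (he' : e' ∈ IsManifold.maximalAtlas (𝓡 2) ∞ M) (hι : ContMDiff (𝓡 2) (𝓡 3) ∞ ι) {p : M}
    (hp : p ∈ e'.source) (hp' : ι p ∈ e.source) (a : Fin 2) (i : Fin 3) :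
    dCoord ι e e' p a i = coordFun i (mfderiv (𝓡 3) (𝓡 3) e (ι p) (mfderiv (𝓡 2) (𝓡 3) ι p
      (mfderiv (𝓡 2) (𝓡 2) e'.symm (e' p) (EuclideanSpace.single a (1 : ℝ) : E2)))) := by
  have hy : e' p ∈ e'.target := e'.map_source hp
  have hs : e'.symm (e' p) = p := e'.left_inv hp
  have hF := contDiffAt_coord he he' hι hy (by rwa [hs])
  have hd : DifferentiableAt ℝ (fun y => e (ι (e'.symm y))) (e' p) := hF.differentiableAt (by simp)
  have h1 : dCoord ι e e' p a i
      = coordFun i (fderiv ℝ (fun y => e (ι (e'.symm y))) (e' p) (EuclideanSpace.single a 1)) := by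
    have := ((coordFun i).hasFDerivAt.comp (e' p)
      hd.hasFDerivAt).fderiv
    simp only [dCoord, pd]
    have h2 : (fun y => (e (ι (e'.symm y))) i)
      = (coordFun i) ∘ fun y => e (ι (e'.symm y)) := rfl
    rw [h2, this]; rfl
  rw [h1, ← mfderiv_eq_fderiv]
  have hι' : MDifferentiableAt (𝓡 2) (𝓡 3) ι (e'.symm (e' p)) := (hι _).mdifferentiableAt (by simp)
  have hes : MDifferentiableAt (𝓡 2) (𝓡 2) e'.symm (e' p) :=
    (chart_mdifferentiable he').mdifferentiableAt_symm hy
  have hee : MDifferentiableAt (𝓡 3) (𝓡 3) e ((ι ∘ e'.symm) (e' p)) :=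
    (chart_mdifferentiable he).mdifferentiableAt (by simpa [hs] using hp')
  have c1 : mfderiv (𝓡 2) (𝓡 3) (e ∘ (ι ∘ e'.symm)) (e' p) = _ :=
    mfderiv_comp (e' p) hee (hι'.comp (e' p) hes)
  have c2 : mfderiv (𝓡 2) (𝓡 3) (ι ∘ e'.symm) (e' p) = _ := mfderiv_comp (e' p) hι' hes
  rw [c2] at c1
  have : (fun y => e (ι (e'.symm y))) = e ∘ (ι ∘ e'.symm) := rfl
  rw [this, c1]
  simp only [Function.comp]
  have h3 : ∀ q, q = p → (mfderiv (𝓡 3) (𝓡 3) e (ι q) ∘L (mfderiv (𝓡 2) (𝓡 3) ι q) : E2 →L[ℝ] E3)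
      = (mfderiv (𝓡 3) (𝓡 3) e (ι p) ∘L (mfderiv (𝓡 2) (𝓡 3) ι p) : E2 →L[ℝ] E3) := by
    rintro q rfl; rfl
  have h4 := congrArg (fun L : E2 →L[ℝ] E3 => coordFun i (L (mfderiv (𝓡 2) (𝓡 2) e'.symm (e' p)
    (EuclideanSpace.single a (1 : ℝ) : E2)))) (h3 _ hs)
  exact h4

/-- The first fundamental form is the matrix of the induced metric in a chart of the surface. -/
theorem firstForm_eq (he : e ∈ IsManifold.maximalAtlas (𝓡 3) ∞ N)
    (he' : e' ∈ IsManifold.maximalAtlas (𝓡 2) ∞ M) (hι : ContMDiff (𝓡 2) (𝓡 3) ∞ ι) {p : M}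
    (hp : p ∈ e'.source) (hp' : ι p ∈ e.source) :
    firstForm g ι e e' p = Matrix.of fun a b =>
      induced g ι p (mfderiv (𝓡 2) (𝓡 2) e'.symm (e' p) (EuclideanSpace.single a (1 : ℝ) : E2))
      (mfderiv (𝓡 2) (𝓡 2) e'.symm (e' p) (EuclideanSpace.single b (1 : ℝ) : E2)) := by
  ext a b
  simp only [firstForm, Matrix.of_apply, induced, dCoord_eq he he' hι hp hp']
  rw [inner_eq_sum he hp']

theorem firstForm_det_ne_zero (he : e ∈ IsManifold.maximalAtlas (𝓡 3) ∞ N)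
    (he' : e' ∈ IsManifold.maximalAtlas (𝓡 2) ∞ M) (hι : ContMDiff (𝓡 2) (𝓡 3) ∞ ι) {p : M}
    (hinj : Function.Injective (mfderiv (𝓡 2) (𝓡 3) ι p))
    (hp : p ∈ e'.source) (hp' : ι p ∈ e.source) : (firstForm g ι e e' p).det ≠ 0 := by
  rw [firstForm_eq he he' hι hp hp']
  exact gram_det_ne_zero (F := TangentSpace (𝓡 3) (ι p)) (g.inner (ι p)) (g.pos _)
    ((mfderiv (𝓡 2) (𝓡 3) ι p : E2 →L[ℝ] E3).comp
      (mfderiv (𝓡 2) (𝓡 2) e'.symm (e' p) : E2 →L[ℝ] E2))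
    (hinj.comp ((chart_mdifferentiable he').symm.mfderiv_injective (e'.map_source hp)))

theorem normalCoord_contMDiffAt {ν : ∀ p, TangentSpace (𝓡 3) (ι p)}
    (hν : ContMDiff (𝓡 2) (𝓡 3).tangent ∞ (fun p => (⟨ι p, ν p⟩ : TangentBundle (𝓡 3) N)))
    (he : e ∈ IsManifold.maximalAtlas (𝓡 3) ∞ N) {p : M} (hp' : ι p ∈ e.source) (i : Fin 3) :
    ContMDiffAt (𝓡 2) 𝓘(ℝ, ℝ) ∞ (fun p => normalCoord ι ν e p i) p := by
  have h1 := contMDiffAt_mfderiv_comp e.open_source (contMDiffOn_of_mem_maximalAtlas he)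
    (hν p) hp'
  have h2 := (contMDiff_snd_tangentBundle_modelSpace E3 𝓘(ℝ, E3) (n := ∞)).contMDiffAt.comp p h1
  exact (coordFun i).contDiff.contMDiff.contMDiffAt.comp
    p h2

/-- The potential of the Jacobi operator in charts is a rational expression, with the determinants
of the metrics as denominators, in derivatives of smooth functions. -/
theorem jacobiPotential_contMDiffAt {ν : ∀ p, TangentSpace (𝓡 3) (ι p)}
    (hν : ContMDiff (𝓡 2) (𝓡 3).tangent ∞ (fun p => (⟨ι p, ν p⟩ : TangentBundle (𝓡 3) N)))
    (he : e ∈ IsManifold.maximalAtlas (𝓡 3) ∞ N)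
    (he' : e' ∈ IsManifold.maximalAtlas (𝓡 2) ∞ M) (hι : ContMDiff (𝓡 2) (𝓡 3) ∞ ι) {p : M}
    (hinj : Function.Injective (mfderiv (𝓡 2) (𝓡 3) ι p))
    (hp : p ∈ e'.source) (hp' : ι p ∈ e.source) :
    ContMDiffAt (𝓡 2) 𝓘(ℝ, ℝ) ∞ (jacobiPotential g ι ν e e') p := by
  have hy : e' p ∈ e'.target := e'.map_source hp
  have hs : e'.symm (e' p) = p := e'.left_inv hp
  have hps : ι (e'.symm (e' p)) ∈ e.source := by rwa [hs]
  have hF := contDiffAt_coord he he' hι hy hps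
  have hFi : ∀ i, ContDiffAt ℝ ∞ (fun y => e (ι (e'.symm y)) i) (e' p) := fun i =>
    (coordFun i).contDiff.contDiffAt.comp _ hF
  have hinv : ∀ᶠ y in 𝓝 (e' p), e' (e'.symm y) = y := e'.eventually_right_inverse hy
  have hd : ∀ a i, ContDiffAt ℝ ∞ (fun y => dCoord ι e e' (e'.symm y) a i) (e' p) := fun a i =>
    (contDiffAt_pd (hFi i) a).congr_of_eventuallyEq (by
      filter_upwards [hinv] with y hy
      simp only [dCoord, hy])
  have hdd : ∀ a b i, ContDiffAt ℝ ∞ (fun y => ddCoord ι e e' (e'.symm y) a b i) (e' p) :=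
    fun a b i => (contDiffAt_pd (contDiffAt_pd (hFi i) a) b).congr_of_eventuallyEq (by
      filter_upwards [hinv] with y hy
      simp only [ddCoord, hy])
  have hes : ContMDiffAt (𝓡 2) (𝓡 2) ∞ e'.symm (e' p) :=
    contMDiffAt_symm_of_mem_maximalAtlas he' hy
  have hn : ∀ i, ContDiffAt ℝ ∞ (fun y => normalCoord ι ν e (e'.symm y) i) (e' p) := fun i =>
    contMDiffAt_iff_contDiffAt.1
      ((normalCoord_contMDiffAt hν he hps i).comp (e' p) hes)
  have ht : e (ι (e'.symm (e' p))) ∈ e.target := e.map_source hps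
  have hG : ∀ i j, ContDiffAt ℝ ∞ (fun y => metricMatrix g e (e (ι (e'.symm y))) i j) (e' p) :=
    fun i j => ContDiffAt.comp (g := fun z => metricMatrix g e z i j) (e' p)
      (metricMatrix_contDiffAt he ht i j) hF
  have hΓ : ∀ k i j, ContDiffAt ℝ ∞
      (fun y => christoffel (metricMatrix g e) (e (ι (e'.symm y))) k i j) (e' p) := fun k i j =>
    ContDiffAt.comp (g := fun z => christoffel (metricMatrix g e) z k i j) (e' p)
      (contDiffAt_christoffel (metricMatrix_contDiffAt he ht) (metricMatrix_det_ne_zero he ht) k i j) hF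
  have hR : ∀ i j, ContDiffAt ℝ ∞
      (fun y => ricci (metricMatrix g e) (e (ι (e'.symm y))) i j) (e' p) := fun i j =>
    ContDiffAt.comp (g := fun z => ricci (metricMatrix g e) z i j) (e' p)
      (contDiffAt_ricci (metricMatrix_contDiffAt he ht) (metricMatrix_det_ne_zero he ht) i j) hF
  have hI : ∀ a b, ContDiffAt ℝ ∞ (fun y => firstForm g ι e e' (e'.symm y) a b) (e' p) :=
    fun a b => ContDiffAt.sum fun i _ => ContDiffAt.sum fun j _ =>
      ((hG i j).mul (hd a i)).mul (hd b j)
  have hII : ∀ a b, ContDiffAt ℝ ∞ (fun y => secondForm g ι ν e e' (e'.symm y) a b) (e' p) :=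
    fun a b => ContDiffAt.sum fun k _ => ContDiffAt.sum fun l _ =>
      ((hG k l).mul (hn k)).mul ((hdd a b l).add (ContDiffAt.sum fun i _ => ContDiffAt.sum fun j _ =>
        ((hΓ l i j).mul (hd a i)).mul (hd b j)))
  have hI0 : (firstForm g ι e e' (e'.symm (e' p))).det ≠ 0 := by
    rw [hs]; exact firstForm_det_ne_zero he he' hι hinj hp hp'
  have hS := contDiffAt_matrix_mul (contDiffAt_matrix_inv hI hI0) hII
  have hSS := contDiffAt_matrix_mul hS hS
  have hJ : ContDiffAt ℝ ∞ (fun y => jacobiPotential g ι ν e e' (e'.symm y)) (e' p) :=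
    (ContDiffAt.sum fun a _ => hSS a a).add (ContDiffAt.sum fun j _ => ContDiffAt.sum fun k _ =>
      ((hR j k).mul (hn j)).mul (hn k))
  have hJ' := (contMDiffAt_iff_contDiffAt.2 hJ).comp p (contMDiffAt_of_mem_maximalAtlas he' hp)
  refine hJ'.congr_of_eventuallyEq ?_
  filter_upwards [e'.open_source.mem_nhds hp] with q hq
  simp only [Function.comp, e'.left_inv hq]

end FirstForm

namespace Background

variable {M N : Type*} [TopologicalSpace M] [ChartedSpace E2 M]
  [IsManifold (𝓡 2) ∞ M] [TopologicalSpace N] [ChartedSpace E3 N] [IsManifold (𝓡 3) ∞ N]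
  [MulAction SymGroup M] [MulAction SymGroup N] (B : Background M N)

theorem contMDiff_ι : ContMDiff (𝓡 2) (𝓡 3) ∞ B.ι := B.embedding.contMDiff

theorem injective_mfderiv_ι (p : M) : Function.Injective (mfderiv (𝓡 2) (𝓡 3) B.ι p) :=
  injective_mfderiv_of_isImmersionAt (B.embedding.isImmersion.isImmersionAt p)

/-- The function `|A|² + Ric(ν, ν)` is smooth, since near each point it is given by one pair of
charts. -/
theorem contMDiff_q : ContMDiff (𝓡 2) 𝓘(ℝ, ℝ) ∞ B.q := by
  intro p
  have he : chartAt E3 (B.ι p) ∈ IsManifold.maximalAtlas (𝓡 3) ∞ N :=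
    IsManifold.chart_mem_maximalAtlas _
  have he' : chartAt E2 p ∈ IsManifold.maximalAtlas (𝓡 2) ∞ M :=
    IsManifold.chart_mem_maximalAtlas _
  have hp := mem_chart_source E2 p
  have hp' := mem_chart_source E3 (B.ι p)
  refine (jacobiPotential_contMDiffAt (g := B.g) B.normal_smooth he he' B.contMDiff_ι
    (B.injective_mfderiv_ι p) hp hp').congr_of_eventuallyEq ?_
  filter_upwards [(chartAt E2 p).open_source.mem_nhds hp,
    B.contMDiff_ι.continuous.continuousAt.preimage_mem_nhds
      ((chartAt E3 (B.ι p)).open_source.mem_nhds hp')] with r hr hr'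
  exact B.q_eq _ he _ he' r hr hr'

theorem contDiff_conformalFactor : ContDiff ℝ ∞ B.conformalFactor := by
  rw [← contMDiff_iff_contDiff]
  intro z
  have hs : ContMDiffAt 𝓘(ℝ, ℝ × ℝ) (𝓡 3).tangent ∞ (fun z => (⟨B.ι (B.x z),
      mfderiv (𝓡 2) (𝓡 3) B.ι (B.x z) (mfderiv 𝓘(ℝ, ℝ × ℝ) (𝓡 2) B.x z ((0, 1) : ℝ × ℝ))⟩ :
      TangentBundle (𝓡 3) N)) z :=
    contMDiffAt_mfderiv_comp isOpen_univ B.contMDiff_ι.contMDiffOn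
      (contMDiffAt_mfderiv_apply isOpen_univ B.x_smooth.contMDiffOn (b := id) contMDiffAt_id
        (mem_univ _) _) (mem_univ _)
  exact contMDiffAt_inner B.g hs hs

theorem contDiff_V : ContDiff ℝ ∞ B.V :=
  B.contDiff_conformalFactor.mul (contMDiff_iff_contDiff.1 (B.contMDiff_q.comp B.x_smooth))

theorem V_pos (z : ℝ × ℝ) : 0 < B.V z := mul_pos (B.x_conformal z).1 (B.q_pos _)

end Background

/-! ### Symmetry of the potential -/

/-- The differentials of the actions of `a` and `a⁻¹` are inverse to each other. -/
theorem mfderiv_act_inv {n : ℕ} {X : Type*} [TopologicalSpace X]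
    [ChartedSpace (EuclideanSpace ℝ (Fin n)) X] [MulAction SymGroup X]
    (hX : ∀ a : SymGroup, ContMDiff (𝓡 n) (𝓡 n) ∞ (fun p : X => a • p))
    (a : SymGroup) (y : X) (v : TangentSpace (𝓡 n) y) :
    (mfderiv (𝓡 n) (𝓡 n) (fun z : X => a⁻¹ • z) (a • y)
      (mfderiv (𝓡 n) (𝓡 n) (fun z : X => a • z) y v) : EuclideanSpace ℝ (Fin n)) = v := by
  have h := mfderiv_comp (I := 𝓡 n) (I' := 𝓡 n) (I'' := 𝓡 n) y
    ((hX a⁻¹).mdifferentiableAt (by simp) :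
      MDifferentiableAt (𝓡 n) (𝓡 n) (fun z : X => a⁻¹ • z) ((fun z : X => a • z) y))
    ((hX a).mdifferentiableAt (by simp))
  have hid : (fun z : X => a⁻¹ • z) ∘ (fun z : X => a • z) = id := by
    funext z; simp
  rw [hid, mfderiv_id] at h
  exact (congrArg (fun L : EuclideanSpace ℝ (Fin n) →L[ℝ] EuclideanSpace ℝ (Fin n) => L v) h).symm

namespace Background

variable {M N : Type*} [TopologicalSpace M] [ChartedSpace E2 M]
  [IsManifold (𝓡 2) ∞ M] [TopologicalSpace N] [ChartedSpace E3 N] [IsManifold (𝓡 3) ∞ N]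
  [MulAction SymGroup M] [MulAction SymGroup N] (B : Background M N)

/-- The action of a group element on the surface as a homeomorphism. -/
def actHomeoM (a : SymGroup) : M ≃ₜ M where
  toEquiv := MulAction.toPerm a
  continuous_toFun := (B.action_smooth a).continuous
  continuous_invFun := (B.action_smooth a⁻¹).continuous

/-- The action of a group element on the three-manifold as a homeomorphism. -/
def actHomeoN (a : SymGroup) : N ≃ₜ N where
  toEquiv := MulAction.toPerm a
  continuous_toFun := (B.action_smooth' a).continuous
  continuous_invFun := (B.action_smooth' a⁻¹).continuous

/-- The normal space of the surface is one-dimensional. -/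
theorem eq_of_unit_normal {p : M} (n : TangentSpace (𝓡 3) (B.ι p))
    (h1 : B.g.inner (B.ι p) n n = 1)
    (h2 : ∀ v, B.g.inner (B.ι p) n (mfderiv (𝓡 2) (𝓡 3) B.ι p v) = 0) :
    ∃ s : ℝ, s ^ 2 = 1 ∧ n = s • B.ν p := by
  set b := B.g.inner (B.ι p) with hb
  let D : E2 →L[ℝ] TangentSpace (𝓡 3) (B.ι p) := mfderiv (𝓡 2) (𝓡 3) B.ι p
  have hν1 : b (B.ν p) (B.ν p) = 1 := B.normal_unit p
  have hν2 : ∀ v, b (B.ν p) (D v) = 0 := B.normal_orthogonal p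
  have hsymm : ∀ v w, b v w = b w v := B.g.symm _
  let T : (E2 × ℝ) →ₗ[ℝ] E3 :=
    LinearMap.coprod (D : E2 →ₗ[ℝ] TangentSpace (𝓡 3) (B.ι p))
      (LinearMap.toSpanSingleton ℝ (TangentSpace (𝓡 3) (B.ι p)) (B.ν p))
  have hT : ∀ v c, T (v, c) = D v + c • B.ν p := fun v c => rfl
  have hinj : Function.Injective T := by
    rw [← LinearMap.ker_eq_bot, LinearMap.ker_eq_bot']
    rintro ⟨v, c⟩ h
    rw [hT] at h
    have h3 : b (B.ν p) (D v + c • B.ν p) = 0 := by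
      rw [show D v + c • B.ν p = 0 from h]; simp
    rw [map_add, map_smul, hν1, hν2] at h3
    have hc : c = 0 := by simpa using h3
    subst hc
    have h4 : D v = 0 := by rw [zero_smul, add_zero] at h; exact h
    have : v = 0 := B.injective_mfderiv_ι p (by
      change D v = D 0
      rw [h4, map_zero])
    rw [this]; rfl
  have hsurj : Function.Surjective T := by
    refine (LinearMap.injective_iff_surjective_of_finrank_eq_finrank ?_).1 hinj
    simp
  -- the component orthogonal to `ν` is tangential, and orthogonal to all tangent vectors
  refine ⟨b n (B.ν p), ?_⟩
  obtain ⟨⟨v, c⟩, hvc⟩ := hsurj (show E3 from (n - b n (B.ν p) • B.ν p))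
  rw [hT] at hvc
  have hr0 : n - b n (B.ν p) • B.ν p = 0 := by
    by_contra hne
    have hpos := B.g.pos _ _ hne
    rw [← hb] at hpos
    have hz : b (n - b n (B.ν p) • B.ν p) (n - b n (B.ν p) • B.ν p) = 0 := by
      have h5 : ∀ w, b (n - b n (B.ν p) • B.ν p) w = b n w - b n (B.ν p) * b (B.ν p) w := by
        intro w
        rw [map_sub, map_smul]; rfl
      have h6 : b (n - b n (B.ν p) • B.ν p) (D v + c • B.ν p) = 0 := by
        rw [h5, map_add, map_add, map_smul, map_smul, hν2, hν1, show b n (D v) = 0 from h2 v]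
        simp only [smul_eq_mul]; ring
      rw [show D v + c • B.ν p = n - b n (B.ν p) • B.ν p from hvc] at h6
      exact h6
    exact hpos.ne' hz
  have hn := sub_eq_zero.1 hr0
  refine ⟨?_, hn⟩
  have h7 : b n n = b n (B.ν p) * b n (B.ν p) := by
    calc b n n = b n (b n (B.ν p) • B.ν p) := by rw [← hn]
      _ = b n (B.ν p) * b n (B.ν p) := by rw [map_smul]; rfl
  rw [sq, ← h7]; exact h1

theorem eq_of_unit_normal' {p : M} {y : N} (h : y = B.ι p) (n : TangentSpace (𝓡 3) y)
    (h1 : B.g.inner y n n = 1)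
    (h2 : ∀ v, B.g.inner y n (mfderiv (𝓡 2) (𝓡 3) B.ι p v : E3) = 0) :
    ∃ s : ℝ, s ^ 2 = 1 ∧ (n : E3) = s • (B.ν p : E3) := by
  subst h
  exact B.eq_of_unit_normal n h1 h2

/-- The action preserves the unit normal up to a sign. -/
theorem normal_act (a : SymGroup) (p : M) : ∃ s : ℝ, s ^ 2 = 1 ∧
    (mfderiv (𝓡 3) (𝓡 3) (fun z : N => a⁻¹ • z) (B.ι (a • p)) (B.ν (a • p)) : E3)
      = s • (B.ν p : E3) := by
  obtain ⟨s, hs, hn⟩ := B.eq_of_unit_normal' (p := a • p) (B.equivariant a p).symm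
    (mfderiv (𝓡 3) (𝓡 3) (fun z : N => a • z) (B.ι p) (B.ν p))
    (by rw [B.isometric]; exact B.normal_unit p) (by
      intro v
      obtain ⟨w, rfl⟩ : ∃ w, mfderiv (𝓡 2) (𝓡 2) (fun z : M => a • z) p w = v := by
        have h := mfderiv_act_inv (n := 2) B.action_smooth a⁻¹ (a • p) v
        rw [inv_inv] at h
        refine ⟨(mfderiv (𝓡 2) (𝓡 2) (fun z : M => a⁻¹ • z) (a • p) v : E2), ?_⟩
        have h2 : ∀ q : M, q = p → ∀ u : E2, (mfderiv (𝓡 2) (𝓡 2) (fun z : M => a • z) q u : E2)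
          = (mfderiv (𝓡 2) (𝓡 2) (fun z : M => a • z) p u : E2) := by
          rintro q rfl u; rfl
        exact (h2 _ (inv_smul_smul a p) _).symm.trans h
      have c1 := mfderiv_comp (I := 𝓡 2) (I' := 𝓡 2) (I'' := 𝓡 3) p
        (B.contMDiff_ι.mdifferentiableAt (by simp) :
          MDifferentiableAt (𝓡 2) (𝓡 3) B.ι ((fun z : M => a • z) p))
        ((B.action_smooth a).mdifferentiableAt (by simp))
      have c2 := mfderiv_comp (I := 𝓡 2) (I' := 𝓡 3) (I'' := 𝓡 3) p
        ((B.action_smooth' a).mdifferentiableAt (by simp) :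
          MDifferentiableAt (𝓡 3) (𝓡 3) (fun z : N => a • z) (B.ι p))
        (B.contMDiff_ι.mdifferentiableAt (by simp))
      have hc : B.ι ∘ (fun z : M => a • z) = (fun z : N => a • z) ∘ B.ι := by
        funext z; exact B.equivariant a z
      rw [hc] at c1
      have c3 : (mfderiv (𝓡 2) (𝓡 3) B.ι (a • p) (mfderiv (𝓡 2) (𝓡 2) (fun z : M => a • z) p w) : E3)
          = mfderiv (𝓡 3) (𝓡 3) (fun z : N => a • z) (B.ι p) (mfderiv (𝓡 2) (𝓡 3) B.ι p w) :=
        congrArg (fun L : E2 →L[ℝ] E3 => L w) (c1.symm.trans c2)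
      refine (congrArg (fun u : E3 => (B.g.inner (a • B.ι p) (mfderiv (𝓡 3) (𝓡 3)
        (fun z : N => a • z) (B.ι p) (B.ν p)) : E3 →L[ℝ] ℝ) u) c3).trans ?_
      exact (B.isometric a (B.ι p) _ _).trans (B.normal_orthogonal p w))
  refine ⟨s, hs, ?_⟩
  have h := mfderiv_act_inv (n := 3) B.action_smooth' a (B.ι p) (B.ν p)
  have h2 : ∀ y : N, y = a • B.ι p → ∀ u : E3,
      (mfderiv (𝓡 3) (𝓡 3) (fun z : N => a⁻¹ • z) y u : E3)
        = (mfderiv (𝓡 3) (𝓡 3) (fun z : N => a⁻¹ • z) (a • B.ι p) u : E3) := by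
    rintro _ rfl u; rfl
  refine (h2 _ (B.equivariant a p) _).trans ?_
  set D : E3 →L[ℝ] E3 := mfderiv (𝓡 3) (𝓡 3) (fun z : N => a⁻¹ • z) (a • B.ι p)
  have h3 : D (s • (B.ν (a • p) : E3)) = B.ν p := by rw [← hn]; exact h
  have h4 : ∀ w u : E3, D (s • w) = u → D w = s • u := by
    rintro w _ rfl
    rw [D.map_smul, smul_smul, ← sq, hs, one_smul]
  exact h4 _ _ h3

/-- The function `|A|² + Ric(ν, ν)` is invariant: its value at `a • p` in the charts carried along
by `a` is the same expression as its value at `p`. The unit normal is only preserved up to a sign,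
but enters quadratically. -/
theorem q_smul (a : SymGroup) (p : M) : B.q (a • p) = B.q p := by
  set e := chartAt E3 (B.ι p) with hedef
  set e' := chartAt E2 p with hedef'
  have he : e ∈ IsManifold.maximalAtlas (𝓡 3) ∞ N := IsManifold.chart_mem_maximalAtlas _
  have he' : e' ∈ IsManifold.maximalAtlas (𝓡 2) ∞ M := IsManifold.chart_mem_maximalAtlas _
  have hp : p ∈ e'.source := mem_chart_source E2 p
  have hp' : B.ι p ∈ e.source := mem_chart_source E3 (B.ι p)
  set f := (B.actHomeoN a⁻¹).toOpenPartialHomeomorph.trans e with hfdef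
  set f' := (B.actHomeoM a⁻¹).toOpenPartialHomeomorph.trans e' with hfdef'
  have hf : f ∈ IsManifold.maximalAtlas (𝓡 3) ∞ N :=
    homeomorph_trans_mem_maximalAtlas _ (B.action_smooth' a⁻¹) (B.action_smooth' a⁻¹⁻¹) he
  have hf' : f' ∈ IsManifold.maximalAtlas (𝓡 2) ∞ M :=
    homeomorph_trans_mem_maximalAtlas _ (B.action_smooth a⁻¹) (B.action_smooth a⁻¹⁻¹) he'
  have f_apply : ∀ y, f y = e (a⁻¹ • y) := fun _ => rfl
  have f'_apply : ∀ y, f' y = e' (a⁻¹ • y) := fun _ => rfl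
  have f_symm : ∀ y, f.symm y = a • e.symm y := fun y => by
    have : f.symm y = a⁻¹⁻¹ • e.symm y := rfl
    rw [this, inv_inv]
  have f'_symm : ∀ y, f'.symm y = a • e'.symm y := fun y => by
    have : f'.symm y = a⁻¹⁻¹ • e'.symm y := rfl
    rw [this, inv_inv]
  have hfs : B.ι (a • p) ∈ f.source := by
    rw [hfdef, OpenPartialHomeomorph.trans_source]
    refine ⟨mem_univ _, ?_⟩
    change a⁻¹ • B.ι (a • p) ∈ e.source
    rwa [B.equivariant, inv_smul_smul]
  have hfs' : a • p ∈ f'.source := by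
    rw [hfdef', OpenPartialHomeomorph.trans_source]
    refine ⟨mem_univ _, ?_⟩
    change a⁻¹ • (a • p) ∈ e'.source
    rwa [inv_smul_smul]
  rw [B.q_eq f hf f' hf' _ hfs' hfs, B.q_eq e he e' he' _ hp hp']
  -- the metric has the same matrix in corresponding charts
  have hG : ∀ y ∈ e.target, metricMatrix B.g f y = metricMatrix B.g e y := by
    intro y hy
    ext i j
    have hc := mfderiv_comp (I := 𝓡 3) (I' := 𝓡 3) (I'' := 𝓡 3) y
      ((B.action_smooth' a).mdifferentiableAt (by simp) :
          MDifferentiableAt (𝓡 3) (𝓡 3) (fun z : N => a • z) (e.symm y))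
      ((chart_mdifferentiable he).mdifferentiableAt_symm hy)
    have hfe : (f.symm : E3 → N) = (fun z : N => a • z) ∘ e.symm := funext f_symm
    unfold metricMatrix
    rw [hfe, hc]
    exact B.isometric a (e.symm y) _ _
  have hpt : f (B.ι (a • p)) = e (B.ι p) := by
    rw [f_apply, B.equivariant, inv_smul_smul]
  have hpt' : f' (a • p) = e' p := by rw [f'_apply, inv_smul_smul]
  have hco : ∀ y, f (B.ι (f'.symm y)) = e (B.ι (e'.symm y)) := fun y => by
    rw [f'_symm, f_apply, B.equivariant, inv_smul_smul]
  have ht : e (B.ι p) ∈ e.target := e.map_source hp'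
  have hGe : metricMatrix B.g f =ᶠ[𝓝 (e (B.ι p))] metricMatrix B.g e :=
    Filter.eventually_of_mem (e.open_target.mem_nhds ht) hG
  have hG0 := hG _ ht
  have hΓ := fun k i j => (christoffel_congr hGe k i j).self_of_nhds
  have hR := fun j k => ricci_congr hGe j k
  have hd : ∀ b i, dCoord B.ι f f' (a • p) b i = dCoord B.ι e e' p b i := fun b i => by
    simp only [dCoord, hco, hpt']
  have hdd : ∀ b c i, ddCoord B.ι f f' (a • p) b c i = ddCoord B.ι e e' p b c i := fun b c i => by
    simp only [ddCoord, hco, hpt']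
  obtain ⟨s, hs, hsν⟩ := B.normal_act a p
  have hn : ∀ i, normalCoord B.ι B.ν f (a • p) i = s * normalCoord B.ι B.ν e p i := by
    intro i
    have hc := mfderiv_comp (I := 𝓡 3) (I' := 𝓡 3) (I'' := 𝓡 3) (B.ι (a • p))
      ((chart_mdifferentiable he).mdifferentiableAt (by
        change a⁻¹ • B.ι (a • p) ∈ e.source
        rwa [B.equivariant, inv_smul_smul]) :
          MDifferentiableAt (𝓡 3) (𝓡 3) e ((fun z : N => a⁻¹ • z) (B.ι (a • p))))
      ((B.action_smooth' a⁻¹).mdifferentiableAt (by simp))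
    have h1 : (mfderiv (𝓡 3) (𝓡 3) f (B.ι (a • p)) (B.ν (a • p)) : E3)
        = (mfderiv (𝓡 3) (𝓡 3) e (a⁻¹ • B.ι (a • p)) (mfderiv (𝓡 3) (𝓡 3) (fun z : N => a⁻¹ • z)
          (B.ι (a • p)) (B.ν (a • p)) : E3) : E3) :=
      congrArg (fun L : E3 →L[ℝ] E3 => L (B.ν (a • p))) hc
    have h2 : ∀ y : N, y = B.ι p → ∀ u : E3, (mfderiv (𝓡 3) (𝓡 3) e y u : E3)
        = (mfderiv (𝓡 3) (𝓡 3) e (B.ι p) u : E3) := by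
      rintro _ rfl u; rfl
    have h1' := (h1.trans (congrArg (fun u : E3 => (mfderiv (𝓡 3) (𝓡 3) e (a⁻¹ • B.ι (a • p)) :
      E3 →L[ℝ] E3) u) hsν)).trans
      (h2 (a⁻¹ • B.ι (a • p)) (by rw [B.equivariant, inv_smul_smul]) _)
    have h3 : (mfderiv (𝓡 3) (𝓡 3) e (B.ι p) (s • (B.ν p : E3)) : E3)
        = s • (mfderiv (𝓡 3) (𝓡 3) e (B.ι p) (B.ν p) : E3) :=
      (mfderiv (𝓡 3) (𝓡 3) e (B.ι p) : E3 →L[ℝ] E3).map_smul s (B.ν p : E3)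
    exact congrArg (fun u : E3 => u i) (h1'.trans h3)
  have hI : firstForm B.g B.ι f f' (a • p) = firstForm B.g B.ι e e' p := by
    ext b c
    simp only [firstForm, hpt, hG0, hd]
  have hII : secondForm B.g B.ι B.ν f f' (a • p) = s • secondForm B.g B.ι B.ν e e' p := by
    ext b c
    simp only [secondForm, hpt, hG0, hd, hdd, hn, hΓ, Matrix.smul_apply, smul_eq_mul,
      Finset.mul_sum]
    refine Finset.sum_congr rfl fun k _ => Finset.sum_congr rfl fun l _ => ?_
    ring
  simp only [jacobiPotential, hI, hII, hpt, hR, hn, Matrix.mul_smul, Matrix.smul_mul, smul_smul,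
    Matrix.trace_smul, smul_eq_mul]
  rw [← sq, hs, one_mul]
  congr 1
  refine Finset.sum_congr rfl fun j _ => Finset.sum_congr rfl fun k _ => ?_
  linear_combination (ricci (metricMatrix B.g e) (e (B.ι p)) j k * normalCoord B.ι B.ν e p j *
    normalCoord B.ι B.ν e p k) * hs

/-- The conformal factor is invariant under a change of coordinates of the cylinder which is induced
by the action and preserves the vector field `∂/∂s` up to sign. -/
theorem conformalFactor_eq (a : SymGroup) (z z' : ℝ × ℝ) (ε : ℝ) (hε : ε ^ 2 = 1) (T : ℝ × ℝ → ℝ × ℝ)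
    (hT : T z = z') (hTd : DifferentiableAt ℝ T z) (hT1 : fderiv ℝ T z (0, 1) = ε • (0, 1))
    (hx : ∀ w, B.x (T w) = a • B.x w) : B.conformalFactor z' = B.conformalFactor z := by
  subst hT
  have c1 := mfderiv_comp (I := 𝓘(ℝ, ℝ × ℝ)) (I' := 𝓘(ℝ, ℝ × ℝ)) (I'' := 𝓡 2) z
    (B.x_smooth.mdifferentiableAt (by simp)) hTd.mdifferentiableAt
  have c2 := mfderiv_comp (I := 𝓘(ℝ, ℝ × ℝ)) (I' := 𝓡 2) (I'' := 𝓡 2) z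
    ((B.action_smooth a).mdifferentiableAt (by simp) :
      MDifferentiableAt (𝓡 2) (𝓡 2) (fun y : M => a • y) (B.x z))
    (B.x_smooth.mdifferentiableAt (by simp))
  have c3 := mfderiv_comp (I := 𝓡 2) (I' := 𝓡 2) (I'' := 𝓡 3) (B.x z)
    (B.contMDiff_ι.mdifferentiableAt (by simp) :
      MDifferentiableAt (𝓡 2) (𝓡 3) B.ι ((fun z : M => a • z) (B.x z)))
    ((B.action_smooth a).mdifferentiableAt (by simp))
  have c4 := mfderiv_comp (I := 𝓡 2) (I' := 𝓡 3) (I'' := 𝓡 3) (B.x z)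
    ((B.action_smooth' a).mdifferentiableAt (by simp) :
      MDifferentiableAt (𝓡 3) (𝓡 3) (fun z : N => a • z) (B.ι (B.x z)))
    (B.contMDiff_ι.mdifferentiableAt (by simp))
  have hc : B.ι ∘ (fun z : M => a • z) = (fun z : N => a • z) ∘ B.ι := by
    funext z; exact B.equivariant a z
  rw [hc] at c3
  have hc2 : B.x ∘ T = (fun y : M => a • y) ∘ B.x := funext hx
  rw [hc2] at c1
  set v : E2 := mfderiv 𝓘(ℝ, ℝ × ℝ) (𝓡 2) B.x z ((0, 1) : ℝ × ℝ) with hv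
  have d1 : (mfderiv (𝓡 2) (𝓡 2) (fun z : M => a • z) (B.x z) v : E2)
      = ε • (mfderiv 𝓘(ℝ, ℝ × ℝ) (𝓡 2) B.x (T z) ((0, 1) : ℝ × ℝ) : E2) := by
    have h1 := congrArg (fun L : ℝ × ℝ →L[ℝ] E2 => L (0, 1)) (c2.symm.trans c1)
    refine h1.trans ?_
    have h2 : (mfderiv 𝓘(ℝ, ℝ × ℝ) 𝓘(ℝ, ℝ × ℝ) T z ((0, 1) : ℝ × ℝ) : ℝ × ℝ)
        = ε • ((0, 1) : ℝ × ℝ) := by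
      rw [mfderiv_eq_fderiv]; exact hT1
    have h3 : (mfderiv 𝓘(ℝ, ℝ × ℝ) (𝓡 2) B.x (T z) (ε • ((0, 1) : ℝ × ℝ) : ℝ × ℝ) : E2)
        = ε • (mfderiv 𝓘(ℝ, ℝ × ℝ) (𝓡 2) B.x (T z) ((0, 1) : ℝ × ℝ) : E2) :=
      (mfderiv 𝓘(ℝ, ℝ × ℝ) (𝓡 2) B.x (T z) : ℝ × ℝ →L[ℝ] E2).map_smul ε _
    refine Eq.trans ?_ h3
    exact congrArg (fun u : ℝ × ℝ => (mfderiv 𝓘(ℝ, ℝ × ℝ) (𝓡 2) B.x (T z) : ℝ × ℝ →L[ℝ] E2) u) h2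
  set u : E2 := mfderiv 𝓘(ℝ, ℝ × ℝ) (𝓡 2) B.x (T z) ((0, 1) : ℝ × ℝ) with hu
  have d2 : (mfderiv (𝓡 2) (𝓡 3) B.ι (a • B.x z) (ε • u : E2) : E3)
      = mfderiv (𝓡 3) (𝓡 3) (fun z : N => a • z) (B.ι (B.x z)) (mfderiv (𝓡 2) (𝓡 3) B.ι (B.x z) v) := by
    refine (congrArg (fun u : E2 => (mfderiv (𝓡 2) (𝓡 3) B.ι (a • B.x z) : E2 →L[ℝ] E3) u)
      d1.symm).trans ?_
    exact congrArg (fun L : E2 →L[ℝ] E3 => L v) (c3.symm.trans c4)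
  have hiso := B.isometric a (B.ι (B.x z)) (mfderiv (𝓡 2) (𝓡 3) B.ι (B.x z) v)
    (mfderiv (𝓡 2) (𝓡 3) B.ι (B.x z) v)
  have key : ∀ (y : N) (p : M) (_ : y = B.ι p) (D : E2 →L[ℝ] E3)
      (_ : D = mfderiv (𝓡 2) (𝓡 3) B.ι p), (B.g.inner (B.ι p) : E3 →L[ℝ] E3 →L[ℝ] ℝ) (D u) (D u)
      = (B.g.inner y : E3 →L[ℝ] E3 →L[ℝ] ℝ) (D (ε • u)) (D (ε • u)) := by
    rintro _ p rfl D _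
    set b : E3 →L[ℝ] E3 →L[ℝ] ℝ := B.g.inner (B.ι p)
    have h1 : b (ε • D u) (ε • D u) = ε ^ 2 * b (D u) (D u) := by
      rw [b.map_smul, (ε • b (D u)).map_smul]
      simp only [smul_apply, smul_eq_mul]
      ring
    have h2 : D (ε • u) = ε • D u := D.map_smul ε u
    rw [h2]
    rw [hε, one_mul] at h1
    exact h1.symm
  have k1 := key (a • B.ι (B.x z)) (B.x (T z)) (by rw [hx, B.equivariant]) _ rfl
  have k2 : ∀ p : M, p = a • B.x z → (mfderiv (𝓡 2) (𝓡 3) B.ι p (ε • u : E2) : E3)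
      = mfderiv (𝓡 2) (𝓡 3) B.ι (a • B.x z) (ε • u : E2) := by
    rintro _ rfl; rfl
  have k3 := (k2 _ (hx z)).trans d2
  unfold conformalFactor induced
  refine k1.trans (Eq.trans ?_ hiso)
  exact congrArg (fun w : E3 => (B.g.inner (a • B.ι (B.x z)) : E3 →L[ℝ] E3 →L[ℝ] ℝ) w w) k3

/-- The rotation by the angle `α`. -/
def rotation (α : ℝ) : Matrix.orthogonalGroup (Fin 2) ℝ :=
  ⟨!![Real.cos α, -Real.sin α; Real.sin α, Real.cos α], by
    rw [Matrix.mem_orthogonalGroup_iff]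
    have h := Real.sin_sq_add_cos_sq α
    ext i j
    fin_cases i <;> fin_cases j <;>
      simp [Matrix.mul_apply, Fin.sum_univ_two] <;> nlinarith⟩

theorem rotation_mulVec (α ϑ : ℝ) :
    (rotation α).1.mulVec ![Real.cos ϑ, Real.sin ϑ] = ![Real.cos (ϑ + α), Real.sin (ϑ + α)] := by
  ext i
  fin_cases i <;> simp [rotation, Matrix.mulVec, dotProduct, Fin.sum_univ_two, Real.cos_add,
    Real.sin_add] <;> ring

theorem x_rotation (α ϑ s : ℝ) :
    B.x (ϑ + α, s) = ((rotation α, 1) : SymGroup) • B.x (ϑ, s) := by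
  rw [B.x_equivariant (rotation α) 1 ϑ (ϑ + α) s (rotation_mulVec α ϑ)]
  simp

theorem x_reflection (ϑ s : ℝ) :
    B.x (ϑ, -s) = ((1, -1) : SymGroup) • B.x (ϑ, s) := by
  rw [B.x_equivariant 1 (-1) ϑ ϑ s (by simp)]
  simp

/-- The potential is a function of the latitude only. -/
theorem V_rotation (ϑ s : ℝ) : B.V (ϑ, s) = B.V (0, s) := by
  have hx : B.x (ϑ, s) = ((rotation ϑ, 1) : SymGroup) • B.x (0, s) := by
    simpa using B.x_rotation ϑ 0 s
  unfold V
  rw [hx, q_smul]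
  congr 1
  have hd : HasFDerivAt (fun w : ℝ × ℝ => w + (ϑ, 0)) (ContinuousLinearMap.id ℝ (ℝ × ℝ)) (0, s) :=
    (hasFDerivAt_id _).add_const _
  refine B.conformalFactor_eq (rotation ϑ, 1) (0, s) (ϑ, s) 1 (by norm_num) (fun w => w + (ϑ, 0)) (by simp)
    hd.differentiableAt ?_ ?_
  · rw [hd.fderiv]; simp
  · rintro ⟨w1, w2⟩
    simpa using B.x_rotation ϑ w1 w2

/-- The potential is an even function of the latitude. -/
theorem V_neg (ϑ s : ℝ) : B.V (ϑ, -s) = B.V (ϑ, s) := by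
  unfold V
  rw [B.x_reflection, q_smul]
  congr 1
  let L : ℝ × ℝ →L[ℝ] ℝ × ℝ := (ContinuousLinearMap.fst ℝ ℝ ℝ).prod (-ContinuousLinearMap.snd ℝ ℝ ℝ)
  refine B.conformalFactor_eq (1, -1) (ϑ, s) (ϑ, -s) (-1) (by norm_num) L (by simp [L])
    L.differentiableAt ?_ ?_
  · rw [L.fderiv]; simp [L]
  · rintro ⟨w1, w2⟩
    simpa [L] using B.x_reflection w1 w2

end Background

/-! ### The area of caps of a sphere -/

theorem det_prod_eq (L : ℝ × ℝ →L[ℝ] ℝ × ℝ) :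
    L.det = (L (1, 0)).1 * (L (0, 1)).2 - (L (0, 1)).1 * (L (1, 0)).2 := by
  rw [ContinuousLinearMap.det, ← LinearMap.det_toMatrix (Module.Basis.finTwoProd ℝ),
    Matrix.det_fin_two]
  simp [LinearMap.toMatrix_apply]

/-- A compact set whose points outside of an open subset lie in a ball is contained in this
ball. -/
theorem subset_closedBall_of_diff_subset {E : Type*} [NormedAddCommGroup E] [NormedSpace ℝ E]
    {K U : Set E} (hK : IsCompact K) (hU : IsOpen U) (hUK : U ⊆ K) {c : E} {r : ℝ} (hr : 0 ≤ r)
    (h : K \ U ⊆ Metric.closedBall c r) : K ⊆ Metric.closedBall c r := by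
  intro y hy
  obtain ⟨m, hmK, hm⟩ := hK.exists_isMaxOn ⟨y, hy⟩ (f := fun z => ‖z - c‖) (by fun_prop)
  have hmy : ‖y - c‖ ≤ ‖m - c‖ := hm hy
  rw [Metric.mem_closedBall, dist_eq_norm]
  refine hmy.trans ?_
  by_contra hlt
  push Not at hlt
  have hmU : m ∈ U := by
    by_contra hmU
    have := h ⟨hmK, hmU⟩
    rw [Metric.mem_closedBall, dist_eq_norm] at this
    linarith
  -- moving away from `c` stays in `U` for a while, contradicting maximality
  have hcont : Continuous fun ε : ℝ => m + ε • (m - c) := by fun_prop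
  have hev : ∀ᶠ ε in 𝓝 (0 : ℝ), m + ε • (m - c) ∈ U :=
    hcont.continuousAt.preimage_mem_nhds (by simpa using hU.mem_nhds hmU)
  obtain ⟨ε, hε, hεU⟩ := ((hev.filter_mono nhdsWithin_le_nhds).and
    (self_mem_nhdsWithin : Ioi (0 : ℝ) ∈ 𝓝[>] 0)).exists
  have hle : ‖m + ε • (m - c) - c‖ ≤ ‖m - c‖ := hm (hUK hε)
  have : m + ε • (m - c) - c = (1 + ε) • (m - c) := by module
  have hεU' : 0 < ε := hεU
  rw [this, norm_smul, Real.norm_of_nonneg (by linarith)] at hle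
  nlinarith

namespace Background

variable {M N : Type*} [TopologicalSpace M] [ChartedSpace E2 M]
  [IsManifold (𝓡 2) ∞ M] [TopologicalSpace N] [ChartedSpace E3 N] [IsManifold (𝓡 3) ∞ N]
  [MulAction SymGroup M] [MulAction SymGroup N] (B : Background M N)

theorem conformalFactor_rotation (ϑ s : ℝ) : B.conformalFactor (ϑ, s) = B.conformalFactor (0, s) := by
  have h := B.V_rotation ϑ s
  have hx : B.x (ϑ, s) = ((rotation ϑ, 1) : SymGroup) • B.x (0, s) := by
    simpa using B.x_rotation ϑ 0 s
  unfold V at h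
  rw [hx, q_smul] at h
  exact mul_right_cancel₀ (B.q_pos _).ne' h

theorem x_eq_of_angle {ϑ ϑ' : ℝ} (h : (ϑ : Real.Angle) = ϑ') (s : ℝ) : B.x (ϑ, s) = B.x (ϑ', s) := by
  have := B.x_equivariant 1 1 ϑ ϑ' s (by
    rw [← Real.Angle.cos_coe ϑ, h, ← Real.Angle.sin_coe ϑ, h]; simp)
  rw [show ((1, 1) : SymGroup) = 1 from rfl, one_smul] at this
  simpa using this

theorem exists_angle_mem (ϑ s : ℝ) : ∃ ϑ' ∈ Icc 0 (2 * Real.pi), B.x (ϑ, s) = B.x (ϑ', s) := by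
  refine ⟨toIcoMod Real.two_pi_pos 0 ϑ, ?_, ?_⟩
  · have := toIcoMod_mem_Ico Real.two_pi_pos 0 ϑ
    rw [zero_add] at this
    exact Ico_subset_Icc_self this
  · exact B.x_eq_of_angle (by rw [Real.Angle.coe_toIcoMod]) s

section Cap

variable [T2Space M] {p₁ p₂ : M}

/-- On a sphere, the points of latitude at least `s` form a compact cap together with the end point.
-/
theorem isCompact_cap (hx : Tendsto B.x (comap Prod.snd atTop) (𝓝 p₁)) (s : ℝ) :
    IsCompact (insert p₁ (B.x '' (Icc 0 (2 * Real.pi) ×ˢ Ici s))) := by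
  have hcl : IsClosed (Icc 0 (2 * Real.pi) ×ˢ Ici s : Set (ℝ × ℝ)) := isClosed_Icc.prod isClosed_Ici
  have : Tendsto (fun z : (Icc 0 (2 * Real.pi) ×ˢ Ici s : Set (ℝ × ℝ)) => B.x z)
      (cocompact _) (𝓝 p₁) := by
    refine hx.comp (tendsto_comap_iff.2 ?_)
    rw [tendsto_atTop]
    intro b
    have hc : IsCompact (Icc 0 (2 * Real.pi) ×ˢ Icc s b : Set (ℝ × ℝ)) :=
      isCompact_Icc.prod isCompact_Icc
    have hc' := hcl.isClosedEmbedding_subtypeVal.isCompact_preimage hc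
    filter_upwards [hc'.compl_mem_cocompact] with z hz
    by_contra hb
    push Not at hb
    exact hz ⟨z.2.1, z.2.2, hb.le⟩
  have h2 := this.isCompact_insert_range_of_cocompact
    (B.x_smooth.continuous.comp continuous_subtype_val)
  rwa [← image_eq_range] at h2

/-- The cap of the points of latitude at most `s` is the image of the other one by the reflection.
-/
theorem isCompact_cap' (hx : Tendsto B.x (comap Prod.snd atBot) (𝓝 p₂)) (s : ℝ) :
    IsCompact (insert p₂ (B.x '' (Icc 0 (2 * Real.pi) ×ˢ Iic s))) := by
  have h := B.isCompact_cap (p₁ := ((1, -1) : SymGroup) • p₂) (by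
    have h1 := (B.action_smooth (1, -1)).continuous.continuousAt.tendsto.comp hx
    have h2 : Tendsto (fun z : ℝ × ℝ => (z.1, -z.2)) (comap Prod.snd atTop) (comap Prod.snd atBot) := by
      rw [tendsto_comap_iff]
      exact tendsto_neg_atTop_atBot.comp tendsto_comap
    refine (h1.comp h2).congr fun z => ?_
    simp only [Function.comp]
    rw [← B.x_reflection, neg_neg]) (-s)
  have h3 := h.image (B.action_smooth (1, -1)).continuous
  have hinv : ∀ p : M, ((1, -1) : SymGroup) • ((1, -1) : SymGroup) • p = p := by
    intro p; rw [smul_smul, show ((1, -1) : SymGroup) * (1, -1) = 1 by simp, one_smul]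
  convert h3 using 1
  rw [image_insert_eq, hinv]
  congr 1
  ext p
  constructor
  · rintro ⟨⟨a, b⟩, ⟨ha, hb⟩, rfl⟩
    refine ⟨B.x (a, -b), ⟨(a, -b), ⟨ha, by simpa using hb⟩, rfl⟩, ?_⟩
    simp only
    rw [← B.x_reflection, neg_neg]
  · rintro ⟨_, ⟨⟨a, b⟩, ⟨ha, hb⟩, rfl⟩, rfl⟩
    refine ⟨(a, -b), ⟨ha, ?_⟩, B.x_reflection a b⟩
    have hb' : -s ≤ b := hb
    simp only [mem_Iic]
    linarith

/-- The cap of latitudes at least `s` is open up to its boundary circle: the complement of the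
opposite cap is contained in it and contains all but this circle. -/
theorem exists_open_cap (hl : B.l = ⊤) (hne : p₁ ≠ p₂) (hrange : range B.x = {p₁, p₂}ᶜ)
    (hx₂ : Tendsto B.x (comap Prod.snd atBot) (𝓝 p₂)) (s : ℝ) :
    ∃ U : Set M, IsOpen U ∧ U ⊆ insert p₁ (B.x '' (Icc 0 (2 * Real.pi) ×ˢ Ici s)) ∧
      insert p₁ (B.x '' (Icc 0 (2 * Real.pi) ×ˢ Ici s)) \ U ⊆
        B.x '' (Icc 0 (2 * Real.pi) ×ˢ {s}) := by
  have hmem : ∀ z, B.x z ≠ p₁ ∧ B.x z ≠ p₂ := by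
    intro z
    have : B.x z ∈ ({p₁, p₂} : Set M)ᶜ := hrange ▸ mem_range_self z
    simpa using this
  refine ⟨(insert p₂ (B.x '' (Icc 0 (2 * Real.pi) ×ˢ Iic s)))ᶜ,
    (B.isCompact_cap' hx₂ s).isClosed.isOpen_compl, ?_, ?_⟩
  · intro p hp
    by_cases h1 : p = p₁
    · exact Or.inl h1
    right
    have h2 : p ≠ p₂ := fun h => hp (Or.inl h)
    have : p ∈ range B.x := by rw [hrange]; simp [h1, h2]
    obtain ⟨⟨ϑ, t⟩, rfl⟩ := this
    obtain ⟨ϑ', hϑ', he⟩ := B.exists_angle_mem ϑ t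
    refine ⟨(ϑ', t), ⟨hϑ', ?_⟩, he.symm⟩
    by_contra hlt
    have hlt' : t ≤ s := le_of_lt (not_le.1 hlt)
    exact hp (Or.inr ⟨(ϑ', t), ⟨hϑ', hlt'⟩, he.symm⟩)
  · rintro p ⟨hp, hpU⟩
    rw [notMem_compl_iff] at hpU
    rcases hp with rfl | ⟨⟨a, b⟩, ⟨ha, hb⟩, rfl⟩
    · rcases hpU with h | ⟨z, -, hz⟩
      · exact absurd h hne
      · exact absurd hz (hmem z).1
    · rcases hpU with h | ⟨⟨a', b'⟩, ⟨ha', hb'⟩, hz⟩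
      · exact absurd h (hmem _).2
      · have := (B.x_injective a' b' a b (by rw [hl]; exact EReal.coe_lt_top _)
          (by rw [hl]; exact EReal.coe_lt_top _) hz).1
        have hb1 : b' ≤ s := hb'
        have hb2 : s ≤ b := hb
        exact ⟨(a, b), ⟨ha, by simp only [mem_singleton_iff]; linarith⟩, rfl⟩

end Cap

set_option maxHeartbeats 1000000 in
/-- In coordinates `ψ` of the surface near a point, the area element of the conformal metric is
bounded by the Jacobian of `ψ ∘ x`, and the squared Euclidean speed along the circles of latitude by
the conformal factor. Indeed, the matrix of the metric in these coordinates is bounded, with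
determinant bounded below. -/
theorem chart_estimates [T2Space M] (p₁ : M) :
    ∃ (O : Set M) (ψ : M → ℝ × ℝ) (C δ : ℝ), O ∈ 𝓝 p₁ ∧ 0 < C ∧ 0 < δ ∧ InjOn ψ O ∧
      ContinuousOn ψ O ∧ (∀ U ⊆ O, IsOpen U → IsOpen (ψ '' U)) ∧
      ∀ z, B.x z ∈ O → ContDiffAt ℝ ∞ (fun z => ψ (B.x z)) z ∧
        ∃ L : ℝ × ℝ →L[ℝ] ℝ × ℝ, HasFDerivAt (fun z => ψ (B.x z)) L z ∧
        B.conformalFactor z ≤ C * |L.det| ∧ ‖L (1, 0)‖ ^ 2 ≤ δ * B.conformalFactor z := by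
  let κ : E2 ≃L[ℝ] ℝ × ℝ := ContinuousLinearEquiv.ofFinrankEq (by simp)
  set e' := chartAt E2 p₁ with hedef'
  have he' : e' ∈ IsManifold.maximalAtlas (𝓡 2) ∞ M := IsManifold.chart_mem_maximalAtlas _
  have hp : p₁ ∈ e'.source := mem_chart_source E2 p₁
  set T : Set (ℝ × ℝ) := κ.symm ⁻¹' e'.target with hT
  have hTo : IsOpen T := e'.open_target.preimage κ.symm.continuous
  set Θ : ℝ × ℝ → M := fun y => e'.symm (κ.symm y) with hΘ
  have hΘs : ContMDiffOn 𝓘(ℝ, ℝ × ℝ) (𝓡 2) ∞ Θ T :=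
    (contMDiffOn_symm_of_mem_maximalAtlas he').comp
      (κ.symm.contDiff.contMDiff.contMDiffOn) (fun y hy => hy)
  set Φ : ℝ × ℝ → N := fun y => B.ι (Θ y) with hΦ
  have hΦs : ContMDiffOn 𝓘(ℝ, ℝ × ℝ) (𝓡 3) ∞ Φ T := B.contMDiff_ι.comp_contMDiffOn hΘs
  let b : ℝ × ℝ → ℝ × ℝ → ℝ × ℝ → ℝ := fun y v w =>
    B.g.inner (Φ y) (mfderiv 𝓘(ℝ, ℝ × ℝ) (𝓡 3) Φ y v) (mfderiv 𝓘(ℝ, ℝ × ℝ) (𝓡 3) Φ y w)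
  have hbc : ∀ v w, ∀ y ∈ T, ContinuousAt (fun y => b y v w) y := fun v w y hy =>
    (contMDiffAt_inner B.g (contMDiffAt_mfderiv_apply hTo hΦs (b := id) contMDiffAt_id hy v)
      (contMDiffAt_mfderiv_apply hTo hΦs (b := id) contMDiffAt_id hy w)).continuousAt
  set ψ : M → ℝ × ℝ := fun p => κ (e' p) with hψ
  have hψΘ : ∀ p ∈ e'.source, Θ (ψ p) = p := fun p hp => by
    simp [hΘ, hψ, e'.left_inv hp]
  have hψT : ∀ p ∈ e'.source, ψ p ∈ T := fun p hp => by
    simp [hT, hψ, e'.map_source hp]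
  -- the quadratic form in terms of its matrix
  have hb : ∀ y (v w : ℝ × ℝ), b y v w = b y (1, 0) (1, 0) * (v.1 * w.1)
      + b y (1, 0) (0, 1) * (v.1 * w.2 + v.2 * w.1) + b y (0, 1) (0, 1) * (v.2 * w.2) := by
    intro y v w
    let D : ℝ × ℝ →L[ℝ] E3 := mfderiv 𝓘(ℝ, ℝ × ℝ) (𝓡 3) Φ y
    let G : E3 →L[ℝ] E3 →L[ℝ] ℝ := B.g.inner (Φ y)
    have hGs : ∀ a c, G a c = G c a := B.g.symm (Φ y)
    have hD : ∀ v : ℝ × ℝ, D v = v.1 • D (1, 0) + v.2 • D (0, 1) := by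
      intro v
      rw [← D.map_smul, ← D.map_smul, ← D.map_add]
      congr 1
      ext <;> simp
    change G (D v) (D w) = G (D (1, 0)) (D (1, 0)) * _ + G (D (1, 0)) (D (0, 1)) * _
      + G (D (0, 1)) (D (0, 1)) * _
    rw [hD v, hD w]
    simp only [map_add, map_smul, add_apply, smul_apply, smul_eq_mul]
    rw [hGs (D (0, 1)) (D (1, 0))]
    ring
  have hpos : ∀ v : ℝ × ℝ, v ≠ 0 → 0 < b (ψ p₁) v v := by
    intro v hv
    refine B.g.pos _ _ fun h0 => hv ?_
    have hy := hψT p₁ hp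
    have c1 := mfderiv_comp (I := 𝓘(ℝ, ℝ × ℝ)) (I' := 𝓡 2) (I'' := 𝓡 3) (ψ p₁)
      (B.contMDiff_ι.mdifferentiableAt (by simp) : MDifferentiableAt (𝓡 2) (𝓡 3) B.ι (Θ (ψ p₁)))
      ((hΘs.contMDiffAt (hTo.mem_nhds hy)).mdifferentiableAt (by simp))
    have c2 := mfderiv_comp (I := 𝓘(ℝ, ℝ × ℝ)) (I' := 𝓡 2) (I'' := 𝓡 2) (ψ p₁)
      ((chart_mdifferentiable he').mdifferentiableAt_symm hy :
        MDifferentiableAt (𝓡 2) (𝓡 2) e'.symm (κ.symm (ψ p₁)))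
      (κ.symm.differentiableAt.mdifferentiableAt)
    have h1 : (mfderiv (𝓡 2) (𝓡 3) B.ι (Θ (ψ p₁)) (mfderiv 𝓘(ℝ, ℝ × ℝ) (𝓡 2) Θ (ψ p₁) v : E2) : E3)
        = 0 := (congrArg (fun L : ℝ × ℝ →L[ℝ] E3 => L v) c1).symm.trans h0
    have h2 : (mfderiv 𝓘(ℝ, ℝ × ℝ) (𝓡 2) Θ (ψ p₁) v : E2) = 0 :=
      B.injective_mfderiv_ι _ (h1.trans (map_zero (mfderiv (𝓡 2) (𝓡 3) B.ι (Θ (ψ p₁)))).symm)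
    have h3 := (congrArg (fun L : ℝ × ℝ →L[ℝ] E2 => L v) c2).symm.trans h2
    rw [mfderiv_eq_fderiv] at h3
    have h4 : (fderiv ℝ κ.symm (ψ p₁) v : E2) = 0 :=
      (chart_mdifferentiable he').symm.mfderiv_injective hy (h3.trans
        (map_zero (mfderiv (𝓡 2) (𝓡 2) e'.symm (κ.symm (ψ p₁)))).symm)
    rw [κ.symm.fderiv] at h4
    exact κ.symm.map_eq_zero_iff.1 h4
  set dt : ℝ × ℝ → ℝ := fun y => b y (1, 0) (1, 0) * b y (0, 1) (0, 1) - b y (1, 0) (0, 1) ^ 2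
    with hdt
  set tr : ℝ × ℝ → ℝ := fun y => b y (1, 0) (1, 0) + b y (0, 1) (0, 1) with htr
  have hdtc : ContinuousAt dt (ψ p₁) := by
    have := hψT p₁ hp
    exact ((hbc _ _ _ this).mul (hbc _ _ _ this)).sub ((hbc _ _ _ this).pow 2)
  have htrc : ContinuousAt tr (ψ p₁) := by
    have := hψT p₁ hp
    exact (hbc _ _ _ this).add (hbc _ _ _ this)
  have h11 : 0 < b (ψ p₁) (1, 0) (1, 0) := hpos _ (by simp)
  have h22 : 0 < b (ψ p₁) (0, 1) (0, 1) := hpos _ (by simp)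
  have hdt1 : 0 < dt (ψ p₁) := by
    have := hpos (-(b (ψ p₁) (1, 0) (0, 1)), b (ψ p₁) (1, 0) (1, 0)) (by
      intro h; have := congrArg Prod.snd h; simp at this; linarith)
    rw [hb] at this
    simp only at this
    have h5 : 0 < b (ψ p₁) (1, 0) (1, 0) * dt (ψ p₁) := by
      simp only [hdt]; nlinarith
    exact pos_of_mul_pos_right h5 h11.le
  have htr1 : 0 < tr (ψ p₁) := add_pos h11 h22
  have hψc : ContinuousAt ψ p₁ := κ.continuous.continuousAt.comp (e'.continuousAt hp)
  refine ⟨e'.source ∩ ψ ⁻¹' {y | dt (ψ p₁) / 2 < dt y ∧ dt y < 2 * dt (ψ p₁) ∧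
    tr y < 2 * tr (ψ p₁)}, ψ, Real.sqrt (2 * dt (ψ p₁)), 2 * tr (ψ p₁) / (dt (ψ p₁) / 2), ?_,
    by positivity, by positivity, ?_, ?_, ?_, ?_⟩
  · refine inter_mem (e'.open_source.mem_nhds hp) (hψc.preimage_mem_nhds ?_)
    have e1 := hdtc.tendsto.eventually_const_lt (show dt (ψ p₁) / 2 < dt (ψ p₁) by linarith)
    have e2 := hdtc.tendsto.eventually_lt_const (show dt (ψ p₁) < 2 * dt (ψ p₁) by linarith)
    have e3 := htrc.tendsto.eventually_lt_const (show tr (ψ p₁) < 2 * tr (ψ p₁) by linarith)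
    filter_upwards [e1, e2, e3] with y a1 a2 a3 using ⟨a1, a2, a3⟩
  · intro p hp q hq h
    exact e'.injOn hp.1 hq.1 (κ.injective h)
  · exact κ.continuous.comp_continuousOn (e'.continuousOn.mono inter_subset_left)
  · intro U hU hUo
    have := e'.isOpen_image_of_subset_source hUo (hU.trans inter_subset_left)
    have h2 := κ.toHomeomorph.isOpenMap _ this
    rw [image_image] at h2
    exact h2
  · rintro z ⟨hz, hz1, hz2, hz3⟩
    set y := ψ (B.x z) with hy
    have hyT : y ∈ T := hψT _ hz
    have hYd : ContMDiffAt 𝓘(ℝ, ℝ × ℝ) 𝓘(ℝ, ℝ × ℝ) ∞ (fun z => ψ (B.x z)) z :=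
      (κ.contDiff.contMDiff _).comp z
        ((contMDiffAt_of_mem_maximalAtlas he' hz).comp z (B.x_smooth z))
    have hYd' : DifferentiableAt ℝ (fun z => ψ (B.x z)) z :=
      (contMDiffAt_iff_contDiffAt.1 hYd).differentiableAt (by simp)
    refine ⟨contMDiffAt_iff_contDiffAt.1 hYd, fderiv ℝ (fun z => ψ (B.x z)) z, hYd'.hasFDerivAt, ?_⟩
    set L := fderiv ℝ (fun z => ψ (B.x z)) z with hL
    -- the pulled back metric in terms of `b`
    have hbL : ∀ v w : ℝ × ℝ, b y (L v) (L w) = induced B.g B.ι (B.x z)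
        (mfderiv 𝓘(ℝ, ℝ × ℝ) (𝓡 2) B.x z v) (mfderiv 𝓘(ℝ, ℝ × ℝ) (𝓡 2) B.x z w) := by
      have c1 := mfderiv_comp (I := 𝓘(ℝ, ℝ × ℝ)) (I' := 𝓘(ℝ, ℝ × ℝ)) (I'' := 𝓡 3) z
        ((hΦs.contMDiffAt (hTo.mem_nhds hyT)).mdifferentiableAt (by simp) :
          MDifferentiableAt 𝓘(ℝ, ℝ × ℝ) (𝓡 3) Φ (ψ (B.x z)))
        hYd'.mdifferentiableAt
      have c2 := mfderiv_comp (I := 𝓘(ℝ, ℝ × ℝ)) (I' := 𝓡 2) (I'' := 𝓡 3) z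
        (B.contMDiff_ι.mdifferentiableAt (by simp) : MDifferentiableAt (𝓡 2) (𝓡 3) B.ι (B.x z))
        (B.x_smooth.mdifferentiableAt (by simp))
      have heq : (Φ ∘ fun z => ψ (B.x z)) =ᶠ[𝓝 z] (B.ι ∘ B.x) := by
        filter_upwards [B.x_smooth.continuous.continuousAt.preimage_mem_nhds
          (e'.open_source.mem_nhds hz)] with w hw
        simp only [Function.comp, hΦ, hψΘ _ hw]
      have c3 : ∀ v : ℝ × ℝ, (mfderiv 𝓘(ℝ, ℝ × ℝ) (𝓡 3) Φ y (L v) : E3)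
          = mfderiv (𝓡 2) (𝓡 3) B.ι (B.x z) (mfderiv 𝓘(ℝ, ℝ × ℝ) (𝓡 2) B.x z v) := by
        intro v
        have c4 := congrArg (fun L : ℝ × ℝ →L[ℝ] E3 => L v) (c1.symm.trans (heq.mfderiv_eq.trans c2))
        rw [mfderiv_eq_fderiv (f := fun z => ψ (B.x z))] at c4
        exact c4
      have c5 : ∀ q, q = B.ι (B.x z) → ∀ u u' : E3, (B.g.inner q : E3 →L[ℝ] E3 →L[ℝ] ℝ) u u'
          = (B.g.inner (B.ι (B.x z)) : E3 →L[ℝ] E3 →L[ℝ] ℝ) u u' := by rintro _ rfl u u'; rfl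
      intro v w
      refine (c5 (Φ y) (by simp only [hΦ, hy, hψΘ _ hz]) _ _).trans ?_
      exact congrArg₂ (fun u u' : E3 => (B.g.inner (B.ι (B.x z)) : E3 →L[ℝ] E3 →L[ℝ] ℝ) u u')
        (c3 v) (c3 w)
    obtain ⟨k1, k2, k3⟩ := B.x_conformal z
    have j1 : b y (L (0, 1)) (L (0, 1)) = B.conformalFactor z := hbL _ _
    have j2 : b y (L (1, 0)) (L (1, 0)) = B.conformalFactor z := (hbL _ _).trans k2
    have j3 : b y (L (1, 0)) (L (0, 1)) = 0 := (hbL _ _).trans k3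
    have hc : 0 < B.conformalFactor z := k1
    rw [hb] at j1 j2 j3
    rcases hA : L (1, 0) with ⟨a1, a2⟩
    rcases hC : L (0, 1) with ⟨c1, c2⟩
    rw [hA] at j2 j3
    rw [hC] at j1 j3
    simp only at j1 j2 j3
    have hdet : L.det = a1 * c2 - c1 * a2 := by rw [det_prod_eq, hA, hC]
    set E := b y (1, 0) (1, 0)
    set F := b y (1, 0) (0, 1)
    set G := b y (0, 1) (0, 1)
    have hgram : (E * G - F ^ 2) * (a1 * c2 - c1 * a2) ^ 2 = B.conformalFactor z ^ 2 := by
      have : (E * G - F ^ 2) * (a1 * c2 - c1 * a2) ^ 2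
        = (E * (a1 * a1) + F * (a1 * a2 + a2 * a1) + G * (a2 * a2)) *
          (E * (c1 * c1) + F * (c1 * c2 + c2 * c1) + G * (c2 * c2))
          - (E * (a1 * c1) + F * (a1 * c2 + a2 * c1) + G * (a2 * c2)) ^ 2 := by ring
      rw [this, j1, j2, j3]; ring
    have hd1 : E * G - F ^ 2 < 2 * dt (ψ p₁) := hz2
    have hd2 : dt (ψ p₁) / 2 < E * G - F ^ 2 := hz1
    have ht : E + G < 2 * tr (ψ p₁) := hz3
    clear_value E F G
    generalize dt (ψ p₁) = d₀ at *
    generalize tr (ψ p₁) = t₀ at *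
    generalize B.conformalFactor z = h at *
    constructor
    · rw [hdet]
      refine abs_le_of_sq_le_sq' ?_ (by positivity) |>.2
      rw [mul_pow, Real.sq_sqrt (by positivity), sq_abs, ← hgram]
      exact mul_le_mul_of_nonneg_right hd1.le (sq_nonneg _)
    · have hid : (E + G) * h - (E * G - F ^ 2) * (a1 ^ 2 + a2 ^ 2)
          = (E * a1 + F * a2) ^ 2 + (F * a1 + G * a2) ^ 2 := by
        rw [← j2]; ring
      have hle : d₀ / 2 * (a1 ^ 2 + a2 ^ 2) ≤ 2 * t₀ * h := by
        have l1 := mul_le_mul_of_nonneg_right hd2.le (add_nonneg (sq_nonneg a1) (sq_nonneg a2))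
        have l2 := mul_le_mul_of_nonneg_right ht.le hc.le
        linarith [sq_nonneg (E * a1 + F * a2), sq_nonneg (F * a1 + G * a2)]
      have hn : ‖((a1, a2) : ℝ × ℝ)‖ ^ 2 ≤ a1 ^ 2 + a2 ^ 2 := by
        rw [Prod.norm_def]
        rcases max_choice ‖a1‖ ‖a2‖ with h | h
        · simp only [h]
          rw [Real.norm_eq_abs, sq_abs]
          linarith [sq_nonneg a2]
        · simp only [h]
          rw [Real.norm_eq_abs, sq_abs]
          linarith [sq_nonneg a1]
      rw [div_mul_eq_mul_div, le_div_iff₀ (by positivity)]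
      have := mul_le_mul_of_nonneg_left hn (show 0 ≤ d₀ / 2 by positivity)
      linarith

/-- The area of a cap of a sphere is bounded by a multiple of the square of the length of its
boundary. In a chart around the end point, the boundary circle lies in a disk whose radius is
comparable to its length, hence the cap does, and its area is bounded by that of the disk. In terms
of the conformal factor `h` this reads `∫ₛ^∞ h ≤ C h(s)`. -/
theorem area_cap_le [T2Space M] {p₁ p₂ : M} (hl : B.l = ⊤) (hne : p₁ ≠ p₂)
    (hrange : range B.x = {p₁, p₂}ᶜ) (hx₁ : Tendsto B.x (comap Prod.snd atTop) (𝓝 p₁))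
    (hx₂ : Tendsto B.x (comap Prod.snd atBot) (𝓝 p₂)) :
    ∃ s₀ C : ℝ, 0 < C ∧ ∀ s, s₀ ≤ s → ∀ b, s ≤ b →
      ∫ t in s..b, B.conformalFactor (0, t) ≤ C * B.conformalFactor (0, s) := by
  obtain ⟨O, ψ, C, δ, hO, hC, hδ, hinj, hcont, hopen, hest'⟩ := B.chart_estimates p₁
  have hest := fun z hz => (hest' z hz).2
  have hO' := hx₁ hO
  rw [mem_map, mem_comap] at hO'
  obtain ⟨t, ht, htO⟩ := hO'
  obtain ⟨s₀, hs₀⟩ := mem_atTop_sets.1 ht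
  have hxO : ∀ ϑ s, s₀ ≤ s → B.x (ϑ, s) ∈ O := fun ϑ s hs => htO (hs₀ s hs)
  refine ⟨s₀, C * (16 * Real.pi ^ 2 * δ) / (2 * Real.pi), by positivity, fun s hs b hsb => ?_⟩
  set h := B.conformalFactor (0, s) with hh
  have hhpos : ∀ z, 0 < B.conformalFactor z := fun z => (B.x_conformal z).1
  have hhc : Continuous fun t => B.conformalFactor (0, t) :=
    B.contDiff_conformalFactor.continuous.comp (by fun_prop)
  set r := Real.sqrt (δ * h) * (2 * Real.pi) with hr
  have hr0 : 0 ≤ r := by positivity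
  set K := insert p₁ (B.x '' (Icc 0 (2 * Real.pi) ×ˢ Ici s)) with hK
  have hKO : K ⊆ O := by
    rintro p (rfl | ⟨⟨ϑ, t⟩, ⟨-, ht⟩, rfl⟩)
    · exact mem_of_mem_nhds hO
    · exact hxO _ _ (hs.trans ht)
  obtain ⟨U, hUo, hUK, hKU⟩ := B.exists_open_cap hl hne hrange hx₂ s
  -- the boundary circle has small diameter
  have hcirc : ∀ ϑ ∈ Icc 0 (2 * Real.pi), ψ (B.x (ϑ, s)) ∈ Metric.closedBall (ψ (B.x (0, s))) r := by
    intro ϑ hϑ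
    rw [Metric.mem_closedBall, dist_eq_norm]
    have hder : ∀ a ∈ Icc (0 : ℝ) (2 * Real.pi), ∃ v : ℝ × ℝ,
        HasDerivAt (fun a => ψ (B.x (a, s))) v a ∧ ‖v‖ ≤ Real.sqrt (δ * h) := by
      intro a _
      obtain ⟨L, hL, -, hL2⟩ := hest (a, s) (hxO a s hs)
      refine ⟨L (1, 0), ?_, ?_⟩
      · have h1 : HasDerivAt (fun a : ℝ => (a, s)) ((1, 0) : ℝ × ℝ) a :=
          (hasDerivAt_id a).prodMk (hasDerivAt_const a s)
        exact hL.comp_hasDerivAt a h1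
      · rw [B.conformalFactor_rotation] at hL2
        exact Real.le_sqrt_of_sq_le hL2
    choose! v hv hvn using hder
    have := (convex_Icc (0 : ℝ) (2 * Real.pi)).norm_image_sub_le_of_norm_hasDerivWithin_le
      (fun a ha => (hv a ha).hasDerivWithinAt) hvn (left_mem_Icc.2 Real.two_pi_pos.le) hϑ
    refine this.trans ?_
    rw [hr, sub_zero, Real.norm_of_nonneg hϑ.1]
    exact mul_le_mul_of_nonneg_left hϑ.2 (Real.sqrt_nonneg _)
  have hball : ψ '' K ⊆ Metric.closedBall (ψ (B.x (0, s))) r := by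
    refine subset_closedBall_of_diff_subset ((B.isCompact_cap hx₁ s).image_of_continuousOn
      (hcont.mono hKO)) (hopen U (hUK.trans hKO) hUo) (image_mono hUK) hr0 ?_
    rintro _ ⟨⟨p, hp, rfl⟩, hpU⟩
    obtain ⟨⟨ϑ, t⟩, ⟨hϑ, rfl⟩, rfl⟩ := hKU ⟨hp, fun hU => hpU ⟨p, hU, rfl⟩⟩
    exact hcirc ϑ hϑ
  -- compare areas
  set R : Set (ℝ × ℝ) := Ioo 0 (2 * Real.pi) ×ˢ Ioo s b with hR
  have hRO : ∀ z ∈ R, B.x z ∈ O := fun z hz => hxO z.1 z.2 (hs.trans hz.2.1.le)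
  choose! L hL hL1 hL2 using hest
  have hinjR : InjOn (fun z => ψ (B.x z)) R := by
    rintro ⟨a, t⟩ hz ⟨a', t'⟩ hz' heq
    have h1 := hinj (hRO _ hz) (hRO _ hz') heq
    obtain ⟨e1, e2, e3⟩ := B.x_injective a t a' t' (by rw [hl]; exact EReal.coe_lt_top _)
          (by rw [hl]; exact EReal.coe_lt_top _) h1
    have e4 : (a : Real.Angle) = a' := Real.Angle.cos_sin_inj e2 e3
    have e5 : a = a' := by
      rw [← (toIcoMod_eq_self Real.two_pi_pos (a := 0)).2 (by
          rw [zero_add]; exact ⟨hz.1.1.le, hz.1.2⟩ : a ∈ Ico 0 (0 + 2 * Real.pi)),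
        ← (toIcoMod_eq_self Real.two_pi_pos (a := 0)).2 (by
          rw [zero_add]; exact ⟨hz'.1.1.le, hz'.1.2⟩ : a' ∈ Ico 0 (0 + 2 * Real.pi))]
      obtain ⟨n, hn⟩ := Real.Angle.angle_eq_iff_two_pi_dvd_sub.1 e4
      rw [show a = a' + n • (2 * Real.pi) by simp; linarith, toIcoMod_add_zsmul]
    simp only [Prod.mk.injEq]
    exact ⟨e5, e1⟩
  have hRm : MeasurableSet R := measurableSet_Ioo.prod measurableSet_Ioo
  have hcv := MeasureTheory.lintegral_abs_det_fderiv_eq_addHaar_image MeasureTheory.volume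
    hRm (fun z hz => (hL z (hRO z hz)).hasFDerivWithinAt) hinjR
  have hsub : (fun z => ψ (B.x z)) '' R ⊆ Metric.closedBall (ψ (B.x (0, s))) r := by
    rintro _ ⟨⟨a, t⟩, hz, rfl⟩
    exact hball ⟨_, Or.inr ⟨(a, t), ⟨Ioo_subset_Icc_self hz.1, hz.2.1.le⟩, rfl⟩, rfl⟩
  have hvol : MeasureTheory.volume (Metric.closedBall (ψ (B.x (0, s))) r)
      = ENNReal.ofReal ((2 * r) ^ 2) := by
    rw [show ψ (B.x (0, s)) = ((ψ (B.x (0, s))).1, (ψ (B.x (0, s))).2) from rfl,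
      ← closedBall_prod_same, MeasureTheory.Measure.volume_eq_prod,
      MeasureTheory.Measure.prod_prod, Real.volume_closedBall, Real.volume_closedBall,
      ← ENNReal.ofReal_mul (by positivity), sq]
  have hup := hcv.le.trans ((MeasureTheory.measure_mono hsub).trans hvol.le)
  have hlow : ENNReal.ofReal (2 * Real.pi * (C⁻¹ * ∫ t in s..b, B.conformalFactor (0, t)))
      ≤ ∫⁻ z in R, ENNReal.ofReal |(L z).det| := by
    have h1 : ∫⁻ z in R, ENNReal.ofReal (C⁻¹ * B.conformalFactor (0, z.2))
        ≤ ∫⁻ z in R, ENNReal.ofReal |(L z).det| := by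
      refine MeasureTheory.setLIntegral_mono' hRm fun z hz => ENNReal.ofReal_le_ofReal ?_
      have := hL1 z (hRO z hz)
      rw [show z = (z.1, z.2) from rfl, B.conformalFactor_rotation] at this
      rw [inv_mul_le_iff₀ hC]
      exact this
    refine le_trans (le_of_eq ?_) h1
    have hmeas : Measurable fun z : ℝ × ℝ => ENNReal.ofReal (C⁻¹ * B.conformalFactor (0, z.2)) :=
      (continuous_const.mul (hhc.comp continuous_snd)).measurable.ennreal_ofReal
    rw [hR, MeasureTheory.Measure.volume_eq_prod, ← MeasureTheory.Measure.prod_restrict,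
      MeasureTheory.lintegral_prod _ hmeas.aemeasurable]
    simp only [MeasureTheory.lintegral_const, MeasureTheory.Measure.restrict_apply_univ, Real.volume_Ioo, sub_zero]
    rw [ENNReal.ofReal_mul Real.two_pi_pos.le, mul_comm]
    congr 1
    rw [← intervalIntegral.integral_const_mul, intervalIntegral.integral_of_le hsb,
      MeasureTheory.integral_Ioc_eq_integral_Ioo]
    refine MeasureTheory.ofReal_integral_eq_lintegral_ofReal ?_ ?_
    · exact ((continuous_const.mul hhc).integrableOn_Icc).mono_set Ioo_subset_Icc_self
    · exact Filter.Eventually.of_forall fun t => mul_nonneg (inv_nonneg.2 hC.le) (hhpos _).le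
  have hfin := hlow.trans hup
  rw [ENNReal.ofReal_le_ofReal_iff (by positivity)] at hfin
  have hr2 : (2 * r) ^ 2 = 16 * Real.pi ^ 2 * δ * h := by
    rw [hr, mul_pow, mul_pow, Real.sq_sqrt (by have := hhpos (0, s); positivity)]; ring
  rw [hr2] at hfin
  have hpi := Real.pi_pos
  rw [div_mul_eq_mul_div, le_div_iff₀ (by positivity)]
  have := mul_le_mul_of_nonneg_left hfin hC.le
  have e : C * (2 * Real.pi * (C⁻¹ * ∫ t in s..b, B.conformalFactor (0, t)))
      = (∫ t in s..b, B.conformalFactor (0, t)) * (2 * Real.pi) := by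
    field_simp
  rw [e] at this
  linarith

/-- Near an end of a sphere the potential is integrable twice: it is bounded by a multiple of the
conformal factor `h`, and `∫ₛ^∞ h ≤ C h(s)` can be integrated once more. -/
theorem exists_iterated_primitives [T2Space M] [CompactSpace M] {p₁ p₂ : M} (hl : B.l = ⊤)
    (hne : p₁ ≠ p₂)
    (hrange : range B.x = {p₁, p₂}ᶜ) (hx₁ : Tendsto B.x (comap Prod.snd atTop) (𝓝 p₁))
    (hx₂ : Tendsto B.x (comap Prod.snd atBot) (𝓝 p₂)) :
    ∃ (s₀ : ℝ) (A J : ℝ → ℝ), (∀ t ≥ s₀, HasDerivAt A (-B.V (0, t)) t ∧ HasDerivAt J (-A t) t ∧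
      0 ≤ A t ∧ 0 ≤ J t) ∧ Tendsto J atTop (𝓝 0) := by
  obtain ⟨s₀, C, hC, hcap⟩ := B.area_cap_le hl hne hrange hx₁ hx₂
  obtain ⟨Q, hQ⟩ : ∃ Q, ∀ p, B.q p ≤ Q := by
    obtain ⟨Q, hQ⟩ := (isCompact_univ.image B.contMDiff_q.continuous).bddAbove
    exact ⟨Q, fun p => hQ ⟨p, mem_univ _, rfl⟩⟩
  have hQ0 : 0 < Q := (B.q_pos (B.x (0, 0))).trans_le (hQ _)
  have hhpos : ∀ z, 0 < B.conformalFactor z := fun z => (B.x_conformal z).1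
  have hhc : Continuous fun t => B.conformalFactor (0, t) :=
    B.contDiff_conformalFactor.continuous.comp (by fun_prop)
  have hVc : Continuous fun t => B.V (0, t) := B.contDiff_V.continuous.comp (by fun_prop)
  have hVh : ∀ t, B.V (0, t) ≤ Q * B.conformalFactor (0, t) := fun t => by
    unfold V
    rw [mul_comm]
    exact mul_le_mul_of_nonneg_right (hQ _) (hhpos _).le
  -- a monotone bounded primitive converges
  have key : ∀ f : ℝ → ℝ, Continuous f → (∀ t ≥ s₀, 0 ≤ f t) → ∀ c, (∀ t ≥ s₀, ∫ u in s₀..t, f u ≤ c) →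
      ∃ d, Tendsto (fun t => ∫ u in s₀..t, f u) atTop (𝓝 d) ∧ ∀ t ≥ s₀, ∫ u in s₀..t, f u ≤ d := by
    intro f hf hf0 c hc
    have hmono : ∀ t ≥ s₀, ∀ t' ≥ t, ∫ u in s₀..t, f u ≤ ∫ u in s₀..t', f u := by
      intro t ht t' ht'
      rw [← intervalIntegral.integral_add_adjacent_intervals (hf.intervalIntegrable s₀ t)
        (hf.intervalIntegrable t t')]
      have := intervalIntegral.integral_nonneg ht' (f := f) (μ := MeasureTheory.volume)
        fun u hu => hf0 u (ht.trans hu.1)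
      linarith
    have hm : Monotone fun t => ∫ u in s₀..(max s₀ t), f u := fun a b hab =>
      hmono _ (le_max_left _ _) _ (max_le_max le_rfl hab)
    have hb : BddAbove (range fun t => ∫ u in s₀..(max s₀ t), f u) :=
      ⟨c, by rintro _ ⟨t, rfl⟩; exact hc _ (le_max_left _ _)⟩
    have ht := tendsto_atTop_ciSup hm hb
    refine ⟨_, ht.congr' ?_, fun t ht => ?_⟩
    · filter_upwards [eventually_ge_atTop s₀] with t ht
      rw [max_eq_right ht]
    · have := le_ciSup hb t
      simpa only [max_eq_right ht] using this
  have hVpos : ∀ t, 0 < B.V (0, t) := fun t => B.V_pos _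
  have hVint : ∀ s, s₀ ≤ s → ∀ b, s ≤ b → ∫ t in s..b, B.V (0, t) ≤ Q * C * B.conformalFactor (0, s) := by
    intro s hs b hsb
    calc ∫ t in s..b, B.V (0, t) ≤ ∫ t in s..b, Q * B.conformalFactor (0, t) :=
          intervalIntegral.integral_mono_on hsb (hVc.intervalIntegrable _ _)
            ((continuous_const.mul hhc).intervalIntegrable _ _) fun t _ => hVh t
      _ = Q * ∫ t in s..b, B.conformalFactor (0, t) := intervalIntegral.integral_const_mul _ _
      _ ≤ Q * C * B.conformalFactor (0, s) := by
          rw [mul_assoc]; exact mul_le_mul_of_nonneg_left (hcap s hs b hsb) hQ0.le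
  obtain ⟨d, hd, hd'⟩ := key _ hVc (fun t _ => (hVpos t).le) _ (hVint s₀ le_rfl)
  set A : ℝ → ℝ := fun t => d - ∫ u in s₀..t, B.V (0, u) with hA
  have hAd : ∀ t, HasDerivAt A (-B.V (0, t)) t := fun t => by
    have := (intervalIntegral.integral_hasDerivAt_right (hVc.intervalIntegrable s₀ t)
      (hVc.stronglyMeasurableAtFilter _ _) hVc.continuousAt).const_sub d
    exact this
  have hAc : Continuous A := continuous_iff_continuousAt.2 fun t => (hAd t).continuousAt
  have hA0 : ∀ t ≥ s₀, 0 ≤ A t := fun t ht => sub_nonneg.2 (hd' t ht)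
  have hAh : ∀ t ≥ s₀, A t ≤ Q * C * B.conformalFactor (0, t) := by
    intro t ht
    have hlim : Tendsto (fun b => ∫ u in t..b, B.V (0, u)) atTop (𝓝 (A t)) := by
      refine (hd.sub_const (∫ u in s₀..t, B.V (0, u))).congr fun b => ?_
      rw [intervalIntegral.integral_interval_sub_left] <;> exact hVc.intervalIntegrable _ _
    refine le_of_tendsto hlim ?_
    filter_upwards [eventually_ge_atTop t] with b hb using hVint t ht b hb
  obtain ⟨d2, hd2, hd2'⟩ := key A hAc hA0 (Q * C * (C * B.conformalFactor (0, s₀))) (by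
    intro b hb
    calc ∫ t in s₀..b, A t ≤ ∫ t in s₀..b, Q * C * B.conformalFactor (0, t) :=
          intervalIntegral.integral_mono_on hb (hAc.intervalIntegrable _ _)
            ((continuous_const.mul hhc).intervalIntegrable _ _) fun t ht => hAh t ht.1
      _ = Q * C * ∫ t in s₀..b, B.conformalFactor (0, t) := intervalIntegral.integral_const_mul _ _
      _ ≤ _ := mul_le_mul_of_nonneg_left (hcap s₀ le_rfl b hb) (by positivity))
  refine ⟨s₀, A, fun t => d2 - ∫ u in s₀..t, A u, fun t ht => ⟨hAd t, ?_, hA0 t ht,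
    sub_nonneg.2 (hd2' t ht)⟩, ?_⟩
  · exact (intervalIntegral.integral_hasDerivAt_right (hAc.intervalIntegrable s₀ t)
      (hAc.stronglyMeasurableAtFilter _ _) hAc.continuousAt).const_sub d2
  · simpa using hd2.const_sub d2

end Background

/-! ### Solutions of the linear equation -/

/-- `y` solves `y'' + V y = 0` on the line, and `y'` is its derivative. -/
structure IsSol (V y y' : ℝ → ℝ) : Prop where
  hasDerivAt : ∀ t, HasDerivAt y (y' t) t
  hasDerivAt' : ∀ t, HasDerivAt y' (-(V t * y t)) t

/-- The estimate of one step of the Neumann iteration. -/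
theorem norm_le_of_norm_deriv_le {E : Type*} [NormedAddCommGroup E] [NormedSpace ℝ E]
    {Y Y' : ℝ → E} (hY : ∀ t, HasDerivAt Y (Y' t) t) (h0 : Y 0 = 0) {D R : ℝ} {n : ℕ}
    (hb : ∀ t, |t| ≤ R → ‖Y' t‖ ≤ D * (|t| ^ n / n.factorial)) {t : ℝ} (ht : |t| ≤ R) :
    ‖Y t‖ ≤ D * (|t| ^ (n + 1) / (n + 1).factorial) := by
  have key : ∀ (Y Y' : ℝ → E), (∀ t, HasDerivAt Y (Y' t) t) → Y 0 = 0 →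
      (∀ t, |t| ≤ R → ‖Y' t‖ ≤ D * (|t| ^ n / n.factorial)) → ∀ t, 0 ≤ t → t ≤ R →
      ‖Y t‖ ≤ D * (t ^ (n + 1) / (n + 1).factorial) := by
    intro Y Y' hY h0 hb t ht0 htR
    have hB : ∀ x : ℝ, HasDerivAt (fun t : ℝ => D * (t ^ (n + 1) / (n + 1).factorial))
        (D * (x ^ n / n.factorial)) x := by
      intro x
      have := ((hasDerivAt_pow (n + 1) x).div_const ((n + 1).factorial : ℝ)).const_mul D
      refine this.congr_deriv ?_
      rw [Nat.factorial_succ]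
      have : (n.factorial : ℝ) ≠ 0 := by positivity
      push_cast
      field_simp
    refine image_norm_le_of_norm_deriv_right_le_deriv_boundary (a := 0) (b := t) (f := Y) (f' := Y')
      (B := fun t : ℝ => D * (t ^ (n + 1) / (n + 1).factorial))
      (B' := fun x => D * (x ^ n / n.factorial))
      (fun x _ => (hY x).continuousAt.continuousWithinAt) (fun x _ => (hY x).hasDerivWithinAt)
      (by simp [h0]) hB (fun x hx => ?_) (right_mem_Icc.2 ht0)
    have := hb x (by rw [abs_of_nonneg hx.1]; linarith [hx.2])
    rwa [abs_of_nonneg hx.1] at this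
  rcases le_total 0 t with h | h
  · rw [abs_of_nonneg h] at ht ⊢
    exact key Y Y' hY h0 hb t h ht
  · rw [abs_of_nonpos h] at ht ⊢
    have := key (fun t => Y (-t)) (fun t => -Y' (-t)) (fun t => by
      have := (hY (-t)).scomp t (hasDerivAt_neg t)
      simp only [neg_smul, one_smul] at this
      exact this) (by simpa using h0)
      (fun t ht => by simpa using hb (-t) (by simpa using ht)) (-t) (by linarith) ht
    simpa using this

/-- Existence of solutions on the whole line, by Neumann iteration. -/
theorem exists_isSol {V : ℝ → ℝ} (hV : Continuous V) (a b : ℝ) :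
    ∃ y y', IsSol V y y' ∧ y 0 = a ∧ y' 0 = b := by
  let A : ℝ → (ℝ × ℝ →L[ℝ] ℝ × ℝ) := fun t =>
    (ContinuousLinearMap.snd ℝ ℝ ℝ).prod (-(V t • ContinuousLinearMap.fst ℝ ℝ ℝ))
  have hA : ∀ t v, A t v = (v.2, -(V t * v.1)) := fun t v => by simp [A]
  let Y : ℕ → ℝ → ℝ × ℝ := fun n => Nat.rec (fun _ => (a, b))
    (fun _ f t => ∫ s in (0 : ℝ)..t, A s (f s)) n
  have Y0 : ∀ t, Y 0 t = (a, b) := fun _ => rfl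
  have Ysucc : ∀ n t, Y (n + 1) t = ∫ s in (0 : ℝ)..t, A s (Y n s) := fun _ _ => rfl
  have hAc : ∀ f : ℝ → ℝ × ℝ, Continuous f → Continuous fun s => A s (f s) := fun f hf => by
    simp only [hA]; fun_prop
  have hprim : ∀ f : ℝ → ℝ × ℝ, Continuous f → ∀ t,
      HasDerivAt (fun t => ∫ s in (0 : ℝ)..t, A s (f s)) (A t (f t)) t := fun f hf t =>
    intervalIntegral.integral_hasDerivAt_right ((hAc f hf).intervalIntegrable _ _)
      ((hAc f hf).stronglyMeasurableAtFilter _ _) (hAc f hf).continuousAt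
  have hYc : ∀ n, Continuous (Y n) := by
    intro n
    induction n with
    | zero => exact continuous_const
    | succ n ih => exact continuous_iff_continuousAt.2 fun t => (hprim _ ih t).continuousAt
  let Y' : ℕ → ℝ → ℝ × ℝ := fun n t => Nat.casesOn n 0 fun n => A t (Y n t)
  have hYd : ∀ n t, HasDerivAt (Y n) (Y' n t) t := by
    intro n t
    cases n with
    | zero => exact hasDerivAt_const t _
    | succ n => exact hprim _ (hYc n) t
  have hbound : ∀ R : ℝ, 0 ≤ R → ∃ C, 1 ≤ C ∧ ∀ n t, |t| ≤ R → ‖Y n t‖ ≤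
      (‖((a, b) : ℝ × ℝ)‖ * C ^ n) * (|t| ^ n / n.factorial) ∧
      ‖A t (Y n t)‖ ≤ (‖((a, b) : ℝ × ℝ)‖ * C ^ (n + 1)) * (|t| ^ n / n.factorial) := by
    intro R hR
    obtain ⟨C₀, hC₀⟩ := (isCompact_Icc (a := -R) (b := R)).exists_bound_of_continuousOn
      hV.continuousOn
    refine ⟨max 1 C₀, le_max_left _ _, fun n => ?_⟩
    set C := max 1 C₀
    have hC1 : 1 ≤ C := le_max_left _ _
    have hAn : ∀ t, |t| ≤ R → ∀ v, ‖A t v‖ ≤ C * ‖v‖ := by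
      intro t ht v
      rw [hA, Prod.norm_def]
      have h1 : ‖v.1‖ ≤ ‖v‖ := norm_fst_le v
      have h2 : ‖v.2‖ ≤ ‖v‖ := norm_snd_le v
      have h3 : ‖V t‖ ≤ C := (hC₀ t (abs_le.1 ht)).trans (le_max_right _ _)
      refine max_le ?_ ?_
      · simp only
        nlinarith [norm_nonneg v]
      · simp only [norm_neg, norm_mul]
        exact mul_le_mul h3 h1 (norm_nonneg _) (by linarith)
    have step : ∀ n t, |t| ≤ R → ‖Y n t‖ ≤ (‖((a, b) : ℝ × ℝ)‖ * C ^ n) * (|t| ^ n / n.factorial) →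
      ‖A t (Y n t)‖ ≤ (‖((a, b) : ℝ × ℝ)‖ * C ^ (n + 1)) * (|t| ^ n / n.factorial) := by
      intro n t ht h
      calc ‖A t (Y n t)‖ ≤ C * ‖Y n t‖ := hAn t ht _
        _ ≤ C * ((‖((a, b) : ℝ × ℝ)‖ * C ^ n) * (|t| ^ n / n.factorial)) :=
            mul_le_mul_of_nonneg_left h (by linarith)
        _ = _ := by ring
    suffices h : ∀ t, |t| ≤ R → ‖Y n t‖ ≤ (‖((a, b) : ℝ × ℝ)‖ * C ^ n) * (|t| ^ n / n.factorial) from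
      fun t ht => ⟨h t ht, step n t ht (h t ht)⟩
    induction n with
    | zero => intro t _; simp [Y0]
    | succ n ih =>
      intro t ht
      exact norm_le_of_norm_deriv_le (fun t => hYd (n + 1) t) (by simp [Ysucc])
        (fun t ht => step n t ht (ih t ht)) ht
  -- the solution is the sum of the iterates `Y n`, which are bounded by an exponential series
  have hsum : ∀ t, Summable fun n => Y n t := by
    intro t
    obtain ⟨C, hC, h⟩ := hbound |t| (abs_nonneg t)
    refine Summable.of_norm_bounded (g := fun n => ‖((a, b) : ℝ × ℝ)‖ * ((C * |t|) ^ n / n.factorial))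
      ((Real.summable_pow_div_factorial _).mul_left _) fun n => ((h n t le_rfl).1).trans (le_of_eq ?_)
    rw [mul_pow]; ring
  have hder : ∀ t, HasDerivAt (fun t => ∑' n, Y n t) (A t (∑' n, Y n t)) t := by
    intro t
    set R := |t| + 1
    obtain ⟨C, hC, h⟩ := hbound R (by positivity)
    have hu : Summable fun n : ℕ => ‖((a, b) : ℝ × ℝ)‖ * C * ((C * R) ^ n / n.factorial) :=
      (Real.summable_pow_div_factorial _).mul_left _
    let u : ℕ → ℝ := fun n => Nat.casesOn n 0 fun n => ‖((a, b) : ℝ × ℝ)‖ * C * ((C * R) ^ n / n.factorial)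
    have hu' : Summable u := (summable_nat_add_iff 1).1 hu
    have := hasDerivAt_tsum_of_isPreconnected (g := Y) (g' := Y') (t := Ioo (-R) R) (y₀ := t) (y := t)
      hu' isOpen_Ioo isPreconnected_Ioo (fun n y _ => hYd n y) (fun n y hy => ?_)
      (abs_lt.1 (by simp [R])) (hsum t) (abs_lt.1 (by simp [R]))
    · refine this.congr_deriv ?_
      have hs' : Summable fun n => Y' n t := by
        refine (summable_nat_add_iff 1).1 ?_
        exact (A t).summable (hsum t)
      rw [hs'.tsum_eq_zero_add]
      exact (((A t).map_tsum (hsum t)).trans (zero_add _).symm).symm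
    · cases n with
      | zero => simp [Y', u]
      | succ n =>
        have hyR : |y| ≤ R := abs_le.2 ⟨hy.1.le, hy.2.le⟩
        refine ((h n y hyR).2).trans ?_
        simp only [u]
        have : |y| ^ n ≤ R ^ n := pow_le_pow_left₀ (abs_nonneg _) hyR n
        calc ‖((a, b) : ℝ × ℝ)‖ * C ^ (n + 1) * (|y| ^ n / n.factorial)
            ≤ ‖((a, b) : ℝ × ℝ)‖ * C ^ (n + 1) * (R ^ n / n.factorial) := by gcongr
          _ = _ := by rw [mul_pow]; ring
  refine ⟨fun t => (∑' n, Y n t).1, fun t => (∑' n, Y n t).2, ⟨fun t => ?_, fun t => ?_⟩, ?_, ?_⟩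
  · have := (ContinuousLinearMap.fst ℝ ℝ ℝ).hasFDerivAt.comp_hasDerivAt t (hder t)
    simpa [hA, Function.comp_def] using this
  · have := (ContinuousLinearMap.snd ℝ ℝ ℝ).hasFDerivAt.comp_hasDerivAt t (hder t)
    simpa [hA, Function.comp_def] using this
  all_goals
    simp only
    rw [(hsum 0).tsum_eq_zero_add]
    simp [Y0, Ysucc]

namespace IsSol

variable {V y y' w w' : ℝ → ℝ}

theorem continuous (h : IsSol V y y') : Continuous y :=
  continuous_iff_continuousAt.2 fun t => (h.hasDerivAt t).continuousAt

theorem continuous' (h : IsSol V y y') : Continuous y' :=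
  continuous_iff_continuousAt.2 fun t => (h.hasDerivAt' t).continuousAt

theorem linComb (h : IsSol V y y') (k : IsSol V w w') (α β : ℝ) :
    IsSol V (fun t => α * y t + β * w t) (fun t => α * y' t + β * w' t) :=
  ⟨fun t => ((h.hasDerivAt t).const_mul α).add ((k.hasDerivAt t).const_mul β), fun t => by
    convert! ((h.hasDerivAt' t).const_mul α).add ((k.hasDerivAt' t).const_mul β) using 1
    ring⟩

theorem contDiff (h : IsSol V y y') (hV : ContDiff ℝ ∞ V) : ContDiff ℝ ∞ y ∧ ContDiff ℝ ∞ y' := by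
  have key : ∀ n : ℕ, ContDiff ℝ n y ∧ ContDiff ℝ n y' := by
    intro n
    induction n with
    | zero => exact ⟨contDiff_zero.2 h.continuous, contDiff_zero.2 h.continuous'⟩
    | succ n ih =>
      have hd : deriv y = y' := funext fun t => (h.hasDerivAt t).deriv
      have hd' : deriv y' = fun t => -(V t * y t) := funext fun t => (h.hasDerivAt' t).deriv
      push_cast
      refine ⟨contDiff_succ_iff_deriv.2 ⟨fun t => (h.hasDerivAt t).differentiableAt, by simp, ?_⟩,
        contDiff_succ_iff_deriv.2 ⟨fun t => (h.hasDerivAt' t).differentiableAt, by simp, ?_⟩⟩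
      · rw [hd]; exact ih.2
      · rw [hd']; exact ((hV.of_le (by exact_mod_cast le_top)).mul ih.1).neg
  exact ⟨contDiff_infty.2 fun n => (key n).1, contDiff_infty.2 fun n => (key n).2⟩

/-- The Wronskian of two solutions is constant. -/
theorem wronskian (h : IsSol V y y') (k : IsSol V w w') (s t : ℝ) :
    y' s * w s - y s * w' s = y' t * w t - y t * w' t := by
  have hd : ∀ t, HasDerivAt (fun t => y' t * w t - y t * w' t) 0 t := fun t => by
    convert! ((h.hasDerivAt' t).mul (k.hasDerivAt t)).sub ((h.hasDerivAt t).mul (k.hasDerivAt' t))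
      using 1
    ring
  exact is_const_of_deriv_eq_zero (fun t => (hd t).differentiableAt) (fun t => (hd t).deriv) s t

/-- The logarithmic derivative of a positive solution is decreasing. -/
theorem log_deriv_lt (h : IsSol V y y') (hV : ∀ t, 0 < V t) {a b : ℝ} (hab : a < b)
    (hpos : ∀ t ∈ Icc a b, 0 < y t) : y' b / y b < y' a / y a := by
  refine strictAntiOn_of_deriv_neg (f := fun t => y' t / y t) (convex_Icc a b)
    (ContinuousOn.div h.continuous'.continuousOn h.continuous.continuousOn
      fun t ht => (hpos t ht).ne') (fun t ht => ?_) (left_mem_Icc.2 hab.le) (right_mem_Icc.2 hab.le) hab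
  rw [interior_Icc] at ht
  have hy := hpos t (Ioo_subset_Icc_self ht)
  have hd : HasDerivAt (fun t => y' t / y t) _ t := (h.hasDerivAt' t).div (h.hasDerivAt t) hy.ne'
  rw [hd.deriv]
  refine div_neg_of_neg_of_pos ?_ (by positivity)
  have := mul_pos (mul_pos (hV t) hy) hy
  nlinarith [sq_nonneg (y' t)]

/-- `y' + m y ≥ 0` keeps a solution positive, since `exp (m t) y` is then nondecreasing. -/
theorem pos_of_nonneg (h : IsSol V y y') {a b m : ℝ} (ha : 0 < y a)
    (hpos : ∀ t ∈ Ioo a b, 0 ≤ y' t + m * y t) : ∀ t ∈ Icc a b, 0 < y t := by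
  intro t ht
  have hd : ∀ t, HasDerivAt (fun t => Real.exp (m * t) * y t)
      (Real.exp (m * t) * (y' t + m * y t)) t := fun t => by
    have h1 : HasDerivAt (fun t : ℝ => Real.exp (m * t)) (Real.exp (m * t) * m) t := by
      simpa using ((hasDerivAt_id t).const_mul m).exp
    convert! h1.mul (h.hasDerivAt t) using 1
    ring
  have hm : MonotoneOn (fun t => Real.exp (m * t) * y t) (Icc a b) := by
    refine monotoneOn_of_deriv_nonneg (convex_Icc a b)
      (fun t _ => (hd t).continuousAt.continuousWithinAt)
      (fun t _ => (hd t).differentiableAt.differentiableWithinAt) fun t ht => ?_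
    rw [interior_Icc] at ht
    rw [(hd t).deriv]
    exact mul_nonneg (Real.exp_pos _).le (hpos t ht)
  have := hm (left_mem_Icc.2 (ht.1.trans ht.2)) ht ht.1
  have h2 : 0 < Real.exp (m * a) * y a := mul_pos (Real.exp_pos _) ha
  exact (mul_pos_iff_of_pos_left (Real.exp_pos _)).1 (h2.trans_le this)

end IsSol

/-! ### Crossings and Sturm comparison -/

/-- A smooth positive even potential `V` on the line, for the equation `y'' + V y = 0`. -/
structure Potential where
  /-- the function `V` -/
  val : ℝ → ℝ
  smooth : ContDiff ℝ ∞ val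
  pos : ∀ t, 0 < val t
  even : ∀ t, val (-t) = val t

namespace Potential

variable (V : Potential)

/-- Two solutions with Wronskian `1`. -/
theorem exists_fundamental : ∃ c c' s s' : ℝ → ℝ, IsSol V.val c c' ∧ IsSol V.val s s' ∧
    ∀ t, c t * s' t - c' t * s t = 1 := by
  obtain ⟨c, c', hc, c0, c0'⟩ := exists_isSol V.smooth.continuous 1 0
  obtain ⟨s, s', hs, s0, s0'⟩ := exists_isSol V.smooth.continuous 0 1
  refine ⟨c, c', s, s', hc, hs, fun t => ?_⟩
  have := hs.wronskian hc 0 t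
  rw [c0, c0', s0, s0'] at this
  linarith

/-- The first of two fundamental solutions. -/
def c : ℝ → ℝ := V.exists_fundamental.choose
/-- The derivative of `Potential.c`. -/
def dc : ℝ → ℝ := V.exists_fundamental.choose_spec.choose
/-- The second of two fundamental solutions. -/
def s : ℝ → ℝ := V.exists_fundamental.choose_spec.choose_spec.choose
/-- The derivative of `Potential.s`. -/
def ds : ℝ → ℝ := V.exists_fundamental.choose_spec.choose_spec.choose_spec.choose

theorem isSol_c : IsSol V.val V.c V.dc :=
  V.exists_fundamental.choose_spec.choose_spec.choose_spec.choose_spec.1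

theorem isSol_s : IsSol V.val V.s V.ds :=
  V.exists_fundamental.choose_spec.choose_spec.choose_spec.choose_spec.2.1

/-- The Wronskian of the fundamental solutions is `1`. -/
theorem wronskian_c_s (t : ℝ) : V.c t * V.ds t - V.dc t * V.s t = 1 :=
  V.exists_fundamental.choose_spec.choose_spec.choose_spec.choose_spec.2.2 t

/-- The solution with the data `y a = 1`, `y' a = p`, as a function of `t`. -/
def sol (a p t : ℝ) : ℝ :=
  (V.ds a - p * V.s a) * V.c t + (p * V.c a - V.dc a) * V.s t

/-- The derivative of `Potential.sol` in `t`. -/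
def dsol (a p t : ℝ) : ℝ :=
  (V.ds a - p * V.s a) * V.dc t + (p * V.c a - V.dc a) * V.ds t

theorem isSol_sol (a p : ℝ) : IsSol V.val (V.sol a p) (V.dsol a p) :=
  V.isSol_c.linComb V.isSol_s _ _

@[simp] theorem sol_self (a p : ℝ) : V.sol a p a = 1 := by
  rw [sol]; linear_combination V.wronskian_c_s a

@[simp] theorem dsol_self (a p : ℝ) : V.dsol a p a = p := by
  rw [dsol]; linear_combination p * V.wronskian_c_s a

theorem contDiff_sol : ContDiff ℝ ∞ fun z : ℝ × ℝ × ℝ => V.sol z.1 z.2.1 z.2.2 := by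
  have h1 := (V.isSol_c.contDiff V.smooth).1
  have h2 := (V.isSol_c.contDiff V.smooth).2
  have h3 := (V.isSol_s.contDiff V.smooth).1
  have h4 := (V.isSol_s.contDiff V.smooth).2
  unfold sol
  fun_prop

theorem contDiff_dsol : ContDiff ℝ ∞ fun z : ℝ × ℝ × ℝ => V.dsol z.1 z.2.1 z.2.2 := by
  have h1 := (V.isSol_c.contDiff V.smooth).1
  have h2 := (V.isSol_c.contDiff V.smooth).2
  have h3 := (V.isSol_s.contDiff V.smooth).1
  have h4 := (V.isSol_s.contDiff V.smooth).2
  unfold dsol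
  fun_prop

theorem continuous_sol : Continuous fun z : ℝ × ℝ × ℝ => V.sol z.1 z.2.1 z.2.2 :=
  V.contDiff_sol.continuous

theorem continuous_dsol : Continuous fun z : ℝ × ℝ × ℝ => V.dsol z.1 z.2.1 z.2.2 :=
  V.contDiff_dsol.continuous

/-- A solution is determined by its data at one point. -/
theorem eq_sol {y y' : ℝ → ℝ} (h : IsSol V.val y y') (a : ℝ) (ha : y a ≠ 0) (t : ℝ) :
    y t = y a * V.sol a (y' a / y a) t ∧ y' t = y a * V.dsol a (y' a / y a) t := by
  have h1 := h.wronskian V.isSol_c a t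
  have h2 := h.wronskian V.isSol_s a t
  have h3 := V.wronskian_c_s t
  have e1 : y a * (V.ds a - y' a / y a * V.s a) = y a * V.ds a - y' a * V.s a := by
    field_simp
  have e2 : y a * (y' a / y a * V.c a - V.dc a) = y' a * V.c a - y a * V.dc a := by
    field_simp
  constructor
  · rw [sol, mul_add, ← mul_assoc, ← mul_assoc, e1, e2]
    linear_combination V.s t * h1 * (-1) + V.c t * h2 - y t * h3
  · rw [dsol, mul_add, ← mul_assoc, ← mul_assoc, e1, e2]
    linear_combination V.ds t * h1 * (-1) + V.dc t * h2 - y' t * h3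

/-- The solution starting at `a` with logarithmic derivative `p` is positive up to `b`, where
its logarithmic derivative has come down to `-m`. -/
structure IsNext (l : EReal) (a p m b : ℝ) : Prop where
  lt : a < b
  lt_end : (b : EReal) < l
  sol_pos : ∀ t ∈ Icc a b, 0 < V.sol a p t
  dsol_eq : V.dsol a p b = -(m * V.sol a p b)

variable {V} {l : EReal} {a p m b a' p' m' b' : ℝ}

theorem IsNext.add_pos (h : V.IsNext l a p m b) : 0 < p + m := by
  have := (V.isSol_sol a p).log_deriv_lt V.pos h.lt h.sol_pos
  rw [h.dsol_eq, V.sol_self, V.dsol_self] at this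
  have hb := h.sol_pos b (right_mem_Icc.2 h.lt.le)
  rw [neg_div, mul_div_cancel_right₀ _ hb.ne'] at this
  linarith

theorem IsNext.unique (h : V.IsNext l a p m b) (h' : V.IsNext l a p m b') : b = b' := by
  have key : ∀ {b b'}, V.IsNext l a p m b → V.IsNext l a p m b' → ¬ b < b' := by
    intro b b' h h' hlt
    have := (V.isSol_sol a p).log_deriv_lt V.pos hlt fun t ht =>
      h'.sol_pos t ⟨h.lt.le.trans ht.1, ht.2⟩
    rw [h.dsol_eq, h'.dsol_eq, neg_div, neg_div,
      mul_div_cancel_right₀ _ (h.sol_pos b (right_mem_Icc.2 h.lt.le)).ne',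
      mul_div_cancel_right₀ _ (h'.sol_pos b' (right_mem_Icc.2 h'.lt.le)).ne'] at this
    exact lt_irrefl _ this
  exact le_antisymm (not_lt.1 (key h' h)) (not_lt.1 (key h h'))

theorem continuous_cross (V : Potential) (a p m : ℝ) :
    Continuous fun t => V.dsol a p t + m * V.sol a p t :=
  (V.isSol_sol a p).continuous'.add (continuous_const.mul (V.isSol_sol a p).continuous)

/-- Before its next crossing, `y' + m y` is positive. -/
theorem IsNext.cross_pos (h : V.IsNext l a p m b) {t : ℝ} (hat : a ≤ t) (htb : t < b) :
    0 < V.dsol a p t + m * V.sol a p t := by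
  have := (V.isSol_sol a p).log_deriv_lt V.pos htb fun t ht =>
    h.sol_pos t ⟨hat.trans ht.1, ht.2⟩
  have hy := h.sol_pos t ⟨hat, htb.le⟩
  rw [h.dsol_eq, neg_div, mul_div_cancel_right₀ _ (h.sol_pos b (right_mem_Icc.2 h.lt.le)).ne',
    lt_div_iff₀ hy] at this
  linarith

/-- If `y' + m y` is nonpositive somewhere, then the first such point is the next crossing. -/
theorem exists_isNext (hpm : 0 < p + m) {d : ℝ} (had : a ≤ d) (hd : (d : EReal) < l)
    (hneg : V.dsol a p d + m * V.sol a p d ≤ 0) : ∃ b ≤ d, V.IsNext l a p m b := by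
  have hc := V.continuous_cross a p m
  set h := fun t => V.dsol a p t + m * V.sol a p t with hh
  have hK : IsCompact (Icc a d ∩ h ⁻¹' Iic 0) := isCompact_Icc.inter_right (isClosed_Iic.preimage hc)
  obtain ⟨b, ⟨hb, hb0⟩, hmin⟩ := hK.exists_isLeast ⟨d, right_mem_Icc.2 had, hneg⟩
  have hpos : ∀ t, a ≤ t → t < b → 0 < h t := fun t h1 h2 => by
    by_contra hn
    exact absurd (hmin ⟨⟨h1, h2.le.trans hb.2⟩, not_lt.1 hn⟩) (not_le.2 h2)
  have hab : a < b := by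
    refine lt_of_le_of_ne hb.1 ?_
    rintro rfl
    have : h a = p + m := by simp [hh]
    rw [mem_preimage, this] at hb0
    exact absurd hpm (not_lt.2 hb0)
  have hb1 : 0 ≤ h b := by
    refine ge_of_tendsto (hc.continuousAt.mono_left nhdsWithin_le_nhds : Tendsto h (𝓝[<] b) _) ?_
    filter_upwards [Ioo_mem_nhdsLT hab] with t ht using (hpos t ht.1.le ht.2).le
  refine ⟨b, hb.2, hab, lt_of_le_of_lt (EReal.coe_le_coe_iff.2 hb.2) hd,
    (V.isSol_sol a p).pos_of_nonneg (by simp) (m := m) fun t ht => (hpos t ht.1.le ht.2).le, ?_⟩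
  have : h b = 0 := le_antisymm hb0 hb1
  simp only [hh] at this
  linarith

/-- Without a next crossing, `y' + m y` and `y` stay positive. -/
theorem cross_pos_of_not_exists (hpm : 0 < p + m) (hn : ∀ b, ¬ V.IsNext l a p m b) {t : ℝ}
    (hat : a ≤ t) (ht : (t : EReal) < l) :
    0 < V.dsol a p t + m * V.sol a p t ∧ 0 < V.sol a p t := by
  have h1 : ∀ t, a ≤ t → (t : EReal) < l → 0 < V.dsol a p t + m * V.sol a p t := by
    intro t hat ht
    by_contra h
    obtain ⟨b, -, hb⟩ := exists_isNext hpm hat ht (not_lt.1 h)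
    exact hn b hb
  refine ⟨h1 t hat ht, (V.isSol_sol a p).pos_of_nonneg (b := t) (by simp) (m := m)
    (fun u hu => (h1 u hu.1.le ((EReal.coe_lt_coe_iff.2 hu.2).trans ht)).le) t ⟨hat, le_rfl⟩⟩

/-- Sturm comparison: the crossing comes no later if the start, the initial and the final
logarithmic derivative are decreased. -/
theorem IsNext.comparison (h' : V.IsNext l a' p' m' b') (ha : a ≤ a') (hp : p ≤ p') (hm : m ≤ m')
    (hpm : 0 < p + m) : ∃ b ≤ b', V.IsNext l a p m b ∧ (a < a' ∨ p < p' ∨ m < m' → b < b') := by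
  -- the Wronskian with the later solution, evaluated at `a'` and at `b'`
  have key : (∀ t ∈ Icc a b', 0 < V.sol a p t) →
      0 ≤ V.dsol a p b' + m * V.sol a p b' →
      V.dsol a p b' + m * V.sol a p b' = 0 ∧ a = a' ∧ p = p' ∧ m = m' := by
    intro hpos hcr
    have hW := (V.isSol_sol a p).wronskian (V.isSol_sol a' p') a' b'
    rw [V.sol_self, V.dsol_self, h'.dsol_eq] at hW
    have ha'pos := hpos a' ⟨ha, h'.lt.le⟩
    have hb'pos := hpos b' ⟨ha.trans h'.lt.le, le_rfl⟩
    have hwb := h'.sol_pos b' (right_mem_Icc.2 h'.lt.le)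
    have h1 : V.dsol a p a' ≤ p * V.sol a p a' ∧ (a < a' → V.dsol a p a' < p * V.sol a p a') := by
      have hlt : a < a' → V.dsol a p a' < p * V.sol a p a' := by
        intro hlt
        have := (V.isSol_sol a p).log_deriv_lt V.pos hlt fun t ht =>
          hpos t ⟨ht.1, ht.2.trans h'.lt.le⟩
        rw [V.sol_self, V.dsol_self, div_lt_iff₀ ha'pos] at this
        simpa using this
      refine ⟨?_, hlt⟩
      rcases ha.eq_or_lt with rfl | h
      · simp
      · exact (hlt h).le
    have h2 : V.dsol a p a' * 1 - V.sol a p a' * p' =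
        V.sol a' p' b' * (V.dsol a p b' + m * V.sol a p b') +
          V.sol a' p' b' * V.sol a p b' * (m' - m) := by rw [hW]; ring
    have h3 : 0 ≤ V.sol a' p' b' * (V.dsol a p b' + m * V.sol a p b') := mul_nonneg hwb.le hcr
    have h4 : 0 < V.sol a' p' b' * V.sol a p b' := mul_pos hwb hb'pos
    have h5 : 0 ≤ V.sol a' p' b' * V.sol a p b' * (m' - m) := mul_nonneg h4.le (by linarith)
    have h6 : V.sol a p a' * p ≤ V.sol a p a' * p' := mul_le_mul_of_nonneg_left hp ha'pos.le
    have e1 : a = a' := by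
      by_contra hne
      have := h1.2 (lt_of_le_of_ne ha hne)
      linarith
    have e2 : p = p' := by
      by_contra hne
      have := mul_lt_mul_of_pos_left (lt_of_le_of_ne hp hne) ha'pos
      linarith [h1.1]
    have e3 : m = m' := by
      by_contra hne
      have : 0 < V.sol a' p' b' * V.sol a p b' * (m' - m) :=
        mul_pos h4 (sub_pos.2 (lt_of_le_of_ne hm hne))
      linarith [h1.1]
    refine ⟨?_, e1, e2, e3⟩
    have : V.sol a' p' b' * (V.dsol a p b' + m * V.sol a p b') = 0 := by linarith [h1.1]
    exact (mul_eq_zero.1 this).resolve_left hwb.ne'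
  by_cases hex : ∃ b ≤ b', V.IsNext l a p m b
  · obtain ⟨b, hbb, hb⟩ := hex
    refine ⟨b, hbb, hb, fun hs => lt_of_le_of_ne hbb ?_⟩
    rintro rfl
    have := key hb.sol_pos (by rw [hb.dsol_eq]; linarith)
    rcases hs with h | h | h <;> linarith [this.2.1, this.2.2.1, this.2.2.2]
  · have hcr : 0 < V.dsol a p b' + m * V.sol a p b' := by
      by_contra hcr
      exact hex (exists_isNext hpm (ha.trans h'.lt.le) h'.lt_end (not_lt.1 hcr))
    have hn : ∀ b, ¬ V.IsNext b' a p m b := by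
      intro b hb
      exact hex ⟨b, (EReal.coe_lt_coe_iff.1 hb.lt_end).le, hb.lt,
        hb.lt_end.trans h'.lt_end, hb.sol_pos, hb.dsol_eq⟩
    have hpos : ∀ t ∈ Icc a b', 0 < V.sol a p t := by
      refine (V.isSol_sol a p).pos_of_nonneg (by simp) (m := m) fun t ht => ?_
      exact (cross_pos_of_not_exists hpm hn ht.1.le (EReal.coe_lt_coe_iff.2 ht.2)).1.le
    have := key hpos hcr.le
    linarith [this.1]

end Potential

/-! ### The end solution and the next crossing -/

/-- The filter of real numbers tending to `l` from below. -/
def endFilter (l : EReal) : Filter ℝ := comap (fun s : ℝ => (s : EReal)) (𝓝[<] l)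

theorem mem_endFilter {l : EReal} (hl : 0 < l) {S : Set ℝ} :
    S ∈ endFilter l ↔ ∃ a : ℝ, (a : EReal) < l ∧ ∀ t : ℝ, a < t → (t : EReal) < l → t ∈ S := by
  rw [endFilter, mem_comap]
  constructor
  · rintro ⟨U, hU, hS⟩
    obtain ⟨x, hx, hxU⟩ := (mem_nhdsLT_iff_exists_Ioo_subset' hl).1 hU
    obtain ⟨a, ha, hal⟩ := EReal.lt_iff_exists_real_btwn.1 (mem_Iio.1 hx)
    exact ⟨a, hal, fun t h1 h2 => hS (hxU ⟨ha.trans (EReal.coe_lt_coe_iff.2 h1), h2⟩)⟩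
  · rintro ⟨a, ha, h⟩
    refine ⟨Ioo (a : EReal) l, Ioo_mem_nhdsLT ha, fun t ht => h t ?_ ht.2⟩
    exact EReal.coe_lt_coe_iff.1 ht.1

theorem endFilter_neBot {l : EReal} (hl : 0 < l) : (endFilter l).NeBot := by
  refine ⟨fun h => ?_⟩
  obtain ⟨a, ha, hS⟩ := (mem_endFilter hl).1 (h ▸ mem_bot : (∅ : Set ℝ) ∈ endFilter l)
  obtain ⟨t, h1, h2⟩ := EReal.lt_iff_exists_real_btwn.1 ha
  exact hS t (EReal.coe_lt_coe_iff.1 h1) h2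

theorem endFilter_coe (τ : ℝ) : endFilter (τ : EReal) ≤ 𝓝 τ := by
  rw [endFilter, (EReal.isOpenEmbedding_coe.isEmbedding.isInducing.nhds_eq_comap τ)]
  exact comap_mono nhdsWithin_le_nhds

namespace Potential

variable {V : Potential} {l : EReal} {a p m b : ℝ}

variable (V) in
/-- A solution tending to `1`, with derivative tending to `0`, at the end `l`. -/
structure IsEnd (l : EReal) (e e' : ℝ → ℝ) : Prop where
  isSol : IsSol V.val e e'
  tendsto : Tendsto e (endFilter l) (𝓝 1)
  tendsto' : Tendsto e' (endFilter l) (𝓝 0)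

variable (V) in
theorem isEnd_coe (τ : ℝ) : V.IsEnd (τ : EReal) (V.sol τ 0) (V.dsol τ 0) where
  isSol := V.isSol_sol τ 0
  tendsto := by
    have := (V.isSol_sol τ 0).continuous.tendsto τ
    rw [V.sol_self] at this
    exact this.mono_left (endFilter_coe τ)
  tendsto' := by
    have := (V.isSol_sol τ 0).continuous'.tendsto τ
    rw [V.dsol_self] at this
    exact this.mono_left (endFilter_coe τ)

/-- A positive solution is strictly concave. -/
theorem deriv_antitone {y y' : ℝ → ℝ} (h : IsSol V.val y y') {a b : ℝ}
    (hpos : ∀ t ∈ Ioo a b, 0 < y t) : StrictAntiOn y' (Icc a b) := by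
  refine strictAntiOn_of_deriv_neg (convex_Icc a b) h.continuous'.continuousOn fun t ht => ?_
  rw [interior_Icc] at ht
  rw [(h.hasDerivAt' t).deriv]
  have := mul_pos (V.pos t) (hpos t ht)
  linarith

/-- The end solution is increasing where it is positive up to the end: being concave, it has
decreasing slope, which tends to `0`. -/
theorem IsEnd.deriv_pos {e e' : ℝ → ℝ} (he : V.IsEnd l e e') (hl : 0 < l) {a : ℝ}
    (hpos : ∀ t : ℝ, a < t → (t : EReal) < l → 0 < e t) (ha : (a : EReal) < l) : 0 < e' a := by
  obtain ⟨b, h1, hb⟩ := EReal.lt_iff_exists_real_btwn.1 ha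
  have hab : a < b := EReal.coe_lt_coe_iff.1 h1
  have : e' b < e' a := deriv_antitone he.isSol
    (fun t ht => hpos t ht.1 ((EReal.coe_lt_coe_iff.2 ht.2).trans hb))
    (left_mem_Icc.2 hab.le) (right_mem_Icc.2 hab.le) hab
  have hb0 : 0 ≤ e' b := by
    have := endFilter_neBot hl
    refine le_of_tendsto he.tendsto' ((mem_endFilter hl).2 ⟨b, hb, fun t h1 h2 => ?_⟩)
    exact (deriv_antitone he.isSol (fun u hu => hpos u (hab.trans hu.1)
      ((EReal.coe_lt_coe_iff.2 hu.2).trans h2))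
      (left_mem_Icc.2 h1.le) (right_mem_Icc.2 h1.le) h1).le
  linarith

/-- A solution steeper than a positive increasing one is increasing as long as the latter is. -/
theorem dsol_pos_of_le {e e' : ℝ → ℝ} (he : IsSol V.val e e') (hpos : ∀ t ∈ Icc a b, 0 < e t)
    (hpos' : ∀ t ∈ Icc a b, 0 < e' t) (hp : e' a ≤ p * e a) : ∀ t ∈ Icc a b, 0 < V.dsol a p t := by
  intro t ht
  by_contra hneg
  have hab : a ≤ b := ht.1.trans ht.2
  have hp0 : 0 < p := by
    have h1 := hpos a (left_mem_Icc.2 hab)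
    have h2 := hpos' a (left_mem_Icc.2 hab)
    by_contra hn
    nlinarith
  -- the first critical point, where the Wronskian with `e` has the wrong sign
  obtain ⟨d, hd, hn⟩ := exists_isNext (V := V) (l := ⊤) (a := a) (p := p) (m := 0) (by linarith)
    ht.1 (EReal.coe_lt_top t) (by linarith)
  have hdI : d ∈ Icc a b := ⟨hn.lt.le, hd.trans ht.2⟩
  have hW := (V.isSol_sol a p).wronskian he a d
  have h0 := hn.dsol_eq
  rw [V.sol_self, V.dsol_self, h0] at hW
  have := mul_pos (hn.sol_pos d (right_mem_Icc.2 hn.lt.le)) (hpos' d hdI)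
  linarith

/-- A solution starting close to the end with logarithmic derivative at least `q > 0` is increasing
up to the end. -/
theorem IsEnd.exists_dsol_pos {e e' : ℝ → ℝ} (he : V.IsEnd l e e') (hl : 0 < l) {q : ℝ}
    (hq : 0 < q) : ∃ s : ℝ, (s : EReal) < l ∧ ∀ a p : ℝ, s ≤ a → q ≤ p → ∀ t : ℝ, a ≤ t →
      (t : EReal) < l → 0 < V.dsol a p t := by
  have h1 : ∀ᶠ t in endFilter l, 1 / 2 < e t := he.tendsto.eventually_const_lt (by norm_num)
  have h2 : ∀ᶠ t in endFilter l, e' t < q / 2 := he.tendsto'.eventually_lt_const (by linarith)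
  obtain ⟨s, hs, h⟩ := (mem_endFilter hl).1 (h1.and h2)
  obtain ⟨r, hr1, hr⟩ := EReal.lt_iff_exists_real_btwn.1 hs
  have hsr : s < r := EReal.coe_lt_coe_iff.1 hr1
  refine ⟨r, hr, fun a p ha hp t hat ht => ?_⟩
  have hlt : ∀ u ∈ Icc a t, (u : EReal) < l := fun u hu =>
    (EReal.coe_le_coe_iff.2 hu.2).trans_lt ht
  have hgt : ∀ u, a ≤ u → s < u := fun u hu => by linarith
  refine dsol_pos_of_le he.isSol (b := t) (fun u hu => ?_) (fun u hu => ?_) ?_ t ⟨hat, le_rfl⟩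
  · have : 1 / 2 < e u := (h u (hgt u hu.1) (hlt u hu)).1
    linarith
  · refine he.deriv_pos hl (fun v hv hvl => ?_) (hlt u hu)
    have : 1 / 2 < e v := (h v (hgt v (hu.1.trans hv.le)) hvl).1
    linarith
  · obtain ⟨h3, h4⟩ : 1 / 2 < e a ∧ e' a < q / 2 := h a (hgt a le_rfl) (hlt a ⟨le_rfl, hat⟩)
    nlinarith

variable (V l) in
/-- The next crossing latitude; meaningful only if it exists. -/
def nxt (a p m : ℝ) : ℝ := Classical.epsilon (V.IsNext l a p m)

theorem IsNext.nxt_eq (h : V.IsNext l a p m b) : V.nxt l a p m = b :=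
  (Classical.epsilon_spec (p := V.IsNext l a p m) ⟨b, h⟩).unique h

theorem IsNext.isNext_nxt (h : V.IsNext l a p m b) : V.IsNext l a p m (V.nxt l a p m) :=
  h.nxt_eq.symm ▸ h

/-- If no crossing takes place up to `s`, then the same holds for nearby data. -/
theorem eventually_lt_of_isNext {z : ℝ × ℝ × ℝ} {s : ℝ}
    (h : ∀ t, z.1 ≤ t → t ≤ s → 0 < V.dsol z.1 z.2.1 t + z.2.2 * V.sol z.1 z.2.1 t) :
    ∀ᶠ w in 𝓝 z, ∀ b, V.IsNext l w.1 w.2.1 w.2.2 b → s < b := by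
  rcases lt_or_ge s z.1 with hs | hs
  · filter_upwards [continuous_fst.tendsto z |>.eventually_const_lt hs] with w hw b hb
    exact hw.trans hb.lt
  have hc : Continuous fun v : (ℝ × ℝ × ℝ) × ℝ =>
      V.dsol v.1.1 v.1.2.1 v.2 + v.1.2.2 * V.sol v.1.1 v.1.2.1 v.2 :=
    (V.continuous_dsol.comp (by fun_prop :
      Continuous fun v : (ℝ × ℝ × ℝ) × ℝ => (v.1.1, v.1.2.1, v.2))).add
    ((by fun_prop : Continuous fun v : (ℝ × ℝ × ℝ) × ℝ => v.1.2.2).mul (V.continuous_sol.comp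
      (by fun_prop : Continuous fun v : (ℝ × ℝ × ℝ) × ℝ => (v.1.1, v.1.2.1, v.2))))
  -- positivity also holds slightly before `z.1`, which covers starting points before it
  have h0 : 0 < V.dsol z.1 z.2.1 z.1 + z.2.2 * V.sol z.1 z.2.1 z.1 := h z.1 le_rfl hs
  obtain ⟨δ, hδ, hball⟩ := Metric.eventually_nhds_iff.1 <|
    (V.continuous_cross z.1 z.2.1 z.2.2).tendsto z.1 |>.eventually_const_lt h0
  have hK : ∀ t ∈ Icc (z.1 - δ / 2) s, 0 < V.dsol z.1 z.2.1 t + z.2.2 * V.sol z.1 z.2.1 t := by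
    intro t ht
    rcases le_total z.1 t with h1 | h1
    · exact h t h1 ht.2
    · refine hball ?_
      rw [Real.dist_eq, abs_of_nonpos (by linarith)]
      linarith [ht.1]
  have hev := (isCompact_Icc (a := z.1 - δ / 2) (b := s)).eventually_forall_of_forall_eventually
    (x₀ := z) (P := fun w t => 0 < V.dsol w.1 w.2.1 t + w.2.2 * V.sol w.1 w.2.1 t)
    fun t ht => hc.tendsto (z, t) |>.eventually_const_lt (hK t ht)
  filter_upwards [hev, continuous_fst.tendsto z |>.eventually_const_lt (u := z.1 - δ / 2)
    (by linarith)] with w hw hwa b hb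
  by_contra hbs
  have := hw b ⟨(hwa.trans hb.lt).le, not_lt.1 hbs⟩
  rw [hb.dsol_eq] at this
  linarith

/-- The next crossing persists for nearby data. -/
theorem IsNext.eventually_exists {z : ℝ × ℝ × ℝ} (h : V.IsNext l z.1 z.2.1 z.2.2 b)
    {d : ℝ} (hd : b < d) : ∀ᶠ w in 𝓝 z, ∃ b' ≤ d, V.IsNext l w.1 w.2.1 w.2.2 b' := by
  obtain ⟨c, hbc, hcd, hcl, hneg⟩ : ∃ c, b < c ∧ c ≤ d ∧ (c : EReal) < l ∧
      V.dsol z.1 z.2.1 c + z.2.2 * V.sol z.1 z.2.1 c < 0 := by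
    obtain ⟨r, hr1, hr⟩ := EReal.lt_iff_exists_real_btwn.1 h.lt_end
    have hbr : b < r := EReal.coe_lt_coe_iff.1 hr1
    have hpos : ∀ᶠ t in 𝓝 b, 0 < V.sol z.1 z.2.1 t := (V.isSol_sol z.1 z.2.1).continuous.tendsto b
      |>.eventually_const_lt (h.sol_pos b (right_mem_Icc.2 h.lt.le))
    obtain ⟨δ, hδ, hball⟩ := Metric.eventually_nhds_iff.1 hpos
    set c := min (min r d) (b + δ / 2) with hc
    have hbc : b < c := lt_min (lt_min hbr hd) (by linarith)
    have hcb : c ≤ b + δ / 2 := min_le_right _ _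
    have hsol : ∀ t ∈ Icc z.1 c, 0 < V.sol z.1 z.2.1 t := by
      intro t ht
      rcases le_total t b with h1 | h1
      · exact h.sol_pos t ⟨ht.1, h1⟩
      · refine hball ?_
        rw [Real.dist_eq, abs_of_nonneg (by linarith)]
        linarith [ht.2]
    refine ⟨c, hbc, (min_le_left _ _).trans (min_le_right _ _),
      (EReal.coe_le_coe_iff.2 ((min_le_left _ _).trans (min_le_left _ _))).trans_lt hr, ?_⟩
    have := (V.isSol_sol z.1 z.2.1).log_deriv_lt V.pos hbc fun t ht =>
      hsol t ⟨h.lt.le.trans ht.1, ht.2⟩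
    rw [h.dsol_eq, neg_div, mul_div_cancel_right₀ _ (h.sol_pos b (right_mem_Icc.2 h.lt.le)).ne',
      div_lt_iff₀ (hsol c ⟨(h.lt.trans hbc).le, le_rfl⟩)] at this
    linarith
  have hpm := h.add_pos
  have hc : Continuous fun w : ℝ × ℝ × ℝ =>
      V.dsol w.1 w.2.1 c + w.2.2 * V.sol w.1 w.2.1 c :=
    (V.continuous_dsol.comp (by fun_prop :
      Continuous fun w : ℝ × ℝ × ℝ => (w.1, w.2.1, c))).add
    ((by fun_prop : Continuous fun w : ℝ × ℝ × ℝ => w.2.2).mul (V.continuous_sol.comp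
      (by fun_prop : Continuous fun w : ℝ × ℝ × ℝ => (w.1, w.2.1, c))))
  filter_upwards [hc.tendsto z |>.eventually_lt_const hneg,
    (continuous_fst.tendsto z).eventually_lt_const (h.lt.trans hbc),
    ((by fun_prop : Continuous fun w : ℝ × ℝ × ℝ => w.2.1 + w.2.2).tendsto z).eventually_const_lt
      hpm] with w hw hwa hwpm
  obtain ⟨b', hb', hn⟩ := exists_isNext hwpm hwa.le hcl hw.le
  exact ⟨b', hb'.trans hcd, hn⟩

/-- The next crossing is a smooth function of its data. -/
theorem IsNext.contDiffAt_nxt {z : ℝ × ℝ × ℝ} (h : V.IsNext l z.1 z.2.1 z.2.2 b) :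
    ContDiffAt ℝ ∞ (fun w : ℝ × ℝ × ℝ => V.nxt l w.1 w.2.1 w.2.2) z := by
  let f : (ℝ × ℝ × ℝ) × ℝ → ℝ := fun v =>
      V.dsol v.1.1 v.1.2.1 v.2 + v.1.2.2 * V.sol v.1.1 v.1.2.1 v.2
  have hf : ContDiff ℝ ∞ f :=
    (V.contDiff_dsol.comp (by fun_prop :
      ContDiff ℝ ∞ fun v : (ℝ × ℝ × ℝ) × ℝ => (v.1.1, v.1.2.1, v.2))).add
    ((by fun_prop : ContDiff ℝ ∞ fun v : (ℝ × ℝ × ℝ) × ℝ => v.1.2.2).mul (V.contDiff_sol.comp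
      (by fun_prop : ContDiff ℝ ∞ fun v : (ℝ × ℝ × ℝ) × ℝ => (v.1.1, v.1.2.1, v.2))))
  have hcd : ContDiffAt ℝ ∞ f (z, b) := hf.contDiffAt
  have hfzb : f (z, b) = 0 := by simp [f, h.dsol_eq]
  have hd : HasDerivAt (fun t => f (z, t)) (-(V.val b * V.sol z.1 z.2.1 b) +
      z.2.2 * V.dsol z.1 z.2.1 b) b :=
    ((V.isSol_sol z.1 z.2.1).hasDerivAt' b).add
      (((V.isSol_sol z.1 z.2.1).hasDerivAt b).const_mul z.2.2)
  have hne : -(V.val b * V.sol z.1 z.2.1 b) + z.2.2 * V.dsol z.1 z.2.1 b ≠ 0 := by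
    have hy := h.sol_pos b (right_mem_Icc.2 h.lt.le)
    rw [h.dsol_eq]
    have := mul_pos (V.pos b) hy
    nlinarith [mul_nonneg (sq_nonneg z.2.2) hy.le]
  -- the crossing is transversal, and the implicit function theorem applies
  have hinv : (fderiv ℝ f (z, b) ∘L .inr ℝ (ℝ × ℝ × ℝ) ℝ).IsInvertible := by
    have h1 : HasFDerivAt f (fderiv ℝ f (z, b)) (z, b) :=
      (hf.differentiable (by simp)).differentiableAt.hasFDerivAt
    have h2 : HasDerivAt (fun t => f (z, t)) ((fderiv ℝ f (z, b) ∘L .inr ℝ (ℝ × ℝ × ℝ) ℝ) 1) b := by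
      have hin : HasDerivAt (fun t : ℝ => (z, t)) ((0, 1) : (ℝ × ℝ × ℝ) × ℝ) b :=
        (hasDerivAt_const b z).prodMk (hasDerivAt_id b)
      exact HasFDerivAt.comp_hasDerivAt b h1 hin
    have h3 := h2.unique hd
    refine ⟨ContinuousLinearEquiv.unitsEquivAut ℝ (Units.mk0 _ hne), ?_⟩
    ext
    rw [h3]
    simp
  have hn0 : (∞ : WithTop ℕ∞) ≠ 0 := by simp
  -- the next crossing for nearby data stays close to `b`, so it is the implicit function
  refine (hcd.contDiffAt_implicitFunction hn0 hinv).congr_of_eventuallyEq ?_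
  obtain ⟨U, hU, W, hW, hUW⟩ := mem_nhds_prod_iff.1
    (hcd.eventually_apply_eq_iff_implicitFunction hn0 hinv)
  obtain ⟨ε, hε, hball⟩ := Metric.mem_nhds_iff.1 hW
  filter_upwards [hU, h.eventually_exists (d := b + ε / 2) (by linarith),
    eventually_lt_of_isNext (V := V) (l := l) (z := z) (s := b - ε / 2)
      fun t h1 h2 => h.cross_pos h1 (by linarith)] with w hw ⟨b', hb', hnx⟩ hgt
  have hb'' := hgt b' hnx
  have hmem : b' ∈ Metric.ball b ε := by
    rw [Metric.mem_ball, Real.dist_eq, abs_lt]; constructor <;> linarith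
  have hiff : f (w, b') = f (z, b) ↔ _ = b' := hUW (mk_mem_prod hw (hball hmem))
  rw [hnx.nxt_eq]
  exact (hiff.1 (by rw [hfzb]; simp [f, hnx.dsol_eq])).symm

end Potential

/-! ### Chains of crossings -/

namespace Potential

variable {V : Potential} {l : EReal} {P M P' M' T T' : ℕ → ℝ} {n : ℕ}

variable (V l) in
/-- The points `T 0, …, T n` are such that a positive solution on `[T j, T (j + 1)]` has logarithmic
derivatives `P j` and `-M (j + 1)` at the two ends. -/
def IsChain (P M T : ℕ → ℝ) (n : ℕ) : Prop :=
  ∀ j < n, V.IsNext l (T j) (P j) (M (j + 1)) (T (j + 1))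

variable (V l) in
/-- The chain starting at `0` determined by the logarithmic derivatives `P`, `M`. -/
def lat (P M : ℕ → ℝ) : ℕ → ℝ
  | 0 => 0
  | j + 1 => V.nxt l (lat P M j) (P j) (M (j + 1))

variable (V l) in
/-- The chain starting at `0` makes `n` steps. -/
def Reach (P M : ℕ → ℝ) (n : ℕ) : Prop := V.IsChain l P M (V.lat l P M) n

@[simp] theorem lat_zero : V.lat l P M 0 = 0 := rfl

theorem lat_succ (j : ℕ) : V.lat l P M (j + 1) = V.nxt l (V.lat l P M j) (P j) (M (j + 1)) := rfl

theorem IsChain.mono {k : ℕ} (h : V.IsChain l P M T n) (hk : k ≤ n) : V.IsChain l P M T k :=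
  fun j hj => h j (hj.trans_le hk)

theorem IsChain.lt {i j : ℕ} (h : V.IsChain l P M T n) (hij : i < j) (hj : j ≤ n) : T i < T j := by
  induction j with
  | zero => omega
  | succ j ih =>
    have := (h j (by omega)).lt
    rcases Nat.lt_succ_iff_lt_or_eq.1 hij with h1 | rfl
    · exact (ih h1 (by omega)).trans this
    · exact this

theorem IsChain.le {i j : ℕ} (h : V.IsChain l P M T n) (hij : i ≤ j) (hj : j ≤ n) : T i ≤ T j := by
  rcases hij.eq_or_lt with rfl | h1
  · exact le_rfl
  · exact (h.lt h1 hj).le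

theorem IsChain.lt_end {j : ℕ} (h : V.IsChain l P M T n) (hj : j ≤ n) (h0 : (T 0 : EReal) < l) :
    (T j : EReal) < l := by
  cases j with
  | zero => exact h0
  | succ j => exact (h j (by omega)).lt_end

theorem IsChain.eq_lat (h : V.IsChain l P M T n) (h0 : T 0 = 0) :
    ∀ j ≤ n, T j = V.lat l P M j := by
  intro j
  induction j with
  | zero => intro _; exact h0
  | succ j ih =>
    intro hj
    rw [lat_succ, ← ih (by omega), (h j (by omega)).nxt_eq]

theorem IsChain.reach (h : V.IsChain l P M T n) (h0 : T 0 = 0) : V.Reach l P M n := by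
  intro j hj
  rw [← h.eq_lat h0 j hj.le, ← h.eq_lat h0 (j + 1) hj]
  exact h j hj

theorem reach_zero : V.Reach l P M 0 := fun _ h => absurd h (Nat.not_lt_zero _)

theorem reach_succ : V.Reach l P M (n + 1) ↔
    V.Reach l P M n ∧ ∃ b, V.IsNext l (V.lat l P M n) (P n) (M (n + 1)) b := by
  constructor
  · intro h
    exact ⟨h.mono n.le_succ, _, h n n.lt_succ_self⟩
  · rintro ⟨h, b, hb⟩ j hj
    rcases Nat.lt_succ_iff_lt_or_eq.1 hj with h1 | rfl
    · exact h j h1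
    · rw [lat_succ]; exact hb.isNext_nxt

theorem lat_congr (hP : ∀ j < n, P j = P' j) (hM : ∀ j < n, M (j + 1) = M' (j + 1)) :
    ∀ j ≤ n, V.lat l P M j = V.lat l P' M' j := by
  intro j
  induction j with
  | zero => intro _; rfl
  | succ j ih => intro hj; rw [lat_succ, lat_succ, ih (by omega), hP j hj, hM j hj]

theorem reach_congr (hP : ∀ j < n, P j = P' j) (hM : ∀ j < n, M (j + 1) = M' (j + 1)) :
    V.Reach l P M n ↔ V.Reach l P' M' n := by
  refine forall₂_congr fun j hj => ?_
  rw [lat_congr hP hM j hj.le, lat_congr hP hM (j + 1) hj, hP j hj, hM j hj]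

/-- Comparison of chains: smaller logarithmic derivatives make the crossings come earlier. -/
theorem IsChain.comparison (h : V.IsChain l P' M' T' n) (h0 : 0 ≤ T' 0)
    (hP : ∀ j < n, P j ≤ P' j) (hM : ∀ j < n, M (j + 1) ≤ M' (j + 1))
    (hpos : ∀ j < n, 0 < P j + M (j + 1)) :
    V.Reach l P M n ∧ ∀ j ≤ n, V.lat l P M j ≤ T' j := by
  induction n with
  | zero => exact ⟨reach_zero, fun j hj => by rw [Nat.le_zero.1 hj]; exact h0⟩
  | succ n ih =>
    obtain ⟨h1, h2⟩ := ih (h.mono n.le_succ) (fun j hj => hP j (hj.trans n.lt_succ_self))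
      (fun j hj => hM j (hj.trans n.lt_succ_self)) (fun j hj => hpos j (hj.trans n.lt_succ_self))
    obtain ⟨b, hb, hn, -⟩ := (h n n.lt_succ_self).comparison (h2 n le_rfl) (hP n n.lt_succ_self)
      (hM n n.lt_succ_self) (hpos n n.lt_succ_self)
    refine ⟨reach_succ.2 ⟨h1, b, hn⟩, fun j hj => ?_⟩
    rcases Nat.le_succ_iff.1 hj with h3 | rfl
    · exact h2 j h3
    · rw [lat_succ, hn.nxt_eq]; exact hb

/-- The comparison is strict at the end of a step whose data differ. -/
theorem IsChain.lat_lt (h : V.IsChain l P' M' T' n) (h0 : 0 ≤ T' 0)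
    (hP : ∀ j < n, P j ≤ P' j) (hM : ∀ j < n, M (j + 1) ≤ M' (j + 1))
    (hpos : ∀ j < n, 0 < P j + M (j + 1)) {j : ℕ} (hj : j < n)
    (hlt : P j < P' j ∨ M (j + 1) < M' (j + 1)) : V.lat l P M (j + 1) < T' (j + 1) := by
  obtain ⟨b, -, hn, hb⟩ := (h j hj).comparison ((h.comparison h0 hP hM hpos).2 j hj.le) (hP j hj)
    (hM j hj) (hpos j hj)
  rw [lat_succ, hn.nxt_eq]
  exact hb (Or.inr hlt)

section Parameters

variable {X : Type*} [TopologicalSpace X] {P M : X → ℕ → ℝ} {x₀ : X}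

/-- The latitudes of a chain depend continuously on the parameters, and the number of steps does not
drop. -/
theorem continuousAt_lat (hP : ∀ j, ContinuousAt (fun x => P x j) x₀)
    (hM : ∀ j, ContinuousAt (fun x => M x j) x₀) (h : V.Reach l (P x₀) (M x₀) n) :
    (∀ᶠ x in 𝓝 x₀, V.Reach l (P x) (M x) n) ∧
      ∀ j ≤ n, ContinuousAt (fun x => V.lat l (P x) (M x) j) x₀ := by
  induction n with
  | zero => exact ⟨Eventually.of_forall fun _ => reach_zero, fun j hj => by
      rw [Nat.le_zero.1 hj]; exact continuousAt_const⟩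
  | succ n ih =>
    obtain ⟨h1, h2⟩ := ih (h.mono n.le_succ)
    have hc : ContinuousAt (fun x => (V.lat l (P x) (M x) n, P x n, M x (n + 1))) x₀ :=
      (h2 n le_rfl).prodMk ((hP n).prodMk (hM (n + 1)))
    have hn := h n n.lt_succ_self
    constructor
    · filter_upwards [h1, hc.eventually (hn.eventually_exists (z := (V.lat l (P x₀) (M x₀) n, P x₀ n,
        M x₀ (n + 1))) (lt_add_one _))] with x hx ⟨b, _, hb⟩
      exact reach_succ.2 ⟨hx, b, hb⟩
    · intro j hj
      rcases Nat.le_succ_iff.1 hj with h3 | rfl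
      · exact h2 j h3
      · exact (hn.contDiffAt_nxt (z := (V.lat l (P x₀) (M x₀) n, P x₀ n,
          M x₀ (n + 1)))).continuousAt.tendsto.comp hc.tendsto

/-- If the chain stops after `n` steps, then for nearby parameters any further step goes beyond
every given latitude. -/
theorem eventually_lt_lat (hP : ∀ j, ContinuousAt (fun x => P x j) x₀)
    (hM : ∀ j, ContinuousAt (fun x => M x j) x₀) (h : V.Reach l (P x₀) (M x₀) n)
    (h' : ¬ V.Reach l (P x₀) (M x₀) (n + 1)) (hpos : 0 < P x₀ n + M x₀ (n + 1))
    {s : ℝ} (hs : (s : EReal) < l) :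
    ∀ᶠ x in 𝓝 x₀, ∀ b, V.IsNext l (V.lat l (P x) (M x) n) (P x n) (M x (n + 1)) b → s < b := by
  have hc : ContinuousAt (fun x => (V.lat l (P x) (M x) n, P x n, M x (n + 1))) x₀ :=
    ((continuousAt_lat hP hM h).2 n le_rfl).prodMk ((hP n).prodMk (hM (n + 1)))
  refine hc.eventually (eventually_lt_of_isNext (V := V) (l := l)
    (z := (V.lat l (P x₀) (M x₀) n, P x₀ n, M x₀ (n + 1))) fun t h1 h2 => ?_)
  exact (cross_pos_of_not_exists (l := l) hpos (fun b hb => h' (reach_succ.2 ⟨h, b, hb⟩)) h1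
    ((EReal.coe_le_coe_iff.2 h2).trans_lt hs)).1

end Parameters

theorem contDiffAt_lat {P M : ℝ → ℕ → ℝ} {x₀ : ℝ} (hP : ∀ j, ContDiffAt ℝ ∞ (fun x => P x j) x₀)
    (hM : ∀ j, ContDiffAt ℝ ∞ (fun x => M x j) x₀) (h : V.Reach l (P x₀) (M x₀) n) :
    ∀ j ≤ n, ContDiffAt ℝ ∞ (fun x => V.lat l (P x) (M x) j) x₀ := by
  intro j
  induction j with
  | zero => intro _; exact contDiffAt_const
  | succ j ih =>
    intro hj
    exact ContDiffAt.comp x₀ (g := fun w : ℝ × ℝ × ℝ => V.nxt l w.1 w.2.1 w.2.2)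
      ((h j hj).contDiffAt_nxt (z := (V.lat l (P x₀) (M x₀) j, P x₀ j, M x₀ (j + 1))))
      ((ih (by omega)).prodMk ((hP j).prodMk (hM (j + 1))))

/-- Small data lead to a crossing after a short time, since the solution with data `(1, 0)` is
strictly concave. -/
theorem exists_isNext_of_small {a c : ℝ} (hac : a < c) (hc : (c : EReal) < l) :
    ∃ δ > 0, ∃ b ≤ c, V.IsNext l a δ δ b := by
  obtain ⟨d, had, hdc, hd⟩ : ∃ d, a < d ∧ d < c ∧ V.dsol a 0 d < 0 := by
    have hpos : ∀ᶠ t in 𝓝 a, 0 < V.sol a 0 t :=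
      (V.isSol_sol a 0).continuous.tendsto a |>.eventually_const_lt (by simp)
    obtain ⟨δ, hδ, hball⟩ := Metric.eventually_nhds_iff.1 hpos
    have had : a < min ((a + c) / 2) (a + δ / 2) := lt_min (by linarith) (by linarith)
    have hle := min_le_right ((a + c) / 2) (a + δ / 2)
    refine ⟨min ((a + c) / 2) (a + δ / 2), had, (min_le_left _ _).trans_lt (by linarith), ?_⟩
    have := deriv_antitone (V.isSol_sol a 0) (a := a) (b := min ((a + c) / 2) (a + δ / 2))
      (fun t ht => hball (by rw [Real.dist_eq, abs_of_pos (by linarith [ht.1])]; linarith [ht.2]))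
      (left_mem_Icc.2 had.le) (right_mem_Icc.2 had.le) had
    rwa [V.dsol_self] at this
  have hcont : Continuous fun δ : ℝ => V.dsol a δ d + δ * V.sol a δ d :=
    (V.continuous_dsol.comp (by fun_prop : Continuous fun δ : ℝ => (a, δ, d))).add
      (continuous_id.mul (V.continuous_sol.comp (by fun_prop : Continuous fun δ : ℝ => (a, δ, d))))
  have hev := (hcont.tendsto 0).eventually_lt_const (u := 0) (by simpa using hd)
  obtain ⟨ε, hε, hball⟩ := Metric.eventually_nhds_iff.1 hev
  have := hball (y := ε / 2) (by rw [Real.dist_eq, sub_zero, abs_of_pos (by linarith)]; linarith)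
  obtain ⟨b, hb, hn⟩ := exists_isNext (V := V) (l := l) (a := a) (p := ε / 2) (m := ε / 2)
    (by linarith) had.le ((EReal.coe_lt_coe_iff.2 hdc).trans hc) this.le
  exact ⟨ε / 2, by linarith, b, hb.trans hdc.le, hn⟩

/-- Chains with small logarithmic derivatives make any given number of steps. -/
theorem exists_reach_of_le (V : Potential) (hl : 0 < l) (n : ℕ) : ∃ δ > 0, ∀ P M : ℕ → ℝ,
    (∀ j < n, P j ≤ δ) → (∀ j < n, M (j + 1) ≤ δ) → (∀ j < n, 0 < P j + M (j + 1)) →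
    V.Reach l P M n := by
  obtain ⟨τ, hτ0, hτ⟩ := EReal.lt_iff_exists_real_btwn.1 hl
  have hτ0 : 0 < τ := EReal.coe_lt_coe_iff.1 hτ0
  -- the `j`-th latitude stays below `τ - τ / (j + 1)`
  let c : ℕ → ℝ := fun j => τ - τ / (j + 1)
  have hc : ∀ j, c j < c (j + 1) := fun j => by
    have : τ / ((j + 1 : ℕ) + 1 : ℝ) < τ / (j + 1) :=
      div_lt_div_of_pos_left hτ0 (by positivity) (by push_cast; linarith)
    simp only [c]; linarith
  have hcl : ∀ j, (c j : EReal) < l := fun j => by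
    have : 0 < τ / ((j : ℝ) + 1) := by positivity
    exact (EReal.coe_lt_coe_iff.2 (by simp only [c]; linarith)).trans hτ
  choose δ hδ b hb hn using fun j => exists_isNext_of_small (V := V) (hc j) (hcl (j + 1))
  obtain ⟨δ₀, hδ₀, hle⟩ : ∃ δ₀ > 0, ∀ j < n, δ₀ ≤ δ j := by
    clear hb hn
    induction n with
    | zero => exact ⟨1, one_pos, fun j hj => absurd hj (Nat.not_lt_zero _)⟩
    | succ n ih =>
      obtain ⟨δ₀, h1, h2⟩ := ih
      refine ⟨min δ₀ (δ n), lt_min h1 (hδ n), fun j hj => ?_⟩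
      rcases Nat.lt_succ_iff_lt_or_eq.1 hj with h | rfl
      · exact (min_le_left _ _).trans (h2 j h)
      · exact min_le_right _ _
  refine ⟨δ₀, hδ₀, fun P M hP hM hpos => ?_⟩
  suffices h : ∀ k ≤ n, V.Reach l P M k ∧ V.lat l P M k ≤ c k from (h n le_rfl).1
  intro k
  induction k with
  | zero => intro _; exact ⟨reach_zero, by simp [c]⟩
  | succ k ih =>
    intro hk
    obtain ⟨h1, h2⟩ := ih (by omega)
    obtain ⟨d, hd, hnd, -⟩ := (hn k).comparison h2 ((hP k hk).trans (hle k hk))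
      ((hM k hk).trans (hle k hk)) (hpos k hk)
    exact ⟨reach_succ.2 ⟨h1, d, hnd⟩, by rw [lat_succ, hnd.nxt_eq]; exact hd.trans (hb k)⟩

/-- A chain whose initial logarithmic derivatives are bounded below by a positive constant stops. -/
theorem exists_not_reach {e e' : ℝ → ℝ} (he : V.IsEnd l e e') {q : ℝ} (hq : 0 < q)
    (hP : ∀ j, 1 ≤ j → q ≤ P j) (hM : ∀ j, 1 ≤ j → 0 ≤ M j) : ∃ n, ¬ V.Reach l P M n := by
  by_contra! hall
  set T := V.lat l P M with hT
  have hnx : ∀ j, V.IsNext l (T j) (P j) (M (j + 1)) (T (j + 1)) := fun j =>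
    hall (j + 1) j j.lt_succ_self
  -- the points of an infinite chain accumulate at some `τ ≤ l`, where there is an end solution,
  -- namely the one with data `(1, 0)` if `τ` is finite; close to `τ` there is no room for a step
  obtain ⟨τ, hτ⟩ : ∃ τ : EReal, τ = ⨆ j, (T j : EReal) := ⟨_, rfl⟩
  have hTτ : ∀ j, (T j : EReal) < τ := fun j =>
    (EReal.coe_lt_coe_iff.2 (hnx j).lt).trans_le (hτ ▸ le_iSup (fun j => (T j : EReal)) (j + 1))
  have hτ0 : 0 < τ := hTτ 0
  have hτl : τ ≤ l := hτ ▸ iSup_le fun j =>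
    ((EReal.coe_lt_coe_iff.2 (hnx j).lt).trans (hnx j).lt_end).le
  obtain ⟨w, w', he'⟩ : ∃ w w', V.IsEnd τ w w' := by
    by_cases hτt : τ = ⊤
    · rw [hτt] at hτl ⊢
      rw [top_le_iff.1 hτl] at he
      exact ⟨e, e', he⟩
    · lift τ to ℝ using ⟨hτt, (bot_lt_iff_ne_bot.1 (bot_le.trans_lt hτ0))⟩
      exact ⟨_, _, V.isEnd_coe τ⟩
  obtain ⟨s, hs, h⟩ := he'.exists_dsol_pos hτ0 hq
  obtain ⟨j, hj⟩ := lt_iSup_iff.1 (hτ ▸ hs)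
  have hsj : s ≤ T (j + 1) := (EReal.coe_lt_coe_iff.1 hj).le.trans (hnx j).lt.le
  have h1 := h (T (j + 1)) (P (j + 1)) hsj (hP _ (by omega)) (T (j + 2)) (hnx (j + 1)).lt.le
    (hTτ (j + 2))
  rw [(hnx (j + 1)).dsol_eq] at h1
  have := mul_nonneg (hM (j + 2) (by omega))
    ((hnx (j + 1)).sol_pos _ (right_mem_Icc.2 (hnx (j + 1)).lt.le)).le
  linarith

end Potential

/-! ### Chains with proportional data and their thresholds -/

/-- The logarithmic derivatives of a chain up to a common positive factor `F`: the pieces of the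
chain start with `F * p j` and end with `-(F * m (j + 1))`. -/
structure Ratios where
  /-- initial logarithmic derivatives -/
  p : ℕ → ℝ
  /-- final logarithmic derivatives, up to sign -/
  m : ℕ → ℝ
  p_nonneg : 0 ≤ p 0
  p_pos : ∀ j, 1 ≤ j → 0 < p j
  m_nonneg : ∀ j, 1 ≤ j → 0 ≤ m j
  add_pos : ∀ j, 0 < p j + m (j + 1)

namespace Ratios

variable (c : Ratios)

theorem p_nonneg' (j : ℕ) : 0 ≤ c.p j := by
  rcases Nat.eq_zero_or_pos j with rfl | h
  · exact c.p_nonneg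
  · exact (c.p_pos j h).le

/-- The logarithmic derivatives `p` multiplied by `F`. -/
def P (F : ℝ) (j : ℕ) : ℝ := F * c.p j

/-- The logarithmic derivatives `m` multiplied by `F`. -/
def M (F : ℝ) (j : ℕ) : ℝ := F * c.m j

theorem add_pos' {F : ℝ} (hF : 0 < F) (j : ℕ) : 0 < c.P F j + c.M F (j + 1) := by
  rw [P, M, ← mul_add]; exact mul_pos hF (c.add_pos j)

theorem contDiff_P (j : ℕ) : ContDiff ℝ ∞ fun F => c.P F j := by unfold P; fun_prop

theorem contDiff_M (j : ℕ) : ContDiff ℝ ∞ fun F => c.M F j := by unfold M; fun_prop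

/-- Replace the last final logarithmic derivative by `0`. -/
def flat (n : ℕ) (hn : 0 < c.p n) : Ratios where
  p := c.p
  m := Function.update c.m (n + 1) 0
  p_nonneg := c.p_nonneg
  p_pos := c.p_pos
  m_nonneg j hj := by
    rcases eq_or_ne j (n + 1) with rfl | h
    · simp
    · rw [Function.update_of_ne h]; exact c.m_nonneg j hj
  add_pos j := by
    rcases eq_or_ne j n with rfl | h
    · simpa using hn
    · rw [Function.update_of_ne (by omega)]; exact c.add_pos j

end Ratios

namespace Potential

variable {V : Potential} {l : EReal} {c c' : Ratios} {n : ℕ} {F F' : ℝ}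

variable (V l) in
/-- The latitudes of the chain with logarithmic derivatives `F * c`. -/
def ratioLat (c : Ratios) (F : ℝ) : ℕ → ℝ := V.lat l (c.P F) (c.M F)

variable (V l) in
/-- The chain with logarithmic derivatives `F * c` makes `n` steps. -/
def RatioReach (c : Ratios) (F : ℝ) (n : ℕ) : Prop := V.Reach l (c.P F) (c.M F) n

/-- Decreasing `F` makes the latitudes smaller. -/
theorem RatioReach.of_le (h : V.RatioReach l c F' n) (hF : 0 < F) (hle : F ≤ F') :
    V.RatioReach l c F n ∧ ∀ j ≤ n, V.ratioLat l c F j ≤ V.ratioLat l c F' j :=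
  IsChain.comparison h le_rfl
    (fun j _ => mul_le_mul_of_nonneg_right hle (c.p_nonneg' j))
    (fun j _ => mul_le_mul_of_nonneg_right hle (c.m_nonneg _ (by omega)))
    (fun j _ => c.add_pos' hF j)

/-- The latitudes are strictly increasing in `F`. -/
theorem RatioReach.lat_lt (h : V.RatioReach l c F' n) (hF : 0 < F) (hlt : F < F') {j : ℕ}
    (hj : j < n) : V.ratioLat l c F (j + 1) < V.ratioLat l c F' (j + 1) := by
  refine IsChain.lat_lt h le_rfl
    (fun j _ => mul_le_mul_of_nonneg_right hlt.le (c.p_nonneg' j))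
    (fun j _ => mul_le_mul_of_nonneg_right hlt.le (c.m_nonneg _ (by omega)))
    (fun j _ => c.add_pos' hF j) hj ?_
  rcases (c.p_nonneg' j).lt_or_eq with h0 | h0
  · exact Or.inl (mul_lt_mul_of_pos_right hlt h0)
  · exact Or.inr (mul_lt_mul_of_pos_right hlt (by linarith [c.add_pos j]))

theorem continuousAt_ratioLat (h : V.RatioReach l c F n) :
    (∀ᶠ x in 𝓝 F, V.RatioReach l c x n) ∧
      ∀ j ≤ n, ContinuousAt (fun x => V.ratioLat l c x j) F :=
  continuousAt_lat (fun j => (c.contDiff_P j).continuous.continuousAt)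
    (fun j => (c.contDiff_M j).continuous.continuousAt) h

theorem contDiffAt_ratioLat (h : V.RatioReach l c F n) :
    ∀ j ≤ n, ContDiffAt ℝ ∞ (fun x => V.ratioLat l c x j) F :=
  contDiffAt_lat (fun j => (c.contDiff_P j).contDiffAt) (fun j => (c.contDiff_M j).contDiffAt) h

/-- For small `F` the chain makes any given number of steps. -/
theorem exists_ratioReach (V : Potential) (hl : 0 < l) (c : Ratios) (n : ℕ) :
    ∃ F > 0, V.RatioReach l c F n := by
  obtain ⟨δ, hδ, h⟩ := V.exists_reach_of_le hl n
  have hP : ∀ᶠ F in 𝓝 (0 : ℝ), ∀ j ∈ Finset.range n, c.P F j < δ ∧ c.M F (j + 1) < δ := by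
    rw [eventually_all_finset]
    intro j _
    refine (((c.contDiff_P j).continuous.tendsto 0).eventually_lt_const ?_).and
      (((c.contDiff_M (j + 1)).continuous.tendsto 0).eventually_lt_const ?_)
    · simpa [Ratios.P] using hδ
    · simpa [Ratios.M] using hδ
  obtain ⟨F, hF0, hF⟩ := ((hP.filter_mono nhdsWithin_le_nhds : ∀ᶠ F in 𝓝[>] (0 : ℝ), _).and
    self_mem_nhdsWithin).exists
  exact ⟨F, hF, h _ _ (fun j hj => (hF0 j (Finset.mem_range.2 hj)).1.le)
    (fun j hj => (hF0 j (Finset.mem_range.2 hj)).2.le) fun j _ => c.add_pos' hF j⟩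

section HasEnd

variable {e e' : ℝ → ℝ}

theorem exists_not_ratioReach (he : V.IsEnd l e e') (hF : 0 < F) {q : ℝ} (hq : 0 < q)
    (hc : ∀ j, 1 ≤ j → q ≤ c.p j) : ∃ n, ¬ V.RatioReach l c F n :=
  exists_not_reach he (mul_pos hF hq) (fun j hj => mul_le_mul_of_nonneg_left (hc j hj) hF.le)
    fun j hj => mul_nonneg hF.le (c.m_nonneg j hj)

/-- Where the chain stops, nearby chains make at most one more step: that step ends so close to `l`
that the next solution is increasing. -/
theorem eventually_not_ratioReach (he : V.IsEnd l e e') (hl : 0 < l) (hF : 0 < F)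
    (h : ¬ V.RatioReach l c F (n + 1)) : ∀ᶠ x in 𝓝 F, ¬ V.RatioReach l c x (n + 2) := by
  obtain ⟨j, hjn, hj, hj'⟩ : ∃ j ≤ n, V.RatioReach l c F j ∧ ¬ V.RatioReach l c F (j + 1) := by
    by_contra! hno
    refine h ?_
    have : ∀ j ≤ n + 1, V.RatioReach l c F j := by
      intro j
      induction j with
      | zero => exact fun _ => reach_zero
      | succ j ih => exact fun hj => hno j (by omega) (ih (by omega))
    exact this _ le_rfl
  have hq : 0 < F / 2 * c.p (j + 1) := mul_pos (by linarith) (c.p_pos _ (by omega))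
  obtain ⟨s, hs, hpos⟩ := he.exists_dsol_pos hl hq
  have hev := eventually_lt_lat (V := V) (l := l) (P := c.P) (M := c.M)
    (fun j => (c.contDiff_P j).continuous.continuousAt)
    (fun j => (c.contDiff_M j).continuous.continuousAt) hj hj' (c.add_pos' hF j) hs
  filter_upwards [hev, lt_mem_nhds (show F / 2 < F by linarith)] with x hx hxF hreach
  have h1 := hreach j (by omega)
  have h2 := hreach (j + 1) (by omega)
  have h3 := hpos _ _ (hx _ h1).le
    (mul_le_mul_of_nonneg_right hxF.le (c.p_nonneg' (j + 1))) _ h2.lt.le h2.lt_end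
  have h4 := h2.dsol_eq
  rw [Ratios.P] at h4
  rw [h4] at h3
  have := mul_nonneg (mul_nonneg (by linarith : 0 ≤ x) (c.m_nonneg (j + 2) (by omega)))
    (h2.sol_pos _ (right_mem_Icc.2 h2.lt.le)).le
  simp only [Ratios.M, Ratios.P] at this h3
  linarith

end HasEnd

variable (V l) in
/-- The number of steps the chain with logarithmic derivatives `F * c` makes. -/
def steps (c : Ratios) (F : ℝ) : ℕ := sInf {n | ¬ V.RatioReach l c F (n + 1)}

theorem ratioReach_iff_le_steps (h : ∃ n, ¬ V.RatioReach l c F n) :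
    V.RatioReach l c F n ↔ n ≤ V.steps l c F := by
  have hne : {n | ¬ V.RatioReach l c F (n + 1)}.Nonempty := by
    obtain ⟨n, hn⟩ := h
    exact ⟨n, fun h => hn (h.mono n.le_succ)⟩
  constructor
  · intro h
    by_contra hlt
    exact Nat.sInf_mem hne (IsChain.mono h (by rw [steps] at hlt; omega))
  · intro hle
    cases n with
    | zero => exact reach_zero
    | succ n =>
      by_contra hn
      have := Nat.sInf_le (s := {n | ¬ V.RatioReach l c F (n + 1)}) hn
      rw [steps] at hle
      omega

variable (V l) in
/-- The supremum of the `F > 0` for which the chain makes `n` steps. -/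
def threshold (c : Ratios) (n : ℕ) : EReal :=
  sSup ((fun F : ℝ => (F : EReal)) '' {F | 0 < F ∧ V.RatioReach l c F n})

/-- The set of the `F` for which the chain makes `n` steps is an interval, open by continuous
dependence. -/
theorem ratioReach_iff_lt_threshold (hF : 0 < F) :
    V.RatioReach l c F n ↔ (F : EReal) < V.threshold l c n := by
  constructor
  · intro h
    obtain ⟨x, hx, hFx⟩ := (((continuousAt_ratioLat h).1.filter_mono nhdsWithin_le_nhds :
      ∀ᶠ x in 𝓝[>] F, _).and self_mem_nhdsWithin).exists
    exact (EReal.coe_lt_coe_iff.2 hFx).trans_le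
      (le_sSup (mem_image_of_mem _ ⟨hF.trans hFx, hx⟩))
  · intro h
    obtain ⟨_, ⟨x, hx, rfl⟩, hFx⟩ := lt_sSup_iff.1 h
    exact (hx.2.of_le hF (EReal.coe_lt_coe_iff.1 hFx).le).1

theorem threshold_pos (hl : 0 < l) : 0 < V.threshold l c n := by
  obtain ⟨F, hF, h⟩ := V.exists_ratioReach hl c n
  exact (EReal.coe_lt_coe_iff.2 hF).trans ((ratioReach_iff_lt_threshold hF).1 h)

theorem threshold_antitone {n' : ℕ} (h : n ≤ n') : V.threshold l c n' ≤ V.threshold l c n :=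
  sSup_le_sSup (image_mono fun _ hF => ⟨hF.1, hF.2.mono h⟩)

/-- A finite threshold is larger than the next one, since near the threshold for `n + 1` steps no
chain makes `n + 2` steps. -/
theorem threshold_succ_lt {e e' : ℝ → ℝ} (he : V.IsEnd l e e') (hl : 0 < l)
    (h : V.threshold l c (n + 1) ≠ ⊤) : V.threshold l c (n + 2) < V.threshold l c (n + 1) := by
  have h0 := threshold_pos (V := V) (c := c) (n := n + 1) hl
  obtain ⟨F, hF⟩ : ∃ F : ℝ, (F : EReal) = V.threshold l c (n + 1) :=
    ⟨_, EReal.coe_toReal h h0.ne_bot⟩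
  have hF0 : 0 < F := EReal.coe_lt_coe_iff.1 (hF ▸ h0)
  have hn : ¬ V.RatioReach l c F (n + 1) := fun hr =>
    absurd ((ratioReach_iff_lt_threshold hF0).1 hr) (by rw [hF]; exact lt_irrefl _)
  obtain ⟨x, hx, hxF⟩ := (((eventually_not_ratioReach he hl hF0 hn).filter_mono
    nhdsWithin_le_nhds : ∀ᶠ x in 𝓝[<] F, _).and (Ioo_mem_nhdsLT hF0)).exists
  rw [ratioReach_iff_lt_threshold hxF.1, not_lt] at hx
  exact hx.trans_lt (hF ▸ EReal.coe_lt_coe_iff.2 hxF.2)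

/-- Whether a chain starting with logarithmic derivative `0` makes `n` steps for all `F` does not
depend on the ratios. -/
theorem threshold_eq_top (hc : c.p 0 = 0) (hc' : c'.p 0 = 0)
    (hm' : ∀ j, 1 ≤ j → 0 < c'.m j) (h : V.threshold l c' n = ⊤) : V.threshold l c n = ⊤ := by
  have hall : ∀ F, 0 < F → V.RatioReach l c' F n := fun F hF =>
    (ratioReach_iff_lt_threshold hF).2 (h ▸ EReal.coe_lt_top F)
  have hall' : ∀ F, 0 < F → V.RatioReach l c F n := by
    intro F hF
    -- the chain with ratios `c` is dominated by that with ratios `c'` and a large factor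
    have hlarge : ∀ᶠ x in atTop, ∀ j ∈ Finset.range n, c.P F j ≤ c'.P x j ∧
        c.M F (j + 1) ≤ c'.M x (j + 1) := by
      rw [eventually_all_finset]
      intro j _
      refine Eventually.and ?_ ((tendsto_id.atTop_mul_const
        (hm' (j + 1) (by omega))).eventually_ge_atTop _)
      rcases Nat.eq_zero_or_pos j with rfl | h
      · simp [Ratios.P, hc, hc']
      · exact (tendsto_id.atTop_mul_const (c'.p_pos j h)).eventually_ge_atTop _
    obtain ⟨x, hx, hx0⟩ := (hlarge.and (eventually_gt_atTop 0)).exists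
    exact (IsChain.comparison (hall x hx0) le_rfl (fun j hj => (hx j (Finset.mem_range.2 hj)).1)
      (fun j hj => (hx j (Finset.mem_range.2 hj)).2) fun j _ => c.add_pos' hF j).1
  refine (EReal.eq_top_iff_forall_lt _).2 fun y => ?_
  have hy : 0 < max y 1 := by positivity
  exact (EReal.coe_le_coe_iff.2 (le_max_left y 1)).trans_lt
    ((ratioReach_iff_lt_threshold hy).1 (hall' _ hy))

end Potential

/-! ### Chains ending on the end solution -/

/-- The ratios `p = (0, 1, 1, …)`, `m = (1, 1, …)`. -/
def Ratios.balanced : Ratios where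
  p j := if j = 0 then 0 else 1
  m _ := 1
  p_nonneg := by simp
  p_pos j hj := by simp [show j ≠ 0 by omega]
  m_nonneg _ _ := zero_le_one
  add_pos j := by split_ifs <;> norm_num

namespace Potential

variable {V : Potential} {l : EReal} {c : Ratios} {n : ℕ} {F F' : ℝ} {e e' : ℝ → ℝ}

/-- The thresholds are strictly decreasing from some index on, which does not depend on the
ratios, and before which they are constant. -/
theorem exists_threshold_strictAnti (he : V.IsEnd l e e') (hl : 0 < l) :
    ∃ κ : ℕ, ∀ c : Ratios, c.p 0 = 0 → (∀ j, 1 ≤ j → 0 < c.m j) →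
      V.threshold l c (κ + 1) = V.threshold l c 1 ∧
      StrictAntiOn (fun k => V.threshold l c (k + 1)) (Ici κ) := by
  classical
  have hex : ∃ k, V.threshold l Ratios.balanced (k + 2) ≠ ⊤ := by
    obtain ⟨n, hn⟩ := exists_not_ratioReach (c := Ratios.balanced) he one_pos one_pos
      fun j hj => by simp [Ratios.balanced, show j ≠ 0 by omega]
    refine ⟨n, fun h => hn ?_⟩
    exact ((ratioReach_iff_lt_threshold one_pos).2 (h ▸ EReal.coe_lt_top 1)).mono (by omega)
  -- finiteness of a threshold does not depend on the ratios, so balanced ones determine the index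
  refine ⟨Nat.find hex, fun c hc hm => ?_⟩
  have hfind := Nat.find_spec hex
  have hbal : Ratios.balanced.p 0 = 0 := by simp [Ratios.balanced]
  have hlow : ∀ n, V.threshold l c n = ⊤ ↔ V.threshold l Ratios.balanced n = ⊤ := fun n =>
    ⟨threshold_eq_top hbal hc hm, threshold_eq_top hc hbal fun j _ => one_pos⟩
  constructor
  · rcases h : Nat.find hex with _ | k
    · rfl
    · have hk : V.threshold l Ratios.balanced (k + 2) = ⊤ := by
        by_contra hk
        exact Nat.find_min hex (m := k) (by omega) hk
      have h1 := (hlow _).2 hk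
      have h2 : V.threshold l c (k + 2) ≤ V.threshold l c 1 := threshold_antitone (by omega)
      rw [h1] at h2
      rw [show k + 1 + 1 = k + 2 from rfl, h1, top_le_iff.1 h2]
  · refine strictAntiOn_of_succ_lt ordConnected_Ici fun k _ hk _ => ?_
    by_cases ht : V.threshold l c (k + 1) = ⊤
    · change V.threshold l c (k + 2) < V.threshold l c (k + 1)
      rw [ht, lt_top_iff_ne_top]
      intro h
      exact hfind ((hlow _).1 (top_le_iff.1 (h.ge.trans
        (threshold_antitone (by have := mem_Ici.1 hk; omega)))))
    · exact threshold_succ_lt he hl ht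

/-- Near the end, the end solution is positive and increasing. -/
theorem IsEnd.eventually_pos (he : V.IsEnd l e e') (hl : 0 < l) :
    ∃ s : ℝ, (s : EReal) < l ∧ ∀ t : ℝ, s < t → (t : EReal) < l → 0 < e t ∧ 0 < e' t := by
  obtain ⟨s, hs, h⟩ := (mem_endFilter hl).1
    (he.tendsto.eventually_const_lt (show (0 : ℝ) < 1 by norm_num))
  exact ⟨s, hs, fun t h1 h2 => ⟨h t h1 h2, he.deriv_pos hl
    (fun u hu hul => h u (h1.trans hu) hul) h2⟩⟩

/-- The end solution and its derivative have no common zero. -/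
theorem IsEnd.ne_zero (he : V.IsEnd l e e') (hl : 0 < l) {a : ℝ} (ha : e a = 0) : e' a ≠ 0 := by
  intro ha'
  obtain ⟨s, hs, h⟩ := he.eventually_pos hl
  obtain ⟨t, h1, h2⟩ := EReal.lt_iff_exists_real_btwn.1 hs
  have ht := (h t (EReal.coe_lt_coe_iff.1 h1) h2).1
  have hc := he.isSol.wronskian V.isSol_c a t
  have hs := he.isSol.wronskian V.isSol_s a t
  have hw := V.wronskian_c_s t
  rw [ha, ha'] at hc hs
  have : e t = 0 := by linear_combination V.c t * hs - V.s t * hc - e t * hw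
  linarith

/-- An increasing solution cannot have a Wronskian with the end solution of the sign making their
quotient decrease to the end. -/
theorem IsEnd.wronskian_nonneg (he : V.IsEnd l e e') (hl : 0 < l) {a p : ℝ} (ha : (a : EReal) < l)
    (hpos : ∀ t : ℝ, a ≤ t → (t : EReal) < l → 0 < V.sol a p t ∧ 0 < V.dsol a p t) :
    0 ≤ p * e a - e' a := by
  by_contra! hw
  obtain ⟨s, hs, h⟩ := he.eventually_pos hl
  obtain ⟨r, hr1, hr⟩ := EReal.lt_iff_exists_real_btwn.1 (max_lt hs ha)
  have hsr : s < r := EReal.coe_lt_coe_iff.1 ((le_max_left _ _).trans_lt hr1)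
  have har : a < r := EReal.coe_lt_coe_iff.1 ((le_max_right _ _).trans_lt hr1)
  have hW : ∀ t, V.dsol a p t * e t - V.sol a p t * e' t = p * e a - e' a := fun t => by
    have := (V.isSol_sol a p).wronskian he.isSol a t
    rw [V.sol_self, V.dsol_self] at this
    linarith
  -- `sol / e` is decreasing, so `sol` stays bounded
  have hanti : ∀ t : ℝ, r ≤ t → (t : EReal) < l → V.sol a p t / e t ≤ V.sol a p r / e r := by
    intro t hrt ht
    have hlt : ∀ u ∈ Icc r t, (u : EReal) < l := fun u hu =>
      (EReal.coe_le_coe_iff.2 hu.2).trans_lt ht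
    have hd : ∀ u ∈ Icc r t, HasDerivAt (fun u => V.sol a p u / e u)
        ((V.dsol a p u * e u - V.sol a p u * e' u) / e u ^ 2) u := fun u hu =>
      ((V.isSol_sol a p).hasDerivAt u).div (he.isSol.hasDerivAt u)
        (h u (hsr.trans_le hu.1) (hlt u hu)).1.ne'
    refine antitoneOn_of_deriv_nonpos (f := fun u => V.sol a p u / e u) (convex_Icc r t)
      (fun u hu => (hd u hu).continuousAt.continuousWithinAt)
      (fun u hu => (hd u (interior_subset hu)).differentiableAt.differentiableWithinAt)
      (fun u hu => ?_) (left_mem_Icc.2 hrt) (right_mem_Icc.2 hrt) hrt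
    rw [(hd u (interior_subset hu)).deriv, hW]
    exact div_nonpos_of_nonpos_of_nonneg hw.le (sq_nonneg _)
  have hneBot := endFilter_neBot hl
  have hlim : Tendsto (fun t => V.sol a p r / e r * e t * e' t) (endFilter l) (𝓝 0) := by
    simpa using (he.tendsto.const_mul (V.sol a p r / e r)).mul he.tendsto'
  have hge : ∀ᶠ t in endFilter l, -(p * e a - e' a) ≤ V.sol a p r / e r * e t * e' t := by
    refine (mem_endFilter hl).2 ⟨r, hr, fun t hrt ht => ?_⟩
    obtain ⟨h1, h2⟩ := h t (hsr.trans hrt) ht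
    have h3 := (div_le_iff₀ h1).1 (hanti t hrt.le ht)
    have h4 := mul_pos (hpos t (har.trans hrt).le ht).2 h1
    have h5 := mul_le_mul_of_nonneg_right h3 h2.le
    have := hW t
    change -(p * e a - e' a) ≤ V.sol a p r / e r * e t * e' t
    linarith
  have := ge_of_tendsto hlim hge
  linarith

theorem flat_reach (hn : 0 < c.p n) {k : ℕ} (hk : k ≤ n) :
    (V.RatioReach l (c.flat n hn) F k ↔ V.RatioReach l c F k) ∧
      ∀ j ≤ n, V.ratioLat l (c.flat n hn) F j = V.ratioLat l c F j := by
  have hM : ∀ j < n, (c.flat n hn).M F (j + 1) = c.M F (j + 1) := fun j hj => by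
    simp [Ratios.M, Ratios.flat, Function.update_of_ne (show j + 1 ≠ n + 1 by omega)]
  exact ⟨reach_congr (fun _ _ => rfl) fun j hj => hM j (by omega), lat_congr (fun _ _ => rfl) hM⟩

/-- One more step of the flattened chain means that the solution after the last point has a maximum.
-/
theorem flat_succ (hn : 0 < c.p n) : V.RatioReach l (c.flat n hn) F (n + 1) ↔
    V.RatioReach l c F n ∧ ∃ b, V.IsNext l (V.ratioLat l c F n) (F * c.p n) 0 b := by
  rw [RatioReach, reach_succ]
  refine and_congr (flat_reach hn le_rfl).1 (exists_congr fun b => ?_)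
  have h1 : V.lat l ((c.flat n hn).P F) ((c.flat n hn).M F) n = V.ratioLat l c F n :=
    (flat_reach hn le_rfl).2 n le_rfl
  rw [h1]
  simp [Ratios.P, Ratios.M, Ratios.flat]

/-- By continuity in `F`, some chain ends on the logarithmic derivative of the end solution:
for small `F` the solution after the last point has a maximum before the end, and at the supremum
of such `F` the Wronskian with the end solution vanishes. -/
theorem exists_smooth_end (he : V.IsEnd l e e') (hl : 0 < l) (hn : 0 < c.p n)
    (hfail : ∃ F > 0, ¬ V.RatioReach l (c.flat n hn) F (n + 1)) :
    ∃ F > 0, V.RatioReach l c F n ∧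
      (∀ t : ℝ, V.ratioLat l c F n ≤ t → (t : EReal) < l →
        0 < V.sol (V.ratioLat l c F n) (F * c.p n) t) ∧
      e (V.ratioLat l c F n) ≠ 0 ∧
      F * c.p n * e (V.ratioLat l c F n) = e' (V.ratioLat l c F n) := by
  set d := c.flat n hn with hd
  obtain ⟨F₁, hF₁, hF₁n⟩ := hfail
  have htop : V.threshold l d (n + 1) ≠ ⊤ := fun h =>
    hF₁n ((ratioReach_iff_lt_threshold hF₁).2 (h ▸ EReal.coe_lt_top F₁))
  have h0 := threshold_pos (V := V) (c := d) (n := n + 1) hl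
  obtain ⟨F, hF⟩ : ∃ F : ℝ, (F : EReal) = V.threshold l d (n + 1) :=
    ⟨_, EReal.coe_toReal htop h0.ne_bot⟩
  have hF0 : 0 < F := EReal.coe_lt_coe_iff.1 (hF ▸ h0)
  have hnot : ¬ V.RatioReach l d F (n + 1) := fun hr =>
    absurd ((ratioReach_iff_lt_threshold hF0).1 hr) (by rw [hF]; exact lt_irrefl _)
  have hleft : ∀ᶠ x in 𝓝[<] F, V.RatioReach l d x (n + 1) := by
    filter_upwards [Ioo_mem_nhdsLT hF0] with x hx
    exact (ratioReach_iff_lt_threshold hx.1).2 (hF ▸ EReal.coe_lt_coe_iff.2 hx.2)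
  have hreach : V.RatioReach l d F n := by
    cases n with
    | zero => exact reach_zero
    | succ k =>
      by_contra hno
      obtain ⟨x, hx1, hx2⟩ := (((eventually_not_ratioReach he hl hF0 hno).filter_mono
        nhdsWithin_le_nhds : ∀ᶠ x in 𝓝[<] F, _).and hleft).exists
      exact hx1 hx2
  have hcr : V.RatioReach l c F n := (flat_reach hn le_rfl).1.1 hreach
  set T := V.ratioLat l c F n with hT
  have hTl : (T : EReal) < l := hcr.lt_end le_rfl hl
  have hpF : 0 < F * c.p n := mul_pos hF0 hn
  have hnx : ∀ b, ¬ V.IsNext l T (F * c.p n) 0 b := fun b hb =>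
    hnot ((flat_succ hn).2 ⟨hcr, b, hb⟩)
  have hpos : ∀ t : ℝ, T ≤ t → (t : EReal) < l →
      0 < V.sol T (F * c.p n) t ∧ 0 < V.dsol T (F * c.p n) t := fun t h1 h2 => by
    have := cross_pos_of_not_exists (by linarith) hnx h1 h2
    exact ⟨this.2, by linarith [this.1]⟩
  have hge := he.wronskian_nonneg hl hTl hpos
  -- for `x < F` close to `F` the solution has its maximum at some `b` near the end, where the end
  -- solution is increasing, so its Wronskian with the end solution is negative
  have hle : F * c.p n * e T - e' T ≤ 0 := by
    obtain ⟨s, hs, hes⟩ := he.eventually_pos hl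
    have hcont : ContinuousAt (fun x => x * c.p n * e (V.ratioLat l c x n) -
        e' (V.ratioLat l c x n)) F := by
      have h1 := (continuousAt_ratioLat hcr).2 n le_rfl
      exact ((continuousAt_id.mul continuousAt_const).mul
        (he.isSol.continuous.continuousAt.comp h1)).sub
        (he.isSol.continuous'.continuousAt.comp h1)
    have hev := eventually_lt_lat (V := V) (l := l) (P := d.P) (M := d.M)
      (fun j => (d.contDiff_P j).continuous.continuousAt)
      (fun j => (d.contDiff_M j).continuous.continuousAt) hreach hnot (d.add_pos' hF0 n) hs
    refine le_of_tendsto (hcont.mono_left nhdsWithin_le_nhds : Tendsto _ (𝓝[<] F) _) ?_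
    filter_upwards [hleft, hev.filter_mono nhdsWithin_le_nhds] with x hx hx'
    have h1 := hx n n.lt_succ_self
    have h2 := hx' _ h1
    obtain ⟨-, b, hb⟩ := (flat_succ hn).1 hx
    have hbeq : V.lat l (d.P x) (d.M x) (n + 1) = b := by
      refine h1.unique ?_
      have h3 : V.lat l (d.P x) (d.M x) n = V.ratioLat l c x n :=
        (flat_reach hn le_rfl).2 n le_rfl
      rw [h3]
      simpa [Ratios.P, Ratios.M, hd, Ratios.flat] using hb
    rw [hbeq] at h2
    have hW := (V.isSol_sol (V.ratioLat l c x n) (x * c.p n)).wronskian he.isSol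
      (V.ratioLat l c x n) b
    rw [V.sol_self, V.dsol_self, hb.dsol_eq] at hW
    have := mul_pos (hb.sol_pos b (right_mem_Icc.2 hb.lt.le)) (hes b h2 hb.lt_end).2
    linarith
  have heq : F * c.p n * e T = e' T := by linarith
  refine ⟨F, hF0, hcr, fun t h1 h2 => (hpos t h1 h2).1, fun h => ?_, heq⟩
  exact he.ne_zero hl h (by rw [← heq, h, mul_zero])

/-- A positive solution agreeing at `a` with the end solution to first order, up to a factor, is
increasing up to the end. -/
theorem IsEnd.pos_of_eq (he : V.IsEnd l e e') (hl : 0 < l) {a p : ℝ}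
    (hpos : ∀ t : ℝ, a ≤ t → (t : EReal) < l → 0 < V.sol a p t) (h0 : e a ≠ 0) (ha : (a : EReal) < l)
    (heq : p * e a = e' a) :
    ∀ t : ℝ, a ≤ t → (t : EReal) < l → 0 < e t ∧ 0 < e' t ∧ 0 < V.dsol a p t := by
  have hp : p = e' a / e a := by rw [← heq, mul_div_cancel_right₀ _ h0]
  have hform := V.eq_sol he.isSol a h0
  rw [← hp] at hform
  have hea : 0 < e a := by
    obtain ⟨s, hs, h⟩ := he.eventually_pos hl
    obtain ⟨r, hr1, hr⟩ := EReal.lt_iff_exists_real_btwn.1 (max_lt hs ha)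
    have hsr : s < r := EReal.coe_lt_coe_iff.1 ((le_max_left _ _).trans_lt hr1)
    have har : a < r := EReal.coe_lt_coe_iff.1 ((le_max_right _ _).trans_lt hr1)
    have h1 := (h r hsr hr).1
    rw [(hform r).1] at h1
    exact (pos_iff_pos_of_mul_pos h1).2 (hpos r har.le hr)
  have hpe : ∀ t : ℝ, a ≤ t → (t : EReal) < l → 0 < e t := fun t h1 h2 => by
    rw [(hform t).1]; exact mul_pos hea (hpos t h1 h2)
  intro t h1 h2
  have h3 : 0 < e' t := he.deriv_pos hl (fun u hu hul => hpe u (h1.trans hu.le) hul) h2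
  refine ⟨hpe t h1 h2, h3, ?_⟩
  rw [(hform t).2] at h3
  exact (pos_iff_pos_of_mul_pos h3).1 hea

/-- At most one chain ends on the logarithmic derivative of the end solution: if `F` increases, then
so do the last latitude and the flux there, while the logarithmic derivative of the end solution
decreases. -/
theorem smooth_end_unique (he : V.IsEnd l e e') (hl : 0 < l) (hn : 0 < c.p n) (hF : 0 < F)
    (hF' : 0 < F') (h : V.RatioReach l c F n) (h' : V.RatioReach l c F' n)
    (hpos : ∀ t : ℝ, V.ratioLat l c F n ≤ t → (t : EReal) < l → 0 < e t)
    (hpos' : ∀ t : ℝ, V.ratioLat l c F' n ≤ t → (t : EReal) < l → 0 < e t)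
    (heq : F * c.p n * e (V.ratioLat l c F n) = e' (V.ratioLat l c F n))
    (heq' : F' * c.p n * e (V.ratioLat l c F' n) = e' (V.ratioLat l c F' n)) : F = F' := by
  have key : ∀ {F F' : ℝ}, 0 < F → V.RatioReach l c F n → V.RatioReach l c F' n →
      (∀ t : ℝ, V.ratioLat l c F n ≤ t → (t : EReal) < l → 0 < e t) →
      (∀ t : ℝ, V.ratioLat l c F' n ≤ t → (t : EReal) < l → 0 < e t) →
      F * c.p n * e (V.ratioLat l c F n) = e' (V.ratioLat l c F n) →
      F' * c.p n * e (V.ratioLat l c F' n) = e' (V.ratioLat l c F' n) → ¬ F < F' := by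
    intro F F' hF h h' hpos hpos' heq heq' hlt
    have hle := (h'.of_le hF hlt.le).2 n le_rfl
    have hp : F * c.p n < F' * c.p n := mul_lt_mul_of_pos_right hlt hn
    have h1 := hpos _ le_rfl (h.lt_end le_rfl hl)
    have h2 := hpos' _ le_rfl (h'.lt_end le_rfl hl)
    rw [← eq_div_iff h1.ne'] at heq
    rw [← eq_div_iff h2.ne'] at heq'
    rcases hle.eq_or_lt with h3 | h3
    · rw [h3, ← heq'] at heq; linarith
    · have := he.isSol.log_deriv_lt V.pos h3 fun t ht => hpos t ht.1
        ((EReal.coe_le_coe_iff.2 ht.2).trans_lt (h'.lt_end le_rfl hl))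
      rw [← heq, ← heq'] at this
      linarith
  exact le_antisymm (not_lt.1 (key hF' h' h hpos' hpos heq' heq))
    (not_lt.1 (key hF h h' hpos hpos' heq heq'))

/-- If some chain of `n` steps is followed by an increasing solution, then the chains of `n + d`
steps with large `F` are not followed by a solution with a maximum. -/
theorem exists_not_flat_reach {P M : ℕ → ℝ} {d : ℕ} (hn : 0 < c.p (n + d))
    (hc : ∀ j, 1 ≤ j → j ≤ n + d → 0 < c.m j)
    (hP : 0 < d ∨ P 0 ≤ 0 ∨ 0 < c.p 0) (hpos : ∀ j < n, 0 < P j + M (j + 1)) (hPn : 0 < P n)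
    (hno : V.Reach l P M n → ∀ b, ¬ V.IsNext l (V.lat l P M n) (P n) 0 b) :
    ∃ F > 0, ¬ V.RatioReach l (c.flat (n + d) hn) F (n + d + 1) := by
  have hlarge : ∀ᶠ x in atTop, ∀ j ∈ Finset.range (n + 1), P j ≤ c.P x (j + d) ∧
      (j < n → M (j + 1) ≤ c.M x (j + 1 + d)) := by
    rw [eventually_all_finset]
    intro j hj
    have hj := Finset.mem_range.1 hj
    refine Eventually.and ?_ ?_
    · by_cases hcp : 0 < c.p (j + d)
      · exact (tendsto_id.atTop_mul_const hcp).eventually_ge_atTop _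
      · have h0 : j + d = 0 := by
          by_contra h0
          exact hcp (c.p_pos _ (by omega))
        obtain ⟨rfl, rfl⟩ : j = 0 ∧ d = 0 := by omega
        rcases hP with h | h | h
        · omega
        · filter_upwards [eventually_ge_atTop 0] with x hx
          exact h.trans (mul_nonneg hx c.p_nonneg)
        · exact absurd h hcp
    · by_cases hjn : j < n
      · filter_upwards [(tendsto_id.atTop_mul_const (hc (j + 1 + d) (by omega)
          (by omega))).eventually_ge_atTop (M (j + 1))] with x hx _
        exact hx
      · exact Eventually.of_forall fun x h => absurd h hjn
  obtain ⟨F, hF, hF0⟩ := (hlarge.and (eventually_gt_atTop 0)).exists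
  refine ⟨F, hF0, fun hreach => ?_⟩
  set f := c.flat (n + d) hn with hf
  -- the last `n + 1` steps of the long chain dominate the short one followed by a maximum
  have hchain : V.IsChain l (fun j => f.P F (j + d)) (fun j => f.M F (j + d))
      (fun j => V.ratioLat l f F (j + d)) (n + 1) := fun j hj => by
    have := hreach (j + d) (by omega)
    rw [show j + d + 1 = j + 1 + d by omega] at this
    exact this
  have h0 : (0 : ℝ) ≤ V.ratioLat l f F (0 + d) :=
    IsChain.le hreach (Nat.zero_le _) (by omega)
  have hM : ∀ j < n + 1, Function.update M (n + 1) 0 (j + 1) ≤ f.M F (j + 1 + d) := by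
    intro j hj
    rcases eq_or_ne j n with rfl | h
    · simp only [Function.update_self]
      exact mul_nonneg hF0.le (f.m_nonneg _ (by omega))
    · rw [Function.update_of_ne (by omega)]
      have h1 := (hF j (Finset.mem_range.2 hj)).2 (by omega)
      have h2 : f.m (j + 1 + d) = c.m (j + 1 + d) := by
        simp only [hf, Ratios.flat]
        rw [Function.update_of_ne (by omega)]
      rw [Ratios.M, h2]; exact h1
  have hr := (hchain.comparison (P := P) (M := Function.update M (n + 1) 0) h0
    (fun j hj => (hF j (Finset.mem_range.2 hj)).1) hM (fun j hj => by
      rcases eq_or_ne j n with rfl | h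
      · simpa using hPn
      · rw [Function.update_of_ne (by omega)]; exact hpos j (by omega))).1
  have hMj : ∀ j < n, Function.update M (n + 1) 0 (j + 1) = M (j + 1) := fun j hj =>
    Function.update_of_ne (by omega) _ _
  obtain ⟨h1, b, hb⟩ := reach_succ.1 hr
  rw [Function.update_self, lat_congr (fun _ _ => rfl) hMj n le_rfl] at hb
  exact hno ((reach_congr (fun _ _ => rfl) hMj).1 h1) b hb

end Potential

/-! ### The end solution at infinity -/

theorem endFilter_top : endFilter ⊤ = atTop := by
  ext S
  rw [mem_endFilter (by simp), mem_atTop_sets]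
  constructor
  · rintro ⟨a, -, h⟩
    exact ⟨a + 1, fun b hb => h b (by linarith) (EReal.coe_lt_top b)⟩
  · rintro ⟨a, h⟩
    exact ⟨a, EReal.coe_lt_top a, fun t ht _ => h t ht.le⟩

theorem monotoneOn_Ici_of_hasDerivAt {f f' : ℝ → ℝ} {a : ℝ} (h : ∀ t, a ≤ t → HasDerivAt f (f' t) t)
    (h0 : ∀ t, a ≤ t → 0 ≤ f' t) : MonotoneOn f (Ici a) :=
  monotoneOn_of_deriv_nonneg (convex_Ici a) (fun t ht => (h t ht).continuousAt.continuousWithinAt)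
    (fun t ht => (h t (interior_subset ht)).differentiableAt.differentiableWithinAt)
    fun t ht => by rw [(h t (interior_subset ht)).deriv]; exact h0 t (interior_subset ht)

theorem antitoneOn_Ici_of_hasDerivAt {f f' : ℝ → ℝ} {a : ℝ} (h : ∀ t, a ≤ t → HasDerivAt f (f' t) t)
    (h0 : ∀ t, a ≤ t → f' t ≤ 0) : AntitoneOn f (Ici a) :=
  antitoneOn_of_deriv_nonpos (convex_Ici a) (fun t ht => (h t ht).continuousAt.continuousWithinAt)
    (fun t ht => (h t (interior_subset ht)).differentiableAt.differentiableWithinAt)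
    fun t ht => by rw [(h t (interior_subset ht)).deriv]; exact h0 t (interior_subset ht)

theorem exists_tendsto_of_antitoneOn {f : ℝ → ℝ} {a m : ℝ} (h : AntitoneOn f (Ici a))
    (hm : ∀ t, a ≤ t → m ≤ f t) : ∃ L, Tendsto f atTop (𝓝 L) ∧ m ≤ L ∧ ∀ t, a ≤ t → L ≤ f t := by
  have hanti : Antitone fun t => f (max t a) := fun s t hst =>
    h (mem_Ici.2 (le_max_right _ _)) (mem_Ici.2 (le_max_right _ _)) (max_le_max_right a hst)
  have hbdd : BddBelow (range fun t => f (max t a)) :=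
    ⟨m, by rintro _ ⟨t, rfl⟩; exact hm _ (le_max_right _ _)⟩
  have hlim := tendsto_atTop_ciInf hanti hbdd
  refine ⟨_, hlim.congr' ?_, le_ciInf fun t => hm _ (le_max_right _ _), fun t ht => ?_⟩
  · filter_upwards [eventually_ge_atTop a] with t ht
    rw [max_eq_left ht]
  · have := ciInf_le hbdd t
    rwa [max_eq_left ht] at this

namespace Potential

variable {V : Potential}

/-- If the slope of a solution `y` stays at least `1`, then it has a positive limit `L`, and a
second solution `z`, minus a multiple `κ y`, tends to `1 / L`. -/
theorem exists_isEnd_of_slope {a p : ℝ} (hpos : ∀ t, a ≤ t → 1 ≤ V.dsol a p t) :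
    ∃ e e', V.IsEnd ⊤ e e' := by
  set y := V.sol a p with hy
  set y' := V.dsol a p with hy'
  have hsol : IsSol V.val y y' := V.isSol_sol a p
  have hymono : MonotoneOn y (Ici a) :=
    monotoneOn_Ici_of_hasDerivAt (fun t _ => hsol.hasDerivAt t) fun t ht => by linarith [hpos t ht]
  have hy1 : ∀ t, a ≤ t → 1 ≤ y t := fun t ht => by
    have := hymono self_mem_Ici ht ht
    rwa [hy, V.sol_self] at this
  have hytop : Tendsto y atTop atTop := by
    have hlin : MonotoneOn (fun t => y t - t) (Ici a) :=
      monotoneOn_Ici_of_hasDerivAt (fun t _ => (hsol.hasDerivAt t).sub (hasDerivAt_id t))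
        fun t ht => by linarith [hpos t ht]
    refine tendsto_atTop_mono' atTop (f₁ := fun t => t + (y a - a)) ?_
      (tendsto_id.atTop_add tendsto_const_nhds)
    filter_upwards [eventually_ge_atTop a] with t ht
    have : y a - a ≤ y t - t := hlin self_mem_Ici ht ht
    linarith
  have hanti : AntitoneOn y' (Ici a) :=
    antitoneOn_Ici_of_hasDerivAt (fun t _ => hsol.hasDerivAt' t) fun t ht => by
      have := mul_pos (V.pos t) (by linarith [hy1 t ht] : 0 < y t)
      linarith
  obtain ⟨L, hL, hL1, hLy⟩ := exists_tendsto_of_antitoneOn hanti hpos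
  have hL0 : 0 < L := by linarith
  set z := V.sol a (p - 1) with hz
  set z' := V.dsol a (p - 1) with hz'
  have hzsol : IsSol V.val z z' := V.isSol_sol a (p - 1)
  have hW : ∀ t, z' t * y t - z t * y' t = -1 := fun t => by
    have := hzsol.wronskian hsol a t
    simp only [hy, hy', hz, hz', V.sol_self, V.dsol_self] at this ⊢
    linarith
  -- the quotient of the two solutions, corrected by a multiple of `1 / y`
  have hquot : ∀ q t, a ≤ t → HasDerivAt (fun t => z t / y t - q * (y t)⁻¹)
      ((-1 + q * y' t) / y t ^ 2) t := fun q t ht => by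
    have hyt : y t ≠ 0 := by linarith [hy1 t ht]
    refine (((hzsol.hasDerivAt t).div (hsol.hasDerivAt t) hyt).sub
      (((hsol.hasDerivAt t).inv hyt).const_mul q)).congr_deriv ?_
    rw [hW]
    field_simp
    ring
  have hinv : Tendsto (fun t => (y t)⁻¹) atTop (𝓝 0) := hytop.inv_tendsto_atTop
  have hr : AntitoneOn (fun t => z t / y t - 0 * (y t)⁻¹) (Ici a) :=
    antitoneOn_Ici_of_hasDerivAt (hquot 0) fun t ht =>
      div_nonpos_of_nonpos_of_nonneg (by linarith) (sq_nonneg _)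
  have hrL : MonotoneOn (fun t => z t / y t - L⁻¹ * (y t)⁻¹) (Ici a) :=
    monotoneOn_Ici_of_hasDerivAt (hquot L⁻¹) fun t ht => by
      refine div_nonneg ?_ (sq_nonneg _)
      have := mul_le_mul_of_nonneg_left (hLy t ht) (inv_nonneg.2 hL0.le)
      rw [inv_mul_cancel₀ hL0.ne'] at this
      linarith
  obtain ⟨κ, hκ, -, -⟩ := exists_tendsto_of_antitoneOn (m := z a / y a - L⁻¹ * (y a)⁻¹) hr
    fun t ht => by
      have h1 : z a / y a - L⁻¹ * (y a)⁻¹ ≤ z t / y t - L⁻¹ * (y t)⁻¹ := hrL self_mem_Ici ht ht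
      have h2 : 0 ≤ L⁻¹ * (y t)⁻¹ := mul_nonneg (inv_nonneg.2 hL0.le)
        (inv_nonneg.2 (by linarith [hy1 t ht]))
      change z a / y a - L⁻¹ * (y a)⁻¹ ≤ z t / y t - 0 * (y t)⁻¹
      linarith
  have hκ : ∀ q, Tendsto (fun t => z t / y t - q * (y t)⁻¹) atTop (𝓝 κ) := fun q => by
    have := hκ.sub (hinv.const_mul q)
    simpa using this
  have hup : ∀ t, a ≤ t → z t - κ * y t ≤ L⁻¹ := fun t ht => by
    have hyt : 0 < y t := by linarith [hy1 t ht]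
    have : z t / y t - L⁻¹ * (y t)⁻¹ ≤ κ := ge_of_tendsto (hκ L⁻¹) (by
      filter_upwards [eventually_ge_atTop t] with s hs
      exact hrL ht (mem_Ici.2 (ht.trans hs)) hs)
    have := mul_le_mul_of_nonneg_right this hyt.le
    rw [sub_mul, div_mul_cancel₀ _ hyt.ne', mul_assoc, inv_mul_cancel₀ hyt.ne'] at this
    linarith
  have hlow : ∀ t, a ≤ t → (y' t)⁻¹ ≤ z t - κ * y t := fun t ht => by
    have hyt : 0 < y t := by linarith [hy1 t ht]
    have hy't : 0 < y' t := by linarith [hpos t ht]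
    have hmon : AntitoneOn (fun s => z s / y s - (y' t)⁻¹ * (y s)⁻¹) (Ici t) :=
      antitoneOn_Ici_of_hasDerivAt (fun s hs => hquot _ s (ht.trans hs)) fun s hs => by
        refine div_nonpos_of_nonpos_of_nonneg ?_ (sq_nonneg _)
        have h1 := hanti ht (mem_Ici.2 (ht.trans hs)) hs
        have := mul_le_mul_of_nonneg_left h1 (inv_nonneg.2 hy't.le)
        rw [inv_mul_cancel₀ hy't.ne'] at this
        linarith
    have : κ ≤ z t / y t - (y' t)⁻¹ * (y t)⁻¹ := le_of_tendsto (hκ _) (by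
      filter_upwards [eventually_ge_atTop t] with s hs
      exact hmon self_mem_Ici hs hs)
    have := mul_le_mul_of_nonneg_right this hyt.le
    rw [sub_mul, div_mul_cancel₀ _ hyt.ne', mul_assoc, inv_mul_cancel₀ hyt.ne'] at this
    linarith
  have hlim : Tendsto (fun t => z t - κ * y t) atTop (𝓝 L⁻¹) := by
    refine tendsto_of_tendsto_of_tendsto_of_le_of_le' (hL.inv₀ hL0.ne') tendsto_const_nhds ?_ ?_
    · filter_upwards [eventually_ge_atTop a] with t ht using hlow t ht
    · filter_upwards [eventually_ge_atTop a] with t ht using hup t ht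
  have hlim' : Tendsto (fun t => z' t - κ * y' t) atTop (𝓝 0) := by
    have h1 : Tendsto (fun t => ((z t - κ * y t) * y' t - 1) * (y t)⁻¹) atTop (𝓝 0) := by
      have := ((hlim.mul hL).sub_const 1).mul hinv
      simpa using this
    refine h1.congr' ?_
    filter_upwards [eventually_ge_atTop a] with t ht
    have hyt : y t ≠ 0 := by linarith [hy1 t ht]
    field_simp
    linear_combination (-1) * hW t
  refine ⟨fun t => L * z t + (-(L * κ)) * y t, fun t => L * z' t + (-(L * κ)) * y' t,
    hzsol.linComb hsol _ _, ?_, ?_⟩ <;> rw [endFilter_top]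
  · have := hlim.const_mul L
    rw [mul_inv_cancel₀ hL0.ne'] at this
    exact this.congr fun t => by ring
  · have := hlim'.const_mul L
    rw [mul_zero] at this
    exact this.congr fun t => by ring

/-- If the potential has an iterated primitive vanishing at infinity, then `1 - J` is a positive
supersolution there, and a solution exists whose slope is bounded below. -/
theorem exists_isEnd_top {s₀ : ℝ} {A J : ℝ → ℝ}
    (h : ∀ t ≥ s₀, HasDerivAt A (-V.val t) t ∧ HasDerivAt J (-A t) t ∧ 0 ≤ A t ∧ 0 ≤ J t)
    (hJ : Tendsto J atTop (𝓝 0)) : ∃ e e', V.IsEnd ⊤ e e' := by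
  obtain ⟨a, ha, haJ⟩ : ∃ a ≥ s₀, ∀ t ≥ a, J t < 1 / 2 := by
    obtain ⟨a, ha⟩ := eventually_atTop.1 (hJ.eventually_lt_const (show (0 : ℝ) < 1 / 2 by norm_num))
    exact ⟨max a s₀, le_max_right _ _, fun t ht => ha t ((le_max_left _ _).trans ht)⟩
  have hJa := haJ a le_rfl
  set p := (A a + 1) / (1 - J a) with hp
  have hp0 : 0 < p := div_pos (by linarith [(h a ha).2.2.1]) (by linarith)
  -- the Wronskian with the supersolution `1 - J` is increasing
  have hw : ∀ b, a ≤ b → (∀ t ∈ Icc a b, 0 < V.sol a p t) →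
      1 ≤ V.dsol a p b * (1 - J b) - V.sol a p b * A b := by
    intro b hab hpos
    have hd : ∀ t ∈ Icc a b, HasDerivAt (fun t => V.dsol a p t * (1 - J t) - V.sol a p t * A t)
        (V.val t * V.sol a p t * J t) t := fun t ht => by
      obtain ⟨h1, h2, -, -⟩ := h t (ha.trans ht.1)
      refine ((((V.isSol_sol a p).hasDerivAt' t).mul ((hasDerivAt_const t (1 : ℝ)).sub h2)).sub
        (((V.isSol_sol a p).hasDerivAt t).mul h1)).congr_deriv ?_
      simp
      ring
    have hmono : MonotoneOn (fun t => V.dsol a p t * (1 - J t) - V.sol a p t * A t) (Icc a b) := by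
      refine monotoneOn_of_deriv_nonneg (convex_Icc a b)
        (fun t ht => (hd t ht).continuousAt.continuousWithinAt)
        (fun t ht => (hd t (interior_subset ht)).differentiableAt.differentiableWithinAt)
        fun t ht => ?_
      rw [(hd t (interior_subset ht)).deriv]
      exact mul_nonneg (mul_pos (V.pos t) (hpos t (interior_subset ht))).le
        (h t (ha.trans (interior_subset ht).1)).2.2.2
    have h1 := hmono (left_mem_Icc.2 hab) (right_mem_Icc.2 hab) hab
    have h2 : p * (1 - J a) = A a + 1 := div_mul_cancel₀ _ (by linarith)
    simp only [V.sol_self, V.dsol_self, h2] at h1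
    linarith
  have hn : ∀ b, ¬ V.IsNext ⊤ a p 0 b := by
    intro b hb
    have h1 := hw b hb.lt.le hb.sol_pos
    have h2 := mul_nonneg (hb.sol_pos b (right_mem_Icc.2 hb.lt.le)).le
      (h b (ha.trans hb.lt.le)).2.2.1
    rw [hb.dsol_eq] at h1
    linarith
  refine exists_isEnd_of_slope (V := V) (a := a) (p := p) fun t ht => ?_
  have hpos : ∀ t, a ≤ t → 0 < V.dsol a p t ∧ 0 < V.sol a p t := fun t ht => by
    have := cross_pos_of_not_exists (by linarith) hn ht (EReal.coe_lt_top t)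
    exact ⟨by linarith [this.1], this.2⟩
  have h1 := hw t ht fun s hs => (hpos s hs.1).2
  have h2 := mul_nonneg (hpos t ht).2.le (h t (ha.trans ht)).2.2.1
  have h3 := mul_nonneg (hpos t ht).1.le (h t (ha.trans ht)).2.2.2
  linarith

end Potential

/-! ### Profiles made of pieces of solutions -/

namespace Potential

variable {V : Potential} {l : EReal}

theorem _root_.RLD.IsSol.ext {y y' w w' : ℝ → ℝ} (h : IsSol V.val y y') (k : IsSol V.val w w') {a : ℝ}
    (h0 : y a = w a) (h1 : y' a = w' a) : y = w ∧ y' = w' := by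
  have key : ∀ t, y t = w t ∧ y' t = w' t := fun t => by
    have c1 := h.wronskian V.isSol_c a t
    have s1 := h.wronskian V.isSol_s a t
    have c2 := k.wronskian V.isSol_c a t
    have s2 := k.wronskian V.isSol_s a t
    have hw := V.wronskian_c_s t
    rw [h0, h1] at c1 s1
    constructor
    · linear_combination V.s t * (c2 - c1) - V.c t * (s2 - s1) - (y t - w t) * hw
    · linear_combination V.ds t * (c2 - c1) - V.dc t * (s2 - s1) - (y' t - w' t) * hw
  exact ⟨funext fun t => (key t).1, funext fun t => (key t).2⟩

theorem _root_.RLD.IsSol.reflect {y y' : ℝ → ℝ} (h : IsSol V.val y y') :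
    IsSol V.val (fun t => y (-t)) (fun t => -y' (-t)) := by
  have hn : ∀ t : ℝ, HasDerivAt (fun t : ℝ => -t) (-1) t := fun t => hasDerivAt_neg t
  refine ⟨fun t => ?_, fun t => ?_⟩
  · refine ((h.hasDerivAt (-t)).comp t (hn t)).congr_deriv (by ring)
  · refine (((h.hasDerivAt' (-t)).comp t (hn t)).neg).congr_deriv ?_
    rw [V.even]; ring

theorem _root_.RLD.IsSol.const_mul {y y' : ℝ → ℝ} (h : IsSol V.val y y') (C : ℝ) :
    IsSol V.val (fun t => C * y t) (fun t => C * y' t) :=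
  ⟨fun t => (h.hasDerivAt t).const_mul C, fun t =>
    ((h.hasDerivAt' t).const_mul C).congr_deriv (by ring)⟩

theorem sol_zero_even (t : ℝ) : V.sol 0 0 (-t) = V.sol 0 0 t :=
  congrFun ((V.isSol_sol 0 0).reflect.ext (V.isSol_sol 0 0) (a := 0) (by simp) (by simp)).1 t

theorem eqOn_Icc_of_deriv_zero {f : ℝ → ℝ} {a b : ℝ} (hf : ContinuousOn f (Icc a b))
    (hd : ∀ t ∈ Ioo a b, HasDerivAt f 0 t) : ∀ t ∈ Icc a b, f t = f a := by
  intro t ht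
  have ha : a ∈ Icc a b := left_mem_Icc.2 (ht.1.trans ht.2)
  have h1 : MonotoneOn f (Icc a b) := monotoneOn_of_deriv_nonneg (convex_Icc a b) hf
    (fun t ht => (hd t (interior_Icc (a := a) ▸ ht)).differentiableAt.differentiableWithinAt)
    fun t ht => (hd t (interior_Icc (a := a) ▸ ht)).deriv.ge
  have h2 : AntitoneOn f (Icc a b) := antitoneOn_of_deriv_nonpos (convex_Icc a b) hf
    (fun t ht => (hd t (interior_Icc (a := a) ▸ ht)).differentiableAt.differentiableWithinAt)
    fun t ht => (hd t (interior_Icc (a := a) ▸ ht)).deriv.le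
  exact le_antisymm (h2 ha ht ht.1) (h1 ha ht ht.1)

/-- A function smooth up to the ends of a compact interval and solving the equation inside extends
to a solution on the line. -/
theorem exists_isSol_eqOn {f : ℝ → ℝ} {a b : ℝ} (hab : a < b) (hf : ContDiffOn ℝ ∞ f (Icc a b))
    (heq : ∀ t ∈ Ioo a b, iteratedDeriv 2 f t + V.val t * f t = 0) :
    ∃ y y', IsSol V.val y y' ∧ EqOn f y (Icc a b) := by
  set f' := derivWithin f (Icc a b) with hf'
  have hf'c : ContinuousOn f' (Icc a b) :=
    hf.continuousOn_derivWithin (uniqueDiffOn_Icc hab) (by simp)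
  have hat : ∀ t ∈ Ioo a b, ContDiffAt ℝ ∞ f t := fun t ht => hf.contDiffAt (Icc_mem_nhds ht.1 ht.2)
  have hd : ∀ t ∈ Ioo a b, HasDerivAt f (f' t) t := fun t ht => by
    rw [hf', derivWithin_of_mem_nhds (Icc_mem_nhds ht.1 ht.2)]
    exact ((hat t ht).differentiableAt (by simp)).hasDerivAt
  have hd' : ∀ t ∈ Ioo a b, HasDerivAt f' (-(V.val t * f t)) t := fun t ht => by
    have h1 : DifferentiableAt ℝ (deriv f) t := by
      have : ContDiffOn ℝ 1 (deriv f) (Ioo a b) :=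
        (hf.mono Ioo_subset_Icc_self).deriv_of_isOpen isOpen_Ioo
          (by norm_cast)
      exact (this.contDiffAt (Ioo_mem_nhds ht.1 ht.2)).differentiableAt (by simp)
    have h2 : deriv (deriv f) t = -(V.val t * f t) := by
      have := heq t ht
      rw [iteratedDeriv_succ, iteratedDeriv_one] at this
      linarith
    rw [← h2]
    refine h1.hasDerivAt.congr_of_eventuallyEq ?_
    filter_upwards [Ioo_mem_nhds ht.1 ht.2] with s hs
    exact derivWithin_of_mem_nhds (Icc_mem_nhds hs.1 hs.2)
  -- the Wronskians of `f` with the fundamental solutions are constant up to the ends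
  have hW : ∀ w w', IsSol V.val w w' → ∀ t ∈ Icc a b,
      f' t * w t - f t * w' t = f' a * w a - f a * w' a := fun w w' hw =>
    eqOn_Icc_of_deriv_zero ((hf'c.mul hw.continuous.continuousOn).sub
      (hf.continuousOn.mul hw.continuous'.continuousOn)) fun t ht =>
      (((hd' t ht).mul (hw.hasDerivAt t)).sub ((hd t ht).mul (hw.hasDerivAt' t))).congr_deriv
        (by ring)
  refine ⟨_, _, V.isSol_c.linComb V.isSol_s (-(f' a * V.s a - f a * V.ds a))
    (f' a * V.c a - f a * V.dc a), fun t ht => ?_⟩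
  have h1 := hW _ _ V.isSol_c t ht
  have h2 := hW _ _ V.isSol_s t ht
  have h3 := V.wronskian_c_s t
  rw [← h1, ← h2]
  linear_combination (-f t) * h3

variable (V) in
/-- The continuous function which on `[T j, T (j + 1)]`, `j < n`, and on `[T n, ∞)` is a multiple
of the solution with logarithmic derivative `P j` at `T j`, with value `1` at `0 = T 0`. -/
def prof (P T : ℕ → ℝ) (n : ℕ) (t : ℝ) : ℝ :=
  V.sol (T n) (P n) (max t (T n)) *
    ∏ j ∈ Finset.range n, V.sol (T j) (P j) (max (T j) (min t (T (j + 1))))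

variable {P T : ℕ → ℝ} {n : ℕ}

theorem prof_succ_of_le {t : ℝ} (ht : t ≤ T (n + 1)) :
    V.prof P T (n + 1) t = V.prof P T n t := by
  rw [prof, prof, Finset.prod_range_succ, max_eq_right ht, sol_self, min_eq_left ht, one_mul,
    mul_comm, max_comm]

theorem prof_eq_of_le {m : ℕ} (hnm : n ≤ m) (h : ∀ i < m, T i ≤ T (i + 1)) {t : ℝ}
    (ht : n < m → t ≤ T (n + 1)) : V.prof P T m t = V.prof P T n t := by
  induction m, hnm using Nat.le_induction with
  | base => rfl
  | succ m hm ih =>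
    have hT : ∀ k, n + 1 ≤ k → k ≤ m + 1 → T (n + 1) ≤ T k := by
      intro k hk
      induction k, hk using Nat.le_induction with
      | base => exact fun _ => le_rfl
      | succ k hk ih => exact fun hkm => (ih (by omega)).trans (h k (by omega))
    rw [prof_succ_of_le ((ht (by omega)).trans (hT _ (by omega) le_rfl))]
    exact ih (fun i hi => h i (by omega)) fun hlt => ht (by omega)

theorem prof_last {t : ℝ} (h : ∀ i < n, T i ≤ T (i + 1)) (ht : T n ≤ t) :
    V.prof P T n t = V.prof P T n (T n) * V.sol (T n) (P n) t := by
  have hT : ∀ j < n, T (j + 1) ≤ T n := by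
    intro j hj
    have : ∀ k, j + 1 ≤ k → k ≤ n → T (j + 1) ≤ T k := by
      intro k hk
      induction k, hk using Nat.le_induction with
      | base => exact fun _ => le_rfl
      | succ k hk ih => exact fun hkm => (ih (by omega)).trans (h k (by omega))
    exact this n hj le_rfl
  rw [prof, prof, max_eq_left ht, max_self, sol_self, one_mul, mul_comm]
  congr 1
  refine Finset.prod_congr rfl fun j hj => ?_
  have := hT j (Finset.mem_range.1 hj)
  rw [min_eq_right this, min_eq_right (this.trans ht)]

/-- On `[T j, T (j + 1)]` the profile is a multiple of one solution. -/
theorem prof_eq {j : ℕ} (hj : j ≤ n) (h : ∀ i < n, T i ≤ T (i + 1)) {t : ℝ} (ht : T j ≤ t)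
    (ht' : j < n → t ≤ T (j + 1)) :
    V.prof P T n t = V.prof P T n (T j) * V.sol (T j) (P j) t := by
  rw [prof_eq_of_le hj h ht', prof_last (fun i hi => h i (by omega)) ht,
    prof_eq_of_le hj h fun hlt => h j hlt]

theorem prof_zero (h0 : T 0 = 0) (h : ∀ i < n, T i ≤ T (i + 1)) : V.prof P T n 0 = 1 := by
  rw [prof_eq_of_le (Nat.zero_le n) h fun hlt => h0 ▸ h 0 hlt]
  simp [prof, h0]

theorem prof_pos {M : ℕ → ℝ} (h : V.IsChain l P M T n)
    (hlast : ∀ t : ℝ, T n ≤ t → (t : EReal) < l → 0 < V.sol (T n) (P n) t) {t : ℝ}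
    (htl : (t : EReal) < l) : 0 < V.prof P T n t := by
  refine mul_pos ?_ (Finset.prod_pos fun j hj => ?_)
  · rcases le_total t (T n) with h1 | h1
    · rw [max_eq_right h1, sol_self]; exact one_pos
    · rw [max_eq_left h1]; exact hlast t h1 htl
  · have hn := h j (Finset.mem_range.1 hj)
    exact hn.sol_pos _ ⟨le_max_left _ _, max_le hn.lt.le (min_le_right _ _)⟩

theorem continuous_prof : Continuous (V.prof P T n) := by
  have h := fun a p => (V.isSol_sol a p).continuous
  unfold prof
  refine ((h _ _).comp (by fun_prop)).mul (continuous_finsetProd _ fun j _ => (h _ _).comp ?_)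
  fun_prop

theorem continuousAt_prof {X : Type*} [TopologicalSpace X] {P T : X → ℕ → ℝ} {x₀ : X} (t : ℝ)
    (hP : ∀ j ≤ n, ContinuousAt (fun x => P x j) x₀)
    (hT : ∀ j ≤ n, ContinuousAt (fun x => T x j) x₀) :
    ContinuousAt (fun z : X × ℝ => V.prof (P z.1) (T z.1) n z.2) (x₀, t) := by
  have hP' : ∀ j ≤ n, ContinuousAt (fun z : X × ℝ => P z.1 j) (x₀, t) := fun j hj =>
    ContinuousAt.comp (f := Prod.fst) (x := (x₀, t)) (hP j hj) continuousAt_fst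
  have hT' : ∀ j ≤ n, ContinuousAt (fun z : X × ℝ => T z.1 j) (x₀, t) := fun j hj =>
    ContinuousAt.comp (f := Prod.fst) (x := (x₀, t)) (hT j hj) continuousAt_fst
  have hs : ∀ {f g h : X × ℝ → ℝ}, ContinuousAt f (x₀, t) → ContinuousAt g (x₀, t) →
      ContinuousAt h (x₀, t) → ContinuousAt (fun z => V.sol (f z) (g z) (h z)) (x₀, t) :=
    fun hf hg hh => V.continuous_sol.continuousAt.comp (hf.prodMk (hg.prodMk hh))
  refine ContinuousAt.mul (hs (hT' n le_rfl) (hP' n le_rfl)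
    (continuousAt_snd.max (hT' n le_rfl))) (tendsto_finsetProd _ fun j hj => ?_)
  have hj := Finset.mem_range.1 hj
  exact hs (hT' j hj.le) (hP' j hj.le) ((hT' j hj.le).max (continuousAt_snd.min (hT' (j + 1) hj)))

/-- A solution which crosses to negative slope does not stay positive on a half-line. -/
theorem exists_sol_nonpos {a p m b : ℝ} (h : V.IsNext ⊤ a p m b) (hm : 0 < m) :
    ∃ t, a ≤ t ∧ V.sol a p t ≤ 0 := by
  by_contra! hpos
  have hb : 0 < m * V.sol a p b := mul_pos hm (hpos b h.lt.le)
  have hle : ∀ t, b ≤ t → V.sol a p t + m * V.sol a p b * t ≤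
      V.sol a p b + m * V.sol a p b * b := by
    intro t ht
    refine antitoneOn_Ici_of_hasDerivAt (a := b)
      (f := fun t => V.sol a p t + m * V.sol a p b * t)
      (f' := fun t => V.dsol a p t + m * V.sol a p b) (fun t _ => ?_) (fun t ht => ?_)
      self_mem_Ici ht ht
    · refine (((V.isSol_sol a p).hasDerivAt t).add ((hasDerivAt_id t).const_mul _)).congr_deriv ?_
      ring
    · have := (deriv_antitone (V.isSol_sol a p) (a := b) (b := t) fun u hu =>
        hpos u (h.lt.trans hu.1).le).antitoneOn (left_mem_Icc.2 ht) (right_mem_Icc.2 ht) ht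
      rw [h.dsol_eq] at this
      linarith
  set t := b + V.sol a p b / (m * V.sol a p b) with ht
  have hbt : b ≤ t := by
    have := div_pos (hpos b h.lt.le) hb
    linarith
  have h1 := hle t hbt
  have h2 : m * V.sol a p b * t = m * V.sol a p b * b + V.sol a p b := by
    rw [ht, mul_add, mul_div_cancel₀ _ hb.ne']
  linarith [hpos t (h.lt.le.trans hbt)]

end Potential

/-! ### The potential of a surface -/

namespace Background

variable {M N : Type*} [TopologicalSpace M] [ChartedSpace E2 M]
  [IsManifold (𝓡 2) ∞ M] [TopologicalSpace N] [ChartedSpace E3 N] [IsManifold (𝓡 3) ∞ N]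
  [MulAction SymGroup M] [MulAction SymGroup N] (B : Background M N)

/-- The potential of the ordinary differential equation for rotationally invariant functions. -/
def potential : Potential where
  val s := B.V (0, s)
  smooth := B.contDiff_V.comp (by fun_prop)
  pos _ := B.V_pos _
  even t := B.V_neg 0 t

theorem potential_val (s : ℝ) : B.potential.val s = B.V (0, s) := rfl

theorem l_pos : 0 < B.l := by
  rcases B.sphere_or_torus with ⟨h, -⟩ | ⟨L, hL, h, -⟩
  · rw [h]; simp
  · rw [h]; exact EReal.coe_lt_coe_iff.2 hL

/-- The end solution exists: on a torus the end is a finite point, on a sphere the potential is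
integrable twice. -/
theorem exists_isEnd [T2Space M] [CompactSpace M] : ∃ e e', B.potential.IsEnd B.l e e' := by
  rcases B.sphere_or_torus with ⟨h, p₁, p₂, hne, hr, h1, h2⟩ | ⟨L, hL, h, -⟩
  · obtain ⟨s₀, A, J, hA, hJ⟩ := B.exists_iterated_primitives h hne hr h1 h2
    rw [h]
    exact Potential.exists_isEnd_top hA hJ
  · rw [h]
    exact ⟨_, _, B.potential.isEnd_coe L⟩

theorem mem_I {t : ℝ} : t ∈ B.I ↔ ((|t| : ℝ) : EReal) < B.l := Iff.rfl

theorem mem_I_of_nonneg {t : ℝ} (h : 0 ≤ t) : t ∈ B.I ↔ (t : EReal) < B.l := by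
  rw [mem_I, abs_of_nonneg h]

theorem neg_mem_I {t : ℝ} (h : t ∈ B.I) : -t ∈ B.I := by
  rw [mem_I, abs_neg]; exact h

theorem zero_mem_I : (0 : ℝ) ∈ B.I := (B.mem_I_of_nonneg le_rfl).2 B.l_pos

theorem isOpen_I : IsOpen B.I :=
  isOpen_Iio.preimage (continuous_coe_real_ereal.comp continuous_abs)

theorem mem_I_of_abs_le {s t : ℝ} (hs : s ∈ B.I) (h : |t| ≤ |s|) : t ∈ B.I :=
  (EReal.coe_le_coe_iff.2 h).trans_lt hs

theorem mem_I_of_mem_Icc {a b t : ℝ} (ha : a ∈ B.I) (hb : b ∈ B.I) (ht : t ∈ Icc a b) : t ∈ B.I := by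
  rcases le_total 0 t with h | h
  · exact B.mem_I_of_abs_le hb (abs_le_abs_of_nonneg h ht.2)
  · refine B.mem_I_of_abs_le ha ?_
    rw [abs_of_nonpos h, abs_of_nonpos (ht.1.trans h)]
    linarith [ht.1]

theorem exists_lt_mem_I {t : ℝ} (ht : t ∈ B.I) : ∃ b, |t| < b ∧ b ∈ B.I := by
  obtain ⟨b, h1, h2⟩ := EReal.lt_iff_exists_real_btwn.1 ht
  have h1 : |t| < b := EReal.coe_lt_coe_iff.1 h1
  exact ⟨b, h1, (B.mem_I_of_nonneg ((abs_nonneg t).trans h1.le)).2 h2⟩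

/-- A solution on `I` is the restriction of a solution on the line. -/
theorem exists_isSol_of_isSolution {f : ℝ → ℝ} (h : B.IsSolution f) :
    ∃ y y', IsSol B.potential.val y y' ∧ EqOn f y B.I ∧ ∀ t ∈ B.I, deriv f t = y' t := by
  obtain ⟨y, y', hy, y0, y0'⟩ := exists_isSol B.potential.smooth.continuous (f 0) (deriv f 0)
  have heq : EqOn f y B.I := by
    intro t ht
    obtain ⟨b, htb, hb⟩ := B.exists_lt_mem_I ht
    have hb0 : 0 < b := (abs_nonneg t).trans_lt htb
    have hsub : Icc (-b) b ⊆ B.I := fun s hs => B.mem_I_of_mem_Icc (B.neg_mem_I hb) hb hs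
    obtain ⟨w, w', hw, hfw⟩ := Potential.exists_isSol_eqOn (V := B.potential) (a := -b) (b := b)
      (by linarith) (h.1.mono hsub) fun s hs => h.2 s (hsub (Ioo_subset_Icc_self hs))
    have hev : f =ᶠ[𝓝 0] w := by
      filter_upwards [Icc_mem_nhds (show -b < 0 by linarith) hb0] with s hs using hfw hs
    have hwy := hw.ext (V := B.potential) hy (a := 0) (by rw [y0, hev.eq_of_nhds])
      (by rw [y0', hev.deriv_eq, (hw.hasDerivAt 0).deriv])
    rw [hfw ⟨by linarith [neg_abs_le t], by linarith [le_abs_self t]⟩, hwy.1]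
  refine ⟨y, y', hy, heq, fun t ht => ?_⟩
  have hev : f =ᶠ[𝓝 t] y := by
    filter_upwards [B.isOpen_I.mem_nhds ht] with s hs using heq hs
  rw [hev.deriv_eq, (hy.hasDerivAt t).deriv]

theorem _root_.RLD.IsSol.iteratedDeriv_two {V y y' : ℝ → ℝ} (h : IsSol V y y') (t : ℝ) :
    iteratedDeriv 2 y t = -(V t * y t) := by
  rw [iteratedDeriv_succ, iteratedDeriv_one, funext fun t => (h.hasDerivAt t).deriv]
  exact (h.hasDerivAt' t).deriv

theorem isSolution_of_isSol {y y' : ℝ → ℝ} (h : IsSol B.potential.val y y') : B.IsSolution y :=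
  ⟨(h.contDiff B.potential.smooth).1.contDiffOn, fun t _ => by
    rw [h.iteratedDeriv_two, potential_val]; ring⟩

/-- The chosen even solution agrees on `I` with the solution with data `(1, 0)` at `0`. -/
theorem phiEven_eq : EqOn B.phiEven (B.potential.sol 0 0) B.I ∧
    ∀ t ∈ B.I, deriv B.phiEven t = B.potential.dsol 0 0 t := by
  have hs := B.potential.isSol_sol 0 0
  have hspec : B.IsSolution B.phiEven ∧ B.phiEven 0 = 1 ∧ deriv B.phiEven 0 = 0 :=
    Classical.epsilon_spec (p := fun f => B.IsSolution f ∧ f 0 = 1 ∧ deriv f 0 = 0)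
      ⟨_, B.isSolution_of_isSol hs, by simp, by rw [(hs.hasDerivAt 0).deriv]; simp⟩
  obtain ⟨y, y', hy, h1, h2⟩ := B.exists_isSol_of_isSolution hspec.1
  have := hy.ext (V := B.potential) hs (a := 0)
    (by rw [← h1 B.zero_mem_I, hspec.2.1]; simp) (by rw [← h2 0 B.zero_mem_I, hspec.2.2]; simp)
  rw [this.1] at h1
  rw [this.2] at h2
  exact ⟨h1, h2⟩

theorem atEnd_mem_I : ∀ᶠ t in endFilter B.l, t ∈ B.I :=
  (mem_endFilter B.l_pos).2 ⟨0, B.l_pos, fun _ h1 h2 => (B.mem_I_of_nonneg h1.le).2 h2⟩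

/-- The chosen end solution agrees on `I` with any end solution of the equation on the line. -/
theorem phiEnd_eq {e e' : ℝ → ℝ} (he : B.potential.IsEnd B.l e e') :
    EqOn B.phiEnd e B.I ∧ ∀ t ∈ B.I, deriv B.phiEnd t = e' t := by
  have hd : deriv e = e' := funext fun t => (he.isSol.hasDerivAt t).deriv
  have hspec : B.IsSolution B.phiEnd ∧ Tendsto B.phiEnd B.atEnd (𝓝 1) ∧
      Tendsto (fun t => deriv B.phiEnd t / B.phiEnd t) B.atEnd (𝓝 0) :=
    Classical.epsilon_spec (p := fun f => B.IsSolution f ∧ Tendsto f B.atEnd (𝓝 1) ∧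
      Tendsto (fun t => deriv f t / f t) B.atEnd (𝓝 0))
      ⟨e, B.isSolution_of_isSol he.isSol, he.tendsto, by
        rw [hd]
        have := he.tendsto'.div he.tendsto one_ne_zero
        rw [zero_div] at this
        exact this⟩
  obtain ⟨y, y', hy, h1, h2⟩ := B.exists_isSol_of_isSolution hspec.1
  have hneBot := endFilter_neBot B.l_pos
  have hy1 : Tendsto y (endFilter B.l) (𝓝 1) := hspec.2.1.congr' (by
    filter_upwards [B.atEnd_mem_I] with t ht using h1 ht)
  have hy2 : Tendsto y' (endFilter B.l) (𝓝 0) := by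
    have := hspec.2.2.mul hspec.2.1
    rw [zero_mul] at this
    refine this.congr' ?_
    filter_upwards [B.atEnd_mem_I, hspec.2.1.eventually_ne one_ne_zero] with t ht ht0
    rw [div_mul_cancel₀ _ ht0, h2 t ht]
  -- the Wronskian of the two solutions tends to `0`, and is constant
  have hW : ∀ t, y' t * e t - y t * e' t = 0 := by
    have hlim : Tendsto (fun t => y' t * e t - y t * e' t) (endFilter B.l) (𝓝 0) := by
      simpa using (hy2.mul he.tendsto).sub (hy1.mul he.tendsto')
    intro t
    refine tendsto_nhds_unique (tendsto_const_nhds.congr fun s => ?_) hlim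
    exact hy.wronskian he.isSol t s
  obtain ⟨a, ha, hae⟩ := he.eventually_pos B.l_pos
  obtain ⟨r, hr1, hr⟩ := EReal.lt_iff_exists_real_btwn.1 ha
  have her := (hae r (EReal.coe_lt_coe_iff.1 hr1) hr).1
  have hye := hy.ext (V := B.potential) (he.isSol.const_mul (y r / e r)) (a := r)
    (div_mul_cancel₀ _ her.ne').symm (by
      have := hW r
      field_simp
      linarith)
  have hκ : y r / e r = 1 := by
    have h3 : Tendsto (fun t => y r / e r * e t) (endFilter B.l) (𝓝 (y r / e r * 1)) :=
      he.tendsto.const_mul _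
    rw [← hye.1, mul_one] at h3
    exact tendsto_nhds_unique h3 hy1
  rw [hκ] at hye
  simp only [one_mul] at hye
  rw [hye.1] at h1
  rw [hye.2] at h2
  exact ⟨h1, h2⟩

/-- `F < F_max` means that the flux of `φ_even` reaches the value `F` before the end. -/
theorem lt_Fmax_iff {F : ℝ} (hF : 0 < F) :
    (F : EReal) < B.Fmax ↔ ∃ b, B.potential.IsNext B.l 0 0 F b := by
  obtain ⟨h1, h2⟩ := B.phiEven_eq
  set y := B.potential.sol 0 0 with hy
  set y' := B.potential.dsol 0 0 with hy'
  by_cases hpos : ∀ t ∈ B.I, 0 < B.phiEven t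
  · have hypos : ∀ t ∈ B.I, 0 < y t := fun t ht => h1 ht ▸ hpos t ht
    -- the flux is increasing, so its limit is its supremum
    set g : ℝ → EReal := fun t => ((-y' t / y t : ℝ) : EReal) with hg
    have hmono : ∀ s t : ℝ, 0 ≤ s → s < t → (t : EReal) < B.l → g s < g t := by
      intro s t hs hst ht
      have ht' : t ∈ B.I := (B.mem_I_of_nonneg (hs.trans hst.le)).2 ht
      have := (B.potential.isSol_sol 0 0).log_deriv_lt B.potential.pos hst fun u hu =>
        hypos u (B.mem_I_of_mem_Icc B.zero_mem_I ht' ⟨hs.trans hu.1, hu.2⟩)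
      refine EReal.coe_lt_coe_iff.2 ?_
      rw [neg_div, neg_div]
      linarith
    have hFmax : B.Fmax = ⨆ t : {t : ℝ // 0 ≤ t ∧ (t : EReal) < B.l}, g t := by
      rw [Fmax, if_pos hpos]
      have hneBot : B.atEnd.NeBot := endFilter_neBot B.l_pos
      refine Tendsto.limUnder_eq (Tendsto.congr' (f₁ := g) ?_ (tendsto_order.2 ⟨fun u hu => ?_,
        fun u hu => ?_⟩))
      · filter_upwards [B.atEnd_mem_I] with t ht
        rw [h1 ht, h2 t ht]
      · obtain ⟨⟨t, ht0, ht⟩, htu⟩ := lt_iSup_iff.1 hu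
        exact (mem_endFilter B.l_pos).2 ⟨t, ht, fun s hts hs => htu.trans (hmono t s ht0 hts hs)⟩
      · exact (mem_endFilter B.l_pos).2 ⟨0, B.l_pos, fun s h0s hs => lt_of_le_of_lt
          (le_iSup (fun t : {t : ℝ // 0 ≤ t ∧ (t : EReal) < B.l} => g t) ⟨s, h0s.le, hs⟩) hu⟩
    rw [hFmax, lt_iSup_iff]
    constructor
    · rintro ⟨⟨t, ht0, ht⟩, hlt⟩
      have hlt : F < -y' t / y t := EReal.coe_lt_coe_iff.1 hlt
      rw [lt_div_iff₀ (hypos t ((B.mem_I_of_nonneg ht0).2 ht))] at hlt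
      obtain ⟨b, -, hb⟩ := Potential.exists_isNext (V := B.potential) (a := 0) (p := 0) (m := F)
        (by linarith) ht0 ht (by linarith)
      exact ⟨b, hb⟩
    · rintro ⟨b, hb⟩
      obtain ⟨d, hd1, hd⟩ := EReal.lt_iff_exists_real_btwn.1 hb.lt_end
      have hbd : b < d := EReal.coe_lt_coe_iff.1 hd1
      refine ⟨⟨d, (hb.lt.trans hbd).le, hd⟩, ?_⟩
      have := hmono b d hb.lt.le hbd hd
      rw [hg] at this
      simp only at this
      rw [hy, hy', hb.dsol_eq, neg_neg,
        mul_div_cancel_right₀ _ (hb.sol_pos b (right_mem_Icc.2 hb.lt.le)).ne'] at this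
      exact this
  · rw [Fmax, if_neg hpos]
    refine iff_of_true (EReal.coe_lt_top F) ?_
    by_contra! hn
    refine hpos fun t ht => ?_
    rw [h1 ht]
    have habs : y t = y |t| := by
      rcases abs_choice t with h | h <;> rw [h]
      exact (Potential.sol_zero_even t).symm
    rw [habs]
    exact (Potential.cross_pos_of_not_exists (by linarith) hn (abs_nonneg t) ht).2

/-- The parametrization is an open map, since its differential is invertible. -/
theorem image_mem_nhds [T2Space M] {z : ℝ × ℝ} {W : Set (ℝ × ℝ)} (hW : W ∈ 𝓝 z) :
    B.x '' W ∈ 𝓝 (B.x z) := by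
  obtain ⟨O, ψ, C, δ, hO, hC, -, hinj, hcont, -, hest⟩ := B.chart_estimates (B.x z)
  obtain ⟨hsm, L, hL, hdet, -⟩ := hest z (mem_of_mem_nhds hO)
  have hdet : L.det ≠ 0 := by
    intro h0
    rw [h0, abs_zero, mul_zero] at hdet
    exact absurd (B.x_conformal z).1 (not_lt.2 hdet)
  have hstrict := hsm.hasStrictFDerivAt (by simp)
  rw [hL.fderiv] at hstrict
  have hxc : ContinuousAt B.x z := B.x_smooth.continuous.continuousAt
  have hmap := hstrict.map_nhds_eq_of_surj (by
    have : LinearMap.range (L : ℝ × ℝ →ₗ[ℝ] ℝ × ℝ) = ⊤ :=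
      LinearMap.range_eq_top.2 (LinearMap.equivOfDetNeZero (L : ℝ × ℝ →ₗ[ℝ] ℝ × ℝ) hdet).surjective
    exact this)
  have hW' : W ∩ B.x ⁻¹' O ∈ 𝓝 z := inter_mem hW (hxc hO)
  have h1 : (fun z => ψ (B.x z)) '' (W ∩ B.x ⁻¹' O) ∈ 𝓝 (ψ (B.x z)) := by
    rw [← hmap]; exact image_mem_map hW'
  have h2 : ContinuousAt ψ (B.x z) := hcont.continuousAt hO
  filter_upwards [h2 h1, hO] with p hp hpO
  obtain ⟨w, ⟨hwW, hwO⟩, hwp⟩ := hp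
  exact ⟨w, hwW, hinj hwO hpO hwp⟩

end Background

/-! ### Solutions from profiles -/

theorem exists_index {T : ℕ → ℝ} {n : ℕ} {t : ℝ} (h0 : T 0 ≤ t) :
    ∃ j ≤ n, T j ≤ t ∧ (j < n → t < T (j + 1)) := by
  induction n with
  | zero => exact ⟨0, le_rfl, h0, fun h => absurd h (lt_irrefl _)⟩
  | succ n ih =>
    obtain ⟨j, hj, h1, h2⟩ := ih
    rcases hj.lt_or_eq with h3 | rfl
    · exact ⟨j, by omega, h1, fun _ => h2 h3⟩
    · by_cases h4 : t < T (j + 1)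
      · exact ⟨j, by omega, h1, fun _ => h4⟩
      · exact ⟨j + 1, le_rfl, not_lt.1 h4, fun h => absurd h (lt_irrefl _)⟩

/-- An orthogonal matrix maps the unit circle to itself. -/
theorem exists_angle_of_orthogonal (A : Matrix.orthogonalGroup (Fin 2) ℝ) (ϑ : ℝ) :
    ∃ ϑ', A.1.mulVec ![Real.cos ϑ, Real.sin ϑ] = ![Real.cos ϑ', Real.sin ϑ'] := by
  set u := A.1 0 0 * Real.cos ϑ + A.1 0 1 * Real.sin ϑ with hu
  set v := A.1 1 0 * Real.cos ϑ + A.1 1 1 * Real.sin ϑ with hv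
  have hA := (Matrix.mem_orthogonalGroup_iff' (Fin 2) ℝ).1 A.2
  have e1 := congrFun (congrFun hA 0) 0
  have e2 := congrFun (congrFun hA 0) 1
  have e3 := congrFun (congrFun hA 1) 1
  simp only [Matrix.mul_apply, Fin.sum_univ_two, Matrix.transpose_apply, Matrix.one_apply_eq, ne_eq, zero_ne_one,
    not_false_eq_true, Matrix.one_apply_ne] at e1 e2 e3
  have huv : u ^ 2 + v ^ 2 = 1 := by
    rw [hu, hv]
    linear_combination Real.cos ϑ ^ 2 * e1 + 2 * Real.cos ϑ * Real.sin ϑ * e2 +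
      Real.sin ϑ ^ 2 * e3 + Real.sin_sq_add_cos_sq ϑ
  have hnorm : ‖(⟨u, v⟩ : ℂ)‖ = 1 := by
    rw [Complex.norm_def, Complex.normSq_mk, ← sq, ← sq, huv, Real.sqrt_one]
  have hne : (⟨u, v⟩ : ℂ) ≠ 0 := fun h => by rw [h, norm_zero] at hnorm; norm_num at hnorm
  refine ⟨Complex.arg ⟨u, v⟩, ?_⟩
  rw [Complex.cos_arg hne, Complex.sin_arg, hnorm]
  ext i
  fin_cases i <;> simp [Matrix.mulVec, dotProduct, Fin.sum_univ_two, hu, hv]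

namespace Potential

variable (V : Potential)

/-- The data of a rotationally invariant solution: a chain beginning at `0`, continued up to the end
by a positive solution. The index `d` says whether `T 0 = 0` is a jump latitude (`d = 0`) or
the solution is smooth at `0` (`d = 1`). -/
structure IsProfile (l : EReal) (P M T : ℕ → ℝ) (n d : ℕ) : Prop where
  zero : T 0 = 0
  chain : V.IsChain l P M T n
  last : ∀ t : ℝ, T n ≤ t → (t : EReal) < l → 0 < V.sol (T n) (P n) t
  parity : (d = 1 ∧ 1 ≤ n ∧ P 0 = 0) ∨ d = 0
  P_pos : ∀ j, d ≤ j → j ≤ n → 0 < P j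
  M_pos : ∀ j, 1 ≤ j → j ≤ n → 0 < M j

variable {V} {l : EReal} {P M T : ℕ → ℝ} {n d : ℕ}

theorem IsProfile.le_succ (h : V.IsProfile l P M T n d) : ∀ i < n, T i ≤ T (i + 1) :=
  fun i hi => (h.chain i hi).lt.le

theorem IsProfile.nonneg (h : V.IsProfile l P M T n d) {j : ℕ} (hj : j ≤ n) : 0 ≤ T j :=
  h.zero ▸ h.chain.le (Nat.zero_le j) hj

theorem IsProfile.d_le (h : V.IsProfile l P M T n d) : d ≤ n ∧ d ≤ 1 := by
  rcases h.parity with h | h <;> omega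

/-- Between the circles, the profile extended evenly solves the equation. -/
theorem IsProfile.exists_isSol (h : V.IsProfile l P M T n d) {a b : ℝ} (hab : a < b)
    (hT : ∀ j, d ≤ j → j ≤ n → T j ∉ Ioo a b ∧ -T j ∉ Ioo a b) :
    ∃ y y', IsSol V.val y y' ∧ ∀ t ∈ Icc a b, V.prof P T n |t| = y t := by
  have key : ∀ a b : ℝ, 0 ≤ a → a < b → (∀ j, d ≤ j → j ≤ n → T j ∉ Ioo a b) →
      ∃ y y', IsSol V.val y y' ∧ ∀ t ∈ Icc a b, V.prof P T n |t| = y t := by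
    intro a b ha hab hT
    obtain ⟨j, hj, h1, h2⟩ := exists_index (n := n) (h.zero.trans_le ha)
    refine ⟨_, _, (V.isSol_sol (T j) (P j)).const_mul (V.prof P T n (T j)), fun t ht => ?_⟩
    rw [abs_of_nonneg (ha.trans ht.1)]
    refine prof_eq hj h.le_succ (h1.trans ht.1) fun hlt => ht.2.trans ?_
    by_contra hb
    exact hT (j + 1) (by have := h.d_le; omega) hlt ⟨h2 hlt, not_le.1 hb⟩
  rcases le_or_gt 0 a with ha | ha
  · exact key a b ha hab fun j h1 h2 => (hT j h1 h2).1
  rcases le_or_gt b 0 with hb | hb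
  · obtain ⟨y, y', hy, hyt⟩ := key (-b) (-a) (by linarith) (by linarith) fun j h1 h2 h3 =>
      (hT j h1 h2).2 ⟨by linarith [h3.2], by linarith [h3.1]⟩
    refine ⟨_, _, hy.reflect, fun t ht => ?_⟩
    rw [← hyt (-t) ⟨by linarith [ht.2], by linarith [ht.1]⟩, abs_neg]
  · rcases h.parity with ⟨rfl, hn, hP0⟩ | rfl
    · have h1 := hT 1 le_rfl hn
      have hT1 : 0 < T 1 := h.zero ▸ h.chain.lt (Nat.zero_lt_one) hn
      have hb1 : b ≤ T 1 := by
        by_contra hb'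
        exact h1.1 ⟨ha.trans hT1, not_le.1 hb'⟩
      have ha1 : -a ≤ T 1 := by
        by_contra ha'
        exact h1.2 ⟨by linarith, by linarith⟩
      refine ⟨_, _, V.isSol_sol 0 0, fun t ht => ?_⟩
      have ht1 : |t| ≤ T 1 := abs_le.2 ⟨by linarith [ht.1], by linarith [ht.2]⟩
      rw [prof_eq (Nat.zero_le n) h.le_succ (h.zero.trans_le (abs_nonneg t)) fun _ => ht1, h.zero,
        prof_zero h.zero h.le_succ, hP0, one_mul]
      rcases abs_choice t with h | h <;> rw [h]
      exact sol_zero_even t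
    · exact absurd ⟨by rw [h.zero]; exact ha, by rw [h.zero]; exact hb⟩ (hT 0 le_rfl (Nat.zero_le n)).1

end Potential

namespace Background

variable {M N : Type*} [TopologicalSpace M] [ChartedSpace E2 M]
  [IsManifold (𝓡 2) ∞ M] [TopologicalSpace N] [ChartedSpace E3 N] [IsManifold (𝓡 3) ∞ N]
  [MulAction SymGroup M] [MulAction SymGroup N] (B : Background M N)

/-- The symmetric function on the surface with a given profile on `[0, l)`. -/
def radial (f : ℝ → ℝ) (p : M) : ℝ :=
  f |Classical.epsilon fun s : ℝ => s ∈ B.I ∧ ∃ ϑ, B.x (ϑ, s) = p|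

theorem radial_x (f : ℝ → ℝ) {s : ℝ} (hs : s ∈ B.I) (ϑ : ℝ) : B.radial f (B.x (ϑ, s)) = f |s| := by
  obtain ⟨h1, ϑ', h2⟩ := Classical.epsilon_spec
    (p := fun s' : ℝ => s' ∈ B.I ∧ ∃ ϑ', B.x (ϑ', s') = B.x (ϑ, s)) ⟨s, hs, ϑ, rfl⟩
  rw [radial, (B.x_injective _ _ _ _ h1 hs h2).1]

theorem exists_smul_x (a : SymGroup) (ϑ s : ℝ) : ∃ ϑ' s', |s'| = |s| ∧
    a • B.x (ϑ, s) = B.x (ϑ', s') := by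
  obtain ⟨A, ε⟩ := a
  obtain ⟨ϑ', h⟩ := exists_angle_of_orthogonal A ϑ
  refine ⟨ϑ', _, ?_, B.x_equivariant A ε ϑ ϑ' s h⟩
  rcases Int.units_eq_one_or ε with rfl | rfl <;> simp

theorem x_mem_Ω {s : ℝ} (hs : s ∈ B.I) (ϑ : ℝ) : B.x (ϑ, s) ∈ B.Ω :=
  mem_image_of_mem _ ⟨mem_univ _, hs⟩

theorem radial_smul (f : ℝ → ℝ) (a : SymGroup) {p : M} (hp : p ∈ B.Ω) :
    B.radial f (a • p) = B.radial f p := by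
  obtain ⟨⟨ϑ, s⟩, ⟨-, hs⟩, rfl⟩ := hp
  obtain ⟨ϑ', s', hs', h⟩ := B.exists_smul_x a ϑ s
  have hsI : s' ∈ B.I := B.mem_I_of_abs_le hs hs'.le
  rw [h, B.radial_x f hs, B.radial_x f hsI, hs']

theorem continuousOn_radial [T2Space M] {f : ℝ → ℝ} (hf : Continuous f) :
    ContinuousOn (B.radial f) B.Ω := by
  rintro _ ⟨⟨ϑ, s⟩, ⟨-, hs⟩, rfl⟩
  refine ContinuousAt.continuousWithinAt fun W hW => ?_
  rw [B.radial_x f hs] at hW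
  have h1 : ∀ᶠ z : ℝ × ℝ in 𝓝 (ϑ, s), f |z.2| ∈ W ∧ z.2 ∈ B.I :=
    (((hf.comp (continuous_abs.comp continuous_snd)).tendsto (ϑ, s)).eventually hW).and
      ((continuous_snd.tendsto (ϑ, s)).eventually (B.isOpen_I.mem_nhds hs))
  rw [mem_map]
  filter_upwards [B.image_mem_nhds h1] with p hp
  obtain ⟨⟨ϑ', s'⟩, ⟨hW', hs'⟩, rfl⟩ := hp
  rw [mem_preimage, B.radial_x f hs']
  exact hW'

section Flux

variable {B} {φ : M → ℝ} {y y' : ℝ → ℝ} {V : ℝ → ℝ} {a b : ℝ}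

theorem fluxP_eq (hy : IsSol V y y') (hab : a < b) (h : ∀ t ∈ Icc a b, B.profile φ t = y t) :
    B.fluxP φ a = y' a / y a := by
  have hd : HasDerivWithinAt (B.profile φ) (y' a) (Ici a) a := by
    refine (hy.hasDerivAt a).hasDerivWithinAt.congr_of_eventuallyEq ?_ (h a (left_mem_Icc.2 hab.le))
    filter_upwards [Icc_mem_nhdsGE hab] with t ht using h t ht
  rw [fluxP, hd.derivWithin (uniqueDiffOn_Ici a a self_mem_Ici), h a (left_mem_Icc.2 hab.le)]

theorem fluxM_eq (hy : IsSol V y y') (hab : a < b) (h : ∀ t ∈ Icc a b, B.profile φ t = y t) :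
    B.fluxM φ b = -y' b / y b := by
  have hd : HasDerivWithinAt (B.profile φ) (y' b) (Iic b) b := by
    refine (hy.hasDerivAt b).hasDerivWithinAt.congr_of_eventuallyEq ?_ (h b (right_mem_Icc.2 hab.le))
    filter_upwards [Icc_mem_nhdsLE hab] with t ht using h t ht
  rw [fluxM, hd.derivWithin (uniqueDiffOn_Iic b b self_mem_Iic), h b (right_mem_Icc.2 hab.le)]

end Flux

variable {B} {P m T : ℕ → ℝ} {n d : ℕ}

theorem profile_radial (f : ℝ → ℝ) {t : ℝ} (ht : t ∈ B.I) : B.profile (B.radial f) t = f |t| :=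
  B.radial_x f ht 0

theorem _root_.RLD.Potential.IsProfile.mem_I (h : B.potential.IsProfile B.l P m T n d) {j : ℕ}
    (hj : j ≤ n) : T j ∈ B.I :=
  (B.mem_I_of_nonneg (h.nonneg hj)).2 (h.chain.lt_end hj (by rw [h.zero]; exact B.l_pos))

theorem _root_.RLD.Potential.IsProfile.prof_pos' (h : B.potential.IsProfile B.l P m T n d) {t : ℝ}
    (ht : t ∈ B.I) : 0 < B.potential.prof P T n |t| :=
  Potential.prof_pos h.chain h.last ht

/-- Up to the next circle, or a little beyond the last one, the profile is a multiple of one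
solution. -/
theorem _root_.RLD.Potential.IsProfile.exists_right (h : B.potential.IsProfile B.l P m T n d) {j : ℕ}
    (hj : j ≤ n) : ∃ b, T j < b ∧ b ∈ B.I ∧ (j < n → b = T (j + 1)) ∧ ∀ t ∈ Icc (T j) b,
      B.profile (B.radial (B.potential.prof P T n)) t =
        B.potential.prof P T n (T j) * B.potential.sol (T j) (P j) t := by
  obtain ⟨b, hb, hbI, hb'⟩ : ∃ b, T j < b ∧ b ∈ B.I ∧ (j < n → b = T (j + 1)) := by
    rcases hj.lt_or_eq with hlt | rfl
    · exact ⟨_, (h.chain j hlt).lt, h.mem_I (by omega), fun _ => rfl⟩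
    · obtain ⟨b, hb, hbI⟩ := B.exists_lt_mem_I (h.mem_I hj)
      exact ⟨b, (le_abs_self _).trans_lt hb, hbI, fun hlt => absurd hlt (lt_irrefl _)⟩
  refine ⟨b, hb, hbI, hb', fun t ht => ?_⟩
  rw [profile_radial _ (B.mem_I_of_mem_Icc (h.mem_I hj) hbI ht),
    abs_of_nonneg ((h.nonneg hj).trans ht.1)]
  exact Potential.prof_eq hj h.le_succ ht.1 fun hlt => hb' hlt ▸ ht.2

theorem _root_.RLD.Potential.IsProfile.fluxP_eq (h : B.potential.IsProfile B.l P m T n d) {j : ℕ}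
    (hj : j ≤ n) : B.fluxP (B.radial (B.potential.prof P T n)) (T j) = P j := by
  obtain ⟨b, hb, -, -, hf⟩ := h.exists_right hj
  have hpos := h.prof_pos' (h.mem_I hj)
  rw [abs_of_nonneg (h.nonneg hj)] at hpos
  rw [Background.fluxP_eq ((B.potential.isSol_sol (T j) (P j)).const_mul _) hb hf,
    Potential.sol_self, Potential.dsol_self, mul_one, mul_div_cancel_left₀ _ hpos.ne']

theorem _root_.RLD.Potential.IsProfile.fluxM_eq (h : B.potential.IsProfile B.l P m T n d) {j : ℕ}
    (hj : j < n) : B.fluxM (B.radial (B.potential.prof P T n)) (T (j + 1)) = m (j + 1) := by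
  obtain ⟨b, hb, -, hb', hf⟩ := h.exists_right hj.le
  have hpos := h.prof_pos' (h.mem_I hj.le)
  rw [abs_of_nonneg (h.nonneg hj.le)] at hpos
  have hn := h.chain j hj
  rw [hb' hj] at hb hf
  rw [Background.fluxM_eq ((B.potential.isSol_sol (T j) (P j)).const_mul _) hb hf, hn.dsol_eq,
    mul_neg, neg_neg, mul_div_mul_left _ _ hpos.ne',
    mul_div_cancel_right₀ _ (hn.sol_pos _ (right_mem_Icc.2 hn.lt.le)).ne']

theorem _root_.RLD.Potential.IsProfile.fluxM_zero (h : B.potential.IsProfile B.l P m T n d) :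
    B.fluxM (B.radial (B.potential.prof P T n)) 0 = P 0 := by
  obtain ⟨b, hb, hbI, -, hf⟩ := h.exists_right (Nat.zero_le n)
  rw [h.zero] at hb hf
  have hone : B.potential.prof P T n 0 = 1 := Potential.prof_zero h.zero h.le_succ
  simp only [hone, one_mul] at hf
  have hf' : ∀ t ∈ Icc (-b) 0, B.profile (B.radial (B.potential.prof P T n)) t =
      B.potential.sol 0 (P 0) (-t) := fun t ht => by
    rw [← hf (-t) ⟨by linarith [ht.2], by linarith [ht.1]⟩]
    have htI : t ∈ B.I := B.mem_I_of_mem_Icc (B.neg_mem_I hbI) B.zero_mem_I ht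
    rw [profile_radial _ htI, profile_radial _ (B.neg_mem_I htI), abs_neg]
  have := Background.fluxM_eq (B := B) (B.potential.isSol_sol 0 (P 0)).reflect
    (a := -b) (b := 0) (by linarith) hf'
  rw [this]
  simp

/-- A profile gives an RLD solution. -/
theorem _root_.RLD.Potential.IsProfile.isRLD [T2Space M] (h : B.potential.IsProfile B.l P m T n d) :
    B.IsRLD (B.radial (B.potential.prof P T n)) (n + 1 - d) (fun i => T (i + d)) where
  k_pos := by have := h.d_le; omega
  s_nonneg := h.nonneg (by have := h.d_le; omega)
  s_lt i hi := h.chain.lt (by omega) (by omega)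
  s_mem i hi := h.mem_I (by omega)
  invariant a p hp := B.radial_smul _ a hp
  continuousOn := B.continuousOn_radial Potential.continuous_prof
  pos := by
    rintro _ ⟨⟨ϑ, s⟩, ⟨-, hs⟩, rfl⟩
    rw [B.radial_x _ hs]
    exact h.prof_pos' hs
  smooth a ha b hb hab hs := by
    obtain ⟨y, y', hy, hyt⟩ := h.exists_isSol hab fun j h1 h2 => by
      have := hs (j - d) (by omega)
      rwa [Nat.sub_add_cancel h1] at this
    refine ((hy.contDiff B.potential.smooth).1.comp contDiff_snd).contDiffOn.congr
      fun z hz => ?_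
    rw [Function.comp_apply, ← hyt z.2 hz.2]
    exact B.radial_x _ (B.mem_I_of_mem_Icc ha hb hz.2) z.1
  equation ϑ t ht hs := by
    have hfin : ({u : ℝ | ∃ i < n + 1 - d, u = T (i + d) ∨ u = -T (i + d)}).Finite := by
      refine ((Set.finite_Iio (n + 1 - d)).biUnion (t := fun i => {T (i + d), -T (i + d)})
        fun i _ => Set.toFinite _).subset ?_
      rintro u ⟨i, hi, hu⟩
      exact mem_biUnion (mem_Iio.2 hi) hu
    have hmem : t ∉ {u : ℝ | ∃ i < n + 1 - d, u = T (i + d) ∨ u = -T (i + d)} := by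
      rintro ⟨i, hi, h1 | h1⟩
      · exact (hs i hi).1 h1
      · exact (hs i hi).2 h1
    obtain ⟨ε, hε, hball⟩ := Metric.mem_nhds_iff.1 (inter_mem
      (hfin.isClosed.isOpen_compl.mem_nhds hmem) (B.isOpen_I.mem_nhds ht))
    have hsub : Icc (t - ε / 2) (t + ε / 2) ⊆ Metric.ball t ε := fun u hu => by
      rw [Metric.mem_ball, Real.dist_eq, abs_lt]
      constructor <;> linarith [hu.1, hu.2]
    obtain ⟨y, y', hy, hyt⟩ := h.exists_isSol (a := t - ε / 2) (b := t + ε / 2) (by linarith)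
      fun j h1 h2 => by
        refine ⟨fun h3 => (hball (hsub (Ioo_subset_Icc_self h3))).1 ⟨j - d, by omega, ?_⟩,
          fun h3 => (hball (hsub (Ioo_subset_Icc_self h3))).1 ⟨j - d, by omega, ?_⟩⟩ <;>
        rw [Nat.sub_add_cancel h1]
        · exact Or.inl rfl
        · exact Or.inr rfl
    have hev : (fun s => B.radial (B.potential.prof P T n) (B.x (ϑ, s))) =ᶠ[𝓝 t] y := by
      filter_upwards [Icc_mem_nhds (show t - ε / 2 < t by linarith)
        (show t < t + ε / 2 by linarith)] with u hu
      rw [B.radial_x _ (hball (hsub hu)).2, hyt u hu]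
    have hconst : (fun ϑ => B.radial (B.potential.prof P T n) (B.x (ϑ, t))) =
        fun _ => B.potential.prof P T n |t| := funext fun ϑ => B.radial_x _ ht ϑ
    simp only [Lchi]
    rw [hconst, hev.iteratedDeriv_eq, hy.iteratedDeriv_two, B.V_rotation, potential_val,
      hev.eq_of_nhds, iteratedDeriv_const]
    simp
  fluxM_pos i hi := by
    rcases Nat.eq_zero_or_pos (i + d) with h0 | h0
    · rw [h0, h.zero, h.fluxM_zero]
      exact h.P_pos 0 (by omega) (Nat.zero_le n)
    · have := h.fluxM_eq (j := i + d - 1) (by omega)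
      rw [Nat.sub_add_cancel h0] at this
      rw [this]
      exact h.M_pos _ h0 (by omega)
  fluxP_pos i hi := by
    rw [h.fluxP_eq (by omega)]
    exact h.P_pos _ (by omega) (by omega)

theorem _root_.RLD.Potential.IsProfile.isUnit (h : B.potential.IsProfile B.l P m T n d) :
    B.IsUnit (B.radial (B.potential.prof P T n)) := by
  rw [IsUnit, profile_radial _ B.zero_mem_I, abs_zero]
  exact Potential.prof_zero h.zero h.le_succ

end Background

/-! ### Profiles from solutions -/

namespace Background

variable {M N : Type*} [TopologicalSpace M] [ChartedSpace E2 M]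
  [IsManifold (𝓡 2) ∞ M] [TopologicalSpace N] [ChartedSpace E3 N] [IsManifold (𝓡 3) ∞ N]
  [MulAction SymGroup M] [MulAction SymGroup N] {B : Background M N}

variable {φ : M → ℝ} {k : ℕ} {s : ℕ → ℝ}

namespace IsRLD

/-- An invariant function is determined by its profile. -/
theorem apply_x (h : B.IsRLD φ k s) {t : ℝ} (ht : t ∈ B.I) (ϑ : ℝ) :
    φ (B.x (ϑ, t)) = B.profile φ |t| := by
  have h1 : φ (B.x (ϑ, t)) = φ (B.x (0, t)) := by
    have := h.invariant (rotation ϑ, 1) _ (B.x_mem_Ω ht 0)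
    rwa [← B.x_rotation, zero_add] at this
  rw [h1, profile]
  rcases abs_choice t with h2 | h2 <;> rw [h2]
  rw [B.x_reflection, h.invariant _ _ (B.x_mem_Ω ht 0)]

theorem profile_neg (h : B.IsRLD φ k s) {t : ℝ} (ht : t ∈ B.I) :
    B.profile φ (-t) = B.profile φ t := by
  have h1 := h.apply_x ht 0
  have h2 := h.apply_x (B.neg_mem_I ht) 0
  rw [abs_neg, ← h1] at h2
  exact h2

theorem profile_pos (h : B.IsRLD φ k s) {t : ℝ} (ht : t ∈ B.I) : 0 < B.profile φ t :=
  h.pos _ (B.x_mem_Ω ht 0)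

theorem s_lt' (h : B.IsRLD φ k s) {i j : ℕ} (hij : i < j) (hj : j < k) : s i < s j := by
  induction j with
  | zero => omega
  | succ j ih =>
    rcases Nat.lt_succ_iff_lt_or_eq.1 hij with h1 | rfl
    · exact (ih h1 (by omega)).trans (h.s_lt j hj)
    · exact h.s_lt i hj

theorem s_le (h : B.IsRLD φ k s) {i j : ℕ} (hij : i ≤ j) (hj : j < k) : s i ≤ s j := by
  rcases hij.eq_or_lt with rfl | h1
  · exact le_rfl
  · exact (h.s_lt' h1 hj).le

theorem nonneg (h : B.IsRLD φ k s) {i : ℕ} (hi : i < k) : 0 ≤ s i :=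
  h.s_nonneg.trans (h.s_le (Nat.zero_le i) hi)

/-- On an interval between circles, the profile is a multiple of one solution. -/
theorem exists_isSol (h : B.IsRLD φ k s) {a b : ℝ} (ha : a ∈ B.I) (hb : b ∈ B.I) (hab : a < b)
    (hs : ∀ i < k, s i ∉ Ioo a b ∧ -s i ∉ Ioo a b) :
    ∃ y y', IsSol B.potential.val y y' ∧ EqOn (B.profile φ) y (Icc a b) := by
  refine Potential.exists_isSol_eqOn hab ?_ fun t ht => ?_
  · exact (h.smooth a ha b hb hab hs).comp (f := fun t : ℝ => ((0 : ℝ), t))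
      (by fun_prop) fun t ht => ⟨mem_univ _, ht⟩
  · have htI := B.mem_I_of_mem_Icc ha hb (Ioo_subset_Icc_self ht)
    have := h.equation 0 t htI fun i hi => ⟨fun h1 => (hs i hi).1 (h1 ▸ ht),
      fun h1 => (hs i hi).2 (h1 ▸ ht)⟩
    have hconst : (fun ϑ => φ (B.x (ϑ, t))) = fun _ => B.profile φ |t| :=
      funext fun ϑ => h.apply_x htI ϑ
    simp only [Lchi] at this
    rw [hconst, iteratedDeriv_const, if_neg two_ne_zero, add_zero] at this
    exact this

/-- On an interval between circles, the fluxes at the ends are logarithmic derivatives of one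
solution. -/
theorem eq_sol (h : B.IsRLD φ k s) {a b : ℝ} (ha : a ∈ B.I) (hb : b ∈ B.I) (hab : a < b)
    (hs : ∀ i < k, s i ∉ Ioo a b ∧ -s i ∉ Ioo a b) :
    (∀ t ∈ Icc a b, B.profile φ t = B.profile φ a * B.potential.sol a (B.fluxP φ a) t) ∧
      B.potential.dsol a (B.fluxP φ a) b =
        -(B.fluxM φ b * B.potential.sol a (B.fluxP φ a) b) := by
  obtain ⟨y, y', hy, hyt⟩ := h.exists_isSol ha hb hab hs
  have hya : 0 < y a := hyt (left_mem_Icc.2 hab.le) ▸ h.profile_pos ha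
  have hyb : 0 < y b := hyt (right_mem_Icc.2 hab.le) ▸ h.profile_pos hb
  have hform := B.potential.eq_sol hy a hya.ne'
  have hP : B.fluxP φ a = y' a / y a := Background.fluxP_eq hy hab hyt
  have hM : B.fluxM φ b = -y' b / y b := Background.fluxM_eq hy hab hyt
  refine ⟨fun t ht => by rw [hyt ht, hP, hyt (left_mem_Icc.2 hab.le), (hform t).1], ?_⟩
  have h1 := hform b
  rw [← hP] at h1
  have h2 : -(B.fluxM φ b * y b) = y' b := by rw [hM]; field_simp
  have h3 : y a * B.potential.dsol a (B.fluxP φ a) b =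
      y a * -(B.fluxM φ b * B.potential.sol a (B.fluxP φ a) b) := by
    rw [← h1.2, ← h2, h1.1]; ring
  exact mul_left_cancel₀ hya.ne' h3

variable (s) in
/-- The jump latitudes of an RLD solution, preceded by `0` if this is not a jump latitude. -/
def _root_.RLD.chainOf (j : ℕ) : ℝ := if s 0 = 0 then s j else if j = 0 then 0 else s (j - 1)

variable (s) in
/-- The number of points of `chainOf s` preceding the first jump latitude. -/
def _root_.RLD.chainShift : ℕ := if s 0 = 0 then 0 else 1

theorem _root_.RLD.chainOf_add (i : ℕ) : chainOf s (i + chainShift s) = s i := by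
  unfold chainOf chainShift
  split_ifs with h h' <;> simp_all

theorem _root_.RLD.chainOf_zero : chainOf s 0 = 0 := by
  by_cases h : s 0 = 0 <;> simp [chainOf, h]

theorem chainOf_lt (h : B.IsRLD φ k s) {j : ℕ} (hj : j + 1 < k + chainShift s) :
    chainOf s j < chainOf s (j + 1) := by
  by_cases h0 : s 0 = 0
  · simp only [chainOf, chainShift, if_pos h0] at hj ⊢
    exact h.s_lt j (by omega)
  · simp only [chainOf, chainShift, if_neg h0] at hj ⊢
    rcases j with _ | j
    · simpa using h.s_nonneg.lt_of_ne' h0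
    · simpa using h.s_lt j (by omega)

theorem _root_.RLD.exists_chainOf {i : ℕ} (hi : i < k) :
    ∃ j < k + chainShift s, chainOf s j = s i :=
  ⟨i + chainShift s, by omega, chainOf_add i⟩

theorem chainOf_mono (h : B.IsRLD φ k s) {i j : ℕ} (hij : i ≤ j) (hj : j < k + chainShift s) :
    chainOf s i ≤ chainOf s j := by
  induction j, hij using Nat.le_induction with
  | base => exact le_rfl
  | succ j hij ih => exact (ih (by omega)).trans (h.chainOf_lt hj).le

theorem chainOf_mem (h : B.IsRLD φ k s) {j : ℕ} (hj : j < k + chainShift s) : chainOf s j ∈ B.I := by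
  rcases lt_or_ge j (chainShift s) with h1 | h1
  · have : j = 0 := by unfold chainShift at h1; split_ifs at h1 <;> omega
    rw [this, chainOf_zero]
    exact B.zero_mem_I
  · have := chainOf_add (s := s) (j - chainShift s)
    rw [Nat.sub_add_cancel h1] at this
    rw [this]
    exact h.s_mem _ (by omega)

theorem fluxP_chainOf_pos (h : B.IsRLD φ k s) {j : ℕ} (hj : chainShift s ≤ j)
    (hj' : j < k + chainShift s) : 0 < B.fluxP φ (chainOf s j) ∧ 0 < B.fluxM φ (chainOf s j) := by
  have := chainOf_add (s := s) (j - chainShift s)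
  rw [Nat.sub_add_cancel hj] at this
  rw [this]
  exact ⟨h.fluxP_pos _ (by omega), h.fluxM_pos _ (by omega)⟩

/-- There are no circles between consecutive points of the chain. -/
theorem not_mem_Ioo (h : B.IsRLD φ k s) {j : ℕ} {b : ℝ} (hj : j < k + chainShift s)
    (hb : j + 1 < k + chainShift s → b ≤ chainOf s (j + 1)) :
    ∀ i < k, s i ∉ Ioo (chainOf s j) b ∧ -s i ∉ Ioo (chainOf s j) b := by
  intro i hi
  have h0 : 0 ≤ chainOf s j := chainOf_zero (s := s) ▸ h.chainOf_mono (Nat.zero_le j) hj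
  refine ⟨fun hm => ?_, fun hm => by linarith [hm.1, h.nonneg hi]⟩
  obtain ⟨j', hj', he⟩ := exists_chainOf (s := s) hi
  rw [← he] at hm
  rcases le_or_gt j' j with h1 | h1
  · linarith [hm.1, h.chainOf_mono h1 hj]
  · linarith [hm.2, hb (by omega), h.chainOf_mono (Nat.succ_le_of_lt h1) hj']

/-- If `0` is not a jump latitude, then the flux there vanishes by symmetry. -/
theorem fluxP_zero (h : B.IsRLD φ k s) (h0 : s 0 ≠ 0) : B.fluxP φ 0 = 0 := by
  have hs0 : 0 < s 0 := h.s_nonneg.lt_of_ne' h0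
  have hI := h.s_mem 0 h.k_pos
  obtain ⟨y, y', hy, hyt⟩ := h.exists_isSol (B.neg_mem_I hI) hI (by linarith) fun i hi => by
    have := h.s_le (Nat.zero_le i) hi
    exact ⟨fun hm => by linarith [hm.2], fun hm => by linarith [hm.1]⟩
  rw [Background.fluxP_eq hy hs0 fun t ht => hyt ⟨by linarith [ht.1], ht.2⟩]
  have heven : (fun t => y (-t)) =ᶠ[𝓝 0] y := by
    filter_upwards [Ioo_mem_nhds (show -s 0 < 0 by linarith) hs0] with t ht
    rw [← hyt ⟨by linarith [ht.2], by linarith [ht.1]⟩, ← hyt (Ioo_subset_Icc_self ht)]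
    exact h.profile_neg (B.mem_I_of_mem_Icc (B.neg_mem_I hI) hI (Ioo_subset_Icc_self ht))
  have h1 := ((hy.reflect (V := B.potential)).hasDerivAt 0).congr_of_eventuallyEq heven.symm
  have h2 := h1.unique (hy.hasDerivAt 0)
  rw [neg_zero] at h2
  rw [show y' 0 = 0 by linarith, zero_div]

/-- An RLD solution comes from a chain. -/
theorem isProfile (h : B.IsRLD φ k s) :
    B.potential.IsProfile B.l (fun j => B.fluxP φ (chainOf s j)) (fun j => B.fluxM φ (chainOf s j))
      (chainOf s) (k + chainShift s - 1) (chainShift s) := by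
  have hk := h.k_pos
  have hpos : ∀ {a t : ℝ}, 0 < B.profile φ a → t ∈ B.I →
      B.profile φ t = B.profile φ a * B.potential.sol a (B.fluxP φ a) t →
      0 < B.potential.sol a (B.fluxP φ a) t := fun ha ht he =>
    (pos_iff_pos_of_mul_pos (he ▸ h.profile_pos ht)).1 ha
  refine ⟨chainOf_zero, fun j hj => ?_, fun t ht htl => ?_, ?_, fun j hj hj' =>
    (h.fluxP_chainOf_pos hj (by omega)).1, fun j hj hj' => (h.fluxP_chainOf_pos
      (by unfold chainShift; split_ifs <;> omega) (by omega)).2⟩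
  · have hlt := h.chainOf_lt (j := j) (by omega)
    have hI := h.chainOf_mem (j := j) (by omega)
    have hI' := h.chainOf_mem (j := j + 1) (by omega)
    obtain ⟨h1, h2⟩ := h.eq_sol hI hI' hlt (h.not_mem_Ioo (by omega) fun _ => le_rfl)
    have h0 : 0 ≤ chainOf s (j + 1) :=
      chainOf_zero (s := s) ▸ h.chainOf_mono (Nat.zero_le _) (by omega)
    exact ⟨hlt, (B.mem_I_of_nonneg h0).1 hI', fun t ht => hpos (h.profile_pos hI)
      (B.mem_I_of_mem_Icc hI hI' ht) (h1 t ht), h2⟩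
  · rcases ht.eq_or_lt with rfl | hlt
    · rw [Potential.sol_self]; exact one_pos
    · have hI := h.chainOf_mem (j := k + chainShift s - 1) (by omega)
      have h0 : 0 ≤ chainOf s (k + chainShift s - 1) :=
        chainOf_zero (s := s) ▸ h.chainOf_mono (Nat.zero_le _) (by omega)
      have htI : t ∈ B.I := (B.mem_I_of_nonneg (h0.trans ht)).2 htl
      exact hpos (h.profile_pos hI) htI ((h.eq_sol hI htI hlt (h.not_mem_Ioo (by omega) fun h1 => by
        omega)).1 t ⟨ht, le_rfl⟩)
  · by_cases h0 : s 0 = 0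
    · exact Or.inr (by simp [chainShift, h0])
    · refine Or.inl ⟨by simp [chainShift, h0], by simp [chainShift, h0]; omega, ?_⟩
      rw [chainOf_zero, h.fluxP_zero h0]

/-- An RLD solution is the radial function of its chain. -/
theorem eq_radial (h : B.IsRLD φ k s) (hu : B.IsUnit φ) : EqOn φ (B.radial (B.potential.prof
    (fun j => B.fluxP φ (chainOf s j)) (chainOf s) (k + chainShift s - 1))) B.Ω := by
  have hk := h.k_pos
  have hp := h.isProfile
  set P := fun j => B.fluxP φ (chainOf s j) with hP
  set n := k + chainShift s - 1 with hn
  have hpiece : ∀ j ≤ n, ∀ t ∈ B.I, chainOf s j ≤ t → (j < n → t ≤ chainOf s (j + 1)) →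
      B.profile φ t = B.profile φ (chainOf s j) *
        B.potential.sol (chainOf s j) (P j) t := by
    intro j hj t htI ht ht'
    rcases ht.eq_or_lt with rfl | hlt
    · rw [Potential.sol_self, mul_one]
    · exact (h.eq_sol (h.chainOf_mem (by omega)) htI hlt (h.not_mem_Ioo (by omega) fun h1 =>
        ht' (by omega))).1 t ⟨ht, le_rfl⟩
  have hnode : ∀ j ≤ n, B.profile φ (chainOf s j) = B.potential.prof P (chainOf s) n (chainOf s j) := by
    intro j
    induction j with
    | zero =>
      intro _
      rw [chainOf_zero, Potential.prof_zero chainOf_zero hp.le_succ]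
      exact hu
    | succ j ih =>
      intro hj
      have hle := hp.le_succ j (by omega)
      rw [hpiece j (by omega) _ (hp.mem_I hj) hle fun _ => le_rfl, ih (by omega),
        Potential.prof_eq (t := chainOf s (j + 1)) (by omega : j ≤ n) hp.le_succ hle fun _ => le_rfl]
  rintro _ ⟨⟨ϑ, t⟩, ⟨-, ht⟩, rfl⟩
  have habs : |t| ∈ B.I := B.mem_I_of_abs_le ht (abs_abs t).le
  rw [h.apply_x ht, B.radial_x _ ht]
  obtain ⟨j, hj, h1, h2⟩ := exists_index (T := chainOf s) (n := n)
    (chainOf_zero.trans_le (abs_nonneg t))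
  rw [hpiece j hj _ habs h1 fun hlt => (h2 hlt).le, hnode j hj,
    Potential.prof_eq hj hp.le_succ h1 fun hlt => (h2 hlt).le]

end IsRLD

/-- The number of circles of an increasing sequence of nonnegative latitudes. -/
theorem _root_.RLD.circles_eq {k : ℕ} {s : ℕ → ℝ} (hk : 0 < k) (h0 : 0 ≤ s 0)
    (hs : ∀ i j, i < j → j < k → s i < s j) :
    circles k s = if s 0 = 0 then 2 * k - 1 else 2 * k := by
  have hnn : ∀ i < k, 0 < i → 0 < s i := fun i hi h => h0.trans_lt (hs 0 i h hi)
  have hinj : InjOn s (Finset.range k) := fun i hi j hj hij => by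
    have hi := Finset.mem_range.1 (Finset.mem_coe.1 hi)
    have hj := Finset.mem_range.1 (Finset.mem_coe.1 hj)
    rcases lt_trichotomy i j with h | h | h
    · exact absurd hij (hs i j h hj).ne
    · exact h
    · exact absurd hij (hs j i h hi).ne'
  set A := (Finset.range k).image s with hA
  set A' := (Finset.range k).image fun i => -s i with hA'
  have hcA : A.card = k := by rw [Finset.card_image_of_injOn hinj, Finset.card_range]
  have hcA' : A'.card = k := by
    rw [Finset.card_image_of_injOn fun i hi j hj hij => hinj hi hj (neg_injective hij),
      Finset.card_range]
  have hset : {t : ℝ | ∃ i < k, t = s i ∨ t = -s i} = ((A ∪ A' : Finset ℝ) : Set ℝ) := by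
    ext t
    simp only [hA, hA', mem_ofPred_eq, Finset.coe_union, Finset.coe_image, Finset.coe_range,
      mem_union, mem_image, mem_Iio]
    constructor
    · rintro ⟨i, hi, rfl | rfl⟩
      · exact Or.inl ⟨i, hi, rfl⟩
      · exact Or.inr ⟨i, hi, rfl⟩
    · rintro (⟨i, hi, rfl⟩ | ⟨i, hi, rfl⟩)
      · exact ⟨i, hi, Or.inl rfl⟩
      · exact ⟨i, hi, Or.inr rfl⟩
  have hinter : (A ∩ A').card = if s 0 = 0 then 1 else 0 := by
    have hmem : ∀ t, t ∈ A ∩ A' ↔ t = 0 ∧ s 0 = 0 := by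
      intro t
      simp only [hA, hA', Finset.mem_inter, Finset.mem_image, Finset.mem_range]
      constructor
      · rintro ⟨⟨i, hi, rfl⟩, j, hj, hij⟩
        rcases Nat.eq_zero_or_pos i with rfl | hi0
        · rcases Nat.eq_zero_or_pos j with rfl | hj0
          · exact ⟨by linarith, by linarith⟩
          · linarith [hnn j hj hj0]
        · have := hnn i hi hi0
          rcases Nat.eq_zero_or_pos j with rfl | hj0
          · linarith
          · linarith [hnn j hj hj0]
      · rintro ⟨rfl, h⟩
        exact ⟨⟨0, hk, h⟩, 0, hk, by rw [h, neg_zero]⟩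
    split_ifs with h
    · have : A ∩ A' = {0} := by ext t; rw [hmem]; simp [h]
      rw [this, Finset.card_singleton]
    · have : A ∩ A' = ∅ := by ext t; rw [hmem]; simp [h]
      rw [this, Finset.card_empty]
  have hsum := Finset.card_union_add_card_inter A A'
  rw [circles, hset, Set.ncard_coe_finset]
  rw [hinter, hcA, hcA'] at hsum
  split_ifs at hsum ⊢ <;> omega

theorem IsRLD.circles_eq (h : B.IsRLD φ k s) :
    circles k s = if s 0 = 0 then 2 * k - 1 else 2 * k :=
  RLD.circles_eq h.k_pos h.s_nonneg fun _ _ hij hj => h.s_lt' hij hj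

end Background

/-! ### Prescribed flux ratios -/

/-- The ratio of the `i`-th mean flux to the first one. -/
def meanFactor (σ : ℕ → ℝ) (i : ℕ) : ℝ := Real.exp (∑ j ∈ Finset.range i, σ j)

theorem meanFactor_pos (σ : ℕ → ℝ) (i : ℕ) : 0 < meanFactor σ i := Real.exp_pos _

theorem meanFactor_succ (σ : ℕ → ℝ) (i : ℕ) :
    meanFactor σ (i + 1) = meanFactor σ i * Real.exp (σ i) := by
  rw [meanFactor, Finset.sum_range_succ, Real.exp_add, meanFactor]

/-- The logarithmic derivatives to the right of the points of the chain, in the case of a solution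
smooth at `0`, divided by the flux `F_{1-}`. -/
def evenP (σ ξ : ℕ → ℝ) : ℕ → ℝ
  | 0 => 0
  | i + 1 => (1 - ξ 0)⁻¹ * meanFactor σ i * (1 + ξ i)

/-- The logarithmic derivatives to the left of the points of the chain, up to sign, in the case of a
solution smooth at `0`, divided by the flux `F_{1-}`. -/
def evenM (σ ξ : ℕ → ℝ) : ℕ → ℝ
  | 0 => 0
  | i + 1 => (1 - ξ 0)⁻¹ * meanFactor σ i * (1 - ξ i)

theorem even_pos {σ ξ : ℕ → ℝ} (hξ : ∀ i, |ξ i| < 1) (i : ℕ) :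
    0 < evenP σ ξ (i + 1) ∧ 0 < evenM σ ξ (i + 1) := by
  have h0 := abs_lt.1 (hξ 0)
  have hi := abs_lt.1 (hξ i)
  have h1 : 0 < (1 - ξ 0)⁻¹ * meanFactor σ i :=
    mul_pos (inv_pos.2 (by linarith)) (meanFactor_pos σ i)
  exact ⟨mul_pos h1 (by linarith), mul_pos h1 (by linarith)⟩

/-- The ratios of a chain smooth at `0` with prescribed flux ratios. -/
def evenRatios (σ ξ : ℕ → ℝ) (hξ : ∀ i, |ξ i| < 1) : Ratios where
  p := evenP σ ξ
  m := evenM σ ξ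
  p_nonneg := le_rfl
  p_pos j hj := by
    obtain ⟨i, rfl⟩ := Nat.exists_eq_add_of_le' hj
    exact (even_pos hξ i).1
  m_nonneg j hj := by
    obtain ⟨i, rfl⟩ := Nat.exists_eq_add_of_le' hj
    exact (even_pos hξ i).2.le
  add_pos j := by
    have h2 := (even_pos (σ := σ) hξ j).2
    rcases j with _ | i
    · exact (zero_add (evenM σ ξ 1)).symm ▸ h2
    · exact add_pos (even_pos hξ i).1 h2

theorem evenRatios_m_pos {σ ξ : ℕ → ℝ} (hξ : ∀ i, |ξ i| < 1) :
    ∀ j, 1 ≤ j → 0 < (evenRatios σ ξ hξ).m j := fun j hj => by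
  obtain ⟨i, rfl⟩ := Nat.exists_eq_add_of_le' hj
  exact (even_pos hξ i).2

theorem abs_lt_one_of_norm {ξ : Linf} (h : ‖ξ‖ < 1) (i : ℕ) : |ξ i| < 1 :=
  (lp.norm_apply_le_norm (by simp) ξ i).trans_lt h

/-- Summability of `σ` and `‖ξ‖ < 1` bound the logarithmic derivatives from below. -/
theorem exists_le_evenP (σ : L1) {ξ : Linf} (h : ‖ξ‖ < 1) :
    ∃ q > 0, ∀ j, 1 ≤ j → q ≤ evenP σ ξ j := by
  refine ⟨2⁻¹ * Real.exp (-‖σ‖) * (1 - ‖ξ‖),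
    mul_pos (by positivity) (by linarith), fun j hj => ?_⟩
  obtain ⟨i, rfl⟩ := Nat.exists_eq_add_of_le' hj
  have h0 := abs_lt.1 (abs_lt_one_of_norm h 0)
  have hi : |ξ i| ≤ ‖ξ‖ := lp.norm_apply_le_norm (by simp) ξ i
  have hi := abs_le.1 hi
  have hsum : ∑ j ∈ Finset.range i, |σ j| ≤ ‖σ‖ := by
    have := lp.sum_rpow_le_norm_rpow (p := 1) (by simp) σ (Finset.range i)
    simpa using this
  have hexp : Real.exp (-‖σ‖) ≤ meanFactor σ i := by
    refine Real.exp_le_exp.2 ?_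
    have := (Finset.abs_sum_le_sum_abs (fun j => σ j) (Finset.range i)).trans hsum
    linarith [(abs_le.1 this).1]
  have hinv : (2 : ℝ)⁻¹ ≤ (1 - ξ 0)⁻¹ := inv_anti₀ (by linarith) (by linarith)
  exact mul_le_mul (mul_le_mul hinv hexp (Real.exp_pos _).le (inv_nonneg.2 (by linarith)))
    (by linarith) (by linarith) (mul_nonneg (inv_nonneg.2 (by linarith)) (meanFactor_pos _ _).le)

/-- The logarithmic derivatives depend continuously on `(F, σ, ξ)`; only finitely many terms of the
sequences enter each of them. -/
theorem continuousAt_even {x₀ : ℝ × L1 × Linf} (h : ‖x₀.2.2‖ < 1) (j : ℕ) :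
    ContinuousAt (fun x : ℝ × L1 × Linf => x.1 * evenP x.2.1 x.2.2 j) x₀ ∧
      ContinuousAt (fun x : ℝ × L1 × Linf => x.1 * evenM x.2.1 x.2.2 j) x₀ := by
  have hσ : ∀ i, Continuous fun x : ℝ × L1 × Linf => x.2.1 i := fun i =>
    (lp.lipschitzWith_one_eval 1 i).continuous.comp (continuous_fst.comp continuous_snd)
  have hξ : ∀ i, Continuous fun x : ℝ × L1 × Linf => x.2.2 i := fun i =>
    (lp.lipschitzWith_one_eval ⊤ i).continuous.comp (continuous_snd.comp continuous_snd)
  have hF : ∀ i, Continuous fun x : ℝ × L1 × Linf => meanFactor x.2.1 i := fun i =>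
    Real.continuous_exp.comp (continuous_finsetSum _ fun j _ => hσ j)
  have hinv : ContinuousAt (fun x : ℝ × L1 × Linf => (1 - x.2.2 0)⁻¹) x₀ :=
    ContinuousAt.inv₀ (continuous_const.sub (hξ 0)).continuousAt (by
      have := abs_lt.1 (abs_lt_one_of_norm h 0)
      linarith)
  rcases j with _ | i
  · exact ⟨continuousAt_fst.mul continuousAt_const, continuousAt_fst.mul continuousAt_const⟩
  · exact ⟨continuousAt_fst.mul ((hinv.mul (hF i).continuousAt).mul
      (continuous_const.add (hξ i)).continuousAt), continuousAt_fst.mul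
      ((hinv.mul (hF i).continuousAt).mul (continuous_const.sub (hξ i)).continuousAt)⟩

theorem Potential.prof_congr {V : Potential} {P P' T T' : ℕ → ℝ} {n : ℕ} (hP : ∀ j ≤ n, P j = P' j)
    (hT : ∀ j ≤ n, T j = T' j) : V.prof P T n = V.prof P' T' n := by
  funext t
  rw [prof, prof, hP n le_rfl, hT n le_rfl]
  congr 1
  refine Finset.prod_congr rfl fun j hj => ?_
  have hj := Finset.mem_range.1 hj
  rw [hP j hj.le, hT j hj.le, hT (j + 1) hj]

namespace Background

variable {M N : Type*} [TopologicalSpace M] [ChartedSpace E2 M]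
  [IsManifold (𝓡 2) ∞ M] [TopologicalSpace N] [ChartedSpace E3 N] [IsManifold (𝓡 3) ∞ N]
  [MulAction SymGroup M] [MulAction SymGroup N] {B : Background M N}

variable {φ φ' : M → ℝ} {k : ℕ} {s s' σ ξ : ℕ → ℝ} {F : ℝ}

/-- The fluxes are determined by the first mean flux and the flux ratios. -/
theorem IsRLD.flux_eq (h : B.IsRLD φ k s) (hr : B.HasFluxRatios φ k s σ ξ) {i : ℕ} (hi : i < k) :
    B.fluxP φ (s i) = B.flux φ (s 0) * meanFactor σ i * (1 + ξ i) ∧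
      B.fluxM φ (s i) = B.flux φ (s 0) * meanFactor σ i * (1 - ξ i) := by
  have hpos : ∀ i < k, 0 < B.flux φ (s i) := fun i hi => by
    have := add_pos (h.fluxP_pos i hi) (h.fluxM_pos i hi)
    exact half_pos this
  have hflux : ∀ i < k, B.flux φ (s i) = B.flux φ (s 0) * meanFactor σ i := by
    intro i
    induction i with
    | zero => intro _; simp [meanFactor]
    | succ i ih =>
      intro hi
      rw [meanFactor_succ, ← mul_assoc, ← ih (by omega), hr.1 i hi,
        mul_div_cancel₀ _ (hpos i (by omega)).ne']
  have hsum : B.fluxP φ (s i) + B.fluxM φ (s i) ≠ 0 :=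
    (add_pos (h.fluxP_pos i hi) (h.fluxM_pos i hi)).ne'
  rw [← hflux i hi, hr.2 i hi, flux]
  constructor <;> field_simp <;> ring

/-- Fluxes of this form have the flux ratios `σ`, `ξ`, whatever the first mean flux `G`. -/
theorem hasFluxRatios_of_flux_eq {G : ℝ} (hG : G ≠ 0)
    (h : ∀ i < k, B.fluxP φ (s i) = G * meanFactor σ i * (1 + ξ i) ∧
      B.fluxM φ (s i) = G * meanFactor σ i * (1 - ξ i)) : B.HasFluxRatios φ k s σ ξ := by
  have hflux : ∀ i < k, B.flux φ (s i) = G * meanFactor σ i := fun i hi => by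
    rw [flux, (h i hi).1, (h i hi).2]; ring
  have hne : ∀ i, G * meanFactor σ i ≠ 0 := fun i => mul_ne_zero hG (meanFactor_pos σ i).ne'
  refine ⟨fun j hj => ?_, fun i hi => ?_⟩
  · rw [hflux _ hj, hflux j (by omega), meanFactor_succ, ← mul_assoc, mul_div_cancel_left₀ _ (hne j)]
  · rw [(h i hi).1, (h i hi).2]
    rw [eq_div_iff]
    · ring
    · have := mul_ne_zero two_ne_zero (hne i)
      intro h0
      exact this (by linear_combination h0)

variable (B) in
/-- The latitudes of the chain with `F_{1-} = F` and prescribed flux ratios. -/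
def hatLat (F : ℝ) (σ ξ : ℕ → ℝ) : ℕ → ℝ :=
  B.potential.lat B.l (fun j => F * evenP σ ξ j) fun j => F * evenM σ ξ j

variable (B) in
/-- The chain with `F_{1-} = F` and prescribed flux ratios makes `n` steps. -/
def HatReach (F : ℝ) (σ ξ : ℕ → ℝ) (n : ℕ) : Prop :=
  B.potential.Reach B.l (fun j => F * evenP σ ξ j) (fun j => F * evenM σ ξ j) n

variable (B) in
/-- The largest number of jump latitudes. -/
def hatCount (F : ℝ) (σ ξ : ℕ → ℝ) : ℕ := sInf {n | ¬ B.HatReach F σ ξ (n + 1)}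

variable (B) in
/-- The function on the surface given by `n` steps of the chain. -/
def hatFun (F : ℝ) (σ ξ : ℕ → ℝ) (n : ℕ) : M → ℝ :=
  B.radial (B.potential.prof (fun j => F * evenP σ ξ j) (B.hatLat F σ ξ) n)

/-- A solution is given by the chain determined by its fluxes. -/
theorem IsRLD.eq_of_flux (h : B.IsRLD φ k s) (hu : B.IsUnit φ) {P m : ℕ → ℝ} {n d : ℕ}
    (hd : chainShift s = d) (hn : k + d = n + 1)
    (hP : ∀ j ≤ n, B.fluxP φ (chainOf s j) = P j)
    (hM : ∀ j < n, B.fluxM φ (chainOf s (j + 1)) = m (j + 1)) :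
    B.potential.IsProfile B.l P m (B.potential.lat B.l P m) n d ∧
      (∀ i < k, s i = B.potential.lat B.l P m (i + d)) ∧
      EqOn φ (B.radial (B.potential.prof P (B.potential.lat B.l P m) n)) B.Ω := by
  have hp := h.isProfile
  have hφ := h.eq_radial hu
  rw [hd, hn, Nat.add_sub_cancel] at hp hφ
  have hreach : B.potential.Reach B.l P m n :=
    (Potential.reach_congr (fun j hj => hP j hj.le) hM).1 (hp.chain.reach chainOf_zero)
  have hT : ∀ j ≤ n, chainOf s j = B.potential.lat B.l P m j := fun j hj =>
    (hp.chain.eq_lat chainOf_zero j hj).trans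
      (Potential.lat_congr (fun j hj => hP j hj.le) hM j hj)
  refine ⟨⟨rfl, hreach, fun t ht htl => ?_, ?_, fun j hj hj' => hP j hj' ▸ hp.P_pos j hj hj',
    fun j hj hj' => ?_⟩, fun i hi => ?_, ?_⟩
  · have := hp.last t (by rw [hT n le_rfl]; exact ht) htl
    simp only [hP n le_rfl] at this
    rwa [hT n le_rfl] at this
  · rw [← hP 0 (Nat.zero_le n)]
    exact hp.parity
  · obtain ⟨i, rfl⟩ := Nat.exists_eq_add_of_le' hj
    rw [← hM i hj']
    exact hp.M_pos _ hj hj'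
  · rw [← hT (i + d) (by omega), ← hd, chainOf_add]
  · rw [← Potential.prof_congr hP hT]
    exact hφ

/-- The fluxes of a solution smooth at `0`. -/
theorem IsRLD.flux_chainOf_even (h : B.IsRLD φ k s) (hs : s 0 ≠ 0)
    (hr : B.HasFluxRatios φ k s σ ξ) :
    (∀ j ≤ k, B.fluxP φ (chainOf s j) = B.fluxM φ (s 0) * evenP σ ξ j) ∧
      ∀ j < k, B.fluxM φ (chainOf s (j + 1)) = B.fluxM φ (s 0) * evenM σ ξ (j + 1) := by
  have hd : chainShift s = 1 := if_neg hs
  have hG : B.fluxM φ (s 0) * (1 - ξ 0)⁻¹ = B.flux φ (s 0) := by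
    have h1 := (h.flux_eq hr h.k_pos).2
    have h2 := h.fluxM_pos 0 h.k_pos
    simp only [meanFactor, Finset.range_zero, Finset.sum_empty, Real.exp_zero, mul_one] at h1
    have h3 : 1 - ξ 0 ≠ 0 := fun h3 => by rw [h3, mul_zero] at h1; linarith
    rw [h1, mul_assoc, mul_inv_cancel₀ h3, mul_one]
  have hflux : ∀ i < k, B.fluxP φ (chainOf s (i + 1)) = B.fluxM φ (s 0) * evenP σ ξ (i + 1) ∧
      B.fluxM φ (chainOf s (i + 1)) = B.fluxM φ (s 0) * evenM σ ξ (i + 1) := fun i hi => by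
    have := chainOf_add (s := s) i
    rw [hd] at this
    rw [this, evenP, evenM, (h.flux_eq hr hi).1, (h.flux_eq hr hi).2, ← hG]
    constructor <;> ring
  refine ⟨fun j hj => ?_, fun j hj => (hflux j hj).2⟩
  rcases j with _ | i
  · rw [chainOf_zero, h.fluxP_zero hs, evenP, mul_zero]
  · exact (hflux i (by omega)).1

/-- A solution smooth at `0` is given by the chain determined by its flux ratios. -/
theorem IsRLD.eq_hat (h : B.IsRLD φ k s) (hu : B.IsUnit φ) (hs : 0 < s 0) (hF : B.fluxM φ (s 0) = F)
    (hr : B.HasFluxRatios φ k s σ ξ) :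
    B.potential.IsProfile B.l (fun j => F * evenP σ ξ j) (fun j => F * evenM σ ξ j)
        (B.hatLat F σ ξ) k 1 ∧ (∀ i < k, s i = B.hatLat F σ ξ (i + 1)) ∧
      EqOn φ (B.hatFun F σ ξ k) B.Ω := by
  obtain ⟨hP, hM⟩ := h.flux_chainOf_even hs.ne' hr
  rw [hF] at hP hM
  exact h.eq_of_flux hu (P := fun j => F * evenP σ ξ j) (m := fun j => F * evenM σ ξ j)
    (if_neg hs.ne') rfl hP hM

/-- The chain gives a solution with the prescribed flux ratios. -/
theorem isHat_hatFun [T2Space M] (hF : 0 < F) (hξ : ∀ i < k, |ξ i| < 1)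
    (hp : B.potential.IsProfile B.l (fun j => F * evenP σ ξ j) (fun j => F * evenM σ ξ j)
      (B.hatLat F σ ξ) k 1) :
    B.IsHat F σ ξ (B.hatFun F σ ξ k) k (fun i => B.hatLat F σ ξ (i + 1)) := by
  have hk : 0 < k := hp.d_le.1
  have h0 := abs_lt.1 (hξ 0 hk)
  have hP : ∀ i < k, B.fluxP (B.hatFun F σ ξ k) (B.hatLat F σ ξ (i + 1)) = F * evenP σ ξ (i + 1) :=
    fun i hi => hp.fluxP_eq (by omega)
  have hM : ∀ i < k, B.fluxM (B.hatFun F σ ξ k) (B.hatLat F σ ξ (i + 1)) = F * evenM σ ξ (i + 1) :=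
    fun i hi => hp.fluxM_eq hi
  refine ⟨hp.isRLD, hp.isUnit, ?_, ?_, ?_⟩
  · have := hp.chain.lt Nat.zero_lt_one hk
    rwa [hp.zero] at this
  · rw [hM 0 hk, evenM]
    simp only [meanFactor, Finset.range_zero, Finset.sum_empty, Real.exp_zero, mul_one]
    rw [inv_mul_cancel₀ (by linarith), mul_one]
  · refine hasFluxRatios_of_flux_eq (G := F * (1 - ξ 0)⁻¹)
      (mul_ne_zero hF.ne' (inv_ne_zero (by linarith))) fun i hi => ?_
    rw [hP i hi, hM i hi, evenP, evenM]
    constructor <;> ring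

end Background

/-! ### The solutions with the largest number of jump latitudes -/

namespace Background

variable {M N : Type*} [TopologicalSpace M] [ChartedSpace E2 M]
  [IsManifold (𝓡 2) ∞ M] [TopologicalSpace N] [ChartedSpace E3 N] [IsManifold (𝓡 3) ∞ N]
  [MulAction SymGroup M] [MulAction SymGroup N] {B : Background M N}

variable {F : ℝ}

/-- The first step is governed by the even solution, hence by `F_max`. -/
theorem hatReach_one_iff {σ ξ : ℕ → ℝ} (hξ : ∀ i, |ξ i| < 1) (hF : 0 < F) :
    B.HatReach F σ ξ 1 ↔ (F : EReal) < B.Fmax := by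
  have h0 := abs_lt.1 (hξ 0)
  have h1 : F * evenM σ ξ 1 = F := by
    simp only [evenM, meanFactor, Finset.range_zero, Finset.sum_empty, Real.exp_zero, mul_one]
    rw [inv_mul_cancel₀ (by linarith), mul_one]
  rw [B.lt_Fmax_iff hF, HatReach, Potential.reach_succ, and_iff_right Potential.reach_zero,
    Potential.lat_zero, h1]
  simp [evenP]

theorem threshold_one {σ ξ : ℕ → ℝ} (hξ : ∀ i, |ξ i| < 1) :
    B.potential.threshold B.l (evenRatios σ ξ hξ) 1 = B.Fmax := by
  have key : ∀ F : ℝ, 0 < F →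
      ((F : EReal) < B.potential.threshold B.l (evenRatios σ ξ hξ) 1 ↔ (F : EReal) < B.Fmax) :=
    fun F hF => (Potential.ratioReach_iff_lt_threshold hF).symm.trans (hatReach_one_iff hξ hF)
  obtain ⟨F₀, hF₀, h⟩ := B.potential.exists_ratioReach B.l_pos (evenRatios σ ξ hξ) 1
  have h1 := (Potential.ratioReach_iff_lt_threshold hF₀).1 h
  have h2 := (key F₀ hF₀).1 h1
  refine le_antisymm ?_ ?_
  · refine le_of_forall_lt fun u hu => ?_
    obtain ⟨r, hr1, hr⟩ := EReal.lt_iff_exists_real_btwn.1 (max_lt hu h1)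
    have hr0 : F₀ < r := EReal.coe_lt_coe_iff.1 ((le_max_right _ _).trans_lt hr1)
    exact ((le_max_left _ _).trans_lt hr1).trans ((key r (hF₀.trans hr0)).1 hr)
  · refine le_of_forall_lt fun u hu => ?_
    obtain ⟨r, hr1, hr⟩ := EReal.lt_iff_exists_real_btwn.1 (max_lt hu h2)
    have hr0 : F₀ < r := EReal.coe_lt_coe_iff.1 ((le_max_right _ _).trans_lt hr1)
    exact ((le_max_left _ _).trans_lt hr1).trans ((key r (hF₀.trans hr0)).2 hr)

variable [T2Space M] [CompactSpace M]

/-- The chain stops after `hatCount` steps. -/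
theorem hatReach_iff {σ : L1} {ξ : Linf} (hF : 0 < F) (hξ : ‖ξ‖ < 1) {n : ℕ} :
    B.HatReach F σ ξ n ↔ n ≤ B.hatCount F σ ξ := by
  obtain ⟨e, e', he⟩ := B.exists_isEnd
  obtain ⟨q, hq, hle⟩ := exists_le_evenP σ hξ
  exact Potential.ratioReach_iff_le_steps (c := evenRatios σ ξ (abs_lt_one_of_norm hξ))
    (Potential.exists_not_ratioReach he hF hq hle)

/-- The chain with the largest number of steps is followed by a positive solution, since there is no
further crossing. -/
theorem isProfile_hat {σ : L1} {ξ : Linf} (h : (F, σ, ξ) ∈ B.params) :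
    B.potential.IsProfile B.l (fun j => F * evenP σ ξ j) (fun j => F * evenM σ ξ j)
      (B.hatLat F σ ξ) (B.hatCount F σ ξ) 1 := by
  have hF : 0 < F := h.1
  have hFm : (F : EReal) < B.Fmax := h.2.1
  have hξ : ‖ξ‖ < 1 := h.2.2
  have hξ' := abs_lt_one_of_norm hξ
  have hr : B.HatReach F σ ξ (B.hatCount F σ ξ) := (hatReach_iff hF hξ).2 le_rfl
  have hn : ¬ B.HatReach F σ ξ (B.hatCount F σ ξ + 1) := fun h => by
    have := (hatReach_iff hF hξ).1 h
    omega
  refine ⟨rfl, hr, fun t ht htl => ?_, Or.inl ⟨rfl, ?_, mul_zero F⟩, fun j hj _ => ?_,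
    fun j hj _ => ?_⟩
  · exact (Potential.cross_pos_of_not_exists ((evenRatios σ ξ hξ').add_pos' hF _)
      (fun b hb => hn (Potential.reach_succ.2 ⟨hr, b, hb⟩)) ht htl).2
  · exact (hatReach_iff hF hξ).1 ((hatReach_one_iff hξ' hF).2 hFm)
  · exact mul_pos hF ((evenRatios σ ξ hξ').p_pos j hj)
  · exact mul_pos hF (evenRatios_m_pos hξ' j hj)

theorem hat_existence {σ : L1} {ξ : Linf} (h : (F, σ, ξ) ∈ B.params) :
    B.IsHat F σ ξ (B.hatFun F σ ξ (B.hatCount F σ ξ)) (B.hatCount F σ ξ)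
      (fun i => B.hatLat F σ ξ (i + 1)) :=
  isHat_hatFun h.1 (fun i _ => abs_lt_one_of_norm h.2.2 i) (isProfile_hat h)

/-- A solution is a chain, so it has at most `hatCount` steps. On a sphere a shorter chain could
make a further step, across which its last solution gets a negative slope; being concave while
positive, this solution has a zero later on. -/
theorem hat_maximal {σ : L1} {ξ : Linf} (h : (F, σ, ξ) ∈ B.params) {φ : M → ℝ} {k : ℕ} {s : ℕ → ℝ}
    (hφ : B.IsHat F σ ξ φ k s) :
    k ≤ B.hatCount F σ ξ ∧ (B.l = ⊤ → k = B.hatCount F σ ξ) := by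
  obtain ⟨hrld, hu, hs, hFM, hr⟩ := hφ
  have hp := (hrld.eq_hat hu hs hFM hr).1
  have hF : 0 < F := h.1
  have hξ : ‖ξ‖ < 1 := h.2.2
  have hk := (hatReach_iff hF hξ).1 hp.chain
  refine ⟨hk, fun hl => ?_⟩
  by_contra hne
  have hlong : B.HatReach F σ ξ (k + 1) := (hatReach_iff hF hξ).2 (by omega)
  have hx := hlong k k.lt_succ_self
  have hlast := hp.last
  rw [hl] at hx hlast
  obtain ⟨t, ht, hneg⟩ := Potential.exists_sol_nonpos hx
    (mul_pos hF (evenRatios_m_pos (σ := σ) (abs_lt_one_of_norm hξ) (k + 1) (by omega)))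
  have hT : B.hatLat F σ ξ k ≤ t := by
    rw [hatLat, hl]; exact ht
  have := hlast t hT (EReal.coe_lt_top t)
  rw [hatLat, hl] at this
  linarith

theorem hat_unique {σ ξ : ℕ → ℝ} {φ φ' : M → ℝ} {k : ℕ} {s s' : ℕ → ℝ}
    (h : B.IsHat F σ ξ φ k s) (h' : B.IsHat F σ ξ φ' k s') :
    EqOn φ φ' B.Ω ∧ ∀ i < k, s i = s' i := by
  obtain ⟨-, h1, h2⟩ := h.1.eq_hat h.2.1 h.2.2.1 h.2.2.2.1 h.2.2.2.2
  obtain ⟨-, h1', h2'⟩ := h'.1.eq_hat h'.2.1 h'.2.2.1 h'.2.2.2.1 h'.2.2.2.2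
  exact ⟨h2.trans h2'.symm, fun i hi => (h1 i hi).trans (h1' i hi).symm⟩

theorem hatLat_strictMonoOn (σ : L1) (ξ : Linf) (i : ℕ) :
    StrictMonoOn (fun F => B.hatLat F σ ξ (i + 1))
      {F : ℝ | (F, σ, ξ) ∈ B.params ∧ i < B.hatCount F σ ξ} := by
  intro F hF F' hF' hlt
  have hξ := hF.1.2.2
  exact Potential.RatioReach.lat_lt (c := evenRatios σ ξ (abs_lt_one_of_norm hξ))
    ((hatReach_iff hF'.1.1 hξ).2 le_rfl) hF.1.1 hlt hF'.2

theorem hatLat_contDiffOn (σ : L1) (ξ : Linf) (i : ℕ) :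
    ContDiffOn ℝ ∞ (fun F => B.hatLat F σ ξ (i + 1))
      {F : ℝ | (F, σ, ξ) ∈ B.params ∧ i < B.hatCount F σ ξ} := by
  intro F hF
  have hξ := hF.1.2.2
  exact (Potential.contDiffAt_ratioLat (c := evenRatios σ ξ (abs_lt_one_of_norm hξ))
    ((hatReach_iff hF.1.1 hξ).2 le_rfl) (i + 1) hF.2).contDiffWithinAt

theorem hatCount_antitoneOn (σ : L1) (ξ : Linf) :
    AntitoneOn (fun F => B.hatCount F σ ξ) {F : ℝ | (F, σ, ξ) ∈ B.params} := by
  intro F hF F' hF' hle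
  have hξ := hF.2.2
  exact (hatReach_iff hF.1 hξ).1 (Potential.RatioReach.of_le
    (c := evenRatios σ ξ (abs_lt_one_of_norm hξ)) ((hatReach_iff hF'.1 hξ).2 le_rfl) hF.1 hle).1

/-- The values `a k` are the thresholds for `k + 1` steps; the first step has the threshold `F_max`.
-/
theorem exists_thresholds (B : Background M N) :
    ∃ kmin : ℕ, 1 ≤ kmin ∧ ∀ (σ : L1) (ξ : Linf), ‖ξ‖ < 1 →
    AntitoneOn (fun F => B.hatCount F σ ξ) {F : ℝ | (F, σ, ξ) ∈ B.params} ∧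
    ∃ a : ℕ → EReal, StrictAntiOn a (Ici (kmin - 1)) ∧ a (kmin - 1) = B.Fmax ∧
      (∀ k, kmin ≤ k → 0 < a k) ∧
      ∀ F : ℝ, (F, σ, ξ) ∈ B.params → kmin ≤ B.hatCount F σ ξ ∧
        ∀ k, kmin ≤ k → (B.hatCount F σ ξ = k ↔ a k ≤ (F : EReal) ∧ (F : EReal) < a (k - 1)) := by
  obtain ⟨e, e', he⟩ := B.exists_isEnd
  obtain ⟨κ, hκ⟩ := Potential.exists_threshold_strictAnti he B.l_pos
  refine ⟨κ + 1, by omega, fun σ ξ hξ => ⟨hatCount_antitoneOn σ ξ, ?_⟩⟩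
  have hξ' := abs_lt_one_of_norm hξ
  set c := evenRatios σ ξ hξ' with hc
  obtain ⟨h1, h2⟩ := hκ c rfl (evenRatios_m_pos hξ')
  have hiff : ∀ {F : ℝ}, 0 < F → ∀ n,
      (n ≤ B.hatCount F σ ξ ↔ (F : EReal) < B.potential.threshold B.l c n) := fun hF n =>
    (hatReach_iff hF hξ).symm.trans (Potential.ratioReach_iff_lt_threshold (c := c) hF)
  refine ⟨fun k => B.potential.threshold B.l c (k + 1), h2, ?_,
    fun k _ => Potential.threshold_pos B.l_pos, fun F hF => ⟨?_, fun k hk => ?_⟩⟩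
  · exact h1.trans (threshold_one hξ')
  · have hF0 : 0 < F := hF.1
    rw [hiff hF0, h1, threshold_one hξ']
    exact hF.2.1
  · have hF0 : 0 < F := hF.1
    have h3 := hiff hF0 k
    have h4 := hiff hF0 (k + 1)
    have h5 : k - 1 + 1 = k := Nat.sub_add_cancel (by omega)
    simp only [h5]
    rw [← not_lt, ← h3, ← h4]
    omega

/-- Joint continuity gives uniform closeness on compact sets. -/
theorem _root_.RLD.eventually_dist_lt {X : Type*} [TopologicalSpace X] {f : X → ℝ → ℝ} {x₀ : X}
    (h : ∀ t, ContinuousAt (fun z : X × ℝ => f z.1 z.2) (x₀, t)) (h₀ : Continuous (f x₀)) {K : Set ℝ}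
    (hK : IsCompact K) {ε : ℝ} (hε : 0 < ε) : ∀ᶠ x in 𝓝 x₀, ∀ t ∈ K, dist (f x₀ t) (f x t) < ε := by
  refine hK.eventually_forall_of_forall_eventually fun t _ => ?_
  have h1 : ContinuousAt (fun z : X × ℝ => f x₀ z.2) (x₀, t) :=
    (h₀.comp continuous_snd).continuousAt
  have h2 : Tendsto (fun z : X × ℝ => dist (f x₀ z.2) (f z.1 z.2)) (𝓝 (x₀, t))
      (𝓝 (dist (f x₀ t) (f x₀ t))) := h1.dist (h t)
  rw [dist_self] at h2
  exact h2.eventually_lt_const hε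

/-- Continuous dependence: near `P₀` the profile is given on a compact set by as many steps of the
chain as for `P₀`, since a further step can only take place near the end. -/
theorem hat_tendstoUniformlyOn {C : Set ℝ} (hC : IsCompact C) (hCI : C ⊆ B.I)
    {P₀ : ℝ × L1 × Linf} (h₀ : P₀ ∈ B.params) :
    TendstoUniformlyOn
      (fun P : ℝ × L1 × Linf => B.hatFun P.1 P.2.1 P.2.2 (B.hatCount P.1 P.2.1 P.2.2))
      (B.hatFun P₀.1 P₀.2.1 P₀.2.2 (B.hatCount P₀.1 P₀.2.1 P₀.2.2))
      (𝓝[B.params] P₀) (B.x '' (univ ×ˢ C)) := by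
  obtain ⟨R, hR0, hRl, hCR⟩ : ∃ R : ℝ, 0 ≤ R ∧ (R : EReal) < B.l ∧ ∀ t ∈ C, |t| ≤ R := by
    rcases C.eq_empty_or_nonempty with rfl | hne
    · exact ⟨0, le_rfl, B.l_pos, by simp⟩
    · obtain ⟨t, ht, hmax⟩ := hC.exists_isMaxOn hne continuous_abs.continuousOn
      exact ⟨|t|, abs_nonneg t, hCI ht, fun u hu => hmax hu⟩
  obtain ⟨n, hn⟩ : ∃ n, n = B.hatCount P₀.1 P₀.2.1 P₀.2.2 := ⟨_, rfl⟩
  rw [← hn]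
  have hξ₀ : ‖P₀.2.2‖ < 1 := h₀.2.2
  have hF₀ : 0 < P₀.1 := h₀.1
  have hreach : B.HatReach P₀.1 P₀.2.1 P₀.2.2 n := (hatReach_iff hF₀ hξ₀).2 hn.le
  have hnot : ¬ B.HatReach P₀.1 P₀.2.1 P₀.2.2 (n + 1) := fun h => by
    have := (hatReach_iff hF₀ hξ₀).1 h
    omega
  have hcP := fun j => (continuousAt_even hξ₀ j).1
  have hcM := fun j => (continuousAt_even hξ₀ j).2
  obtain ⟨hev, hclat⟩ := Potential.continuousAt_lat
    (P := fun x : ℝ × L1 × Linf => fun j => x.1 * evenP x.2.1 x.2.2 j)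
    (M := fun x : ℝ × L1 × Linf => fun j => x.1 * evenM x.2.1 x.2.2 j) hcP hcM hreach
  have hesc := Potential.eventually_lt_lat
    (P := fun x : ℝ × L1 × Linf => fun j => x.1 * evenP x.2.1 x.2.2 j)
    (M := fun x : ℝ × L1 × Linf => fun j => x.1 * evenM x.2.1 x.2.2 j) hcP hcM hreach hnot
    ((evenRatios P₀.2.1 P₀.2.2 (abs_lt_one_of_norm hξ₀)).add_pos' hF₀ n) hRl
  have hfc := fun t => Potential.continuousAt_prof (V := B.potential) (n := n)
    (P := fun x : ℝ × L1 × Linf => fun j => x.1 * evenP x.2.1 x.2.2 j)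
    (T := fun x : ℝ × L1 × Linf => B.hatLat x.1 x.2.1 x.2.2) t (fun j _ => hcP j) hclat
  rw [Metric.tendstoUniformlyOn_iff]
  intro ε hε
  have hunif := eventually_dist_lt (x₀ := P₀) (f := fun x : ℝ × L1 × Linf =>
    B.potential.prof (fun j => x.1 * evenP x.2.1 x.2.2 j) (B.hatLat x.1 x.2.1 x.2.2) n) hfc
    Potential.continuous_prof (isCompact_Icc (a := 0) (b := R)) hε
  filter_upwards [hunif.filter_mono nhdsWithin_le_nhds, hev.filter_mono nhdsWithin_le_nhds,
    hesc.filter_mono nhdsWithin_le_nhds, self_mem_nhdsWithin] with x hx hxr hxesc hxp p hp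
  obtain ⟨⟨ϑ, t⟩, ⟨-, ht⟩, rfl⟩ := hp
  have htR : |t| ∈ Icc 0 R := ⟨abs_nonneg t, hCR t ht⟩
  have hxn : n ≤ B.hatCount x.1 x.2.1 x.2.2 := (hatReach_iff hxp.1 hxp.2.2).1 hxr
  have hprof := isProfile_hat hxp
  rw [hatFun, hatFun, B.radial_x _ (hCI ht), B.radial_x _ (hCI ht),
    Potential.prof_eq_of_le hxn hprof.le_succ fun hlt => ?_]
  · exact hx _ htR
  · exact htR.2.trans (hxesc _ (hprof.chain n hlt)).le

end Background

/-! ### Solutions smooth at the ends -/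

/-- The ratios of a chain with jump latitude `0` and prescribed flux ratios; the common factor is
the mean flux at `0`. -/
def oddRatios (σ ξ : ℕ → ℝ) (hξ : ∀ i, |ξ i| < 1) : Ratios where
  p i := meanFactor σ i * (1 + ξ i)
  m i := meanFactor σ i * (1 - ξ i)
  p_nonneg := mul_nonneg (meanFactor_pos σ 0).le (by linarith [abs_lt.1 (hξ 0)])
  p_pos j _ := mul_pos (meanFactor_pos σ j) (by linarith [abs_lt.1 (hξ j)])
  m_nonneg j _ := mul_nonneg (meanFactor_pos σ j).le (by linarith [abs_lt.1 (hξ j)])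
  add_pos j := add_pos (mul_pos (meanFactor_pos σ j) (by linarith [abs_lt.1 (hξ j)]))
    (mul_pos (meanFactor_pos σ _) (by linarith [abs_lt.1 (hξ (j + 1))]))

namespace Background

variable {M N : Type*} [TopologicalSpace M] [ChartedSpace E2 M]
  [IsManifold (𝓡 2) ∞ M] [TopologicalSpace N] [ChartedSpace E3 N] [IsManifold (𝓡 3) ∞ N]
  [MulAction SymGroup M] [MulAction SymGroup N] {B : Background M N}

variable {φ : M → ℝ} {k n d : ℕ} {s : ℕ → ℝ} {e e' : ℝ → ℝ} {c : Ratios} {F : ℝ}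

theorem HasFluxRatios.congr {σ ξ ξ' : ℕ → ℝ} (h : B.HasFluxRatios φ k s σ ξ)
    (hξ : ∀ i < k, ξ i = ξ' i) : B.HasFluxRatios φ k s σ ξ' :=
  ⟨h.1, fun i hi => (hξ i hi).symm.trans (h.2 i hi)⟩

/-- Smoothness at the ends says that the last flux is the logarithmic derivative of the end
solution. -/
theorem smoothAtEnds_iff (he : B.potential.IsEnd B.l e e') (hI : s (k - 1) ∈ B.I)
    (hpos : 0 < B.fluxP φ (s (k - 1))) :
    B.SmoothAtEnds φ k s ↔
      e (s (k - 1)) ≠ 0 ∧ B.fluxP φ (s (k - 1)) * e (s (k - 1)) = e' (s (k - 1)) := by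
  obtain ⟨h1, h2⟩ := B.phiEnd_eq he
  rw [SmoothAtEnds, h1 hI, h2 _ hI]
  constructor
  · intro h
    have hne : e (s (k - 1)) ≠ 0 := fun h0 => by rw [h0, div_zero] at h; exact hpos.ne' h
    exact ⟨hne, (eq_div_iff hne).1 h⟩
  · rintro ⟨hne, h⟩
    exact (eq_div_iff hne).2 h

section Existence

variable [T2Space M]

/-- If the chains with large `F` fail to be followed by a maximum, then some chain gives a solution
smooth at the ends. -/
theorem exists_isProfile_smooth (he : B.potential.IsEnd B.l e e') (hn : 0 < c.p n)
    (hm : ∀ j, 1 ≤ j → j ≤ n → 0 < c.m j) (hd : (d = 1 ∧ 1 ≤ n ∧ c.p 0 = 0) ∨ d = 0 ∧ 0 < c.p 0)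
    (hfail : ∃ F > 0, ¬ B.potential.RatioReach B.l (c.flat n hn) F (n + 1)) :
    ∃ F > 0, B.potential.IsProfile B.l (c.P F) (c.M F) (B.potential.ratioLat B.l c F) n d ∧
      e (B.potential.ratioLat B.l c F n) ≠ 0 ∧
      c.P F n * e (B.potential.ratioLat B.l c F n) = e' (B.potential.ratioLat B.l c F n) := by
  obtain ⟨F, hF, hreach, hpos, hne, heq⟩ := Potential.exists_smooth_end he B.l_pos hn hfail
  refine ⟨F, hF, ⟨rfl, hreach, hpos, ?_, fun j hj hj' => mul_pos hF ?_,
    fun j hj hj' => mul_pos hF (hm j hj hj')⟩, hne, heq⟩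
  · rcases hd with ⟨h1, h2, h3⟩ | ⟨h1, -⟩
    · exact Or.inl ⟨h1, h2, by rw [Ratios.P, h3, mul_zero]⟩
    · exact Or.inr h1
  · rcases Nat.eq_zero_or_pos j with rfl | h0
    · rcases hd with ⟨h1, -⟩ | ⟨-, h2⟩
      · omega
      · exact h2
    · exact c.p_pos j h0

theorem isProfile_smoothAtEnds (he : B.potential.IsEnd B.l e e') {P m T : ℕ → ℝ}
    (hp : B.potential.IsProfile B.l P m T n d) (hne : e (T n) ≠ 0) (heq : P n * e (T n) = e' (T n)) :
    B.SmoothAtEnds (B.radial (B.potential.prof P T n)) (n + 1 - d) (fun i => T (i + d)) := by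
  have hidx : n + 1 - d - 1 + d = n := by have := hp.d_le; omega
  have hP := hp.fluxP_eq (le_refl n)
  refine (smoothAtEnds_iff he ?_ ?_).2 ?_
  · simp only [hidx]; exact hp.mem_I le_rfl
  · simp only [hidx, hP]; exact hp.P_pos n hp.d_le.1 le_rfl
  · simp only [hidx, hP]; exact ⟨hne, heq⟩

end Existence

/-- The half-number of circles is the number of steps of the chain, and its parity tells whether `0`
is a jump latitude. -/
theorem IsRLD.circles_parity (h : B.IsRLD φ k s) :
    k + chainShift s = circles k s / 2 + 1 ∧ chainShift s = 1 - circles k s % 2 := by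
  have hk := h.k_pos
  rw [h.circles_eq, chainShift]
  split_ifs <;> omega

/-- A solution smooth at the ends is increasing after the last jump latitude. -/
theorem IsRLD.end_pos (h : B.IsRLD φ k s) (he : B.potential.IsEnd B.l e e')
    (hs : B.SmoothAtEnds φ k s) :
    (∀ t : ℝ, s (k - 1) ≤ t → (t : EReal) < B.l →
      0 < e t ∧ 0 < e' t ∧ 0 < B.potential.dsol (s (k - 1)) (B.fluxP φ (s (k - 1))) t) ∧
      B.fluxP φ (s (k - 1)) * e (s (k - 1)) = e' (s (k - 1)) := by
  have hk := h.k_pos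
  have hI := h.s_mem (k - 1) (by omega)
  obtain ⟨hne, heq⟩ := (smoothAtEnds_iff he hI (h.fluxP_pos _ (by omega))).1 hs
  have hlast := h.isProfile.last
  have hT : chainOf s (k + chainShift s - 1) = s (k - 1) := by
    rw [show k + chainShift s - 1 = k - 1 + chainShift s by omega, chainOf_add]
  simp only [hT] at hlast
  exact ⟨he.pos_of_eq B.l_pos hlast hne ((B.mem_I_of_nonneg (h.nonneg (by omega))).1 hI) heq, heq⟩

/-- Domination: if there is a solution smooth at the ends with fewer circles, then the chains with
large `F` are not followed by a maximum. -/
theorem IsRLD.exists_not_flat_reach (h : B.IsRLD φ k s) (he : B.potential.IsEnd B.l e e')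
    (hs : B.SmoothAtEnds φ k s) {kc : ℕ} (hkc : circles k s ≤ kc) (hn : 0 < c.p (kc / 2))
    (hm : ∀ j, 1 ≤ j → j ≤ kc / 2 → 0 < c.m j) (hodd : Odd kc → 0 < c.p 0) :
    ∃ F > 0, ¬ B.potential.RatioReach B.l (c.flat (kc / 2) hn) F (kc / 2 + 1) := by
  obtain ⟨h1, h2⟩ := h.circles_parity
  have hk := h.k_pos
  have hp := h.isProfile
  have hidx : k + chainShift s - 1 = circles k s / 2 := by omega
  rw [hidx] at hp
  obtain ⟨D, hD⟩ : ∃ D, kc / 2 = circles k s / 2 + D := ⟨kc / 2 - circles k s / 2, by omega⟩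
  have hT : chainOf s (circles k s / 2) = s (k - 1) := by
    rw [← hidx, show k + chainShift s - 1 = k - 1 + chainShift s by omega, chainOf_add]
  simp only [hD] at hn hm ⊢
  refine Potential.exists_not_flat_reach (P := fun j => B.fluxP φ (chainOf s j))
    (M := fun j => B.fluxM φ (chainOf s j)) hn hm ?_ (fun j hj => (hp.chain j hj).add_pos)
    (hp.P_pos _ hp.d_le.1 le_rfl) fun _ b hb => ?_
  · by_cases h0 : s 0 = 0
    · by_cases hD0 : 0 < D
      · exact Or.inl hD0
      · refine Or.inr (Or.inr (hodd ?_))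
        have : chainShift s = 0 := if_pos h0
        rw [Nat.odd_iff]
        omega
    · refine Or.inr (Or.inl ?_)
      rw [chainOf_zero, h.fluxP_zero h0]
  · rw [← hp.chain.eq_lat chainOf_zero _ le_rfl] at hb
    simp only [hT] at hb
    have := ((h.end_pos he hs).1 b hb.lt.le hb.lt_end).2.2
    rw [hb.dsol_eq] at this
    linarith

variable [T2Space M] [CompactSpace M]

variable (B) in
/-- The least number of circles is attained: the balanced chain with `F = 1` stops, which provides a
chain smooth at the ends. -/
theorem exists_kCircMin : ∃ φ k s, B.IsRLD φ k s ∧ B.SmoothAtEnds φ k s ∧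
    circles k s = B.kCircMin := by
  obtain ⟨e, e', he⟩ := B.exists_isEnd
  obtain ⟨n, hn⟩ := Potential.exists_not_ratioReach (c := Ratios.balanced) he one_pos one_pos
    fun j hj => by simp [Ratios.balanced, show j ≠ 0 by omega]
  have hp : 0 < Ratios.balanced.p (n + 1) := by simp [Ratios.balanced]
  obtain ⟨F, -, hprof, hne, heq⟩ := exists_isProfile_smooth (d := 1) he hp
    (fun _ _ _ => one_pos) (Or.inl ⟨rfl, by omega, by simp [Ratios.balanced]⟩)
    ⟨1, one_pos, fun h => hn (((Potential.flat_succ hp).1 h).1.mono n.le_succ)⟩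
  exact Nat.sInf_mem (s := {c | ∃ φ k s, B.IsRLD φ k s ∧ B.SmoothAtEnds φ k s ∧ circles k s = c})
    ⟨_, _, _, _, hprof.isRLD, isProfile_smoothAtEnds he hprof hne heq, rfl⟩

/-- Existence and uniqueness of solutions smooth at the ends, for a description of the flux
ratios by ratios of a chain. -/
theorem exists_unique_smooth {kc : ℕ} (hkc : B.kCircMin ≤ kc) {σ ξ : ℕ → ℝ} (c : Ratios)
    (hm : ∀ j, 1 ≤ j → 0 < c.m j) (hc : (Even kc ∧ c.p 0 = 0) ∨ (Odd kc ∧ 0 < c.p 0))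
    (hflux : ∀ F > 0, B.potential.IsProfile B.l (c.P F) (c.M F) (B.potential.ratioLat B.l c F)
      (kc / 2) (1 - kc % 2) →
      B.HasFluxRatios (B.radial (B.potential.prof (c.P F) (B.potential.ratioLat B.l c F) (kc / 2)))
        ((kc + 1) / 2) (fun i => B.potential.ratioLat B.l c F (i + (1 - kc % 2))) σ ξ)
    (hdet : ∀ φ s, B.IsRLD φ ((kc + 1) / 2) s → chainShift s = 1 - kc % 2 →
      B.HasFluxRatios φ ((kc + 1) / 2) s σ ξ → ∃ F > 0,
        (∀ j ≤ kc / 2, B.fluxP φ (chainOf s j) = c.P F j) ∧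
        ∀ j < kc / 2, B.fluxM φ (chainOf s (j + 1)) = c.M F (j + 1)) :
    ∃ φ s, B.IsRLD φ ((kc + 1) / 2) s ∧ B.IsUnit φ ∧ B.SmoothAtEnds φ ((kc + 1) / 2) s ∧
      circles ((kc + 1) / 2) s = kc ∧ B.HasFluxRatios φ ((kc + 1) / 2) s σ ξ ∧
      ∀ φ' k' s', B.IsRLD φ' k' s' → B.IsUnit φ' → B.SmoothAtEnds φ' k' s' →
        circles k' s' = kc → B.HasFluxRatios φ' k' s' σ ξ →
          k' = (kc + 1) / 2 ∧ EqOn φ' φ B.Ω ∧ ∀ i < k', s' i = s i := by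
  obtain ⟨e, e', he⟩ := B.exists_isEnd
  obtain ⟨φ₀, k₀, s₀, h₀, hs₀, hc₀⟩ := B.exists_kCircMin
  have hkc0 : 0 < kc := by
    have := h₀.circles_parity
    have := h₀.k_pos
    omega
  have hn : 0 < c.p (kc / 2) := by
    rcases Nat.eq_zero_or_pos (kc / 2) with h | h
    · rcases hc with ⟨h1, -⟩ | ⟨-, h1⟩
      · rw [Nat.even_iff] at h1; omega
      · rwa [h]
    · exact c.p_pos _ h
  have hparity : (1 - kc % 2 = 1 ∧ 1 ≤ kc / 2 ∧ c.p 0 = 0) ∨ 1 - kc % 2 = 0 ∧ 0 < c.p 0 := by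
    rcases hc with ⟨h1, h2⟩ | ⟨h1, h2⟩
    · rw [Nat.even_iff] at h1; exact Or.inl ⟨by omega, by omega, h2⟩
    · rw [Nat.odd_iff] at h1; exact Or.inr ⟨by omega, h2⟩
  obtain ⟨F, hF, hp, hne, heq⟩ := exists_isProfile_smooth he hn (fun j hj _ => hm j hj) hparity
    (h₀.exists_not_flat_reach he hs₀ (hc₀.trans_le hkc) hn (fun j hj _ => hm j hj) fun hodd => by
      rcases hc with ⟨h1, -⟩ | ⟨-, h1⟩
      · exact absurd hodd (Nat.not_odd_iff_even.2 h1)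
      · exact h1)
  have hk : kc / 2 + 1 - (1 - kc % 2) = (kc + 1) / 2 := by omega
  have hrld := hp.isRLD
  have hsm := isProfile_smoothAtEnds he hp hne heq
  rw [hk] at hrld hsm
  have hcirc : circles ((kc + 1) / 2) (fun i => B.potential.ratioLat B.l c F (i + (1 - kc % 2))) =
      kc := by
    rw [hrld.circles_eq]
    rcases hc with ⟨h1, -⟩ | ⟨h1, -⟩
    · rw [Nat.even_iff] at h1
      have h2 : (0 : ℝ) < B.potential.ratioLat B.l c F (0 + (1 - kc % 2)) :=
        hp.zero ▸ hp.chain.lt (by omega) (by omega)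
      rw [if_neg h2.ne']
      omega
    · rw [Nat.odd_iff] at h1
      rw [if_pos (by rw [show 0 + (1 - kc % 2) = 0 by omega]; exact hp.zero)]
      omega
  refine ⟨_, _, hrld, hp.isUnit, hsm, hcirc, hflux F hF hp, fun φ' k' s' h' hu' hs' hc' hr' => ?_⟩
  obtain ⟨hk', hd'⟩ := h'.circles_parity
  rw [hc'] at hk' hd'
  have hkk : k' = (kc + 1) / 2 := by omega
  subst hkk
  obtain ⟨F', hF', hP', hM'⟩ := hdet φ' s' h' hd' hr'
  obtain ⟨hp', hs, hφ⟩ := h'.eq_of_flux hu' hd' (by omega) hP' hM'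
  have hlast : B.potential.ratioLat B.l c F' (kc / 2) = s' ((kc + 1) / 2 - 1) := by
    rw [hs _ (by omega), show (kc + 1) / 2 - 1 + (1 - kc % 2) = kc / 2 by omega]
    rfl
  have hlastP : B.fluxP φ' (s' ((kc + 1) / 2 - 1)) = F' * c.p (kc / 2) := by
    have h1 := hP' _ le_rfl
    have h2 := chainOf_add (s := s') ((kc + 1) / 2 - 1)
    rw [hd', show (kc + 1) / 2 - 1 + (1 - kc % 2) = kc / 2 by omega] at h2
    rw [h2] at h1
    exact h1
  obtain ⟨hpos', heq'⟩ := h'.end_pos he hs'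
  rw [hlastP, ← hlast] at heq'
  rw [← hlast] at hpos'
  have hpos := he.pos_of_eq B.l_pos hp.last hne (hp.chain.lt_end le_rfl B.l_pos) heq
  have hFF : F' = F := Potential.smooth_end_unique he B.l_pos hn hF' hF hp'.chain hp.chain
    (fun t h1 h2 => (hpos' t h1 h2).1) (fun t h1 h2 => (hpos t h1 h2).1) heq' heq
  subst hFF
  exact ⟨rfl, hφ, hs⟩

/-- Existence and uniqueness of solutions smooth at the ends with prescribed flux ratios. -/
theorem exists_unique_smoothAtEnds {kc : ℕ} (hkc : B.kCircMin ≤ kc) {σ ξ : ℕ → ℝ}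
    (hξ : ∀ i < (kc + 1) / 2, |ξ i| < 1) (hodd : Odd kc → ξ 0 = 0) :
    ∃ φ s, B.IsRLD φ ((kc + 1) / 2) s ∧ B.IsUnit φ ∧ B.SmoothAtEnds φ ((kc + 1) / 2) s ∧
      circles ((kc + 1) / 2) s = kc ∧ B.HasFluxRatios φ ((kc + 1) / 2) s σ ξ ∧
      ∀ φ' k' s', B.IsRLD φ' k' s' → B.IsUnit φ' → B.SmoothAtEnds φ' k' s' →
        circles k' s' = kc → B.HasFluxRatios φ' k' s' σ ξ →
          k' = (kc + 1) / 2 ∧ EqOn φ' φ B.Ω ∧ ∀ i < k', s' i = s i := by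
  -- only the first `k` terms of `ξ` matter
  set ξ' : ℕ → ℝ := fun i => if i < (kc + 1) / 2 then ξ i else 0 with hξ'
  have hlt : ∀ i, |ξ' i| < 1 := fun i => by
    simp only [hξ']
    split_ifs with h
    · exact hξ i h
    · simp
  have hcongr : ∀ i < (kc + 1) / 2, ξ i = ξ' i := fun i hi => by simp only [hξ', if_pos hi]
  rcases Nat.even_or_odd kc with heven | hoddk
  · have hmod := Nat.even_iff.1 heven
    have hk : (kc + 1) / 2 = kc / 2 := by omega
    refine exists_unique_smooth hkc (evenRatios σ ξ' hlt) (evenRatios_m_pos hlt)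
      (Or.inl ⟨heven, rfl⟩) (fun F hF hp => ?_) fun φ s h hd hr => ?_
    · rw [hmod] at hp ⊢
      rw [hk] at hcongr ⊢
      exact (isHat_hatFun hF (fun i _ => hlt i) hp).2.2.2.2.congr fun i hi => (hcongr i hi).symm
    · have hs : s 0 ≠ 0 := fun h0 => by rw [chainShift, if_pos h0] at hd; omega
      obtain ⟨h1, h2⟩ := h.flux_chainOf_even hs (hr.congr hcongr)
      rw [hk] at h1 h2
      exact ⟨_, h.fluxM_pos 0 h.k_pos, h1, h2⟩
  · have hmod := Nat.odd_iff.1 hoddk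
    have hk : (kc + 1) / 2 = kc / 2 + 1 := by omega
    refine exists_unique_smooth hkc (oddRatios σ ξ' hlt) (fun j _ => mul_pos (meanFactor_pos σ j)
      (by linarith [abs_lt.1 (hlt j)])) (Or.inr ⟨hoddk, mul_pos (meanFactor_pos σ 0)
      (by linarith [abs_lt.1 (hlt 0)])⟩) (fun F hF hp => ?_) fun φ s h hd hr => ?_
    · rw [hmod] at hp ⊢
      have h0 : ξ' 0 = 0 := (hcongr 0 (by omega)).symm.trans (hodd hoddk)
      refine (hasFluxRatios_of_flux_eq (ξ := ξ') hF.ne' fun i hi => ⟨?_, ?_⟩).congr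
        fun i hi => (hcongr i hi).symm
      · exact (hp.fluxP_eq (by omega)).trans (mul_assoc _ _ _).symm
      · rcases i with _ | i
        · refine hp.fluxM_zero.trans ?_
          simp only [Ratios.P, oddRatios, h0]
          ring
        · exact (hp.fluxM_eq (j := i) (by omega)).trans (mul_assoc _ _ _).symm
    · have hs : s 0 = 0 := by
        by_contra h0
        rw [chainShift, if_neg h0] at hd
        omega
      have hT : ∀ j, chainOf s j = s j := fun j => if_pos hs
      have hfl := fun i (hi : i < (kc + 1) / 2) => h.flux_eq (hr.congr hcongr) hi
      refine ⟨B.flux φ (s 0), half_pos (add_pos (h.fluxP_pos 0 h.k_pos) (h.fluxM_pos 0 h.k_pos)),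
        fun j hj => ?_, fun j hj => ?_⟩
      · rw [hT, (hfl j (by omega)).1, mul_assoc]; rfl
      · rw [hT, (hfl (j + 1) (by omega)).2, mul_assoc]; rfl

end Background

end RLD

end

theorem proposition6p19 {M N : Type*}
    [TopologicalSpace M] [ChartedSpace RLD.E2 M] [IsManifold (𝓡 2) ∞ M]
    [T2Space M] [CompactSpace M] [ConnectedSpace M]
    [TopologicalSpace N] [ChartedSpace RLD.E3 N] [IsManifold (𝓡 3) ∞ N] [T2Space N]
    [MulAction RLD.SymGroup M] [MulAction RLD.SymGroup N] (B : RLD.Background M N) :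
    -- the solutions with prescribed `F_{1-} = F` and flux ratios `σ`, `ξ`
    (∃ (K : ℝ → RLD.L1 → RLD.Linf → ℕ) (S : ℝ → RLD.L1 → RLD.Linf → ℕ → ℝ)
        (Φ : ℝ → RLD.L1 → RLD.Linf → M → ℝ),
      -- existence and uniqueness
      (∀ (F : ℝ) (σ : RLD.L1) (ξ : RLD.Linf), (F, σ, ξ) ∈ B.params →
          B.IsHat F σ ξ (Φ F σ ξ) (K F σ ξ) (S F σ ξ) ∧
          (∀ φ k s, B.IsHat F σ ξ φ k s → k ≤ K F σ ξ ∧ (B.l = ⊤ → k = K F σ ξ)) ∧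
          (∀ φ φ' k s s', B.IsHat F σ ξ φ k s → B.IsHat F σ ξ φ' k s' →
            EqOn φ φ' B.Ω ∧ ∀ i < k, s i = s' i)) ∧
      -- the jump latitudes are increasing smooth functions of `F`
      (∀ (σ : RLD.L1) (ξ : RLD.Linf) (i : ℕ),
        StrictMonoOn (fun F => S F σ ξ i) {F : ℝ | (F, σ, ξ) ∈ B.params ∧ i < K F σ ξ} ∧
        ContDiffOn ℝ ∞ (fun F => S F σ ξ i) {F : ℝ | (F, σ, ξ) ∈ B.params ∧ i < K F σ ξ}) ∧
      -- the number of jump latitudes is a nonincreasing function of `F`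
      (∃ kmin : ℕ, 1 ≤ kmin ∧ ∀ (σ : RLD.L1) (ξ : RLD.Linf), ‖ξ‖ < 1 →
        AntitoneOn (fun F => K F σ ξ) {F : ℝ | (F, σ, ξ) ∈ B.params} ∧
        ∃ a : ℕ → EReal, StrictAntiOn a (Ici (kmin - 1)) ∧ a (kmin - 1) = B.Fmax ∧
          (∀ k, kmin ≤ k → 0 < a k) ∧
          ∀ F : ℝ, (F, σ, ξ) ∈ B.params → kmin ≤ K F σ ξ ∧
            ∀ k, kmin ≤ k → (K F σ ξ = k ↔ a k ≤ (F : EReal) ∧ (F : EReal) < a (k - 1))) ∧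
      -- continuous dependence, uniformly on compact subsets of `Cyl_I`
      (∀ C : Set ℝ, IsCompact C → C ⊆ B.I → ∀ P₀ ∈ B.params,
        TendstoUniformlyOn (fun P => Φ P.1 P.2.1 P.2.2) (Φ P₀.1 P₀.2.1 P₀.2.2)
          (𝓝[B.params] P₀) (B.x '' (univ ×ˢ C)))) ∧
    -- the solutions smooth at the ends, with `kc` circles
    (∀ kc : ℕ, B.kCircMin ≤ kc → ∀ σ ξ : ℕ → ℝ,
      (∀ i < (kc + 1) / 2, |ξ i| < 1) → (Odd kc → ξ 0 = 0) →
        ∃ φ s, B.IsRLD φ ((kc + 1) / 2) s ∧ B.IsUnit φ ∧ B.SmoothAtEnds φ ((kc + 1) / 2) s ∧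
          RLD.circles ((kc + 1) / 2) s = kc ∧ B.HasFluxRatios φ ((kc + 1) / 2) s σ ξ ∧
          ∀ φ' k' s', B.IsRLD φ' k' s' → B.IsUnit φ' → B.SmoothAtEnds φ' k' s' →
            RLD.circles k' s' = kc → B.HasFluxRatios φ' k' s' σ ξ →
              k' = (kc + 1) / 2 ∧ EqOn φ' φ B.Ω ∧ ∀ i < k', s' i = s i) :=  by
  refine ⟨⟨fun F σ ξ => B.hatCount F σ ξ, fun F σ ξ i => B.hatLat F σ ξ (i + 1),
    fun F σ ξ => B.hatFun F σ ξ (B.hatCount F σ ξ), fun F σ ξ h => ⟨?_, ?_, ?_⟩, ?_, ?_, ?_⟩, ?_⟩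
  · exact RLD.Background.hat_existence h
  · exact fun φ k s hφ => RLD.Background.hat_maximal h hφ
  · exact fun φ φ' k s s' hφ hφ' => RLD.Background.hat_unique hφ hφ'
  · exact fun σ ξ i => ⟨RLD.Background.hatLat_strictMonoOn σ ξ i,
      RLD.Background.hatLat_contDiffOn σ ξ i⟩
  · exact RLD.Background.exists_thresholds B
  · exact fun C hC hCI P₀ h₀ => RLD.Background.hat_tendstoUniformlyOn hC hCI h₀
  · exact fun kc hkc σ ξ hξ hodd => RLD.Background.exists_unique_smoothAtEnds hkc hξ hodd
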